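/- Let $X$ be a complex projective manifold and $k\ge 1$. Let $E_{k,\bullet}^{GG}\Omega_X=\bigoplus_m E_{k,m}^{GG}\Omega_X$ be the graded $\mathcal O_X$-algebra of Green–Griffiths jet differentials of order $k$: locally it is generated over $\mathcal O_X$ by the derivatives $a^{(i)}$ ($1\le i\le k$, $a$ a regular function), with $a^{(i)}$ in degree $i$. Put $X_k^{GG}=\mathbf{Proj}_X\,E_{k,\bullet}^{GG}\Omega_X$, with its tautological orbifold line bundle $\mathcal O(1)$. Let $F$ be the increasing filtration of $E_{k,\bullet}^{GG}\Omega_X$ indexed by $\mathbb N^k$, with the lexicographic order that compares the last entries first, where $F^{l}$ is locally spanned over $\mathcal O_X$ by the monomials $(f')^{I_1}\cdots(f^{(k)})^{I_k}$ with $(|I_1|,\dots,|I_k|)\le l$. For vector bundles $E_i$ and weights $a_i\ge1$, let ${\rm P}(E_1^{(a_1)}\oplus\dots\oplus E_p^{(a_p)})$ be the $\mathbf{Proj}$ of $\mathrm{Sym}(E_1^*)\otimes\dots\otimes \mathrm{Sym}(E_p^*)$, where $E_i^*$ is placed in degree $a_i$, with its tautological orbifold line bundle. Then there exist a proper morphism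 $\mathcal X_k^{GG}\to X\times\mathbb C$, flat over $\mathbb C$, and an orbifold line bundle $\mathcal O_{\mathcal X_k^{GG}}(1)$ on $\mathcal X_k^{GG}$ such that: 1. for every $\lambda\in\mathbb C^*$, the fibre of $\mathcal X_k^{GG}$ over $X\times\{\lambda\}\cong X$, with the restriction of $\mathcal O_{\mathcal X_k^{GG}}(1)$, is identified over $X$ with $X_k^{GG}$ and $\mathcal O_{X_k^{GG}}(1)$; 2. the fibre over $X\times\{0\}$, with the restriction of $\mathcal O_{\mathcal X_k^{GG}}(1)$, is identified over $X$ with $\mathbf{Proj}_X\big(\mathrm{Gr}_F\,E_{k,\bullet}^{GG}\Omega_X\big)\cong {\rm P}(T_X^{(1)}\oplus\dots\oplus T_X^{(k)})$ and its tautological orbifold line bundle. Moreover, let $D\subset X$ be a reduced simple normal crossing divisor. Then the same statement holds with $E_{k,\bullet}^{GG}\Omega_X$ replaced by the graded algebra $E_{k,\bullet}^{GG}\Omega_X(\log D)$ of logarithmic jet differentials (locally generated over $\mathcal O_X$ by the $a^{(i)}$, $a$ regular, and the $(\log z)^{(i)}$, $z$ regular and invertible outside $D$), $X_k^{GG}$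 replaced by $X_k^{GG,\log}=\mathbf{Proj}_X\,E_{k,\bullet}^{GG}\Omega_X(\log D)$, $F$ by the analogous filtration, and $T_X$ by $T_X(-\log D)$. -/

import Mathlib

open CategoryTheory AlgebraicGeometry

namespace JetDeformation

noncomputable section

/-! ### Gradings -/

/-- A family of additive subgroups that is multiplicative, spans the ring and is independent is a
grading. -/
@[reducible] def gradedRingOf {A : Type} [CommRing A] (gr : ℕ → AddSubgroup A)
    (h1 : (1 : A) ∈ gr 0)
    (hmul : ∀ i j (a b : A), a ∈ gr i → b ∈ gr j → a * b ∈ gr (i + j))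
    (hsup : ⨆ n, gr n = ⊤)
    (hind : ∀ (s : Finset ℕ) (x : ℕ → A), (∀ n ∈ s, x n ∈ gr n) → ∑ n ∈ s, x n = 0 →
      ∀ n ∈ s, x n = 0) :
    GradedRing gr := by
  have hint : DirectSum.IsInternal gr := by
    constructor
    · rw [injective_iff_map_eq_zero]
      intro x hx
      classical
      rw [DirectSum.coeAddMonoidHom_eq_dfinsuppSum, DFinsupp.sum] at hx
      have h := hind _ (fun n => ((x n : gr n) : A)) (fun n _ => (x n).2) hx
      ext n
      by_cases hn : n ∈ DFinsupp.support x
      · simpa using h n hn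
      · simpa using hn
    · rw [← AddMonoidHom.range_eq_top, eq_top_iff, ← hsup]
      refine iSup_le fun n a ha => ?_
      exact ⟨DirectSum.of (fun n => gr n) n ⟨a, ha⟩, by simp⟩
  letI := hint.chooseDecomposition
  exact { one_mem := h1, mul_mem := fun i j a b ha hb => hmul i j a b ha hb }

section Coaction

variable {A : Type} [CommRing A] (δ : A →+* Polynomial A)

/-- The elements of weight `n` for a coaction `δ : A → A[T]` of the multiplicative group: those
`a` with `δ a = a Tⁿ`, in other words `lam · a = lam ^ n a`. -/
def weightPart (n : ℕ) : AddSubgroup A where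
  carrier := {a | δ a = Polynomial.monomial n a}
  zero_mem' := by simp
  add_mem' {a b} ha hb := by simp_all
  neg_mem' {a} ha := by simp_all

theorem mem_weightPart {n : ℕ} {a : A} :
    a ∈ weightPart δ n ↔ δ a = Polynomial.monomial n a := Iff.rfl

theorem weightPart_mul (i j : ℕ) (a b : A) (ha : a ∈ weightPart δ i) (hb : b ∈ weightPart δ j) :
    a * b ∈ weightPart δ (i + j) := by
  rw [mem_weightPart] at *
  rw [map_mul, ha, hb, Polynomial.monomial_mul_monomial]

theorem weightPart_one : (1 : A) ∈ weightPart δ 0 := by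
  rw [mem_weightPart]; simp

theorem weightPart_prod_unit {a b : A} (ha : a ∈ weightPart δ 0) (hab : a * b = 1) :
    b ∈ weightPart δ 0 := by
  rw [mem_weightPart] at *
  have h : δ a * δ b = 1 := by rw [← map_mul, hab, map_one]
  rw [ha] at h
  have h2 : Polynomial.monomial 0 b * Polynomial.monomial 0 a = (1 : Polynomial A) := by
    rw [Polynomial.monomial_mul_monomial, mul_comm b a, hab]; rfl
  calc δ b = (Polynomial.monomial 0 b * Polynomial.monomial 0 a) * δ b := by rw [h2, one_mul]
    _ = _ := by rw [mul_assoc, h, mul_one]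

/-- If the ring is generated by homogeneous elements, the weight parts form a grading. -/
@[reducible] def weightGrading (hgen : Subring.closure {a | ∃ n, a ∈ weightPart δ n} = ⊤) :
    GradedRing (weightPart δ) := by
  refine gradedRingOf _ (weightPart_one δ) (weightPart_mul δ) ?_ ?_
  · rw [eq_top_iff]
    intro a _
    have ha : a ∈ Subring.closure {a | ∃ n, a ∈ weightPart δ n} := by rw [hgen]; trivial
    induction ha using Subring.closure_induction with
    | mem x hx => obtain ⟨n, hn⟩ := hx; exact AddSubgroup.mem_iSup_of_mem n hn
    | zero => exact zero_mem _
    | one => exact AddSubgroup.mem_iSup_of_mem 0 (weightPart_one δ)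
    | add x y _ _ hx hy => exact add_mem (hx trivial) (hy trivial)
    | neg x _ hx => exact neg_mem (hx trivial)
    | mul x y _ _ hx hy =>
      refine AddSubgroup.iSup_induction (fun n => weightPart δ n)
        (C := fun z => z * y ∈ ⨆ n, weightPart δ n) (hx trivial) ?_ ?_ ?_
      · intro i z hz
        refine AddSubgroup.iSup_induction (fun n => weightPart δ n)
          (C := fun w => z * w ∈ ⨆ n, weightPart δ n) (hy trivial) ?_ ?_ ?_
        · intro j w hw
          exact AddSubgroup.mem_iSup_of_mem (i + j) (weightPart_mul δ i j z w hz hw)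
        · simp
        · intro u v hu hv; rw [mul_add]; exact add_mem hu hv
      · simp
      · intro u v hu hv; rw [add_mul]; exact add_mem hu hv
  · intro s x hx h n hn
    have h2 : δ (∑ n ∈ s, x n) = ∑ n ∈ s, Polynomial.monomial n (x n) := by
      rw [map_sum]; exact Finset.sum_congr rfl fun m hm => hx m hm
    rw [h, map_zero] at h2
    have h3 := congrArg (fun f => Polynomial.coeff f n) h2
    simp only [Polynomial.coeff_zero, Polynomial.finsetSum_coeff, Polynomial.coeff_monomial] at h3
    rw [Finset.sum_ite_eq' s n] at h3
    simpa [hn] using h3.symm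

end Coaction

/-! ### The algebra of jet differentials of a ring -/

section Jets

variable (k : ℕ) (B : Type) [CommRing B] [Algebra ℂ B]

/-- The relations between the symbols `b^{(i)}`, `0 ≤ i ≤ k`: the `i`-th derivative is additive,
satisfies the Leibniz formula, and kills constants for `i > 0`, while `c^{(0)} = c`. -/
inductive JetRel : MvPolynomial (B × Fin (k + 1)) ℂ → Prop
  | add (a b : B) (i : Fin (k + 1)) :
      JetRel (MvPolynomial.X (a + b, i) - (MvPolynomial.X (a, i) + MvPolynomial.X (b, i)))
  | mul (a b : B) (i : Fin (k + 1)) :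
      JetRel (MvPolynomial.X (a * b, i) -
        ∑ p : Fin (k + 1) × Fin (k + 1) with (p.1 : ℕ) + (p.2 : ℕ) = (i : ℕ),
          ((i : ℕ).choose (p.1 : ℕ)) • (MvPolynomial.X (a, p.1) * MvPolynomial.X (b, p.2)))
  | const (c : ℂ) (i : Fin (k + 1)) :
      JetRel (MvPolynomial.X (algebraMap ℂ B c, i) - if i = 0 then MvPolynomial.C c else 0)

/-- The algebra of jet differentials of order `k` on `Spec B`: the commutative `ℂ`-algebra
generated by the symbols `b^{(i)}` (the `i`-th derivative of `b` along a `k`-jet of curve,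
`0 ≤ i ≤ k`). It is the coordinate ring of the scheme of `k`-jets of curves in `Spec B`. -/
def JetRing : Type :=
  MvPolynomial (B × Fin (k + 1)) ℂ ⧸ Ideal.span {r | JetRel k B r}

instance : CommRing (JetRing k B) :=
  inferInstanceAs (CommRing (MvPolynomial (B × Fin (k + 1)) ℂ ⧸ Ideal.span {r | JetRel k B r}))

instance : Algebra ℂ (JetRing k B) :=
  inferInstanceAs (Algebra ℂ (MvPolynomial (B × Fin (k + 1)) ℂ ⧸ Ideal.span {r | JetRel k B r}))

/-- The quotient map from polynomials in the symbols to the algebra of jet differentials. -/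
def jetMk : MvPolynomial (B × Fin (k + 1)) ℂ →ₐ[ℂ] JetRing k B :=
  Ideal.Quotient.mkₐ ℂ _

theorem jetMk_surjective : Function.Surjective (jetMk k B) :=
  Ideal.Quotient.mk_surjective

theorem jetMk_rel {r : MvPolynomial (B × Fin (k + 1)) ℂ} (h : JetRel k B r) :
    jetMk k B r = 0 :=
  Ideal.Quotient.eq_zero_iff_mem.2 (Ideal.subset_span h)

variable {B}

/-- The jet differential `b^{(i)}`. -/
def jd (i : Fin (k + 1)) (b : B) : JetRing k B :=
  jetMk k B (MvPolynomial.X (b, i))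

variable {k}

theorem jd_add (i : Fin (k + 1)) (a b : B) : jd k i (a + b) = jd k i a + jd k i b := by
  have h := jetMk_rel k B (JetRel.add a b i)
  rw [map_sub, map_add, sub_eq_zero] at h
  exact h

theorem jd_mul (i : Fin (k + 1)) (a b : B) : jd k i (a * b) =
    ∑ p : Fin (k + 1) × Fin (k + 1) with (p.1 : ℕ) + (p.2 : ℕ) = (i : ℕ),
      ((i : ℕ).choose (p.1 : ℕ)) • (jd k p.1 a * jd k p.2 b) := by
  have h := jetMk_rel k B (JetRel.mul a b i)
  rw [map_sub, map_sum, sub_eq_zero] at h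
  simp only [map_nsmul, map_mul] at h
  exact h

theorem jd_const (i : Fin (k + 1)) (c : ℂ) : jd k i (algebraMap ℂ B c) =
    if i = 0 then algebraMap ℂ (JetRing k B) c else 0 := by
  have h := jetMk_rel k B (JetRel.const c i)
  rw [map_sub, sub_eq_zero] at h
  refine Eq.trans h ?_
  split_ifs
  · exact (jetMk k B).commutes c
  · simp

theorem filter_zero : (Finset.univ.filter fun p : Fin (k + 1) × Fin (k + 1) =>
    (p.1 : ℕ) + (p.2 : ℕ) = ((0 : Fin (k + 1)) : ℕ)) = {(0, 0)} := by
  ext ⟨p, q⟩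
  rw [Finset.mem_filter, Finset.mem_singleton, Prod.mk.injEq]
  constructor
  · rintro ⟨_, h⟩
    have h' : (p : ℕ) + (q : ℕ) = 0 := h
    exact ⟨Fin.ext (by simpa using Nat.eq_zero_of_add_eq_zero_right h'),
      Fin.ext (by simpa using Nat.eq_zero_of_add_eq_zero_left h')⟩
  · rintro ⟨rfl, rfl⟩
    exact ⟨Finset.mem_univ _, rfl⟩

variable (k B)

/-- Functions on `Spec B` as jet differentials of order `0`. -/
def jd0 : B →+* JetRing k B where
  toFun := jd k 0
  map_one' := by simpa using jd_const (k := k) (B := B) 0 1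
  map_mul' a b := by rw [jd_mul, filter_zero]; simp
  map_zero' := by simpa using jd_const (k := k) (B := B) 0 0
  map_add' := jd_add 0

variable {k B}

/-- Universal property of the jet algebra. -/
def jetLift {T : Type} [CommRing T] [Algebra ℂ T] (f : Fin (k + 1) → B → T)
    (hadd : ∀ i a b, f i (a + b) = f i a + f i b)
    (hmul : ∀ i a b, f i (a * b) =
      ∑ p : Fin (k + 1) × Fin (k + 1) with (p.1 : ℕ) + (p.2 : ℕ) = (i : ℕ),
        ((i : ℕ).choose (p.1 : ℕ)) • (f p.1 a * f p.2 b))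
    (hconst : ∀ i c, f i (algebraMap ℂ B c) = if i = 0 then algebraMap ℂ T c else 0) :
    JetRing k B →ₐ[ℂ] T :=
  Ideal.Quotient.liftₐ _ (MvPolynomial.aeval fun x : B × Fin (k + 1) => f x.2 x.1) (by
    intro a ha
    have hle : Ideal.span {r | JetRel k B r} ≤
        RingHom.ker (MvPolynomial.aeval (R := ℂ) fun x : B × Fin (k + 1) => f x.2 x.1) := by
      rw [Ideal.span_le]
      intro r hr
      induction hr with
      | add a b i => simp [RingHom.mem_ker, hadd]
      | mul a b i => simp [RingHom.mem_ker, hmul]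
      | const c i => split_ifs with h <;> simp [RingHom.mem_ker, hconst, h]
    exact hle ha)

@[simp] theorem jetLift_jd {T : Type} [CommRing T] [Algebra ℂ T] (f : Fin (k + 1) → B → T)
    (hadd hmul hconst) (i : Fin (k + 1)) (b : B) :
    jetLift f hadd hmul hconst (jd k i b) = f i b := by
  change MvPolynomial.aeval _ (MvPolynomial.X (b, i)) = _
  simp

theorem jetHom_ext {T : Type} [CommRing T] [Algebra ℂ T] {f g : JetRing k B →ₐ[ℂ] T}
    (h : ∀ i b, f (jd k i b) = g (jd k i b)) : f = g := by
  have h2 : f.comp (jetMk k B) = g.comp (jetMk k B) := by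
    ext x
    exact h x.2 x.1
  ext x
  obtain ⟨p, rfl⟩ := jetMk_surjective k B x
  exact DFunLike.congr_fun h2 p

variable (k) in
/-- Functoriality of the jet algebra: `b^{(i)} ↦ (g b)^{(i)}`. -/
def jetMap {B' : Type} [CommRing B'] [Algebra ℂ B'] (g : B →ₐ[ℂ] B') :
    JetRing k B →ₐ[ℂ] JetRing k B' :=
  jetLift (fun i b => jd k i (g b)) (by intro i a b; simp [jd_add])
    (by intro i a b; simp [jd_mul]) (by intro i c; rw [AlgHom.commutes, jd_const])

@[simp] theorem jetMap_jd {B' : Type} [CommRing B'] [Algebra ℂ B'] (g : B →ₐ[ℂ] B')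
    (i : Fin (k + 1)) (b : B) : jetMap k g (jd k i b) = jd k i (g b) := by
  simp [jetMap]

theorem jetMap_comp {B' B'' : Type} [CommRing B'] [Algebra ℂ B'] [CommRing B''] [Algebra ℂ B'']
    (g : B →ₐ[ℂ] B') (g' : B' →ₐ[ℂ] B'') (x : JetRing k B) :
    jetMap k g' (jetMap k g x) = jetMap k (g'.comp g) x := by
  have : (jetMap k g').comp (jetMap k g) = jetMap k (g'.comp g) := jetHom_ext (by simp)
  exact DFunLike.congr_fun this x

variable (k B) in
/-- The action of `ℂ^*` by reparametrisation of jets: `b^{(i)} ↦ T^i b^{(i)}`. -/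
def jetCoaction : JetRing k B →ₐ[ℂ] Polynomial (JetRing k B) :=
  jetLift (fun i b => Polynomial.monomial (i : ℕ) (jd k i b)) (by intro i a b; simp [jd_add])
    (by
      intro i a b
      rw [jd_mul, map_sum]
      refine Finset.sum_congr rfl fun p hp => ?_
      rw [Finset.mem_filter] at hp
      rw [Polynomial.monomial_mul_monomial, hp.2, map_nsmul])
    (by
      intro i c
      rw [jd_const]
      split_ifs with h
      · subst h; rfl
      · simp)

theorem jetCoaction_jd (i : Fin (k + 1)) (b : B) :
    jetCoaction k B (jd k i b) = Polynomial.monomial (i : ℕ) (jd k i b) := by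
  simp [jetCoaction]

variable (k B) in
/-- `jetGr k B m` consists of the jet differentials of order `k` and weighted degree `m`. -/
def jetGr (m : ℕ) : AddSubgroup (JetRing k B) :=
  weightPart (jetCoaction k B).toRingHom m

theorem jd_mem (i : Fin (k + 1)) (b : B) : jd k i b ∈ jetGr k B (i : ℕ) := by
  rw [jetGr, mem_weightPart]
  exact jetCoaction_jd i b

theorem jetRing_closure (S : Subring (JetRing k B)) (h : ∀ i b, jd k i b ∈ S) : S = ⊤ := by
  rw [eq_top_iff]
  intro x _
  obtain ⟨p, rfl⟩ := jetMk_surjective k B x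
  induction p using MvPolynomial.induction_on with
  | C c =>
    have := h 0 (algebraMap ℂ B c)
    rw [jd_const, if_pos rfl, ← (jetMk k B).commutes] at this
    exact this
  | add p q hp hq => rw [map_add]; exact add_mem (hp trivial) (hq trivial)
  | mul_X p n hp => rw [map_mul]; exact mul_mem (hp trivial) (h n.2 n.1)

instance : GradedRing (jetGr k B) :=
  weightGrading _ (jetRing_closure _ fun i b => Subring.subset_closure ⟨i, jd_mem i b⟩)

theorem jetMap_mem {B' : Type} [CommRing B'] [Algebra ℂ B'] (g : B →ₐ[ℂ] B') {m : ℕ}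
    {x : JetRing k B} (hx : x ∈ jetGr k B m) : jetMap k g x ∈ jetGr k B' m := by
  rw [jetGr, mem_weightPart] at *
  have h : (jetCoaction k B').comp (jetMap k g) =
      (Polynomial.mapAlgHom (jetMap k g)).comp (jetCoaction k B) :=
    jetHom_ext (k := k) (B := B) (T := Polynomial (JetRing k B')) fun i b => by
      rw [AlgHom.comp_apply, AlgHom.comp_apply, jetMap_jd, jetCoaction_jd, jetCoaction_jd]
      simp
  have h2 := DFunLike.congr_fun h x
  simp only [AlgHom.comp_apply] at h2
  have hx' : jetCoaction k B x = Polynomial.monomial m x := hx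
  rw [hx'] at h2
  simpa using h2

end Jets

/-! ### Logarithmic derivatives, monomials in derivatives and their types -/

section Monomials

variable {k : ℕ} {B : Type} [CommRing B] [Algebra ℂ B]

/-- The jet differential `(log z)^{(i+1)}` of a unit `z`, for `i < k`. It is determined by
`z^{(i+1)} = (z · (log z)')^{(i)} = ∑_{j ≤ i} binom(i, j) z^{(i-j)} (log z)^{(j+1)}`. -/
def logD (z : Bˣ) (i : Fin k) : JetRing k B :=
  jd k 0 ((z⁻¹ : Bˣ) : B) * (jd k i.succ (z : B) -
    ∑ j : Fin (i : ℕ), ((i : ℕ).choose (j : ℕ)) •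
      (jd k ⟨(i : ℕ) - (j : ℕ), by omega⟩ (z : B) * logD z ⟨(j : ℕ), by omega⟩))
termination_by (i : ℕ)
decreasing_by exact j.2

/-- Let `A₀ ⊆ B` be the ring of functions that extend to a partial compactification of `Spec B`.
The letters of order `i + 1` are the derivatives `a^{(i+1)}` with `a ∈ A₀`, and the
`(log z)^{(i+1)}` with `z ∈ A₀` a function that is invertible on `Spec B`. -/
def letters (A₀ : Subring B) (i : Fin k) : Set (JetRing k B) :=
  {x | (∃ a ∈ A₀, x = jd k i.succ a) ∨ (∃ z : Bˣ, (z : B) ∈ A₀ ∧ x = logD z i)}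

/-- `IsMono A₀ l x` says that `x` is a product of letters, with `l i` letters of order `i + 1`
for each `i`; that is, a monomial `(f')^{I_1} ⋯ (f^{(k)})^{I_k}` with `|I_i| = l_i`. -/
inductive IsMono (A₀ : Subring B) : (Fin k →₀ ℕ) → JetRing k B → Prop
  | one : IsMono A₀ 0 1
  | mul (l : Fin k →₀ ℕ) (x : JetRing k B) (i : Fin k) (y : JetRing k B) :
      IsMono A₀ l x → y ∈ letters A₀ i → IsMono A₀ (l + Finsupp.single i 1) (x * y)

/-- The `A₀`-linear combinations of monomials of types in `S`. -/
def typeSpan (A₀ : Subring B) (S : Set (Fin k →₀ ℕ)) : AddSubgroup (JetRing k B) :=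
  AddSubgroup.closure {x | ∃ a ∈ A₀, ∃ l ∈ S, ∃ y, IsMono A₀ l y ∧ x = jd k 0 a * y}

theorem IsMono.mul_mono {A₀ : Subring B} {l l' : Fin k →₀ ℕ} {x y : JetRing k B}
    (hx : IsMono A₀ l x) (hy : IsMono A₀ l' y) : IsMono A₀ (l + l') (x * y) := by
  induction hy with
  | one => simpa using hx
  | mul l' y i w _ hw ih => rw [← add_assoc, ← mul_assoc]; exact IsMono.mul _ _ _ _ ih hw

theorem typeSpan_one (A₀ : Subring B) : (1 : JetRing k B) ∈ typeSpan A₀ {0} := by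
  refine AddSubgroup.subset_closure ⟨1, one_mem _, 0, rfl, 1, IsMono.one, ?_⟩
  rw [mul_one]
  exact ((jd0 k B).map_one).symm

theorem typeSpan_jd0 (A₀ : Subring B) {a : B} (ha : a ∈ A₀) : jd k 0 a ∈ typeSpan A₀ {0} :=
  AddSubgroup.subset_closure ⟨a, ha, 0, rfl, 1, IsMono.one, by rw [mul_one]⟩

theorem typeSpan_mono (A₀ : Subring B) {S S' : Set (Fin k →₀ ℕ)} (h : S ⊆ S') :
    typeSpan A₀ S ≤ typeSpan A₀ S' := by
  refine AddSubgroup.closure_mono ?_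
  rintro x ⟨a, ha, l, hl, y, hy⟩
  exact ⟨a, ha, l, h hl, y, hy⟩

theorem typeSpan_mul (A₀ : Subring B) {S S' S'' : Set (Fin k →₀ ℕ)}
    (h : ∀ l ∈ S, ∀ l' ∈ S', l + l' ∈ S'') {x y : JetRing k B} (hx : x ∈ typeSpan A₀ S)
    (hy : y ∈ typeSpan A₀ S') : x * y ∈ typeSpan A₀ S'' := by
  refine AddSubgroup.closure_induction (p := fun x _ => x * y ∈ typeSpan A₀ S'')
    ?_ ?_ ?_ ?_ hx
  · rintro x ⟨a, ha, l, hl, u, hu, rfl⟩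
    refine AddSubgroup.closure_induction
      (p := fun y _ => (jd k 0 a * u) * y ∈ typeSpan A₀ S'') ?_ ?_ ?_ ?_ hy
    · rintro y ⟨a', ha', l', hl', u', hu', rfl⟩
      refine AddSubgroup.subset_closure
        ⟨a * a', mul_mem ha ha', l + l', h l hl l' hl', u * u', hu.mul_mono hu', ?_⟩
      have : jd k 0 (a * a') = jd k 0 a * jd k 0 a' := (jd0 k B).map_mul a a'
      rw [this]; ring
    · simp
    · intro u v _ _ hu hv; rw [mul_add]; exact add_mem hu hv
    · intro u _ hu; rw [mul_neg]; exact neg_mem hu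
  · simp
  · intro u v _ _ hu hv; rw [add_mul]; exact add_mem hu hv
  · intro u _ hu; rw [neg_mul]; exact neg_mem hu

theorem logD_mem (z : Bˣ) (i : Fin k) : logD z i ∈ jetGr k B ((i : ℕ) + 1) := by
  obtain ⟨n, hn⟩ := i
  induction n using Nat.strong_induction_on with
  | _ n ih =>
    rw [logD]
    have h0 := jd_mem (k := k) 0 ((z⁻¹ : Bˣ) : B)
    have := weightPart_mul (jetCoaction k B).toRingHom 0 (n + 1) (jd k 0 ((z⁻¹ : Bˣ) : B))
      (jd k (Fin.succ ⟨n, hn⟩) (z : B) -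
        ∑ j : Fin n, (n.choose (j : ℕ)) •
          (jd k ⟨n - (j : ℕ), by omega⟩ (z : B) * logD z ⟨(j : ℕ), by omega⟩)) h0 (by
        refine sub_mem (jd_mem _ _) (sum_mem fun j _ => nsmul_mem ?_ _)
        have h := weightPart_mul (jetCoaction k B).toRingHom (n - j) (j + 1) _ _
          (jd_mem ⟨n - (j : ℕ), by omega⟩ (z : B)) (ih j j.2 (by omega))
        have e : n - (j : ℕ) + ((j : ℕ) + 1) = n + 1 := by omega
        rwa [e] at h)
    rwa [zero_add] at this

theorem letters_mem {A₀ : Subring B} {i : Fin k} {x : JetRing k B} (hx : x ∈ letters A₀ i) :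
    x ∈ jetGr k B ((i : ℕ) + 1) := by
  rcases hx with ⟨a, _, rfl⟩ | ⟨z, _, rfl⟩
  · exact jd_mem i.succ a
  · exact logD_mem z i

theorem IsMono.homogeneous {A₀ : Subring B} {l : Fin k →₀ ℕ} {x : JetRing k B}
    (hx : IsMono A₀ l x) : ∃ n, x ∈ jetGr k B n := by
  induction hx with
  | one => exact ⟨0, weightPart_one _⟩
  | mul l x i y _ hy ih =>
    obtain ⟨n, hn⟩ := ih
    exact ⟨_, weightPart_mul _ _ _ _ _ hn (letters_mem hy)⟩

theorem proj_mem_of_homogeneous {A : Type} [CommRing A] (gr : ℕ → AddSubgroup A) [GradedRing gr]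
    {G : AddSubgroup A} {x : A} (hx : x ∈ G) (h : ∃ n, x ∈ gr n) (m : ℕ) :
    GradedRing.proj gr m x ∈ G := by
  obtain ⟨n, hn⟩ := h
  rw [GradedRing.proj_apply]
  by_cases hmn : n = m
  · subst hmn
    rwa [DirectSum.decompose_of_mem_same gr hn]
  · rw [DirectSum.decompose_of_mem_ne gr hn hmn]
    exact zero_mem _

theorem typeSpan_proj (A₀ : Subring B) (S : Set (Fin k →₀ ℕ)) (m : ℕ) {x : JetRing k B}
    (hx : x ∈ typeSpan A₀ S) : GradedRing.proj (jetGr k B) m x ∈ typeSpan A₀ S := by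
  refine AddSubgroup.closure_induction
    (p := fun x _ => GradedRing.proj (jetGr k B) m x ∈ typeSpan A₀ S) ?_ ?_ ?_ ?_ hx
  · rintro x ⟨a, ha, l, hl, u, hu, rfl⟩
    have hmem : jd k 0 a * u ∈ typeSpan A₀ S :=
      AddSubgroup.subset_closure ⟨a, ha, l, hl, u, hu, rfl⟩
    refine proj_mem_of_homogeneous _ hmem ?_ m
    obtain ⟨n, hn⟩ := hu.homogeneous
    exact ⟨_, weightPart_mul _ _ _ _ _ (jd_mem 0 a) hn⟩
  · rw [map_zero]; exact zero_mem _
  · intro u v _ _ hu hv; rw [map_add]; exact add_mem hu hv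
  · intro u _ hu; rw [map_neg]; exact neg_mem hu

section Map

variable {B' : Type} [CommRing B'] [Algebra ℂ B'] (g : B →ₐ[ℂ] B')

theorem jetMap_logD (z : Bˣ) (i : Fin k) :
    jetMap k g (logD z i) = logD (Units.map (g : B →* B') z) i := by
  obtain ⟨n, hn⟩ := i
  induction n using Nat.strong_induction_on with
  | _ n ih =>
    rw [logD, logD, map_mul, map_sub, map_sum, jetMap_jd, jetMap_jd]
    congr 1
    congr 1
    refine Finset.sum_congr rfl fun j _ => ?_
    rw [map_nsmul, map_mul, jetMap_jd, ih j j.2]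
    rfl

theorem IsMono.map {A₀ : Subring B} {A₀' : Subring B'} (hA : ∀ a ∈ A₀, g a ∈ A₀')
    {l : Fin k →₀ ℕ} {x : JetRing k B} (hx : IsMono A₀ l x) :
    IsMono A₀' l (jetMap k g x) := by
  induction hx with
  | one => rw [map_one]; exact IsMono.one
  | mul l x i y _ hy ih =>
    rw [map_mul]
    refine IsMono.mul _ _ _ _ ih ?_
    rcases hy with ⟨a, ha, rfl⟩ | ⟨z, hz, rfl⟩
    · exact Or.inl ⟨g a, hA a ha, by rw [jetMap_jd]⟩
    · exact Or.inr ⟨Units.map (g : B →* B') z, hA _ hz, jetMap_logD g z i⟩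

theorem typeSpan_map {A₀ : Subring B} {A₀' : Subring B'} (hA : ∀ a ∈ A₀, g a ∈ A₀')
    (S : Set (Fin k →₀ ℕ)) {x : JetRing k B} (hx : x ∈ typeSpan A₀ S) :
    jetMap k g x ∈ typeSpan A₀' S := by
  refine AddSubgroup.closure_induction
    (p := fun x _ => jetMap k g x ∈ typeSpan A₀' S) ?_ ?_ ?_ ?_ hx
  · rintro x ⟨a, ha, l, hl, u, hu, rfl⟩
    exact AddSubgroup.subset_closure ⟨g a, hA a ha, l, hl, _, hu.map g hA, by
      rw [map_mul, jetMap_jd]⟩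
  · rw [map_zero]; exact zero_mem _
  · intro u v _ _ hu hv; rw [map_add]; exact add_mem hu hv
  · intro u _ hu; rw [map_neg]; exact neg_mem hu

end Map

end Monomials

/-! ### Filtrations indexed by types, and the associated graded algebra -/

section Filtration

variable {k : ℕ}

/-- The order on `ℕ^k` in which the last entries are compared first. -/
def lexLT (p n : Fin k →₀ ℕ) : Prop := ∃ i, p i < n i ∧ ∀ j, i < j → p j = n j

/-- The non-strict version of `lexLT`. -/
def lexLE (p n : Fin k →₀ ℕ) : Prop := p = n ∨ lexLT p n

theorem lexLT_add {p n p' n' : Fin k →₀ ℕ} (h : lexLT p n) (h' : lexLE p' n') :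
    lexLT (p + p') (n + n') := by
  obtain ⟨i, hi, hij⟩ := h
  rcases h' with rfl | ⟨i', hi', hij'⟩
  · exact ⟨i, by simpa using hi, fun j hj => by simp [hij j hj]⟩
  · rcases lt_trichotomy i i' with h | h | h
    · exact ⟨i', by simp [hij i' h, hi'], fun j hj => by simp [hij j (h.trans hj), hij' j hj]⟩
    · subst h
      exact ⟨i, by simp only [Finsupp.add_apply]; omega,
        fun j hj => by simp [hij j hj, hij' j hj]⟩
    · exact ⟨i, by simp [hij' i h, hi], fun j hj => by simp [hij j hj, hij' j (h.trans hj)]⟩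

theorem lexLE_add {p n p' n' : Fin k →₀ ℕ} (h : lexLE p n) (h' : lexLE p' n') :
    lexLE (p + p') (n + n') := by
  rcases h with rfl | h
  · rcases h' with rfl | h'
    · exact Or.inl rfl
    · right
      rw [add_comm p p', add_comm p n']
      exact lexLT_add h' (Or.inl rfl)
  · exact Or.inr (lexLT_add h h')

variable (H : Type) [CommRing H] (gr : ℕ → AddSubgroup H) [GradedRing gr]

/-- For each set `S` of types, a homogeneous subgroup `F S` of a graded ring, multiplicatively. -/
structure TypeFil (k : ℕ) where
  F : Set (Fin k →₀ ℕ) → AddSubgroup H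
  one_mem : (1 : H) ∈ F {0}
  mono : ∀ {S S'}, S ⊆ S' → F S ≤ F S'
  mul_mem : ∀ {S S' S''}, (∀ l ∈ S, ∀ l' ∈ S', l + l' ∈ S'') → ∀ {x y : H},
    x ∈ F S → y ∈ F S' → x * y ∈ F S''
  proj_mem : ∀ {S} (m : ℕ) {x : H}, x ∈ F S → GradedRing.proj gr m x ∈ F S

variable {H gr} (T : TypeFil H gr k)

namespace TypeFil

/-- The step `F^l` of the filtration: types `≤ l` in the lexicographic order. -/
def le (l : Fin k →₀ ℕ) : AddSubgroup H := T.F {l' | lexLE l' l}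

/-- The part of the filtration strictly below `l`. -/
def lt (l : Fin k →₀ ℕ) : AddSubgroup H := T.F {l' | lexLT l' l}

theorem zero_le (l : Fin k →₀ ℕ) : lexLE 0 l := by
  classical
  by_cases h : l = 0
  · exact Or.inl h.symm
  · right
    have hne : l.support.Nonempty := Finsupp.support_nonempty_iff.2 h
    refine ⟨l.support.max' hne, ?_, fun j hj => ?_⟩
    · have := l.support.max'_mem hne
      simp only [Finsupp.mem_support_iff] at this
      simp only [Finsupp.coe_zero, Pi.zero_apply]
      omega
    · by_contra hj'
      have : j ∈ l.support := by
        rw [Finsupp.mem_support_iff]; exact fun h => hj' (by simp [h])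
      exact absurd (l.support.le_max' j this) (not_le.2 hj)

/-- The Rees algebra: the polynomials `∑ u_l t^l` with `u_l ∈ F^l`. -/
def rees : Subring (MvPolynomial (Fin k) H) where
  carrier := {p | ∀ l, p.coeff l ∈ T.le l}
  zero_mem' l := by simp
  one_mem' l := by
    classical
    rw [MvPolynomial.coeff_one]
    split_ifs
    · exact T.mono (by rintro _ rfl; exact zero_le l) T.one_mem
    · exact zero_mem _
  add_mem' {p q} hp hq l := by rw [MvPolynomial.coeff_add]; exact add_mem (hp l) (hq l)
  neg_mem' {p} hp l := by rw [MvPolynomial.coeff_neg]; exact neg_mem (hp l)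
  mul_mem' {p q} hp hq l := by
    classical
    rw [MvPolynomial.coeff_mul]
    refine sum_mem fun x hx => ?_
    have hx := Finset.HasAntidiagonal.mem_antidiagonal.1 hx
    exact T.mul_mem (fun a ha b hb => by rw [← hx]; exact lexLE_add ha hb) (hp x.1) (hq x.2)

/-- The ideal of the `∑ u_l t^l` with every `u_l` strictly below `l`. -/
def reesIdeal : Ideal T.rees where
  carrier := {p | ∀ l, (p : MvPolynomial (Fin k) H).coeff l ∈ T.lt l}
  zero_mem' l := by simp
  add_mem' {p q} hp hq l := by
    rw [Subring.coe_add, MvPolynomial.coeff_add]; exact add_mem (hp l) (hq l)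
  smul_mem' p q hq l := by
    classical
    rw [smul_eq_mul, mul_comm, Subring.coe_mul, MvPolynomial.coeff_mul]
    refine sum_mem fun x hx => ?_
    have hx := Finset.HasAntidiagonal.mem_antidiagonal.1 hx
    exact T.mul_mem (fun a ha b hb => by rw [← hx]; exact lexLT_add ha hb) (hq x.1) (p.2 x.2)

/-- The associated graded ring `⨁_l F^l / F^{<l}`. -/
abbrev Gr : Type := T.rees ⧸ T.reesIdeal

/-- The weight-`m` part of the associated graded ring, `⨁_l F^l H_m / F^{<l} H_m`. -/
def grGr (m : ℕ) : AddSubgroup T.Gr where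
  carrier := {x | ∃ p : T.rees, (∀ l, (p : MvPolynomial (Fin k) H).coeff l ∈ gr m) ∧
    Ideal.Quotient.mk T.reesIdeal p = x}
  zero_mem' := ⟨0, fun l => by simp, by simp⟩
  add_mem' := by
    rintro _ _ ⟨p, hp, rfl⟩ ⟨q, hq, rfl⟩
    exact ⟨p + q, fun l => by
      rw [Subring.coe_add, MvPolynomial.coeff_add]; exact add_mem (hp l) (hq l), by simp⟩
  neg_mem' := by
    rintro _ ⟨p, hp, rfl⟩
    exact ⟨-p, fun l => by
      rw [Subring.coe_neg, MvPolynomial.coeff_neg]; exact neg_mem (hp l), by simp⟩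

/-- The weight-`m` part of a polynomial with coefficients in a graded ring. -/
def cproj (gr : ℕ → AddSubgroup H) [GradedRing gr] (m : ℕ) (p : MvPolynomial (Fin k) H) :
    MvPolynomial (Fin k) H :=
  ∑ l ∈ p.support, MvPolynomial.monomial l (GradedRing.proj gr m (p.coeff l))

theorem coeff_cproj (m : ℕ) (p : MvPolynomial (Fin k) H) (l : Fin k →₀ ℕ) :
    (cproj gr m p).coeff l = GradedRing.proj gr m (p.coeff l) := by
  classical
  rw [cproj, MvPolynomial.coeff_sum]
  simp only [MvPolynomial.coeff_monomial]
  rw [Finset.sum_ite_eq']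
  split_ifs with h
  · rfl
  · rw [MvPolynomial.notMem_support_iff.1 h, map_zero]

instance : GradedRing T.grGr := by
  classical
  refine gradedRingOf _ ?_ ?_ ?_ ?_
  · refine ⟨1, fun l => ?_, map_one _⟩
    rw [Subring.coe_one, MvPolynomial.coeff_one]
    split_ifs
    · exact SetLike.GradedOne.one_mem
    · exact zero_mem _
  · rintro i j _ _ ⟨p, hp, rfl⟩ ⟨q, hq, rfl⟩
    refine ⟨p * q, fun l => ?_, map_mul _ _ _⟩
    rw [Subring.coe_mul, MvPolynomial.coeff_mul]
    exact sum_mem fun x _ => SetLike.mul_mem_graded (hp x.1) (hq x.2)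
  · rw [eq_top_iff]
    intro x _
    obtain ⟨p, rfl⟩ := Ideal.Quotient.mk_surjective x
    let s : Finset ℕ := (p : MvPolynomial (Fin k) H).support.biUnion fun l =>
      DFinsupp.support (DirectSum.decompose gr ((p : MvPolynomial (Fin k) H).coeff l))
    let P : ℕ → T.rees := fun m => ⟨cproj gr m p, fun l => by
      rw [coeff_cproj]; exact T.proj_mem m (p.2 l)⟩
    have hp : p = ∑ m ∈ s, P m := by
      apply Subtype.ext
      rw [AddSubmonoidClass.coe_finsetSum]
      ext l
      rw [MvPolynomial.coeff_sum]
      simp only [P, coeff_cproj, GradedRing.proj_apply]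
      by_cases hl : l ∈ (p : MvPolynomial (Fin k) H).support
      · conv_lhs => rw [← DirectSum.sum_support_decompose gr
          ((p : MvPolynomial (Fin k) H).coeff l)]
        refine Finset.sum_subset (fun m hm => Finset.mem_biUnion.2 ⟨l, hl, hm⟩) ?_
        intro m _ hm
        simpa using hm
      · rw [MvPolynomial.notMem_support_iff.1 hl]
        simp
    rw [hp, map_sum]
    refine sum_mem fun m _ => AddSubgroup.mem_iSup_of_mem m ⟨P m, fun l => ?_, rfl⟩
    simp only [P, coeff_cproj, GradedRing.proj_apply]
    exact SetLike.coe_mem _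
  · intro s x hx h n hn
    have hx' : ∀ n, ∃ p : T.rees, (n ∈ s → ∀ l, (p : MvPolynomial (Fin k) H).coeff l ∈ gr n) ∧
        (n ∈ s → Ideal.Quotient.mk T.reesIdeal p = x n) := by
      intro n
      by_cases hn : n ∈ s
      · obtain ⟨p, h1, h2⟩ := hx n hn
        exact ⟨p, fun _ => h1, fun _ => h2⟩
      · exact ⟨0, fun h => absurd h hn, fun h => absurd h hn⟩
    choose p hp1 hp2 using hx'
    have hs : Ideal.Quotient.mk T.reesIdeal (∑ m ∈ s, p m) = 0 := by
      rw [map_sum, ← h]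
      exact Finset.sum_congr rfl fun m hm => hp2 m hm
    rw [Ideal.Quotient.eq_zero_iff_mem] at hs
    rw [← hp2 n hn, Ideal.Quotient.eq_zero_iff_mem]
    intro l
    have hl := T.proj_mem n (hs l)
    rw [AddSubmonoidClass.coe_finsetSum, MvPolynomial.coeff_sum, map_sum,
      Finset.sum_eq_single n] at hl
    · rw [GradedRing.proj_apply, DirectSum.decompose_of_mem_same gr (hp1 n hn l)] at hl
      exact hl
    · intro m hm hmn
      rw [GradedRing.proj_apply, DirectSum.decompose_of_mem_ne gr (hp1 m hm l) hmn]
    · exact fun h => absurd hn h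

/-- The inclusion of the ring elements of type `0` in the associated graded ring. -/
def zeroHom {R : Type} [CommRing R] (φ : R →+* H) (hφ : ∀ r, φ r ∈ T.F {0}) : R →+* T.Gr :=
  (Ideal.Quotient.mk T.reesIdeal).comp
    ((MvPolynomial.C.comp φ).codRestrict T.rees (by
      classical
      intro r l
      rw [RingHom.comp_apply, MvPolynomial.coeff_C]
      split_ifs
      · exact T.mono (by rintro _ rfl; exact zero_le l) (hφ r)
      · exact zero_mem _))

theorem zeroHom_mem {R : Type} [CommRing R] (φ : R →+* H) (hφ : ∀ r, φ r ∈ T.F {0})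
    (h0 : ∀ r, φ r ∈ gr 0) (r : R) : T.zeroHom φ hφ r ∈ T.grGr 0 := by
  classical
  refine ⟨_, fun l => ?_, rfl⟩
  change (MvPolynomial.C (φ r)).coeff l ∈ gr 0
  rw [MvPolynomial.coeff_C]
  split_ifs
  · exact h0 r
  · exact zero_mem _

variable {H' : Type} [CommRing H'] {gr' : ℕ → AddSubgroup H'} [GradedRing gr']
  (T' : TypeFil H' gr' k)

/-- Functoriality of the associated graded ring. -/
def map (g : H →+* H') (hg : ∀ S x, x ∈ T.F S → g x ∈ T'.F S) : T.Gr →+* T'.Gr :=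
  Ideal.quotientMap T'.reesIdeal
    (((MvPolynomial.map g).comp T.rees.subtype).codRestrict T'.rees (fun p l => by
      rw [RingHom.comp_apply, MvPolynomial.coeff_map]; exact hg _ _ (p.2 l)))
    (fun p hp l => by
      change (MvPolynomial.map g (p : MvPolynomial (Fin k) H)).coeff l ∈ _
      rw [MvPolynomial.coeff_map]; exact hg _ _ (hp l))

theorem map_mem (g : H →+* H') (hg : ∀ S x, x ∈ T.F S → g x ∈ T'.F S)
    (hgr : ∀ m x, x ∈ gr m → g x ∈ gr' m) (m : ℕ) (x : T.Gr) (hx : x ∈ T.grGr m) :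
    T.map T' g hg x ∈ T'.grGr m := by
  obtain ⟨p, hp, rfl⟩ := hx
  refine ⟨_, fun l => ?_, rfl⟩
  change (MvPolynomial.map g (p : MvPolynomial (Fin k) H)).coeff l ∈ _
  rw [MvPolynomial.coeff_map]
  exact hgr m _ (hp l)

theorem map_zeroHom (g : H →+* H') (hg : ∀ S x, x ∈ T.F S → g x ∈ T'.F S)
    {R R' : Type} [CommRing R] [CommRing R'] (φ : R →+* H) (hφ : ∀ r, φ r ∈ T.F {0})
    (φ' : R' →+* H') (hφ' : ∀ r, φ' r ∈ T'.F {0}) (ρ : R →+* R')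
    (h : ∀ r, g (φ r) = φ' (ρ r)) (r : R) :
    T.map T' g hg (T.zeroHom φ hφ r) = T'.zeroHom φ' hφ' (ρ r) := by
  change Ideal.Quotient.mk T'.reesIdeal _ = Ideal.Quotient.mk T'.reesIdeal _
  congr 1
  apply Subtype.ext
  change MvPolynomial.map g (MvPolynomial.C (φ r)) = MvPolynomial.C (φ' (ρ r))
  rw [MvPolynomial.map_C, h]

end TypeFil

end Filtration

/-! ### Weighted symmetric algebras -/

section WeightedSym

variable (R : Type) [CommRing R] {p : ℕ} (M : Fin p → Type) [∀ i, AddCommGroup (M i)]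
  [∀ i, Module R (M i)] (a : Fin p → ℕ)

/-- The coaction on the symmetric algebra of `⨁ M i` for which `M i` has weight `a i`. -/
def symCoaction : SymmetricAlgebra R (∀ i, M i) →ₐ[R]
    Polynomial (SymmetricAlgebra R (∀ i, M i)) :=
  SymmetricAlgebra.lift
    (∑ i, ((Polynomial.monomial (a i)).restrictScalars R) ∘ₗ SymmetricAlgebra.ι R (∀ i, M i) ∘ₗ
      LinearMap.single R M i ∘ₗ LinearMap.proj i)

/-- The weight-`m` part of `Sym (M₁^{(a₁)}) ⊗ ⋯ ⊗ Sym (M_p^{(a_p)}) = Sym (M₁ ⊕ ⋯ ⊕ M_p)`,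
where the elements of `M i` are given weight `a i`. -/
def symGr (m : ℕ) : AddSubgroup (SymmetricAlgebra R (∀ i, M i)) :=
  weightPart (symCoaction R M a).toRingHom m

theorem symGr_algebraMap (r : R) :
    algebraMap R (SymmetricAlgebra R (∀ i, M i)) r ∈ symGr R M a 0 := by
  rw [symGr, mem_weightPart]
  exact (symCoaction R M a).commutes r

theorem symGr_ι (i : Fin p) (x : M i) :
    SymmetricAlgebra.ι R (∀ i, M i) (LinearMap.single R M i x) ∈ symGr R M a (a i) := by
  rw [symGr, mem_weightPart]
  change symCoaction R M a _ = _
  rw [symCoaction, SymmetricAlgebra.lift_ι_apply, LinearMap.sum_apply, Finset.sum_eq_single i]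
  · simp
  · intro j _ hj
    simp [Pi.single_eq_of_ne hj]
  · simp

theorem sym_closure (S : Subring (SymmetricAlgebra R (∀ i, M i)))
    (h1 : ∀ r, algebraMap R _ r ∈ S)
    (h2 : ∀ i x, SymmetricAlgebra.ι R (∀ i, M i) (LinearMap.single R M i x) ∈ S) : S = ⊤ := by
  rw [eq_top_iff]
  intro x _
  induction x using SymmetricAlgebra.induction with
  | algebraMap r => exact h1 r
  | ι x =>
    have : x = ∑ i, LinearMap.single R M i (x i) := by
      ext j; simp [Finset.sum_apply]
    rw [this, map_sum]
    exact sum_mem fun i _ => h2 i (x i)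
  | mul u v hu hv => exact mul_mem (hu trivial) (hv trivial)
  | add u v hu hv => exact add_mem (hu trivial) (hv trivial)

instance : GradedRing (symGr R M a) :=
  weightGrading _ (sym_closure R M _
    (fun r => Subring.subset_closure ⟨0, symGr_algebraMap R M a r⟩)
    (fun i x => Subring.subset_closure ⟨a i, symGr_ι R M a i x⟩))

variable {R M} {R' : Type} [CommRing R'] {M' : Fin p → Type} [∀ i, AddCommGroup (M' i)]
  [∀ i, Module R' (M' i)] (ρ : R →+* R') (f : ∀ i, M i →+ M' i)
  (hf : ∀ i (r : R) (x : M i), f i (r • x) = ρ r • f i x)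

/-- Functoriality of symmetric algebras, for semilinear maps. -/
def symMap : SymmetricAlgebra R (∀ i, M i) →+* SymmetricAlgebra R' (∀ i, M' i) :=
  letI : Algebra R (SymmetricAlgebra R' (∀ i, M' i)) :=
    ((algebraMap R' (SymmetricAlgebra R' (∀ i, M' i))).comp ρ).toAlgebra
  (SymmetricAlgebra.lift
    { toFun := fun x => SymmetricAlgebra.ι R' (∀ i, M' i) (fun i => f i (x i))
      map_add' := fun x y => by rw [← map_add]; congr 1; ext i; simp
      map_smul' := fun r x => by
        rw [RingHom.id_apply, Algebra.smul_def]
        change _ = algebraMap R' _ (ρ r) * _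
        rw [← Algebra.smul_def, ← map_smul]
        congr 1
        ext i
        simp [hf] } : SymmetricAlgebra R (∀ i, M i) →ₐ[R] _).toRingHom

theorem symMap_algebraMap (r : R) :
    symMap ρ f hf (algebraMap R _ r) = algebraMap R' _ (ρ r) := by
  let _ : Algebra R (SymmetricAlgebra R' (∀ i, M' i)) :=
    ((algebraMap R' (SymmetricAlgebra R' (∀ i, M' i))).comp ρ).toAlgebra
  exact AlgHom.commutes _ r

theorem symMap_ι (x : ∀ i, M i) :
    symMap ρ f hf (SymmetricAlgebra.ι R _ x) =
      SymmetricAlgebra.ι R' _ (fun i => f i (x i)) := by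
  let _ : Algebra R (SymmetricAlgebra R' (∀ i, M' i)) :=
    ((algebraMap R' (SymmetricAlgebra R' (∀ i, M' i))).comp ρ).toAlgebra
  exact SymmetricAlgebra.lift_ι_apply _ x

theorem symMap_mem (m : ℕ) (x : SymmetricAlgebra R (∀ i, M i)) (hx : x ∈ symGr R M a m) :
    symMap ρ f hf x ∈ symGr R' M' a m := by
  let S : Subring (SymmetricAlgebra R (∀ i, M i)) :=
    RingHom.eqLocus ((symCoaction R' M' a).toRingHom.comp (symMap ρ f hf))
      ((Polynomial.mapRingHom (symMap ρ f hf)).comp (symCoaction R M a).toRingHom)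
  have hS : S = ⊤ := by
    refine sym_closure R M S (fun r => ?_) (fun i x => ?_)
    · change symCoaction R' M' a (symMap ρ f hf (algebraMap R _ r)) =
        (symCoaction R M a (algebraMap R _ r)).map (symMap ρ f hf)
      rw [symMap_algebraMap, AlgHom.commutes, AlgHom.commutes, Polynomial.algebraMap_apply,
        Polynomial.algebraMap_apply, Polynomial.map_C, symMap_algebraMap]
    · change symCoaction R' M' a (symMap ρ f hf (SymmetricAlgebra.ι R _ _)) =
        (symCoaction R M a (SymmetricAlgebra.ι R _ _)).map (symMap ρ f hf)
      have h1 : symCoaction R M a (SymmetricAlgebra.ι R _ (LinearMap.single R M i x)) = _ :=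
        symGr_ι R M a i x
      have e : symMap ρ f hf (SymmetricAlgebra.ι R _ (LinearMap.single R M i x)) =
          SymmetricAlgebra.ι R' _ (LinearMap.single R' M' i (f i x)) := by
        rw [symMap_ι]
        congr 1
        ext j
        by_cases hj : j = i
        · subst hj; simp
        · simp [Pi.single_eq_of_ne hj]
      have h2 : symCoaction R' M' a
          (SymmetricAlgebra.ι R' _ (LinearMap.single R' M' i (f i x))) = _ :=
        symGr_ι R' M' a i (f i x)
      rw [e, h1, h2, Polynomial.map_monomial, e]
  have h : x ∈ S := by rw [hS]; trivial
  have h' : symCoaction R' M' a (symMap ρ f hf x) =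
    (symCoaction R M a x).map (symMap ρ f hf) := h
  have hx' : symCoaction R M a x = Polynomial.monomial m x := hx
  rw [hx', Polynomial.map_monomial] at h'
  exact h'

end WeightedSym

/-! ### Sections of schemes over `ℂ` -/

/-- `Spec ℂ`. -/
abbrev SpecC : Scheme.{0} := Spec (CommRingCat.of ℂ)

section Schemes

set_option linter.unusedVariables false

variable {X : Scheme.{0}} (b : X ⟶ SpecC)

/-- The `ℂ`-algebra of regular functions on an open subset of a scheme over `ℂ`. -/
def Sec (_ : X ⟶ SpecC) (U : X.Opens) : Type := Γ(X, U)

instance (U : X.Opens) : CommRing (Sec b U) := inferInstanceAs (CommRing Γ(X, U))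

instance (U : X.Opens) : Algebra ℂ (Sec b U) :=
  ((b.appLE ⊤ U le_top).hom.comp (Scheme.ΓSpecIso (CommRingCat.of ℂ)).inv.hom).toAlgebra

/-- Restriction of regular functions. -/
def secRes {U V : X.Opens} (h : V ≤ U) : Sec b U →ₐ[ℂ] Sec b V where
  __ := (X.presheaf.map (homOfLE h).op).hom
  commutes' c := by
    have := congrArg (fun φ => φ.hom ((Scheme.ΓSpecIso (CommRingCat.of ℂ)).inv.hom c))
      (b.appLE_map (U := ⊤) (V := U) le_top (homOfLE h).op)
    exact this

theorem secRes_comp {U V W : X.Opens} (h : V ≤ U) (h' : W ≤ V) :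
    (secRes b h').comp (secRes b h) = secRes b (h'.trans h) := by
  ext x
  have := congrArg (fun φ => φ.hom x) (X.presheaf.map_comp (homOfLE h).op (homOfLE h').op)
  exact this.symm

/-! ### Sheaves of modules and of graded algebras, given on affine open subsets -/

/-- A sheaf of `𝒪_X`-modules, given by its sections on affine open subsets. -/
structure ModuleOn where
  mod : X.affineOpens → Type
  [addCommGroup : ∀ U, AddCommGroup (mod U)]
  [module : ∀ U : X.affineOpens, Module (Sec b U) (mod U)]
  res : ∀ {U V : X.affineOpens}, (V : X.Opens) ≤ U → mod U →+ mod V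
  res_smul : ∀ {U V : X.affineOpens} (h : (V : X.Opens) ≤ U) (r : Sec b U) (x : mod U),
    res h (r • x) = secRes b h r • res h x

attribute [instance] ModuleOn.addCommGroup ModuleOn.module

/-- A sheaf of graded `𝒪_X`-algebras, given by its sections on affine open subsets. -/
structure GradedAlgOn where
  ring : X.affineOpens → Type
  [commRing : ∀ U, CommRing (ring U)]
  gr : ∀ U, ℕ → AddSubgroup (ring U)
  [graded : ∀ U, GradedRing (gr U)]
  str : ∀ U : X.affineOpens, Sec b U →+* ring U
  str_mem : ∀ U r, str U r ∈ gr U 0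
  res : ∀ {U V : X.affineOpens}, (V : X.Opens) ≤ U → ring U →+* ring V
  res_mem : ∀ {U V : X.affineOpens} (h : (V : X.Opens) ≤ U) (m : ℕ) (x : ring U),
    x ∈ gr U m → res h x ∈ gr V m
  res_str : ∀ {U V : X.affineOpens} (h : (V : X.Opens) ≤ U) (r : Sec b U),
    res h (str U r) = str V (secRes b h r)

attribute [instance] GradedAlgOn.commRing GradedAlgOn.graded

/-- The graded algebra `Sym (M₁^{(a₁)}) ⊗ ⋯ ⊗ Sym (M_p^{(a_p)})`, where the sections of `M i` have
degree `a i`. Its `Proj` is the weighted projectivized bundle `P(E₁^{(a₁)} ⊕ ⋯ ⊕ E_p^{(a_p)})` of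
the vector bundles `E i` with dual `M i`. -/
def weightedSym {p : ℕ} (M : Fin p → ModuleOn b) (a : Fin p → ℕ) : GradedAlgOn b where
  ring U := SymmetricAlgebra (Sec b U) (∀ i, (M i).mod U)
  gr U := symGr (Sec b U) (fun i => (M i).mod U) a
  str U := algebraMap _ _
  str_mem U r := symGr_algebraMap _ _ a r
  res {U V} h := symMap (secRes b h).toRingHom (fun i => (M i).res h)
    (fun i r x => (M i).res_smul h r x)
  res_mem h m x hx := symMap_mem a _ _ _ m x hx
  res_str h r := symMap_algebraMap _ _ _ r

/-! ### Subsheaves generated locally -/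

section LocallyIn

variable {N : X.Opens → Type} [∀ U, AddCommGroup (N U)]
  (res : ∀ {U V : X.Opens}, V ≤ U → N U →+ N V)
  (G : ∀ V : X.affineOpens, AddSubgroup (N V))

/-- The sections of a presheaf `N` over `U` that lie in `G V` on the affine open sets `V` of some
covering of `U`. -/
def locallyIn (res_comp : ∀ {U V W : X.Opens} (h : V ≤ U) (h' : W ≤ V) (x : N U),
      res h' (res h x) = res (h'.trans h) x)
    (hG : ∀ {V V' : X.affineOpens} (h : (V' : X.Opens) ≤ V) (x : N V), x ∈ G V → res h x ∈ G V')
    (U : X.Opens) : AddSubgroup (N U) where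
  carrier := {x | ∀ u ∈ U, ∃ (V : X.affineOpens) (h : (V : X.Opens) ≤ U),
    u ∈ (V : X.Opens) ∧ res h x ∈ G V}
  zero_mem' u hu := by
    obtain ⟨_, ⟨V, hV, rfl⟩, huV, hVU⟩ :=
      X.isBasis_affineOpens.exists_subset_of_mem_open hu U.2
    exact ⟨⟨V, hV⟩, hVU, huV, by rw [map_zero]; exact zero_mem _⟩
  add_mem' {x y} hx hy u hu := by
    obtain ⟨V, hVU, huV, hxV⟩ := hx u hu
    obtain ⟨V', hVU', huV', hyV⟩ := hy u hu
    obtain ⟨_, ⟨W, hW, rfl⟩, huW, hWV⟩ :=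
      X.isBasis_affineOpens.exists_subset_of_mem_open (a := u)
        (u := ((V : X.Opens) ⊓ V' : X.Opens)) ⟨huV, huV'⟩ ((V : X.Opens) ⊓ V' : X.Opens).2
    have h1 : W ≤ (V : X.Opens) := fun w hw => (hWV hw).1
    have h2 : W ≤ (V' : X.Opens) := fun w hw => (hWV hw).2
    refine ⟨⟨W, hW⟩, h1.trans hVU, huW, ?_⟩
    rw [map_add]
    refine add_mem ?_ ?_
    · rw [← res_comp hVU h1]; exact hG (V' := ⟨W, hW⟩) h1 _ hxV
    · rw [← res_comp hVU' h2]; exact hG (V' := ⟨W, hW⟩) h2 _ hyV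
  neg_mem' {x} hx u hu := by
    obtain ⟨V, hVU, huV, hxV⟩ := hx u hu
    exact ⟨V, hVU, huV, by rw [map_neg]; exact neg_mem hxV⟩

end LocallyIn

theorem exists_affine_le {U : X.Opens} {u : X} (hu : u ∈ U) :
    ∃ V : X.affineOpens, (V : X.Opens) ≤ U ∧ u ∈ (V : X.Opens) := by
  obtain ⟨_, ⟨V, hV, rfl⟩, huV, hVU⟩ :=
    X.isBasis_affineOpens.exists_subset_of_mem_open hu U.2
  exact ⟨⟨V, hV⟩, hVU, huV⟩

theorem exists_affine_le_inf {V V' : X.Opens} {u : X} (h : u ∈ V) (h' : u ∈ V') :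
    ∃ W : X.affineOpens, (W : X.Opens) ≤ V ∧ (W : X.Opens) ≤ V' ∧ u ∈ (W : X.Opens) := by
  obtain ⟨W, hW, hu⟩ := exists_affine_le (U := V ⊓ V') (u := u) ⟨h, h'⟩
  exact ⟨W, hW.trans inf_le_left, hW.trans inf_le_right, hu⟩

/-! ### The Green–Griffiths algebra -/

/-- The filtration by types on jet differentials. -/
def jetFil (k : ℕ) (B : Type) [CommRing B] [Algebra ℂ B] :
    TypeFil (JetRing k B) (jetGr k B) k where
  F := typeSpan ⊤
  one_mem := typeSpan_one _
  mono := typeSpan_mono _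
  mul_mem := typeSpan_mul _
  proj_mem := typeSpan_proj _ _

/-- The algebra `E^{GG}_{k,•} Ω_X` of Green–Griffiths jet differentials of order `k`, graded by
the weighted degree. -/
def greenGriffiths (k : ℕ) : GradedAlgOn b where
  ring U := JetRing k (Sec b U)
  gr U := jetGr k (Sec b U)
  str U := jd0 k (Sec b U)
  str_mem U r := jd_mem 0 r
  res h := (jetMap k (secRes b h)).toRingHom
  res_mem h m x hx := jetMap_mem _ hx
  res_str h r := jetMap_jd _ 0 r

/-- The graded algebra `Gr_F (E^{GG}_{k,•} Ω_X)` of the filtration by types in lexicographic order,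
graded by the weighted degree. -/
def grGreenGriffiths (k : ℕ) : GradedAlgOn b where
  ring U := (jetFil k (Sec b U)).Gr
  gr U := (jetFil k (Sec b U)).grGr
  str U := (jetFil k (Sec b U)).zeroHom (jd0 k (Sec b U)) fun r => typeSpan_jd0 _ (Subring.mem_top _)
  str_mem U r := (jetFil k (Sec b U)).zeroHom_mem _ _ (fun r => jd_mem 0 r) r
  res {U V} h := (jetFil k (Sec b U)).map (jetFil k (Sec b V)) (jetMap k (secRes b h)).toRingHom
    fun S x hx => typeSpan_map _ (fun _ _ => Subring.mem_top _) S hx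
  res_mem {U V} h m x hx := (jetFil k (Sec b U)).map_mem _ _ _
    (fun m x hx => jetMap_mem _ hx) m x hx
  res_str {U V} h r := (jetFil k (Sec b U)).map_zeroHom _ _ _ _ _ _ _ (secRes b h).toRingHom
    (fun r => jetMap_jd _ 0 r) r

/-- Functoriality of Kähler differentials over `ℂ`. -/
def omegaMap {B B' : Type} [CommRing B] [Algebra ℂ B] [CommRing B'] [Algebra ℂ B']
    (g : B →ₐ[ℂ] B') : Ω[B⁄ℂ] →+ Ω[B'⁄ℂ] :=
  letI : Algebra B B' := g.toRingHom.toAlgebra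
  letI : IsScalarTower ℂ B B' := IsScalarTower.of_algebraMap_eq fun c => (g.commutes c).symm
  (KaehlerDifferential.map ℂ ℂ B B').toAddMonoidHom

theorem omegaMap_smul {B B' : Type} [CommRing B] [Algebra ℂ B] [CommRing B'] [Algebra ℂ B']
    (g : B →ₐ[ℂ] B') (r : B) (x : Ω[B⁄ℂ]) : omegaMap g (r • x) = g r • omegaMap g x := by
  let _ : Algebra B B' := g.toRingHom.toAlgebra
  have : IsScalarTower ℂ B B' := IsScalarTower.of_algebraMap_eq fun c => (g.commutes c).symm
  have h := (KaehlerDifferential.map ℂ ℂ B B').map_smul r x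
  exact h.trans (algebraMap_smul B' r (KaehlerDifferential.map ℂ ℂ B B' x)).symm

theorem omegaMap_D {B B' : Type} [CommRing B] [Algebra ℂ B] [CommRing B'] [Algebra ℂ B']
    (g : B →ₐ[ℂ] B') (x : B) :
    omegaMap g (KaehlerDifferential.D ℂ B x) = KaehlerDifferential.D ℂ B' (g x) := by
  let _ : Algebra B B' := g.toRingHom.toAlgebra
  have : IsScalarTower ℂ B B' := IsScalarTower.of_algebraMap_eq fun c => (g.commutes c).symm
  exact KaehlerDifferential.map_D ℂ ℂ B B' x

theorem omegaMap_comp {B B' B'' : Type} [CommRing B] [Algebra ℂ B] [CommRing B'] [Algebra ℂ B']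
    [CommRing B''] [Algebra ℂ B''] (g : B →ₐ[ℂ] B') (g' : B' →ₐ[ℂ] B'') (x : Ω[B⁄ℂ]) :
    omegaMap g' (omegaMap g x) = omegaMap (g'.comp g) x := by
  have hx : x ∈ Submodule.span B (Set.range (KaehlerDifferential.D ℂ B)) := by
    rw [KaehlerDifferential.span_range_derivation]; trivial
  induction hx using Submodule.span_induction with
  | mem x hx => obtain ⟨y, rfl⟩ := hx; simp [omegaMap_D]
  | zero => simp
  | add x y _ _ hx hy => simp only [map_add, hx, hy]
  | smul r x _ hx => simp only [omegaMap_smul, hx, AlgHom.comp_apply]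

/-- The cotangent sheaf `Ω_X`, dual of `T_X`. -/
def cotangent : ModuleOn b where
  mod U := Ω[Sec b U⁄ℂ]
  res h := omegaMap (secRes b h)
  res_smul h r x := omegaMap_smul _ r x

/-! ### The logarithmic versions, for a divisor with complement `W` -/

section Log

variable (W : X.Opens)

/-- Restriction of regular functions to the complement of the divisor. -/
def secResLog {U V : X.Opens} (h : V ≤ U) : Sec b (U ⊓ W) →ₐ[ℂ] Sec b (V ⊓ W) :=
  secRes b (inf_le_inf_right W h)

theorem secResLog_comp {U V V' : X.Opens} (h : V ≤ U) (h' : V' ≤ V) :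
    (secResLog b W h').comp (secResLog b W h) = secResLog b W (h'.trans h) :=
  secRes_comp b _ _

/-- The functions on `U ∩ W` that extend to `U`. -/
def extendable (U : X.Opens) : Subring (Sec b (U ⊓ W)) :=
  (secRes b (inf_le_left : U ⊓ W ≤ U)).toRingHom.range

theorem extendable_res {U V : X.Opens} (h : V ≤ U) (a : Sec b (U ⊓ W))
    (ha : a ∈ extendable b W U) : secResLog b W h a ∈ extendable b W V := by
  obtain ⟨c, rfl⟩ := ha
  refine ⟨secRes b h c, ?_⟩
  change ((secRes b (inf_le_left : V ⊓ W ≤ V)).comp (secRes b h)) c =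
    ((secResLog b W h).comp (secRes b (inf_le_left : U ⊓ W ≤ U))) c
  rw [secResLog, secRes_comp, secRes_comp]

variable (k : ℕ)

/-- The jet differentials `ω` on `U ∩ W` that are, locally on `U`, combinations of the monomials
with type in `S` in the derivatives of regular functions and in the derivatives of the `log z`,
where `z` is regular, with zeros only in the divisor. The coefficients are regular functions. -/
def logTypeSpan (U : X.Opens) (S : Set (Fin k →₀ ℕ)) : AddSubgroup (JetRing k (Sec b (U ⊓ W))) :=
  locallyIn (N := fun U => JetRing k (Sec b (U ⊓ W)))
    (fun h => (jetMap k (secResLog b W h)).toRingHom.toAddMonoidHom)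
    (fun V => typeSpan (extendable b W V) S)
    (fun h h' x => (jetMap_comp _ _ x).trans (by rw [secResLog_comp]; rfl))
    (fun h x hx => typeSpan_map _ (extendable_res b W h) S hx) U

theorem mem_logTypeSpan {U : X.Opens} {S : Set (Fin k →₀ ℕ)}
    {x : JetRing k (Sec b (U ⊓ W))} : x ∈ logTypeSpan b W k U S ↔
    ∀ u ∈ U, ∃ (V : X.affineOpens) (h : (V : X.Opens) ≤ U), u ∈ (V : X.Opens) ∧
      jetMap k (secResLog b W h) x ∈ typeSpan (extendable b W V) S := Iff.rfl

theorem logTypeSpan_of_typeSpan {U : X.Opens} {S : Set (Fin k →₀ ℕ)}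
    {x : JetRing k (Sec b (U ⊓ W))} (hx : x ∈ typeSpan (extendable b W U) S) :
    x ∈ logTypeSpan b W k U S := by
  intro u hu
  obtain ⟨V, hV, huV⟩ := exists_affine_le hu
  exact ⟨V, hV, huV, typeSpan_map _ (extendable_res b W hV) S hx⟩

theorem logTypeSpan_mono {U : X.Opens} {S S' : Set (Fin k →₀ ℕ)} (h : S ⊆ S') :
    logTypeSpan b W k U S ≤ logTypeSpan b W k U S' := by
  intro x hx u hu
  obtain ⟨V, hV, huV, hxV⟩ := hx u hu
  exact ⟨V, hV, huV, typeSpan_mono _ h hxV⟩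

theorem logTypeSpan_mul {U : X.Opens} {S S' S'' : Set (Fin k →₀ ℕ)}
    (h : ∀ l ∈ S, ∀ l' ∈ S', l + l' ∈ S'') {x y : JetRing k (Sec b (U ⊓ W))}
    (hx : x ∈ logTypeSpan b W k U S) (hy : y ∈ logTypeSpan b W k U S') :
    x * y ∈ logTypeSpan b W k U S'' := by
  rw [mem_logTypeSpan] at *
  intro u hu
  obtain ⟨V, hV, huV, hxV⟩ := hx u hu
  obtain ⟨V', hV', huV', hyV⟩ := hy u hu
  obtain ⟨Z, h1, h2, huZ⟩ := exists_affine_le_inf huV huV'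
  refine ⟨Z, h1.trans hV, huZ, ?_⟩
  rw [map_mul]
  refine typeSpan_mul _ h ?_ ?_
  · have := typeSpan_map _ (extendable_res b W h1) S hxV
    rwa [jetMap_comp, secResLog_comp] at this
  · have := typeSpan_map _ (extendable_res b W h2) S' hyV
    rwa [jetMap_comp, secResLog_comp] at this

theorem logTypeSpan_res {U U' : X.Opens} (hU : U' ≤ U) {S : Set (Fin k →₀ ℕ)}
    {x : JetRing k (Sec b (U ⊓ W))} (hx : x ∈ logTypeSpan b W k U S) :
    jetMap k (secResLog b W hU) x ∈ logTypeSpan b W k U' S := by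
  rw [mem_logTypeSpan] at *
  intro u hu
  obtain ⟨V, hV, huV, hxV⟩ := hx u (hU hu)
  obtain ⟨Z, h1, h2, huZ⟩ := exists_affine_le_inf huV hu
  refine ⟨Z, h2, huZ, ?_⟩
  have := typeSpan_map _ (extendable_res b W h1) S hxV
  rw [jetMap_comp, secResLog_comp] at this
  rwa [jetMap_comp, secResLog_comp]

theorem proj_ringHom {A A' : Type} [CommRing A] [CommRing A'] (gr : ℕ → AddSubgroup A)
    [GradedRing gr] (gr' : ℕ → AddSubgroup A') [GradedRing gr'] (g : A →+* A')
    (hg : ∀ m x, x ∈ gr m → g x ∈ gr' m) (m : ℕ) (x : A) :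
    g (GradedRing.proj gr m x) = GradedRing.proj gr' m (g x) := by
  classical
  conv_rhs => rw [← DirectSum.sum_support_decompose gr x, map_sum, map_sum]
  rw [Finset.sum_eq_single m]
  · rw [GradedRing.proj_apply, GradedRing.proj_apply,
      DirectSum.decompose_of_mem_same gr' (hg m _ (SetLike.coe_mem _))]
  · intro n _ hn
    rw [GradedRing.proj_apply, DirectSum.decompose_of_mem_ne gr' (hg n _ (SetLike.coe_mem _)) hn]
  · intro hm
    rw [DFinsupp.notMem_support_iff.1 hm]
    simp

theorem logTypeSpan_proj {U : X.Opens} {S : Set (Fin k →₀ ℕ)} (m : ℕ)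
    {x : JetRing k (Sec b (U ⊓ W))} (hx : x ∈ logTypeSpan b W k U S) :
    GradedRing.proj (jetGr k (Sec b (U ⊓ W))) m x ∈ logTypeSpan b W k U S := by
  intro u hu
  obtain ⟨V, hV, huV, hxV⟩ := hx u hu
  refine ⟨V, hV, huV, ?_⟩
  have := proj_ringHom (jetGr k (Sec b (U ⊓ W))) (jetGr k (Sec b ((V : X.Opens) ⊓ W)))
    (jetMap k (secResLog b W hV)).toRingHom (fun m x hx => jetMap_mem _ hx) m x
  change (jetMap k (secResLog b W hV)).toRingHom _ ∈ _
  rw [this]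
  exact typeSpan_proj _ _ m hxV

/-- The filtration by types on logarithmic jet differentials. -/
def logFil (U : X.Opens) :
    TypeFil (JetRing k (Sec b (U ⊓ W))) (jetGr k (Sec b (U ⊓ W))) k where
  F := logTypeSpan b W k U
  one_mem := logTypeSpan_of_typeSpan b W k (typeSpan_one _)
  mono := logTypeSpan_mono b W k
  mul_mem := logTypeSpan_mul b W k
  proj_mem := logTypeSpan_proj b W k

/-- The ring of logarithmic jet differentials on `U`, inside the jet differentials on `U ∩ W`. -/
def logJets (U : X.Opens) : Subring (JetRing k (Sec b (U ⊓ W))) where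
  __ := logTypeSpan b W k U Set.univ
  one_mem' := logTypeSpan_mono b W k (Set.subset_univ _) (logFil b W k U).one_mem
  mul_mem' := logTypeSpan_mul b W k (fun _ _ _ _ => Set.mem_univ _)

theorem mem_logJets {U : X.Opens} {x : JetRing k (Sec b (U ⊓ W))} :
    x ∈ logJets b W k U ↔ x ∈ logTypeSpan b W k U Set.univ := Iff.rfl

/-- The logarithmic jet differentials of weighted degree `m`. -/
def logJetGr (U : X.Opens) (m : ℕ) : AddSubgroup (logJets b W k U) :=
  (jetGr k (Sec b (U ⊓ W)) m).comap (logJets b W k U).subtype.toAddMonoidHom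

instance (U : X.Opens) : GradedRing (logJetGr b W k U) := by
  classical
  refine gradedRingOf _ ?_ ?_ ?_ ?_
  · exact weightPart_one (jetCoaction k (Sec b (U ⊓ W))).toRingHom
  · intro i j x y hx hy
    exact weightPart_mul (jetCoaction k (Sec b (U ⊓ W))).toRingHom i j _ _ hx hy
  · rw [eq_top_iff]
    intro x _
    let P : ℕ → logJets b W k U := fun m =>
      ⟨GradedRing.proj (jetGr k (Sec b (U ⊓ W))) m x, logTypeSpan_proj b W k m x.2⟩
    have hx : x = ∑ m ∈ DFinsupp.support (DirectSum.decompose (jetGr k (Sec b (U ⊓ W)))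
        (x : JetRing k (Sec b (U ⊓ W)))), P m := by
      apply Subtype.ext
      rw [AddSubmonoidClass.coe_finsetSum]
      exact (DirectSum.sum_support_decompose (jetGr k (Sec b (U ⊓ W))) _).symm
    rw [hx]
    refine sum_mem fun m _ => AddSubgroup.mem_iSup_of_mem m ?_
    change GradedRing.proj (jetGr k (Sec b (U ⊓ W))) m _ ∈ jetGr k (Sec b (U ⊓ W)) m
    rw [GradedRing.proj_apply]
    exact SetLike.coe_mem _
  · intro s x hx h n hn
    have h' := congrArg (fun y : logJets b W k U =>
      GradedRing.proj (jetGr k (Sec b (U ⊓ W))) n (y : JetRing k (Sec b (U ⊓ W)))) h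
    simp only [AddSubmonoidClass.coe_finsetSum, ZeroMemClass.coe_zero, map_zero, map_sum] at h'
    rw [Finset.sum_eq_single n] at h'
    · have hxn : (x n : JetRing k (Sec b (U ⊓ W))) ∈ jetGr k (Sec b (U ⊓ W)) n := hx n hn
      rw [GradedRing.proj_apply, DirectSum.decompose_of_mem_same _ hxn] at h'
      exact Subtype.ext h'
    · intro m hm hmn
      have hxm : (x m : JetRing k (Sec b (U ⊓ W))) ∈ jetGr k (Sec b (U ⊓ W)) m := hx m hm
      rw [GradedRing.proj_apply, DirectSum.decompose_of_mem_ne _ hxm hmn]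
    · exact fun h => absurd hn h

/-- Regular functions on `U` as jet differentials on `U ∩ W`. -/
def logStr (U : X.Opens) : Sec b U →+* JetRing k (Sec b (U ⊓ W)) :=
  (jd0 k (Sec b (U ⊓ W))).comp (secRes b (inf_le_left : U ⊓ W ≤ U)).toRingHom

theorem logStr_type (U : X.Opens) (r : Sec b U) :
    logStr b W k U r ∈ logTypeSpan b W k U {0} :=
  logTypeSpan_of_typeSpan b W k (typeSpan_jd0 _ ⟨r, rfl⟩)

theorem logStr_res {U V : X.Opens} (h : V ≤ U) (r : Sec b U) :
    jetMap k (secResLog b W h) (logStr b W k U r) = logStr b W k V (secRes b h r) := by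
  change jetMap k (secResLog b W h) (jd k 0 _) = jd k 0 _
  rw [jetMap_jd]
  congr 1
  change ((secResLog b W h).comp (secRes b (inf_le_left : U ⊓ W ≤ U))) r =
    ((secRes b (inf_le_left : V ⊓ W ≤ V)).comp (secRes b h)) r
  rw [secResLog, secRes_comp, secRes_comp]

/-- The algebra `E^{GG}_{k,•} Ω_X(log D)` of logarithmic jet differentials of order `k`, graded by
the weighted degree, where `W = X ∖ D`. -/
def logGreenGriffiths : GradedAlgOn b where
  ring U := logJets b W k U
  gr U := logJetGr b W k U
  str U := (logStr b W k U).codRestrict (logJets b W k U)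
    fun r => logTypeSpan_mono b W k (Set.subset_univ _) (logStr_type b W k U r)
  str_mem U r := jd_mem 0 _
  res {U V} h := ((jetMap k (secResLog b W h)).toRingHom.comp
    (logJets b W k U).subtype).codRestrict (logJets b W k V)
      fun x => logTypeSpan_res b W k h x.2
  res_mem h m x hx := jetMap_mem _ hx
  res_str h r := Subtype.ext (logStr_res b W k h r)

/-- The graded algebra `Gr_F (E^{GG}_{k,•} Ω_X(log D))` of the filtration by types in lexicographic
order, graded by the weighted degree, where `W = X ∖ D`. -/
def grLogGreenGriffiths : GradedAlgOn b where
  ring U := (logFil b W k U).Gr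
  gr U := (logFil b W k U).grGr
  str U := (logFil b W k U).zeroHom (logStr b W k U) (logStr_type b W k U)
  str_mem U r := (logFil b W k U).zeroHom_mem _ _ (fun r => jd_mem 0 _) r
  res {U V} h := (logFil b W k U).map (logFil b W k V)
    (jetMap k (secResLog b W h)).toRingHom fun S x hx => logTypeSpan_res b W k h hx
  res_mem {U V} h m x hx := (logFil b W k U).map_mem _ _ _
    (fun m x hx => jetMap_mem _ hx) m x hx
  res_str {U V} h r := (logFil b W k U).map_zeroHom _ _ _ _ _ _ _ (secRes b h).toRingHom
    (fun r => logStr_res b W k h r) r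

/-- The differential forms on `U ∩ W` generated over the functions that extend to `U` by the `da`,
and by the `dz / z` with `z` invertible on `U ∩ W`, where `a` and `z` are regular on `U`. -/
def logFormSpan (U : X.Opens) : AddSubgroup (Ω[Sec b (U ⊓ W)⁄ℂ]) :=
  AddSubgroup.closure
    ({x | ∃ c ∈ extendable b W U, ∃ a ∈ extendable b W U,
        x = c • KaehlerDifferential.D ℂ (Sec b (U ⊓ W)) a} ∪
      {x | ∃ c ∈ extendable b W U, ∃ z : (Sec b (U ⊓ W))ˣ,
        (z : Sec b (U ⊓ W)) ∈ extendable b W U ∧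
        x = (c * ((z⁻¹ : (Sec b (U ⊓ W))ˣ) : Sec b (U ⊓ W))) •
          KaehlerDifferential.D ℂ (Sec b (U ⊓ W)) (z : Sec b (U ⊓ W))})

theorem logFormSpan_res {U V : X.Opens} (h : V ≤ U) {x : Ω[Sec b (U ⊓ W)⁄ℂ]}
    (hx : x ∈ logFormSpan b W U) : omegaMap (secResLog b W h) x ∈ logFormSpan b W V := by
  refine AddSubgroup.closure_induction
    (p := fun x _ => omegaMap (secResLog b W h) x ∈ logFormSpan b W V) ?_ ?_ ?_ ?_ hx
  · rintro x (⟨c, hc, a, ha, rfl⟩ | ⟨c, hc, z, hz, rfl⟩)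
    · exact AddSubgroup.subset_closure (Or.inl ⟨_, extendable_res b W h c hc, _,
        extendable_res b W h a ha, by rw [omegaMap_smul, omegaMap_D]⟩)
    · refine AddSubgroup.subset_closure (Or.inr ⟨_, extendable_res b W h c hc,
        Units.map (secResLog b W h : Sec b (U ⊓ W) →* Sec b (V ⊓ W)) z, extendable_res b W h _ hz, ?_⟩)
      rw [omegaMap_smul, omegaMap_D, map_mul]
      rfl
  · rw [map_zero]; exact zero_mem _
  · intro u v _ _ hu hv; rw [map_add]; exact add_mem hu hv
  · intro u _ hu; rw [map_neg]; exact neg_mem hu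

theorem logFormSpan_smul {U : X.Opens} {c : Sec b (U ⊓ W)} (hc : c ∈ extendable b W U)
    {x : Ω[Sec b (U ⊓ W)⁄ℂ]} (hx : x ∈ logFormSpan b W U) : c • x ∈ logFormSpan b W U := by
  refine AddSubgroup.closure_induction
    (p := fun x _ => c • x ∈ logFormSpan b W U) ?_ ?_ ?_ ?_ hx
  · rintro x (⟨c', hc', a, ha, rfl⟩ | ⟨c', hc', z, hz, rfl⟩)
    · exact AddSubgroup.subset_closure (Or.inl ⟨_, mul_mem hc hc', a, ha, by rw [smul_smul]⟩)
    · exact AddSubgroup.subset_closure (Or.inr ⟨_, mul_mem hc hc', z, hz, by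
        rw [smul_smul, mul_assoc]⟩)
  · rw [smul_zero]; exact zero_mem _
  · intro u v _ _ hu hv; rw [smul_add]; exact add_mem hu hv
  · intro u _ hu; rw [smul_neg]; exact neg_mem hu

/-- The logarithmic differential forms on `U`. -/
def logForms (U : X.Opens) : AddSubgroup (Ω[Sec b (U ⊓ W)⁄ℂ]) :=
  locallyIn (N := fun U => Ω[Sec b (U ⊓ W)⁄ℂ]) (fun h => omegaMap (secResLog b W h))
    (fun V => logFormSpan b W V)
    (fun h h' x => (omegaMap_comp _ _ x).trans (by rw [secResLog_comp]))
    (fun h x hx => logFormSpan_res b W h hx) U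

theorem logForms_res {U V : X.Opens} (h : V ≤ U) {x : Ω[Sec b (U ⊓ W)⁄ℂ]}
    (hx : x ∈ logForms b W U) : omegaMap (secResLog b W h) x ∈ logForms b W V := by
  intro u hu
  obtain ⟨Z, hZ, huZ, hxZ⟩ := hx u (h hu)
  obtain ⟨Z', h1, h2, huZ'⟩ := exists_affine_le_inf huZ hu
  refine ⟨Z', h2, huZ', ?_⟩
  have := logFormSpan_res b W h1 hxZ
  rw [omegaMap_comp, secResLog_comp] at this
  rwa [omegaMap_comp, secResLog_comp]

theorem logForms_smul {U : X.Opens} (r : Sec b U) {x : Ω[Sec b (U ⊓ W)⁄ℂ]}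
    (hx : x ∈ logForms b W U) :
    secRes b (inf_le_left : U ⊓ W ≤ U) r • x ∈ logForms b W U := by
  intro u hu
  obtain ⟨Z, hZ, huZ, hxZ⟩ := hx u hu
  refine ⟨Z, hZ, huZ, ?_⟩
  rw [omegaMap_smul]
  exact logFormSpan_smul b W (extendable_res b W hZ _ ⟨r, rfl⟩) hxZ

/-- The sheaf `Ω_X(log D)`, dual of `T_X(-log D)`, where `W = X ∖ D`. -/
def logCotangent : ModuleOn b where
  mod U := logForms b W U
  module U :=
    { smul := fun r x => ⟨secRes b (inf_le_left : (U : X.Opens) ⊓ W ≤ U) r • (x : Ω[Sec b ((U : X.Opens) ⊓ W)⁄ℂ]),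
        logForms_smul b W r x.2⟩
      one_smul := fun x => Subtype.ext (by
        change secRes b _ 1 • (x : Ω[Sec b ((U : X.Opens) ⊓ W)⁄ℂ]) = x
        rw [map_one, one_smul])
      mul_smul := fun r s x => Subtype.ext (by
        change secRes b _ (r * s) • (x : Ω[Sec b ((U : X.Opens) ⊓ W)⁄ℂ]) = secRes b _ r • secRes b _ s • (x : Ω[Sec b ((U : X.Opens) ⊓ W)⁄ℂ])
        rw [map_mul, mul_smul])
      smul_zero := fun r => Subtype.ext (smul_zero _)
      smul_add := fun r x y => Subtype.ext (smul_add _ _ _)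
      add_smul := fun r s x => Subtype.ext (by
        change secRes b _ (r + s) • (x : Ω[Sec b ((U : X.Opens) ⊓ W)⁄ℂ]) =
          secRes b _ r • (x : Ω[Sec b ((U : X.Opens) ⊓ W)⁄ℂ]) + secRes b _ s • (x : Ω[Sec b ((U : X.Opens) ⊓ W)⁄ℂ])
        rw [map_add, add_smul])
      zero_smul := fun x => Subtype.ext (by
        change secRes b _ 0 • (x : Ω[Sec b ((U : X.Opens) ⊓ W)⁄ℂ]) = 0
        rw [map_zero, zero_smul]) }
  res {U V} h := ((omegaMap (secResLog b W h)).comp (logForms b W U).subtype).codRestrict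
    (logForms b W V) fun x => logForms_res b W h x.2
  res_smul {U V} h r x := Subtype.ext (by
    change omegaMap (secResLog b W h) (secRes b (inf_le_left : (U : X.Opens) ⊓ W ≤ U) r • (x : Ω[Sec b ((U : X.Opens) ⊓ W)⁄ℂ])) =
      secRes b (inf_le_left : (V : X.Opens) ⊓ W ≤ V) (secRes b h r) • omegaMap (secResLog b W h) (x : Ω[Sec b ((U : X.Opens) ⊓ W)⁄ℂ])
    rw [omegaMap_smul]
    congr 1
    change ((secResLog b W h).comp (secRes b (inf_le_left : (U : X.Opens) ⊓ W ≤ U))) r =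
      ((secRes b (inf_le_left : (V : X.Opens) ⊓ W ≤ V)).comp (secRes b h)) r
    rw [secResLog, secRes_comp, secRes_comp])

end Log

/-! ### Varieties with an orbifold line bundle -/

/-- A scheme `Y` over `S` with an orbifold structure and a (locally ample) orbifold line bundle
`𝒪(1)`, given by the `ℂ^*`-bundle `q : P ⟶ Y` of its frames, i.e. by the complement `P` of the zero
section in the total space of the dual bundle. The action of `ℂ^*` on `P` is recorded by the
`ℤ`-grading `q_* 𝒪_P = ⨁ 𝒪(m)` of the sheaf of regular functions along the fibres of `q`; the
degree-`m` part is the sheaf of sections of `𝒪(m)`. Here `Y` is the quotient of `P` by `ℂ^*`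
(the degree `0` part is `𝒪_Y`), `P` is smooth over `ℂ`, and locally on `Y` there is an invertible
section `u` of some `𝒪(N)`, `N > 0`. The orbifold is `[P / ℂ^*]`: its chart over the open set where
`u` lives is the smooth slice `{u = 1} ⊆ P`, with the group `μ_N` of `N`-th roots of unity, whose
stabilizers act faithfully on the fibres of `𝒪(1)`. -/
structure OrbiFamily {S : Scheme.{0}} (s : S ⟶ SpecC) where
  Y : Scheme.{0}
  π : Y ⟶ S
  P : Scheme.{0}
  q : P ⟶ Y
  affine : IsAffineHom q
  smooth : Smooth (q ≫ π ≫ s)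
  /-- The sections of `𝒪(m)` over `U`. -/
  O : ∀ U : Y.Opens, ℤ → AddSubgroup Γ(P, q ⁻¹ᵁ U)
  mul : ∀ U i j x y, x ∈ O U i → y ∈ O U j → x * y ∈ O U (i + j)
  res : ∀ {U V : Y.Opens} (h : V ≤ U) (m : ℤ) (x : Γ(P, q ⁻¹ᵁ U)), x ∈ O U m →
    (P.presheaf.map (homOfLE (q.preimage_mono h)).op).hom x ∈ O V m
  locality : ∀ (U : Y.Opens) (m : ℤ) (x : Γ(P, q ⁻¹ᵁ U)),
    (∀ y ∈ U, ∃ (V : Y.Opens) (h : V ≤ U), y ∈ V ∧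
      (P.presheaf.map (homOfLE (q.preimage_mono h)).op).hom x ∈ O V m) → x ∈ O U m
  internal : ∀ U : Y.affineOpens, DirectSum.IsInternal (O U)
  zero_eq : ∀ U, (O U 0 : Set Γ(P, q ⁻¹ᵁ U)) = Set.range (q.app U).hom
  injective : ∀ U, Function.Injective (q.app U).hom
  exists_unit : ∀ y : Y, ∃ U : Y.Opens, y ∈ U ∧ ∃ N : ℤ, 0 < N ∧ ∃ u ∈ O U N, IsUnit u

/-- `Z'` over `S'` is the fibre product of `Z` with `i : S' ⟶ S`, and its orbifold line bundle is
the restriction of that of `Z`: the `ℂ^*`-bundle of frames of `Z'` is the pullback of that of `Z`,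
equivariantly. -/
structure IsRestriction {S S' : Scheme.{0}} {s : S ⟶ SpecC} {s' : S' ⟶ SpecC} (i : S' ⟶ S)
    (Z' : OrbiFamily s') (Z : OrbiFamily s) where
  f : Z'.Y ⟶ Z.Y
  isPullback : IsPullback f Z'.π Z.π i
  g : Z'.P ⟶ Z.P
  isPullback_frames : IsPullback g Z'.q Z.q f
  map_mem : ∀ (U : Z.Y.Opens) (m : ℤ) (x : Γ(Z.P, Z.q ⁻¹ᵁ U)), x ∈ Z.O U m →
    (g.appLE (Z.q ⁻¹ᵁ U) (Z'.q ⁻¹ᵁ f ⁻¹ᵁ U) (by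
      rw [← Scheme.Hom.comp_preimage, ← Scheme.Hom.comp_preimage, isPullback_frames.w])).hom x ∈
        Z'.O (f ⁻¹ᵁ U) m

/-- `Z` is `Proj_X` of the sheaf `A` of graded algebras, as a scheme over `X`: over each affine open
set `U` it is identified with `Proj A(U)`, compatibly with restriction. The compatibility, and the
identification of the orbifold line bundle with the tautological one, are expressed by the graded
homomorphisms `A(U) → ⨁ Γ(Z_U, 𝒪(m))`: they commute with restriction, and over `D₊(f)` they
identify `⨁ 𝒪(m)` with the localization `A(U)_f`, where the fraction `a / f ^ n` of degree zero
corresponds to the function `a / f ^ n` on `D₊(f) ⊆ Proj A(U)`. -/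
structure IsProj {b : X ⟶ SpecC} (A : GradedAlgOn b) (Z : OrbiFamily b) where
  chart : ∀ U : X.affineOpens, Proj (A.gr U) ⟶ Z.Y
  openImm : ∀ U, IsOpenImmersion (chart U)
  range : ∀ U : X.affineOpens, (chart U).opensRange = Z.π ⁻¹ᵁ (U : X.Opens)
  sec : ∀ U : X.affineOpens, A.ring U →+* Γ(Z.P, Z.q ⁻¹ᵁ Z.π ⁻¹ᵁ (U : X.Opens))
  sec_mem : ∀ U (m : ℕ) (x : A.ring U), x ∈ A.gr U m → sec U x ∈ Z.O (Z.π ⁻¹ᵁ (U : X.Opens)) m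
  sec_str : ∀ (U : X.affineOpens) (r : Sec b U),
    sec U (A.str U r) = (Z.q.app (Z.π ⁻¹ᵁ (U : X.Opens))).hom ((Z.π.app (U : X.Opens)).hom r)
  sec_res : ∀ {U V : X.affineOpens} (h : (V : X.Opens) ≤ U) (x : A.ring U),
    sec V (A.res h x) =
      (Z.P.presheaf.map (homOfLE (Z.q.preimage_mono (Z.π.preimage_mono h))).op).hom (sec U x)
  isLocalization : ∀ (U : X.affineOpens) (d : ℕ) (f : A.ring U), 0 < d → f ∈ A.gr U d →
    ∀ (h : chart U ''ᵁ Proj.basicOpen (A.gr U) f ≤ Z.π ⁻¹ᵁ (U : X.Opens)),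
    letI := ((Z.P.presheaf.map (homOfLE (Z.q.preimage_mono h)).op).hom.comp (sec U)).toAlgebra
    IsLocalization.Away f Γ(Z.P, Z.q ⁻¹ᵁ (chart U ''ᵁ Proj.basicOpen (A.gr U) f))
  fraction : ∀ (U : X.affineOpens) (d : ℕ) (f : A.ring U), 0 < d → ∀ (hf : f ∈ A.gr U d)
    (h : chart U ''ᵁ Proj.basicOpen (A.gr U) f ≤ Z.π ⁻¹ᵁ (U : X.Opens))
    (n : ℕ) (a : A.ring U) (ha : a ∈ A.gr U (n • d)),
    (Z.q.app (chart U ''ᵁ Proj.basicOpen (A.gr U) f)).hom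
        (((chart U).appIso (Proj.basicOpen (A.gr U) f)).inv.hom
          ((Proj.awayToSection (A.gr U) f).hom (HomogeneousLocalization.Away.mk (A.gr U) hf n a ha)))
      * (Z.P.presheaf.map (homOfLE (Z.q.preimage_mono h)).op).hom (sec U f) ^ n =
      (Z.P.presheaf.map (homOfLE (Z.q.preimage_mono h)).op).hom (sec U a)

/-! ### The deformation -/

/-- The affine line `ℂ`. -/
abbrev affineLine : Scheme.{0} := Spec (CommRingCat.of (Polynomial ℂ))

/-- The structure map of the affine line. -/
def affineLineMap : affineLine ⟶ SpecC :=
  Spec.map (CommRingCat.ofHom (Polynomial.C : ℂ →+* Polynomial ℂ))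

/-- The point `lam` of the affine line. -/
def point (lam : ℂ) : SpecC ⟶ affineLine :=
  Spec.map (CommRingCat.ofHom (Polynomial.evalRingHom lam))

theorem point_comp (lam : ℂ) : point lam ≫ affineLineMap = 𝟙 SpecC := by
  rw [point, affineLineMap, ← Spec.map_comp, ← CommRingCat.ofHom_comp]
  have : (Polynomial.evalRingHom lam).comp Polynomial.C = RingHom.id ℂ := by ext; simp
  rw [this]
  exact Spec.map_id _

/-- The product `X × ℂ`. -/
abbrev timesLine : Scheme.{0} := Limits.pullback b affineLineMap

/-- The inclusion of `X = X × {lam}` in `X × ℂ`. -/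
def slice (lam : ℂ) : X ⟶ timesLine b :=
  Limits.pullback.lift (𝟙 X) (b ≫ point lam) (by
    rw [Category.assoc, point_comp, Category.comp_id, Category.id_comp])

/-- There is a proper morphism `𝒳 ⟶ X × ℂ`, flat over `ℂ`, and an orbifold line bundle on `𝒳`, such
that for every `lam ≠ 0` the fibre over `X × {lam}` is `Proj_X E` with its tautological bundle, and
the fibre over `X × {0}` is both `Proj_X G` and `Proj_X A` with their tautological bundles. -/
def DeformsTo {b : X ⟶ SpecC} (E G A : GradedAlgOn b) : Prop :=
  ∃ 𝒳 : OrbiFamily (Limits.pullback.fst b affineLineMap ≫ b),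
    IsProper 𝒳.π ∧
    Flat (𝒳.π ≫ Limits.pullback.snd b affineLineMap) ∧
    (∀ lam : ℂ, lam ≠ 0 → ∃ Z : OrbiFamily b,
      Nonempty (IsRestriction (slice b lam) Z 𝒳) ∧ Nonempty (IsProj E Z)) ∧
    (∃ Z : OrbiFamily b,
      Nonempty (IsRestriction (slice b 0) Z 𝒳) ∧ Nonempty (IsProj G Z) ∧ Nonempty (IsProj A Z))

/-! ### Projective manifolds and normal crossing divisors -/

instance (N : ℕ) : GradedRing (MvPolynomial.homogeneousSubmodule (Fin (N + 1)) ℂ) :=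
  MvPolynomial.gradedAlgebra

/-- The structure map of the projective space `ℙ^N` over `ℂ`. -/
def projectiveSpaceMap (N : ℕ) :
    Proj (MvPolynomial.homogeneousSubmodule (Fin (N + 1)) ℂ) ⟶ SpecC :=
  Proj.toSpecZero (MvPolynomial.homogeneousSubmodule (Fin (N + 1)) ℂ) ≫
    Spec.map (CommRingCat.ofHom
      (algebraMap ℂ (MvPolynomial.homogeneousSubmodule (Fin (N + 1)) ℂ 0)))

/-- `X` is a smooth projective variety over `ℂ`, i.e. a complex projective manifold. -/
def IsProjectiveManifold : Prop :=
  Smooth b ∧ ∃ (N : ℕ) (i : X ⟶ Proj (MvPolynomial.homogeneousSubmodule (Fin (N + 1)) ℂ)),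
    IsClosedImmersion i ∧ i ≫ projectiveSpaceMap N = b

/-- The closed subset `D` is a (reduced) simple normal crossing divisor: near every point there are
local coordinates `z i` such that `D` is defined by a product of some of them. -/
def IsSNCDivisor (D : TopologicalSpace.Closeds X) : Prop :=
  ∀ x : X, ∃ V : X.affineOpens, x ∈ (V : X.Opens) ∧
    ∃ (n : ℕ) (z : Fin n → Sec b V) (c : Finset (Fin n)),
      LinearIndependent (Sec b V) (fun i => KaehlerDifferential.D ℂ (Sec b V) (z i)) ∧
      Submodule.span (Sec b V) (Set.range fun i => KaehlerDifferential.D ℂ (Sec b V) (z i)) = ⊤ ∧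
      ∀ y ∈ (V : X.Opens), y ∈ D ↔ ∃ i ∈ c, y ∉ X.basicOpen (z i : Γ(X, V))

end Schemes

end

end JetDeformation

namespace JetDeformation

noncomputable section

open MvPolynomial (monomial aeval coeff_monomial eval₂Hom eval₂Hom_C eval₂Hom_X' coeff_map
  coeff_zero coeff_add coeff_neg coeff_C coeff_C_mul coeff_mul C_mul_monomial notMem_support_iff
  mem_support_iff X_pow_eq_monomial ringHom_ext map_C map_X map_monomial monomial_mul monomial_pow
  aeval_X induction_on induction_on' C_pow map_map map_id)
open Polynomial (evalRingHom mapRingHom coe_eval₂RingHom coe_evalRingHom eval₂RingHom eval₂_C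
  eval₂_X eval_C eval_X coe_mapRingHom)
open HomogeneousLocalization (fromZeroRingHom val_injective)
open HomogeneousLocalization.Away (val_mk map_mk)
open CommRingCat (ofHom ofHom_comp)
open CategoryTheory.Category (assoc comp_id id_comp)
open Ideal.Quotient (mk_surjective eq_zero_iff_mem)
open KaehlerDifferential (D span_range_derivation)
open RingHom (comp_apply eqLocus)
open HomogeneousIdeal (irrelevant toIdeal_irrelevant_le mem_irrelevant_of_mem)
open Finsupp (single linearCombination induction_linear single_eq_of_ne single_eq_same)
open Submonoid (powers)
open Function (Bijective Injective Surjective iterate_succ_apply' iterate_succ_apply bijective_id)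
open GradedRing (proj proj_apply)
open Localization (Away AtPrime mk_eq_mk'_apply)
open IsLocalization.Away (algebraMap_isUnit)
open IsLocalization (mk'_spec map_eq_zero_iff)
open AddSubgroup (subset_closure closure_induction)
open Subring (mem_top)
open Algebra (smul_def)
open Finset (sum_congr sum_eq_single mem_univ mul_sum mem_filter sum_add_distrib)
open AlgebraicGeometry.Scheme.AffineZariskiSite (directedCover toOpens_mono)
open AlgebraicGeometry.Scheme.Hom (comp_preimage appLE_comp_appLE app_eq_appLE)
open AlgebraicGeometry.Scheme (presieve₀_mem_precoverage_iff)
open CategoryTheory.Limits.pullback (lift_fst lift_snd)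
open AlgebraicGeometry.Proj (awayι basicOpenIsoSpec opensRange_awayι awayToSection affineOpenCover)
open Finset.HasAntidiagonal (mem_antidiagonal antidiagonal)
open TopologicalSpace.Opens (mem_iSup)

variable {X : Scheme.{0}} {b : X ⟶ SpecC}

lemma basicOpen_le {U : X.Opens} (f : Sec b U) : X.basicOpen (f : Γ(X, U)) ≤ U := X.basicOpen_le _

section
section OpenPullback

/-- A square whose horizontal sides are open immersions is cartesian if the left-hand corner is the
preimage. -/
lemma isPullback_of_preimage_opensRange {U V Y Z : Scheme.{0}} (i : U ⟶ Z) (j : V ⟶ Y)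
    [IsOpenImmersion i] [IsOpenImmersion j] (g : V ⟶ U) (f : Y ⟶ Z) (w : g ≫ i = j ≫ f)
    (h : f ⁻¹ᵁ i.opensRange ≤ j.opensRange) : IsPullback g j i f := by
  have H (s : Limits.PullbackCone i f) : Set.range s.snd ⊆ Set.range j := by
    rintro _ ⟨x, rfl⟩
    apply h
    change f (s.snd x) ∈ i.opensRange
    rw [← Scheme.Hom.comp_apply, ← s.condition]
    exact ⟨s.fst x, by simp⟩
  refine ⟨⟨w⟩, ⟨Limits.PullbackCone.IsLimit.mk _
    (fun s => IsOpenImmersion.lift j s.snd (H s)) ?_ ?_ ?_⟩⟩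
  · intro s
    rw [← cancel_mono i, assoc, w, IsOpenImmersion.lift_fac_assoc, s.condition]
  · intro s
    exact IsOpenImmersion.lift_fac _ _ _
  · intro s m h1 h2
    rw [← cancel_mono j, IsOpenImmersion.lift_fac, h2]

/-- A square is cartesian if it is so over an open cover of the upper right corner. -/
lemma isPullback_of_cover {X' X Y' Y : Scheme.{0}} (f : X' ⟶ X) (p' : X' ⟶ Y') (p : X ⟶ Y)
    (t : Y' ⟶ Y) (𝒰 : X.OpenCover) (Z : 𝒰.I₀ → Scheme.{0}) (g : ∀ i, Z i ⟶ 𝒰.X i)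
    (j : ∀ i, Z i ⟶ X') (h1 : ∀ i, IsPullback (g i) (j i) (𝒰.f i) f)
    (h2 : ∀ i, IsPullback (g i) (j i ≫ p') (𝒰.f i ≫ p) t) : IsPullback f p' p t := by
  refine Scheme.isPullback_of_openCover f p' p t 𝒰 fun i => ?_
  refine (h2 i).of_iso (h1 i).flip.isoPullback (Iso.refl _) (Iso.refl _) (Iso.refl _) ?_ ?_ ?_ ?_
  · simp only [Iso.refl_hom, comp_id]
    exact ((h1 i).flip.isoPullback_hom_snd).symm
  · simp only [Iso.refl_hom, comp_id]
    change _ = _ ≫ Limits.pullback.fst _ _ ≫ p'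
    rw [← assoc, (h1 i).flip.isoPullback_hom_fst]
  · simp
  · simp

lemma isZariskiLocalAtTarget_isAffineHom : IsZariskiLocalAtTarget @IsAffineHom.{0} :=
  @HasAffineProperty.instIsZariskiLocalAtTarget _ _ instHasAffinePropertyIsAffineHomIsAffine

/-- A morphism is affine if it is so over an open cover of the target. -/
lemma isAffineHom_of_cover {X Y : Scheme.{0}} (f : X ⟶ Y) (𝒰 : Y.OpenCover)
    (h𝒰 : ∀ i, IsAffine (𝒰.X i)) (Z : 𝒰.I₀ → Scheme.{0}) (j : ∀ i, Z i ⟶ X)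
    (g : ∀ i, Z i ⟶ 𝒰.X i) (hZ : ∀ i, IsAffine (Z i))
    (h : ∀ i, IsPullback (j i) (g i) f (𝒰.f i)) : IsAffineHom f :=
  (@HasAffineProperty.iff_of_openCover _ _ instHasAffinePropertyIsAffineHomIsAffine _ _ _ 𝒰 h𝒰).2
    fun i => @IsAffine.of_isIso _ _ (h i).isoPullback.inv (h i).isoPullback.isIso_inv (hZ i)

end OpenPullback

section Cone

variable {A : Type} [CommRing A] (𝒜 : ℕ → AddSubgroup A) [GradedRing 𝒜]

/-- The complement of the zero section in `Spec A`, for a graded ring `A`. -/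
def coneOpens : (Spec (.of A)).Opens :=
  ⨆ s : (Σ i : PNat, 𝒜 i), (PrimeSpectrum.basicOpen (s.2 : A) : (Spec (.of A)).Opens)

/-- The complement of the zero section in `Spec A`, as a scheme. -/
abbrev Cone : Scheme.{0} := (coneOpens 𝒜).toScheme

variable {𝒜} in
lemma mem_coneOpens {x : Spec (.of A)} :
    x ∈ coneOpens 𝒜 ↔ ∃ (n : ℕ) (s : A), 0 < n ∧ s ∈ 𝒜 n ∧ s ∉ x.asIdeal := by
  refine mem_iSup.trans ?_
  constructor
  · rintro ⟨⟨i, s⟩, h⟩; exact ⟨i, s, i.2, s.2, h⟩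
  · rintro ⟨n, s, hn, hs, h⟩; exact ⟨⟨⟨n, hn⟩, s, hs⟩, h⟩

variable {n : ℕ} {s : A} (hs : s ∈ 𝒜 n) (hn : 0 < n)

lemma opensRange_specMap_away (R : Type) [CommRing R] (s : R) :
    (Spec.map (ofHom (algebraMap R (Away s)))).opensRange = PrimeSpectrum.basicOpen s :=
  TopologicalSpace.Opens.ext (PrimeSpectrum.localization_away_comap_range _ s)

def coneι : Spec (.of (Away s)) ⟶ Cone 𝒜 := IsOpenImmersion.lift (coneOpens 𝒜).ι
    (Spec.map (ofHom (algebraMap A (Away s)))) (by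
      have := opensRange_specMap_away A s
      rw [Scheme.Opens.range_ι]
      intro x hx
      have hx' : x ∈ (Spec.map (ofHom (algebraMap A (Away s)))).opensRange := hx
      rw [this] at hx'
      exact mem_coneOpens.2 ⟨n, s, hn, hs, hx'⟩)

@[simp]
lemma coneι_ι : coneι 𝒜 hs hn ≫ (coneOpens 𝒜).ι = Spec.map (ofHom (algebraMap A (Away s))) :=
  IsOpenImmersion.lift_fac _ _ _

instance : IsOpenImmersion (coneι 𝒜 hs hn) := by
  have : IsOpenImmersion (coneι 𝒜 hs hn ≫ (coneOpens 𝒜).ι) := by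
    rw [coneι_ι]; infer_instance
  exact IsOpenImmersion.of_comp _ (coneOpens 𝒜).ι

lemma mem_opensRange_coneι {x : Cone 𝒜} :
    x ∈ (coneι 𝒜 hs hn).opensRange ↔ s ∉ ((coneOpens 𝒜).ι x).asIdeal := by
  have h : (coneOpens 𝒜).ι ''ᵁ (coneι 𝒜 hs hn).opensRange = PrimeSpectrum.basicOpen s := by
    rw [← opensRange_specMap_away A s, ← Scheme.Hom.opensRange_comp]
    simp_rw [coneι_ι]
  change _ ↔ (coneOpens 𝒜).ι x ∈ PrimeSpectrum.basicOpen s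
  rw [← h]
  constructor
  · intro hx; exact ⟨x, hx, rfl⟩
  · rintro ⟨y, hy, hyx⟩
    rwa [← (coneOpens 𝒜).ι.injective hyx]

variable {𝒜} in
lemma exists_mem_opensRange_coneι (x : Cone 𝒜) : ∃ (n : ℕ) (s : A) (hn : 0 < n) (hs : s ∈ 𝒜 n),
    x ∈ (coneι 𝒜 hs hn).opensRange := by
  obtain ⟨n, s, hn, hs, h⟩ := mem_coneOpens.1 x.2
  exact ⟨n, s, hn, hs, (mem_opensRange_coneι 𝒜 hs hn).2 h⟩

/-- A family of homogeneous elements whose nonvanishing loci cover the cone. -/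
@[simps I₀ X f]
def coneCoverOf {ι : Type} (m : ι → ℕ) (t : ι → A) (ht : ∀ i, t i ∈ 𝒜 (m i)) (hm : ∀ i, 0 < m i)
    (h : ∀ x : Cone 𝒜, ∃ i, x ∈ (coneι 𝒜 (ht i) (hm i)).opensRange) : (Cone 𝒜).OpenCover where
  I₀ := ι
  X i := Spec (.of (Away (t i)))
  f i := coneι 𝒜 (ht i) (hm i)
  mem₀ := by
    rw [presieve₀_mem_precoverage_iff]
    exact ⟨fun x => h x, fun i => inferInstance⟩

/-- The cover of the cone by the `D(s)`, for `s` homogeneous of positive degree. -/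
def coneCover : (Cone 𝒜).OpenCover :=
  coneCoverOf 𝒜 (ι := Σ i : PNat, 𝒜 i) (fun s => s.1) (fun s => s.2) (fun s => s.2.2)
    (fun s => s.1.2) fun x => by
      obtain ⟨n, s, hn, hs, hx⟩ := exists_mem_opensRange_coneι x
      exact ⟨⟨⟨n, hn⟩, s, hs⟩, hx⟩

def coneAway : Spec (.of (Away s)) ⟶ Proj 𝒜 :=
  Spec.map (ofHom (algebraMap (HomogeneousLocalization.Away 𝒜 s) (Away s))) ≫ awayι 𝒜 s hs hn

variable {m : ℕ} {t : A} (ht : t ∈ 𝒜 m) (hm : 0 < m)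

def awayRes {s x : A} (h : s ∣ x) : Away s →+* Away x :=
  IsLocalization.Away.lift (S := Away s) s (g := algebraMap A (Away x))
    (isUnit_of_dvd_unit (map_dvd _ h) (algebraMap_isUnit x))

lemma awayRes_comp {s x : A} (h : s ∣ x) : (awayRes h).comp (algebraMap A _) = algebraMap A _ :=
  IsLocalization.Away.lift_comp _ _

lemma specMap_awayRes_coneι {x : A} {d : ℕ} (hx : x ∈ 𝒜 d) (hd : 0 < d) (h : s ∣ x) :
    Spec.map (ofHom (awayRes h)) ≫ coneι 𝒜 hs hn = coneι 𝒜 hx hd := by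
  rw [← cancel_mono (coneOpens 𝒜).ι, assoc, coneι_ι, coneι_ι, ← Spec.map_comp,
    ← ofHom_comp, awayRes_comp]

include ht in
lemma specMap_awayRes_coneAway {x : A} (hx : x = s * t) {d : ℕ} (hxd : x ∈ 𝒜 d) (hd : 0 < d) :
    Spec.map (ofHom (awayRes ⟨t, hx⟩)) ≫ coneAway 𝒜 hs hn = coneAway 𝒜 hxd hd := by
  have h := Proj.SpecMap_awayMap_awayι 𝒜 hs hn ht hx
  have e : awayι 𝒜 x hxd hd = awayι 𝒜 x (hx ▸ SetLike.mul_mem_graded hs ht)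
      (hn.trans_le (n.le_add_right m)) := by
    rw [awayι, awayι]
    congr 1
  rw [coneAway, coneAway, e, ← h, ← assoc, ← assoc, ← Spec.map_comp,
    ← Spec.map_comp, ← ofHom_comp, ← ofHom_comp]
  congr 3
  ext a
  exact (HomogeneousLocalization.val_awayMap 𝒜 ht hx a).symm

lemma coneAway_compat : Limits.pullback.fst (coneι 𝒜 hs hn) (coneι 𝒜 ht hm) ≫ coneAway 𝒜 hs hn =
    Limits.pullback.snd (coneι 𝒜 hs hn) (coneι 𝒜 ht hm) ≫ coneAway 𝒜 ht hm := by
  have hst : s * t ∈ 𝒜 (n + m) := SetLike.mul_mem_graded hs ht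
  have hnm : 0 < n + m := by omega
  let e := IsOpenImmersion.isoOfRangeEq
    (Limits.pullback.fst (coneι 𝒜 hs hn) (coneι 𝒜 ht hm) ≫ coneι 𝒜 hs hn)
    (coneι 𝒜 hst hnm) (by
      rw [IsOpenImmersion.range_pullback_to_base_of_left]
      ext x
      change x ∈ (coneι 𝒜 hs hn).opensRange ∧ x ∈ (coneι 𝒜 ht hm).opensRange ↔
        x ∈ (coneι 𝒜 hst hnm).opensRange
      rw [mem_opensRange_coneι, mem_opensRange_coneι, mem_opensRange_coneι,
        ((coneOpens 𝒜).ι x).2.mul_mem_iff_mem_or_mem, not_or])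
  have he : e.inv ≫ Limits.pullback.fst (coneι 𝒜 hs hn) (coneι 𝒜 ht hm) ≫ coneι 𝒜 hs hn =
    coneι 𝒜 hst hnm := IsOpenImmersion.isoOfRangeEq_inv_fac _ _ _
  have h1 : e.inv ≫ Limits.pullback.fst (coneι 𝒜 hs hn) (coneι 𝒜 ht hm) =
      Spec.map (ofHom (awayRes ⟨t, rfl⟩)) := by
    rw [← cancel_mono (coneι 𝒜 hs hn), assoc, he, specMap_awayRes_coneι]
  have h2 : e.inv ≫ Limits.pullback.snd (coneι 𝒜 hs hn) (coneι 𝒜 ht hm) =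
      Spec.map (ofHom (awayRes ⟨s, mul_comm s t⟩)) := by
    rw [← cancel_mono (coneι 𝒜 ht hm), assoc, ← Limits.pullback.condition, he,
      specMap_awayRes_coneι]
  rw [← cancel_epi e.inv, reassoc_of% h1, reassoc_of% h2,
    specMap_awayRes_coneAway 𝒜 hs hn ht rfl hst hnm,
    specMap_awayRes_coneAway 𝒜 ht hm hs (mul_comm s t) hst hnm]

def coneToProj : Cone 𝒜 ⟶ Proj 𝒜 := (coneCover 𝒜).glueMorphisms (fun s => coneAway 𝒜 s.2.2 s.1.2)
    fun s t => coneAway_compat 𝒜 s.2.2 s.1.2 t.2.2 t.1.2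

lemma coneι_coneToProj : coneι 𝒜 hs hn ≫ coneToProj 𝒜 = coneAway 𝒜 hs hn :=
  (coneCover 𝒜).ι_glueMorphisms _ _ ⟨⟨n, hn⟩, s, hs⟩

lemma coneToProj_preimage :
    coneToProj 𝒜 ⁻¹ᵁ (awayι 𝒜 s hs hn).opensRange = (coneι 𝒜 hs hn).opensRange := by
  ext x
  obtain ⟨m, t, hm, ht, y, rfl⟩ := exists_mem_opensRange_coneι x
  change coneToProj 𝒜 (coneι 𝒜 ht hm y) ∈ (awayι 𝒜 s hs hn).opensRange ↔
    coneι 𝒜 ht hm y ∈ (coneι 𝒜 hs hn).opensRange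
  rw [opensRange_awayι, mem_opensRange_coneι, ← Scheme.Hom.comp_apply,
    ← Scheme.Hom.comp_apply, coneι_ι, coneι_coneToProj, coneAway, Scheme.Hom.comp_apply]
  have h := Proj.awayι_preimage_basicOpen 𝒜 ht hm hs hn
  have h' := congrArg (fun U => Spec.map (ofHom (algebraMap
    (HomogeneousLocalization.Away 𝒜 t) (Away t))) y ∈ U) h
  refine (iff_of_eq h').trans ?_
  change HomogeneousLocalization.val (HomogeneousLocalization.Away.isLocalizationElem ht hs)
    ∉ y.asIdeal ↔ algebraMap A (Away t) s ∉ y.asIdeal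
  rw [HomogeneousLocalization.Away.isLocalizationElem, val_mk, mk_eq_mk'_apply, not_iff_not]
  have hu : IsUnit (algebraMap A (Away t) (t ^ n)) := by
    rw [map_pow]; exact (algebraMap_isUnit t).pow n
  have e := mk'_spec (Away t) (s ^ m) (⟨t ^ n, n, rfl⟩ : powers t)
  have e2 : IsLocalization.mk' (Away t) (s ^ m) (⟨t ^ n, n, rfl⟩ : powers t) ∈ y.asIdeal ↔
      algebraMap A (Away t) (s ^ m) ∈ y.asIdeal := by
    rw [← e]
    exact (Ideal.mul_unit_mem_iff_mem _ hu).symm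
  rw [e2, map_pow]
  exact ⟨fun h => y.2.mem_of_pow_mem _ h, fun h => Ideal.pow_mem_of_mem _ h _ hm⟩

lemma isPullback_coneι : IsPullback (Spec.map (ofHom (algebraMap (HomogeneousLocalization.Away 𝒜 s)
      (Away s)))) (coneι 𝒜 hs hn) (awayι 𝒜 s hs hn) (coneToProj 𝒜) :=
  isPullback_of_preimage_opensRange _ _ _ _ (coneι_coneToProj 𝒜 hs hn).symm
    (coneToProj_preimage 𝒜 hs hn).le

instance : IsAffineHom (coneToProj 𝒜) := by
  refine isAffineHom_of_cover _ (affineOpenCover 𝒜).openCover (fun s => ?_)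
    (fun s => Spec (.of (Away (s.2 : A)))) (fun s => coneι 𝒜 s.2.2 s.1.2)
    (fun s => Spec.map (ofHom (algebraMap (HomogeneousLocalization.Away 𝒜 (s.2 : A))
      (Away (s.2 : A))))) (fun s => inferInstance)
    fun s => (isPullback_coneι 𝒜 s.2.2 s.1.2).flip
  change IsAffine (Spec _)
  infer_instance

end Cone

end

section
section Pushout

variable {R R' S S' : Type} [CommRing R] [CommRing R'] [CommRing S] [CommRing S']

lemma isPushout_of_lift (ρ : R →+* R') (ψ : R →+* S) (ψ' : R' →+* S') (g : S →+* S')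
    (w : ψ'.comp ρ = g.comp ψ)
    (hlift : ∀ (T : Type) [CommRing T] (u : S →+* T) (v : R' →+* T), u.comp ψ = v.comp ρ →
      ∃ l : S' →+* T, l.comp g = u)
    (hg : ∀ (T : Type) [CommRing T] (l l' : S' →+* T), l.comp g = l'.comp g → l = l')
    (hρ : ∀ (T : Type) [CommRing T] (l l' : R' →+* T), l.comp ρ = l'.comp ρ → l = l') :
    IsPushout (ofHom ρ) (ofHom ψ) (ofHom ψ') (ofHom g) := by
  refine ⟨⟨by rw [← ofHom_comp, ← ofHom_comp, w]⟩, ⟨Limits.PushoutCocone.IsColimit.mk _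
      (fun s => ofHom (hlift s.pt s.inr.hom s.inl.hom ?_).choose) ?_ ?_ ?_⟩⟩
  · have := congrArg CommRingCat.Hom.hom s.condition
    exact this.symm
  · intro s
    have hs := congrArg CommRingCat.Hom.hom s.condition
    have h := (hlift s.pt s.inr.hom s.inl.hom hs.symm).choose_spec
    ext1
    refine hρ _ _ _ ?_
    change ((hlift s.pt s.inr.hom s.inl.hom hs.symm).choose.comp ψ').comp ρ = s.inl.hom.comp ρ
    rw [RingHom.comp_assoc, w, ← RingHom.comp_assoc, h]
    exact hs.symm
  · intro s
    have hs := congrArg CommRingCat.Hom.hom s.condition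
    have h := (hlift s.pt s.inr.hom s.inl.hom hs.symm).choose_spec
    ext1
    exact h
  · intro s m h1 h2
    have hs := congrArg CommRingCat.Hom.hom s.condition
    have h := (hlift s.pt s.inr.hom s.inl.hom hs.symm).choose_spec
    ext1
    refine hg _ _ _ ?_
    refine Eq.trans ?_ h.symm
    exact congrArg CommRingCat.Hom.hom h2

structure IsLoc (g : S →+* S') (f : S) : Prop where
  unit : IsUnit (g f)
  inj : ∀ x, g x = 0 → ∃ n : ℕ, f ^ n * x = 0
  surj : ∀ y, ∃ (n : ℕ) (x : S), g x = g f ^ n * y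

structure IsQuot (g : S →+* S') (t : S) : Prop where
  zero : g t = 0
  inj : ∀ x, g x = 0 → ∃ y, x = t * y
  surj : Surjective g

lemma IsLoc.ext {g : S →+* S'} {f : S} (h : IsLoc g f) {T : Type} [CommRing T]
    {l l' : S' →+* T} (hl : l.comp g = l'.comp g) : l = l' := by
  ext y
  obtain ⟨n, x, hx⟩ := h.surj y
  have e : ∀ x, l (g x) = l' (g x) := DFunLike.congr_fun hl
  have e1 := e x
  rw [hx, map_mul, map_mul, map_pow, map_pow, e] at e1
  exact ((h.unit.map l').pow n).mul_left_cancel e1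

lemma IsLoc.isLocalization {g : S →+* S'} {f : S} (h : IsLoc g f) :
    letI := g.toAlgebra
    IsLocalization.Away f S' := by
  let _ := g.toAlgebra
  refine ⟨?_, ?_, ?_⟩
  · rintro ⟨_, n, rfl⟩
    change IsUnit (g (f ^ n))
    rw [map_pow]; exact h.unit.pow n
  · intro y
    obtain ⟨n, x, hx⟩ := h.surj y
    refine ⟨(x, ⟨f ^ n, n, rfl⟩), ?_⟩
    change y * g (f ^ n) = g x
    rw [hx, map_pow, mul_comm]
  · intro x y hxy
    obtain ⟨n, hn⟩ := h.inj (x - y) (by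
      rw [map_sub, sub_eq_zero]; exact hxy)
    exact ⟨⟨f ^ n, n, rfl⟩, by rwa [mul_sub, sub_eq_zero] at hn⟩

lemma IsLoc.of_isLocalization {f : S} [Algebra S S'] [IsLocalization.Away f S'] :
    IsLoc (algebraMap S S') f where
  unit := algebraMap_isUnit f
  inj x hx := by
    obtain ⟨⟨_, n, rfl⟩, hn⟩ := (map_eq_zero_iff (powers f) S' x).1 hx
    exact ⟨n, hn⟩
  surj y := by
    obtain ⟨⟨x, ⟨_, n, rfl⟩⟩, hx⟩ := IsLocalization.surj (powers f) y
    exact ⟨n, x, by rw [← hx, mul_comm, map_pow]⟩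

lemma IsLoc.isPushout {ρ : R →+* R'} {ψ : R →+* S} {ψ' : R' →+* S'} {g : S →+* S'}
    (w : ψ'.comp ρ = g.comp ψ) {r : R} (hρ : IsLoc ρ r) (hg : IsLoc g (ψ r)) :
    IsPushout (ofHom ρ) (ofHom ψ) (ofHom ψ') (ofHom g) := by
  refine isPushout_of_lift ρ ψ ψ' g w ?_ (fun T _ _ _ h => hg.ext h) (fun T _ _ _ h => hρ.ext h)
  intro T _ u v huv
  let _ := g.toAlgebra
  have := hg.isLocalization
  have hu : IsUnit (u (ψ r)) := by
    have : u (ψ r) = v (ρ r) := DFunLike.congr_fun huv r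
    rw [this]; exact hρ.unit.map v
  exact ⟨IsLocalization.Away.lift (ψ r) hu, IsLocalization.Away.lift_comp (ψ r) hu⟩

lemma IsQuot.isPushout {ρ : R →+* R'} {ψ : R →+* S} {ψ' : R' →+* S'} {g : S →+* S'}
    (w : ψ'.comp ρ = g.comp ψ) {r : R} (hρ : IsQuot ρ r) (hg : IsQuot g (ψ r)) :
    IsPushout (ofHom ρ) (ofHom ψ) (ofHom ψ') (ofHom g) := by
  have hext : ∀ {S S' : Type} [CommRing S] [CommRing S'] {g : S →+* S'} {t : S}, IsQuot g t →
      ∀ {T : Type} [CommRing T] (l l' : S' →+* T), l.comp g = l'.comp g → l = l' :=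
    fun hg T _ l l' h => RingHom.ext fun y => by
      obtain ⟨x, rfl⟩ := hg.surj y
      exact DFunLike.congr_fun h x
  refine isPushout_of_lift ρ ψ ψ' g w ?_ (fun T _ l l' h => hext hg l l' h)
    (fun T _ l l' h => hext hρ l l' h)
  intro T _ u v huv
  refine ⟨RingHom.liftOfRightInverse g _ (Function.rightInverse_surjInv hg.surj) ⟨u, ?_⟩,
    RingHom.liftOfRightInverse_comp g _ _ _⟩
  intro x hx
  obtain ⟨y, rfl⟩ := hg.inj x hx
  have : u (ψ r) = v (ρ r) := DFunLike.congr_fun huv r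
  rw [RingHom.mem_ker, map_mul, this, hρ.zero, map_zero, zero_mul]

lemma IsLoc.awayMap {g : S →+* S'} {f : S} (h : IsLoc g f) (s : S) :
    IsLoc (Localization.awayMap g s) (algebraMap S _ f) where
  unit := by
    rw [Localization.awayMap, IsLocalization.Away.map, IsLocalization.map_eq]
    exact h.unit.map _
  inj x hx := by
    obtain ⟨n, a, ha⟩ := IsLocalization.Away.surj s x
    have h1 : algebraMap S' (Away (g s)) (g a) = 0 := by
      have := congrArg (Localization.awayMap g s) ha
      rw [map_mul, hx, zero_mul] at this
      rw [Localization.awayMap, IsLocalization.Away.map, IsLocalization.map_eq] at this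
      exact this.symm
    obtain ⟨⟨_, m, rfl⟩, hm⟩ := (map_eq_zero_iff (powers (g s)) _ _).1 h1
    have hm' : g (s ^ m * a) = 0 := by rw [map_mul, map_pow]; exact hm
    obtain ⟨N, hN⟩ := h.inj _ hm'
    refine ⟨N, ?_⟩
    have hu : IsUnit (algebraMap S (Away s) s) := algebraMap_isUnit s
    refine (hu.pow (m + n)).mul_left_cancel ?_
    have := congrArg (algebraMap S (Away s)) hN
    rw [map_mul, map_mul, ← ha, map_zero] at this
    rw [mul_zero, ← this, map_pow, map_pow]
    ring
  surj y := by
    obtain ⟨n, b, hb⟩ := IsLocalization.Away.surj (g s) y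
    obtain ⟨m, x, hx⟩ := h.surj b
    have hs : IsUnit (algebraMap S' (Away (g s)) (g s)) := algebraMap_isUnit _
    refine ⟨m, IsLocalization.Away.invSelf s ^ n * algebraMap S _ x, ?_⟩
    refine (hs.pow n).mul_left_cancel ?_
    have h2 : ∀ c, Localization.awayMap g s (algebraMap S _ c) = algebraMap S' _ (g c) := by
      intro c
      rw [Localization.awayMap, IsLocalization.Away.map, IsLocalization.map_eq]
    rw [h2, ← h2 s, ← map_pow, ← map_mul, ← mul_assoc, ← mul_pow,
      IsLocalization.Away.mul_invSelf, one_pow, one_mul, h2, hx, map_mul, ← hb]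
    simp only [map_pow, h2]
    ring

lemma IsQuot.awayMap {g : S →+* S'} {f : S} (h : IsQuot g f) (s : S) :
    IsQuot (Localization.awayMap g s) (algebraMap S _ f) where
  zero := by
    rw [Localization.awayMap, IsLocalization.Away.map, IsLocalization.map_eq, h.zero, map_zero]
  inj x hx := by
    obtain ⟨n, a, ha⟩ := IsLocalization.Away.surj s x
    have h1 : algebraMap S' (Away (g s)) (g a) = 0 := by
      have := congrArg (Localization.awayMap g s) ha
      rw [map_mul, hx, zero_mul] at this
      rw [Localization.awayMap, IsLocalization.Away.map, IsLocalization.map_eq] at this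
      exact this.symm
    obtain ⟨⟨_, m, rfl⟩, hm⟩ := (map_eq_zero_iff (powers (g s)) _ _).1 h1
    have hm' : g (s ^ m * a) = 0 := by rw [map_mul, map_pow]; exact hm
    obtain ⟨y, hy⟩ := h.inj _ hm'
    have hu : IsUnit (algebraMap S (Away s) s) := algebraMap_isUnit s
    refine ⟨IsLocalization.Away.invSelf s ^ (m + n) * algebraMap S _ y, ?_⟩
    refine (hu.pow (m + n)).mul_left_cancel ?_
    have e := congrArg (algebraMap S (Away s)) hy
    rw [map_mul, ← ha, map_mul, map_pow] at e
    rw [mul_left_comm _ (algebraMap S _ f), ← mul_assoc (_ ^ _) (_ ^ _), ← mul_pow,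
      IsLocalization.Away.mul_invSelf, one_pow, one_mul, ← e]
    ring
  surj y := by
    obtain ⟨n, b, hb⟩ := IsLocalization.Away.surj (g s) y
    obtain ⟨x, rfl⟩ := h.surj b
    have hs : IsUnit (algebraMap S' (Away (g s)) (g s)) := algebraMap_isUnit _
    refine ⟨IsLocalization.Away.invSelf s ^ n * algebraMap S _ x, ?_⟩
    refine (hs.pow n).mul_left_cancel ?_
    have h2 : ∀ c, Localization.awayMap g s (algebraMap S _ c) = algebraMap S' _ (g c) := by
      intro c
      rw [Localization.awayMap, IsLocalization.Away.map, IsLocalization.map_eq]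
    rw [← h2 s, ← map_pow, ← map_mul, ← mul_assoc, ← mul_pow,
      IsLocalization.Away.mul_invSelf, one_pow, one_mul, h2, ← hb]
    simp only [map_pow, h2]
    ring

end Pushout

section GradedLoc

variable {A B : Type} [CommRing A] [CommRing B] {𝒜 : ℕ → AddSubgroup A} {ℬ : ℕ → AddSubgroup B}
  [GradedRing 𝒜] [GradedRing ℬ] (φ : 𝒜 →+*ᵍ ℬ)

lemma map_proj (m : ℕ) (x : A) : φ (proj 𝒜 m x) = proj ℬ m (φ x) :=
  proj_ringHom 𝒜 ℬ φ.toRingHom (fun _ _ h => φ.map_mem h) m x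

lemma proj_of_mem (𝒜 : ℕ → AddSubgroup A) [GradedRing 𝒜] {m : ℕ} {x : A} (hx : x ∈ 𝒜 m) :
    proj 𝒜 m x = x := by
  rw [proj_apply, DirectSum.decompose_of_mem_same 𝒜 hx]

lemma proj_mem (𝒜 : ℕ → AddSubgroup A) [GradedRing 𝒜] (m : ℕ) (x : A) :
    proj 𝒜 m x ∈ 𝒜 m := by
  rw [proj_apply]; exact SetLike.coe_mem _

lemma proj_mul_of_mem_zero (𝒜 : ℕ → AddSubgroup A) [GradedRing 𝒜] {f : A} (hf : f ∈ 𝒜 0)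
    (m : ℕ) (x : A) : proj 𝒜 m (f * x) = f * proj 𝒜 m x := by
  rw [proj_apply, proj_apply]
  have := DirectSum.coe_decompose_mul_add_of_left_mem (j := m) 𝒜 hf (b := x)
  rwa [zero_add] at this

lemma irrelevant_le_map (h : ∀ m, 0 < m → ∀ y ∈ ℬ m, ∃ (u : B) (x : A), IsUnit u ∧ x ∈ 𝒜 m ∧
    φ x = u * y) : irrelevant ℬ ≤ (irrelevant 𝒜).map φ := by
  rw [← toIdeal_le_toIdeal_iff, toIdeal_irrelevant_le]
  intro m hm y hy
  obtain ⟨u, x, hu, hx, e⟩ := h m hm y hy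
  have hx' : φ x ∈ ((irrelevant 𝒜).map φ).toIdeal :=
    Ideal.mem_map_of_mem _ ((mem_irrelevant_of_mem 𝒜 hm hx))
  rw [e] at hx'
  exact (Ideal.unit_mul_mem_iff_mem _ hu).1 hx'

variable {φ}

lemma IsLoc.irrelevant_le {f : A} (hf : f ∈ 𝒜 0) (h : IsLoc φ.toRingHom f) :
    irrelevant ℬ ≤ (irrelevant 𝒜).map φ := by
  refine irrelevant_le_map φ fun m hm y hy => ?_
  obtain ⟨n, x, hx⟩ := h.surj y
  refine ⟨φ f ^ n, proj 𝒜 m x, h.unit.pow n, proj_mem 𝒜 m x, ?_⟩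
  have hx' : φ x = φ f ^ n * y := hx
  have h0 : φ f ^ n ∈ ℬ 0 := by simpa using SetLike.pow_mem_graded n (φ.map_mem hf)
  rw [map_proj, hx', proj_mul_of_mem_zero ℬ h0, proj_of_mem ℬ hy]

lemma IsQuot.irrelevant_le {f : A} (h : IsQuot φ.toRingHom f) :
    irrelevant ℬ ≤ (irrelevant 𝒜).map φ := by
  refine irrelevant_le_map φ fun m hm y hy => ?_
  obtain ⟨x, hx⟩ := h.surj y
  refine ⟨1, proj 𝒜 m x, isUnit_one, proj_mem 𝒜 m x, ?_⟩
  have hx' : φ x = y := hx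
  rw [map_proj, hx', proj_of_mem ℬ hy, one_mul]

lemma away_mk_eq_zero {n : ℕ} {s : A} (hs : s ∈ 𝒜 n) {d : ℕ} {a : A} {ha : a ∈ 𝒜 (d • n)}
    (h : HomogeneousLocalization.Away.mk 𝒜 hs d a ha = 0) : ∃ m : ℕ, s ^ m * a = 0 := by
  have h1 := congrArg HomogeneousLocalization.val h
  rw [val_mk, HomogeneousLocalization.val_zero,
    mk_eq_mk'_apply, IsLocalization.mk'_eq_zero_iff] at h1
  obtain ⟨⟨_, m, rfl⟩, hm⟩ := h1
  exact ⟨m, hm⟩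

lemma IsLoc.away {f : 𝒜 0} (h : IsLoc φ.toRingHom f) {n : ℕ} {s : A} (hs : s ∈ 𝒜 n) :
    IsLoc (HomogeneousLocalization.Away.map φ s) (fromZeroRingHom 𝒜 (powers s) f) := by
  have hf0 : φ f ∈ ℬ 0 := φ.map_mem f.2
  have key : ∀ N : ℕ, fromZeroRingHom 𝒜 (powers s) f ^ N =
      HomogeneousLocalization.Away.mk 𝒜 hs 0 ((f : A) ^ N)
        (by simpa using SetLike.pow_mem_graded N f.2) := by
    intro N
    apply val_injective
    rw [val_mk, HomogeneousLocalization.val_pow]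
    change Localization.mk (f : A) ⟨1, _⟩ ^ N = _
    rw [Localization.mk_pow]
    congr 1
    ext; simp
  refine ⟨?_, ?_, ?_⟩
  · obtain ⟨v, hv⟩ := h.unit.exists_right_inv
    have hv' : φ f * v = 1 := hv
    have hv0 : φ f * proj ℬ 0 v = 1 := by
      rw [← proj_mul_of_mem_zero ℬ hf0, hv', proj_of_mem ℬ SetLike.GradedOne.one_mem]
    refine IsUnit.of_mul_eq_one (fromZeroRingHom ℬ (powers (φ s)) ⟨_, proj_mem ℬ 0 v⟩) ?_
    have e : HomogeneousLocalization.Away.map φ s (fromZeroRingHom 𝒜 (powers s) f) =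
        fromZeroRingHom ℬ (powers (φ s)) ⟨_, hf0⟩ := by
      have := key 1
      rw [pow_one] at this
      rw [this, map_mk]
      apply val_injective
      rw [val_mk]
      change _ = Localization.mk (φ f) ⟨1, _⟩
      congr 1
      · simp
      · ext; simp
    rw [e, ← map_mul]
    convert map_one (fromZeroRingHom ℬ (powers (φ s)))
    exact Subtype.ext hv0
  · intro x hx
    obtain ⟨d, a, ha, rfl⟩ := HomogeneousLocalization.Away.mk_surjective 𝒜 hs x
    rw [map_mk] at hx
    obtain ⟨m, hm⟩ := away_mk_eq_zero (φ.map_mem hs) hx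
    obtain ⟨N, hN⟩ := h.inj (s ^ m * a) (by
      change φ _ = 0; rw [map_mul, map_pow]; exact hm)
    refine ⟨N, ?_⟩
    rw [key]
    apply val_injective
    rw [HomogeneousLocalization.val_mul, val_mk,
      val_mk, Localization.mk_mul, HomogeneousLocalization.val_zero,
      mk_eq_mk'_apply, IsLocalization.mk'_eq_zero_iff]
    refine ⟨⟨s ^ m, m, rfl⟩, ?_⟩
    change s ^ m * (_ * a) = 0
    rw [← hN]; ring
  · intro y
    obtain ⟨d, b, hb, rfl⟩ := HomogeneousLocalization.Away.mk_surjective ℬ (φ.map_mem hs) y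
    obtain ⟨N, x, hx⟩ := h.surj b
    have hx' : φ x = φ f ^ N * b := hx
    have h0 : φ f ^ N ∈ ℬ 0 := by simpa using SetLike.pow_mem_graded N hf0
    refine ⟨N, HomogeneousLocalization.Away.mk 𝒜 hs d _ (proj_mem 𝒜 (d • n) x), ?_⟩
    rw [← map_pow, key, map_mk, map_mk]
    apply val_injective
    rw [HomogeneousLocalization.val_mul, val_mk, val_mk, val_mk, Localization.mk_mul]
    congr 1
    · rw [map_proj, hx', proj_mul_of_mem_zero ℬ h0, proj_of_mem ℬ hb, map_pow]
    · ext; simp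

lemma IsQuot.away {f : 𝒜 0} (h : IsQuot φ.toRingHom f) {n : ℕ} {s : A} (hs : s ∈ 𝒜 n) :
    IsQuot (HomogeneousLocalization.Away.map φ s) (fromZeroRingHom 𝒜 (powers s) f) := by
  have key : fromZeroRingHom 𝒜 (powers s) f =
      HomogeneousLocalization.Away.mk 𝒜 hs 0 (f : A) (by simp) := by
    apply val_injective
    rw [val_mk]
    change Localization.mk (f : A) ⟨1, _⟩ = _
    congr 1
    ext; simp
  refine ⟨?_, ?_, ?_⟩
  · rw [key, map_mk]
    apply val_injective
    have : φ f = 0 := h.zero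
    rw [val_mk, HomogeneousLocalization.val_zero, this, Localization.mk_zero]
  · intro x hx
    obtain ⟨d, a, ha, rfl⟩ := HomogeneousLocalization.Away.mk_surjective 𝒜 hs x
    rw [map_mk] at hx
    obtain ⟨m, hm⟩ := away_mk_eq_zero (φ.map_mem hs) hx
    obtain ⟨y, hy⟩ := h.inj (s ^ m * a) (by
      change φ _ = 0; rw [map_mul, map_pow]; exact hm)
    have hsa : s ^ m * a ∈ 𝒜 ((m + d) • n) := by
      rw [add_smul]; exact SetLike.mul_mem_graded (SetLike.pow_mem_graded m hs) ha
    have hy' : s ^ m * a = f * proj 𝒜 ((m + d) • n) y := by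
      rw [← proj_mul_of_mem_zero 𝒜 f.2, ← hy, proj_of_mem 𝒜 hsa]
    refine ⟨HomogeneousLocalization.Away.mk 𝒜 hs (m + d) _ (proj_mem 𝒜 _ y), ?_⟩
    rw [key]
    apply val_injective
    rw [HomogeneousLocalization.val_mul, val_mk, val_mk, val_mk, Localization.mk_mul,
      ← hy', Localization.mk_eq_mk_iff, Localization.r_iff_exists]
    refine ⟨1, ?_⟩
    change (1 : A) * ((s ^ 0 * s ^ (m + d)) * a) = 1 * (s ^ d * (s ^ m * a))
    ring
  · intro y
    obtain ⟨d, b, hb, rfl⟩ := HomogeneousLocalization.Away.mk_surjective ℬ (φ.map_mem hs) y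
    obtain ⟨x, hx⟩ := h.surj b
    have hx' : φ x = b := hx
    refine ⟨HomogeneousLocalization.Away.mk 𝒜 hs d _ (proj_mem 𝒜 (d • n) x), ?_⟩
    rw [map_mk]
    apply val_injective
    rw [val_mk, val_mk]
    congr 1
    rw [map_proj, hx', proj_of_mem ℬ hb]

end GradedLoc

end

section
section ConeMap

variable {A B : Type} [CommRing A] [CommRing B] {𝒜 : ℕ → AddSubgroup A} {ℬ : ℕ → AddSubgroup B}
  [GradedRing 𝒜] [GradedRing ℬ] (φ : 𝒜 →+*ᵍ ℬ)
  (hφ : irrelevant ℬ ≤ (irrelevant 𝒜).map φ)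

lemma cone_hom_ext {Z : Scheme.{0}} {f g : Cone 𝒜 ⟶ Z}
    (h : ∀ (n : ℕ) (s : A) (hs : s ∈ 𝒜 n) (hn : 0 < n), coneι 𝒜 hs hn ≫ f = coneι 𝒜 hs hn ≫ g) :
    f = g :=
  (coneCover 𝒜).hom_ext _ _ fun s => h _ _ s.2.2 s.1.2

lemma exists_map_notMem (P : PrimeSpectrum B) (hφ : irrelevant ℬ ≤ (irrelevant 𝒜).map φ)
    (h : ∃ (n : ℕ) (s : B), 0 < n ∧ s ∈ ℬ n ∧ s ∉ P.asIdeal) :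
    ∃ (n : ℕ) (s : A), 0 < n ∧ s ∈ 𝒜 n ∧ φ s ∉ P.asIdeal := by
  by_contra! H
  obtain ⟨n, s, hn, hs, hsP⟩ := h
  refine hsP ?_
  have h1 : (irrelevant 𝒜).toIdeal ≤ P.asIdeal.comap φ := by
    rw [toIdeal_irrelevant_le]
    intro i hi x hx
    exact H i x hi hx
  have h2 : ((irrelevant 𝒜).map φ).toIdeal ≤ P.asIdeal := Ideal.map_le_iff_le_comap.2 h1
  exact h2 (hφ (mem_irrelevant_of_mem ℬ hn hs))

def coneMap : Cone ℬ ⟶ Cone 𝒜 := IsOpenImmersion.lift (coneOpens 𝒜).ι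
    ((coneOpens ℬ).ι ≫ Spec.map (ofHom φ.toRingHom)) (by
      rw [Scheme.Opens.range_ι]
      rintro _ ⟨x, rfl⟩
      have := exists_map_notMem φ ((coneOpens ℬ).ι x) hφ (mem_coneOpens.1 x.2)
      exact mem_coneOpens.2 this)

lemma coneMap_ι : coneMap φ hφ ≫ (coneOpens 𝒜).ι = (coneOpens ℬ).ι ≫ Spec.map (ofHom φ.toRingHom) :=
  IsOpenImmersion.lift_fac _ _ _

variable {n : ℕ} {s : A} (hs : s ∈ 𝒜 n) (hn : 0 < n)

def gradedAwayMap (s : A) : Away s →+* Away (φ s) := Localization.awayMap φ.toRingHom s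

lemma awayMap_comp (s : A) : (gradedAwayMap φ s).comp (algebraMap A _) =
    (algebraMap B _).comp φ.toRingHom := by
  ext x
  change Localization.awayMap φ.toRingHom s (algebraMap A _ x) = algebraMap B _ (φ.toRingHom x)
  rw [Localization.awayMap, IsLocalization.Away.map, IsLocalization.map_eq]

lemma coneι_coneMap : coneι ℬ (Graded.map_mem φ hs) hn ≫ coneMap φ hφ =
    Spec.map (ofHom (gradedAwayMap φ s)) ≫ coneι 𝒜 hs hn := by
  rw [← cancel_mono (coneOpens 𝒜).ι, assoc, assoc, coneMap_ι, coneι_ι,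
    reassoc_of% coneι_ι, ← Spec.map_comp, ← Spec.map_comp, ← ofHom_comp,
    ← ofHom_comp, awayMap_comp]

lemma coneMap_preimage : coneMap φ hφ ⁻¹ᵁ (coneι 𝒜 hs hn).opensRange =
    (coneι ℬ (Graded.map_mem φ hs) hn).opensRange := by
  ext x
  change coneMap φ hφ x ∈ (coneι 𝒜 hs hn).opensRange ↔
    x ∈ (coneι ℬ (Graded.map_mem φ hs) hn).opensRange
  rw [mem_opensRange_coneι, mem_opensRange_coneι, ← Scheme.Hom.comp_apply, coneMap_ι]
  rfl

def mapConeCover : (Cone ℬ).OpenCover :=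
  coneCoverOf ℬ (ι := Σ i : PNat, 𝒜 i) (fun s => s.1) (fun s => φ (s.2 : A))
    (fun s => Graded.map_mem φ s.2.2) (fun s => s.1.2) fun x => by
      obtain ⟨n, s, hn, hs, h⟩ := exists_map_notMem φ ((coneOpens ℬ).ι x) hφ (mem_coneOpens.1 x.2)
      exact ⟨⟨⟨n, hn⟩, s, hs⟩, (mem_opensRange_coneι ℬ _ _).2 h⟩

lemma isPullback_coneMap_coneι : IsPullback (Spec.map (ofHom (gradedAwayMap φ s)))
    (coneι ℬ (Graded.map_mem φ hs) hn) (coneι 𝒜 hs hn) (coneMap φ hφ) :=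
  isPullback_of_preimage_opensRange _ _ _ _ (coneι_coneMap φ hφ hs hn).symm
    (coneMap_preimage φ hφ hs hn).le

lemma isPullback_projMap_awayι : IsPullback
    (Spec.map (ofHom (HomogeneousLocalization.Away.map φ s)))
    (awayι ℬ (φ s) (Graded.map_mem φ hs) hn) (awayι 𝒜 s hs hn) (Proj.map φ hφ) :=
  isPullback_of_preimage_opensRange _ _ _ _ (Proj.awayι_comp_map φ hφ hn s hs).symm (by
    rw [opensRange_awayι, opensRange_awayι, Proj.map_preimage_basicOpen])

include hs in
lemma gradedAwayMap_comp_algebraMap :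
    (gradedAwayMap φ s).comp (algebraMap (HomogeneousLocalization.Away 𝒜 s) _) =
      (algebraMap (HomogeneousLocalization.Away ℬ (φ s)) _).comp
        (HomogeneousLocalization.Away.map φ s) := by
  ext x
  obtain ⟨d, a, ha, rfl⟩ := HomogeneousLocalization.Away.mk_surjective 𝒜 hs x
  rw [comp_apply, comp_apply, map_mk,
    HomogeneousLocalization.algebraMap_apply, HomogeneousLocalization.algebraMap_apply,
    val_mk,
    val_mk, mk_eq_mk'_apply, mk_eq_mk'_apply]
  have h1 := mk'_spec (Away s) a (⟨s ^ d, d, rfl⟩ : powers s)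
  have h2 := mk'_spec (Away (φ s)) (φ a) (⟨φ s ^ d, d, rfl⟩ : powers (φ s))
  have e (x : A) := DFunLike.congr_fun (awayMap_comp φ s) x
  simp only [comp_apply] at e
  have h3 := congrArg (gradedAwayMap φ s) h1
  rw [map_mul, e, e] at h3
  have hu : IsUnit (algebraMap B (Away (φ s)) (φ s ^ d)) := by
    rw [map_pow]; exact (algebraMap_isUnit _).pow d
  refine hu.mul_right_cancel ?_
  refine Eq.trans ?_ (h3.trans h2.symm)
  congr 2
  exact (map_pow φ s d).symm

lemma coneMap_coneToProj : coneMap φ hφ ≫ coneToProj 𝒜 = coneToProj ℬ ≫ Proj.map φ hφ := by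
  suffices H : ∀ (n : ℕ) (s : A) (hs : s ∈ 𝒜 n) (hn : 0 < n),
      coneι ℬ (Graded.map_mem φ hs) hn ≫ coneMap φ hφ ≫ coneToProj 𝒜 =
        coneι ℬ (Graded.map_mem φ hs) hn ≫ coneToProj ℬ ≫ Proj.map φ hφ from
    (mapConeCover φ hφ).hom_ext _ _ fun s => H _ _ s.2.2 s.1.2
  intro n s hs hn
  rw [reassoc_of% coneι_coneMap φ hφ hs hn, coneι_coneToProj, reassoc_of% coneι_coneToProj, coneAway, coneAway,
    assoc, Proj.awayι_comp_map φ hφ hn s hs, ← assoc, ← assoc,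
    ← Spec.map_comp, ← Spec.map_comp, ← ofHom_comp, ← ofHom_comp,
    gradedAwayMap_comp_algebraMap φ hs]

end ConeMap

section Structure

variable {A : Type} [CommRing A] {𝒜 : ℕ → AddSubgroup A} [GradedRing 𝒜] {R : Type} [CommRing R]
  (ψ : R →+* 𝒜 0)

def projStr : Proj 𝒜 ⟶ Spec (.of R) := Proj.toSpecZero 𝒜 ≫ Spec.map (ofHom ψ)

def coneStr : Cone 𝒜 ⟶ Spec (.of R) :=
  (coneOpens 𝒜).ι ≫ Spec.map (ofHom ((algebraMap (𝒜 0) A).comp ψ))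

variable {n : ℕ} {s : A} (hs : s ∈ 𝒜 n) (hn : 0 < n)

lemma awayι_projStr : awayι 𝒜 s hs hn ≫ projStr ψ = Spec.map (ofHom
    ((fromZeroRingHom 𝒜 (powers s)).comp ψ)) := by
  rw [projStr, Proj.awayι_toSpecZero_assoc, ← Spec.map_comp, ← ofHom_comp]

lemma coneι_coneStr : coneι 𝒜 hs hn ≫ coneStr ψ = Spec.map (ofHom
    ((algebraMap A (Away s)).comp ((algebraMap (𝒜 0) A).comp ψ))) := by
  rw [coneStr, reassoc_of% coneι_ι, ← Spec.map_comp, ← ofHom_comp]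

lemma coneToProj_projStr : coneToProj 𝒜 ≫ projStr ψ = coneStr ψ := by
  refine cone_hom_ext fun n s hs hn => ?_
  rw [reassoc_of% coneι_coneToProj, coneAway, assoc, awayι_projStr, coneι_coneStr,
    ← Spec.map_comp, ← ofHom_comp]
  rfl

end Structure

section BaseChange

variable {A B : Type} [CommRing A] [CommRing B] {𝒜 : ℕ → AddSubgroup A} {ℬ : ℕ → AddSubgroup B}
  [GradedRing 𝒜] [GradedRing ℬ] {R R' : Type} [CommRing R] [CommRing R']

/-- The graded `R'`-algebra `B` is the base change of the graded `R`-algebra `A`, and its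
homogeneous localizations are the base changes of those of `A`. -/
structure IsGradedBaseChange (φ : 𝒜 →+*ᵍ ℬ) (ψ : R →+* 𝒜 0) (ψ' : R' →+* ℬ 0) (ρ : R →+* R') :
    Prop where
  irr : irrelevant ℬ ≤ (irrelevant 𝒜).map φ
  w : ∀ r, φ (ψ r : A) = ψ' (ρ r)
  away : ∀ {n : ℕ} {s : A}, s ∈ 𝒜 n → IsPushout (ofHom ρ)
    (ofHom ((fromZeroRingHom 𝒜 (powers s)).comp ψ))
    (ofHom ((fromZeroRingHom ℬ (powers (φ s))).comp ψ'))
    (ofHom (HomogeneousLocalization.Away.map φ s))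
  loc : ∀ s : A, IsPushout (ofHom ρ)
    (ofHom ((algebraMap A (Away s)).comp ((algebraMap (𝒜 0) A).comp ψ)))
    (ofHom ((algebraMap B (Away (φ s))).comp ((algebraMap (ℬ 0) B).comp ψ')))
    (ofHom (gradedAwayMap φ s))

variable {φ : 𝒜 →+*ᵍ ℬ} {ψ : R →+* 𝒜 0} {ψ' : R' →+* ℬ 0} {ρ : R →+* R'}

lemma awayMap_fromZero (w : ∀ r, φ (ψ r : A) = ψ' (ρ r)) {n : ℕ} {s : A} (hs : s ∈ 𝒜 n) :
    ((fromZeroRingHom ℬ (powers (φ s))).comp ψ').comp ρ =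
    (HomogeneousLocalization.Away.map φ s).comp ((fromZeroRingHom 𝒜 (powers s)).comp ψ) := by
  ext r
  change HomogeneousLocalization.val (fromZeroRingHom ℬ _ (ψ' (ρ r))) =
    HomogeneousLocalization.val (HomogeneousLocalization.Away.map φ s (fromZeroRingHom 𝒜 _ (ψ r)))
  have key : fromZeroRingHom 𝒜 (powers s) (ψ r) =
      HomogeneousLocalization.Away.mk 𝒜 hs 0 (ψ r : A) (by simp) := by
    apply val_injective
    rw [val_mk]
    change Localization.mk (ψ r : A) ⟨1, _⟩ = _
    congr 1
    ext; simp
  rw [key, map_mk, val_mk]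
  change Localization.mk (ψ' (ρ r) : B) ⟨1, _⟩ = _
  congr 1
  · exact (w r).symm
  · ext; simp

lemma awayMap_algebraMap (w : ∀ r, φ (ψ r : A) = ψ' (ρ r)) (s : A) :
    ((algebraMap B (Away (φ s))).comp ((algebraMap (ℬ 0) B).comp ψ')).comp ρ =
    (gradedAwayMap φ s).comp ((algebraMap A (Away s)).comp ((algebraMap (𝒜 0) A).comp ψ)) := by
  rw [← RingHom.comp_assoc _ _ (gradedAwayMap φ s), awayMap_comp]
  ext r
  exact congrArg (algebraMap B (Away (φ s))) (w r).symm

lemma IsLoc.isGradedBaseChange {r : R} (w : ∀ r, φ (ψ r : A) = ψ' (ρ r)) (hρ : IsLoc ρ r)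
    (h : IsLoc φ.toRingHom (ψ r : A)) : IsGradedBaseChange φ ψ ψ' ρ where
  irr := h.irrelevant_le (ψ r).2
  w := w
  away hs := hρ.isPushout (awayMap_fromZero w hs) (h.away hs)
  loc s := hρ.isPushout (awayMap_algebraMap w s) (h.awayMap s)

lemma IsQuot.isGradedBaseChange {r : R} (w : ∀ r, φ (ψ r : A) = ψ' (ρ r)) (hρ : IsQuot ρ r)
    (h : IsQuot φ.toRingHom (ψ r : A)) : IsGradedBaseChange φ ψ ψ' ρ where
  irr := h.irrelevant_le
  w := w
  away hs := hρ.isPushout (awayMap_fromZero w hs) (h.away hs)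
  loc s := hρ.isPushout (awayMap_algebraMap w s) (h.awayMap s)

namespace IsGradedBaseChange

variable (h : IsGradedBaseChange φ ψ ψ' ρ)
include h

lemma isPullback_proj : IsPullback (Proj.map φ h.irr) (projStr ψ') (projStr ψ)
    (Spec.map (ofHom ρ)) := by
  have H {n : ℕ} {s : A} (hs : s ∈ 𝒜 n) (hn : 0 < n) : IsPullback
      (Spec.map (ofHom (HomogeneousLocalization.Away.map φ s)))
      (awayι ℬ (φ s) (Graded.map_mem φ hs) hn ≫ projStr ψ') (awayι 𝒜 s hs hn ≫ projStr ψ)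
      (Spec.map (ofHom ρ)) := by
    rw [awayι_projStr, awayι_projStr]
    exact (isPullback_SpecMap_of_isPushout _ _ _ _ (h.away hs)).flip
  exact isPullback_of_cover _ _ _ _ (affineOpenCover 𝒜).openCover
    (fun s => Spec (.of (HomogeneousLocalization.Away ℬ (φ (s.2 : A)))))
    (fun s => Spec.map (ofHom (HomogeneousLocalization.Away.map φ (s.2 : A))))
    (fun s => awayι ℬ (φ (s.2 : A)) (Graded.map_mem φ s.2.2) s.1.2)
    (fun s => isPullback_projMap_awayι φ h.irr s.2.2 s.1.2) fun s => H s.2.2 s.1.2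

lemma isPullback_cone : IsPullback (coneMap φ h.irr) (coneStr ψ') (coneStr ψ)
    (Spec.map (ofHom ρ)) := by
  have H {n : ℕ} {s : A} (hs : s ∈ 𝒜 n) (hn : 0 < n) : IsPullback
      (Spec.map (ofHom (gradedAwayMap φ s)))
      (coneι ℬ (Graded.map_mem φ hs) hn ≫ coneStr ψ') (coneι 𝒜 hs hn ≫ coneStr ψ)
      (Spec.map (ofHom ρ)) := by
    rw [coneι_coneStr, coneι_coneStr]
    exact (isPullback_SpecMap_of_isPushout _ _ _ _ (h.loc s)).flip
  exact isPullback_of_cover _ _ _ _ (coneCover 𝒜) (fun s => Spec (.of (Away (φ (s.2 : A)))))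
    (fun s => Spec.map (ofHom (gradedAwayMap φ (s.2 : A))))
    (fun s => coneι ℬ (Graded.map_mem φ s.2.2) s.1.2)
    (fun s => isPullback_coneMap_coneι φ h.irr s.2.2 s.1.2) fun s => H s.2.2 s.1.2

lemma isPullback_coneToProj : IsPullback (coneMap φ h.irr) (coneToProj ℬ) (coneToProj 𝒜)
    (Proj.map φ h.irr) := by
  refine IsPullback.of_bot ?_ (coneMap_coneToProj φ h.irr) h.isPullback_proj
  rw [coneToProj_projStr, coneToProj_projStr]
  exact h.isPullback_cone

end IsGradedBaseChange

end BaseChange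

end

section
section Glue

variable {X : Scheme.{0}}

lemma specMap_isoSpec_inv {U V : X.AffineZariskiSite} (i : V ⟶ U) :
    Spec.map (X.presheaf.map (homOfLE (toOpens_mono i.le)).op) ≫ U.2.isoSpec.inv = V.2.isoSpec.inv ≫
        X.homOfLE (toOpens_mono i.le) :=
  (Scheme.AffineZariskiSite.restrictIsoSpec X).inv.naturality i

/-- Schemes over the spectra of the rings of functions of the affine open sets, compatible with
base change. -/
structure Pieces (X : Scheme.{0}) where
  F : X.AffineZariskiSite ⥤ Scheme.{0}
  str : ∀ U, F.obj U ⟶ Spec Γ(X, U.toOpens)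
  isPullback : ∀ {U V : X.AffineZariskiSite} (i : V ⟶ U), IsPullback (F.map i) (str V) (str U)
    (Spec.map (X.presheaf.map (homOfLE (toOpens_mono i.le)).op))

/-- The scheme obtained by gluing, as an opaque version of `RelativeGluingData.glued`. -/
def gluedOf (D : (directedCover X).RelativeGluingData) : Scheme.{0} := D.glued

def gluedOfToBase (D : (directedCover X).RelativeGluingData) :
    gluedOf D ⟶ X := D.toBase

lemma hasColimit_functor (D : (directedCover X).RelativeGluingData) :
    Limits.HasColimit D.functor := by
  have : (D.functor ⋙ Scheme.forget).IsLocallyDirected :=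
    Scheme.Cover.RelativeGluingData.instIsLocallyDirectedI₀CompFunctorForgetOfIsThin ..
  infer_instance

def gluedOfι (D : (directedCover X).RelativeGluingData)
    (U : X.AffineZariskiSite) : D.functor.obj U ⟶ gluedOf D :=
  D.cover.f U

instance (D : (directedCover X).RelativeGluingData)
    (U : X.AffineZariskiSite) : IsOpenImmersion (gluedOfι D U) :=
  D.cover.map_prop U

lemma gluedOfι_toBase (D : (directedCover X).RelativeGluingData)
    (U : X.AffineZariskiSite) : gluedOfι D U ≫ gluedOfToBase D = D.natTrans.app U ≫ U.toOpens.ι :=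
  D.ι_toBase U

lemma opensRange_gluedOfι (D : (directedCover X).RelativeGluingData) (U : X.AffineZariskiSite) :
    (gluedOfι D U).opensRange = gluedOfToBase D ⁻¹ᵁ U.toOpens := by
  refine (D.toBase_preimage_eq_opensRange_ι U).symm.trans ?_
  change D.toBase ⁻¹ᵁ U.toOpens.ι.opensRange = D.toBase ⁻¹ᵁ U.toOpens
  rw [U.toOpens.opensRange_ι]

lemma map_gluedOfι (D : (directedCover X).RelativeGluingData)
    {U V : X.AffineZariskiSite} (i : V ⟶ U) : D.functor.map i ≫ gluedOfι D U = gluedOfι D V :=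
  have := hasColimit_functor D
  Limits.colimit.w D.functor i

lemma gluedOf_hom_ext (D : (directedCover X).RelativeGluingData)
    {Z : Scheme.{0}} {f g : gluedOf D ⟶ Z}
    (hfg : ∀ U : X.AffineZariskiSite, gluedOfι D U ≫ f = gluedOfι D U ≫ g) : f = g :=
  D.cover.hom_ext _ _ hfg

lemma exists_gluedOf_desc (D : (directedCover X).RelativeGluingData)
    {Z : Scheme.{0}} (f : ∀ U : X.AffineZariskiSite, D.functor.obj U ⟶ Z)
    (hf : ∀ {U V : X.AffineZariskiSite} (i : V ⟶ U), D.functor.map i ≫ f U = f V) :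
    ∃ g : gluedOf D ⟶ Z, ∀ U : X.AffineZariskiSite, gluedOfι D U ≫ g = f U :=
  have := hasColimit_functor D
  ⟨Limits.colimit.desc D.functor
    ⟨Z, { app := f, naturality := fun _ _ i => (hf i).trans (comp_id _).symm }⟩,
    fun U => Limits.colimit.ι_desc _ U⟩

namespace Pieces

variable (G G' : Pieces X)

lemma square {U V : X.AffineZariskiSite} (i : V ⟶ U) :
    IsPullback (G.F.map i) (G.str V ≫ V.2.isoSpec.inv) (G.str U ≫ U.2.isoSpec.inv)
      (X.homOfLE (toOpens_mono i.le)) :=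
  IsPullback.paste_vert (G.isPullback i) (IsPullback.of_vert_isIso ⟨specMap_isoSpec_inv i⟩)

def gluingData : (directedCover X).RelativeGluingData where
  functor := G.F
  natTrans :=
    { app U := G.str U ≫ U.2.isoSpec.inv
      naturality _ _ i := (G.square i).w }
  equifibered _ _ i := G.square i

def glued : Scheme.{0} := gluedOf G.gluingData

def toBase : G.glued ⟶ X := gluedOfToBase G.gluingData

def ι (U : X.AffineZariskiSite) : G.F.obj U ⟶ G.glued := gluedOfι G.gluingData U

instance (U : X.AffineZariskiSite) : IsOpenImmersion (G.ι U) :=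
  inferInstanceAs (IsOpenImmersion (gluedOfι G.gluingData U))

lemma ι_toBase (U : X.AffineZariskiSite) : G.ι U ≫ G.toBase = G.str U ≫ U.2.fromSpec := by
  refine (gluedOfι_toBase G.gluingData U).trans ?_
  change (G.str U ≫ U.2.isoSpec.inv) ≫ U.toOpens.ι = _
  rw [assoc, IsAffineOpen.isoSpec_inv_ι]

lemma map_ι {U V : X.AffineZariskiSite} (i : V ⟶ U) : G.F.map i ≫ G.ι U = G.ι V :=
  map_gluedOfι G.gluingData i

lemma opensRange_ι (U : X.AffineZariskiSite) :
    (G.ι U).opensRange = G.toBase ⁻¹ᵁ U.toOpens := opensRange_gluedOfι G.gluingData U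

variable {G} in
lemma hom_ext {Z : Scheme.{0}} {f g : G.glued ⟶ Z} (hfg : ∀ U, G.ι U ≫ f = G.ι U ≫ g) : f = g :=
  gluedOf_hom_ext G.gluingData hfg

def desc {Z : Scheme.{0}} (f : ∀ U, G.F.obj U ⟶ Z)
    (hf : ∀ {U V : X.AffineZariskiSite} (i : V ⟶ U), G.F.map i ≫ f U = f V) : G.glued ⟶ Z :=
  (exists_gluedOf_desc G.gluingData f hf).choose

lemma ι_desc {Z : Scheme.{0}} (f : ∀ U, G.F.obj U ⟶ Z)
    (hf : ∀ {U V : X.AffineZariskiSite} (i : V ⟶ U), G.F.map i ≫ f U = f V)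
    (U : X.AffineZariskiSite) : G.ι U ≫ G.desc f hf = f U :=
  (exists_gluedOf_desc G.gluingData f hf).choose_spec U

lemma exists_mem_range (y : G.glued) : ∃ U, y ∈ (G.ι U).opensRange := by
  obtain ⟨U, -, hy⟩ := exists_affine_le (U := (⊤ : X.Opens)) (u := G.toBase y) trivial
  exact ⟨⟨U.1, U.2⟩, (congrArg (y ∈ ·) (G.opensRange_ι ⟨U.1, U.2⟩)).mpr hy⟩

@[simps I₀ X f]
def cover : G.glued.OpenCover where
  I₀ := X.AffineZariskiSite
  X U := G.F.obj U
  f U := G.ι U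
  mem₀ := by
    rw [presieve₀_mem_precoverage_iff]
    exact ⟨fun x => G.exists_mem_range x, fun i => inferInstance⟩

variable {G G'} in
/-- A morphism of glued schemes is cartesian over the pieces. -/
lemma isPullback_ι (f : ∀ U, G.F.obj U ⟶ G'.F.obj U) (q : G.glued ⟶ G'.glued)
    (hq : ∀ U, G.ι U ≫ q = f U ≫ G'.ι U) (hf : ∀ U, f U ≫ G'.str U = G.str U)
    (U : X.AffineZariskiSite) : IsPullback (f U) (G.ι U) (G'.ι U) q := by
  have e : q ≫ G'.toBase = G.toBase := hom_ext fun V => by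
    rw [reassoc_of% hq V, ι_toBase, ι_toBase, reassoc_of% hf V]
  refine isPullback_of_preimage_opensRange _ _ _ _ (hq U).symm (le_of_eq ?_)
  rw [opensRange_ι, opensRange_ι, ← comp_preimage, e]

end Pieces

end Glue

section GradedAlgOn

variable (A : GradedAlgOn b)

/-- A sheaf of graded algebras is quasi-coherent if its sections on `D(f)` are obtained by inverting
`f`. -/
structure GradedAlgOn.IsQuasiCoherent : Prop where
  res_id : ∀ (U : X.affineOpens) (x : A.ring U), A.res le_rfl x = x
  res_comp : ∀ {U V W : X.affineOpens} (h : (V : X.Opens) ≤ U) (h' : (W : X.Opens) ≤ V)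
    (x : A.ring U), A.res h' (A.res h x) = A.res (h'.trans h) x
  inj : ∀ (U : X.affineOpens) (f : Sec b U) (x : A.ring U),
    A.res (V := X.affineBasicOpen (U := U) f) (X.basicOpen_le f) x = 0 →
      ∃ n : ℕ, A.str U f ^ n * x = 0
  surj : ∀ (U : X.affineOpens) (f : Sec b U) (y : A.ring (X.affineBasicOpen (U := U) f)),
    ∃ (n : ℕ) (x : A.ring U), A.res (V := X.affineBasicOpen (U := U) f) (X.basicOpen_le f) x =
      A.res (V := X.affineBasicOpen (U := U) f) (X.basicOpen_le f) (A.str U f) ^ n * y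

def GradedAlgOn.resHom {U V : X.affineOpens} (h : (V : X.Opens) ≤ U) : A.gr U →+*ᵍ A.gr V where
  __ := A.res h
  map_mem hx := A.res_mem h _ _ hx

def GradedAlgOn.strZero (U : X.affineOpens) : Sec b U →+* A.gr U 0 where
  toFun r := ⟨A.str U r, A.str_mem U r⟩
  map_one' := Subtype.ext (map_one _)
  map_mul' _ _ := Subtype.ext (map_mul _ _ _)
  map_zero' := Subtype.ext (map_zero _)
  map_add' _ _ := Subtype.ext (map_add _ _ _)

lemma isLoc_secRes (U : X.affineOpens) (f : Sec b U) :
    IsLoc (secRes b (X.basicOpen_le (U := U) f)).toRingHom f := by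
  let _ : Algebra (Sec b U) (Sec b (X.basicOpen (U := U) f)) :=
    (secRes b (X.basicOpen_le (U := U) f)).toRingHom.toAlgebra
  have : IsLocalization.Away f (Sec b (X.basicOpen (U := U) f)) := U.2.isLocalization_basicOpen f
  exact IsLoc.of_isLocalization (S := Sec b U) (S' := Sec b (X.basicOpen (U := U) f))

variable {A}

lemma GradedAlgOn.IsQuasiCoherent.isLoc (hA : A.IsQuasiCoherent) (U : X.affineOpens) (f : Sec b U) :
    IsLoc (A.resHom (V := X.affineBasicOpen (U := U) f) (X.basicOpen_le f)).toRingHom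
      (A.str U f) where
  unit := by
    have : (A.resHom (V := X.affineBasicOpen (U := U) f) (X.basicOpen_le f)).toRingHom (A.str U f) =
      A.str (X.affineBasicOpen (U := U) f) (secRes b (X.basicOpen_le (U := U) f) f) := A.res_str _ _
    rw [this]
    exact (isLoc_secRes U f).unit.map _
  inj := hA.inj U f
  surj := hA.surj U f

lemma GradedAlgOn.IsQuasiCoherent.isGradedBaseChange_basicOpen (hA : A.IsQuasiCoherent)
    (U : X.affineOpens) (f : Sec b U) :
    IsGradedBaseChange (A.resHom (V := X.affineBasicOpen (U := U) f) (X.basicOpen_le f))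
      (A.strZero U) (A.strZero _) (secRes b (X.basicOpen_le (U := U) f)).toRingHom :=
  IsLoc.isGradedBaseChange (fun _ => A.res_str _ _) (isLoc_secRes U f) (hA.isLoc U f)

/-- The affine open set underlying an element of the affine Zariski site. -/
abbrev siteOpen (U : X.AffineZariskiSite) : X.affineOpens := ⟨U.1, U.2⟩

lemma siteOpen_le {U V : X.AffineZariskiSite} (h : V ≤ U) :
    (siteOpen V : X.Opens) ≤ siteOpen U := toOpens_mono h

lemma GradedAlgOn.IsQuasiCoherent.isGradedBaseChange (hA : A.IsQuasiCoherent)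
    {U V : X.AffineZariskiSite} (h : V ≤ U) :
    IsGradedBaseChange (A.resHom (siteOpen_le h)) (A.strZero (siteOpen U))
      (A.strZero (siteOpen V)) (secRes b (siteOpen_le h)).toRingHom := by
  obtain ⟨V, hV⟩ := V
  obtain ⟨f, hf⟩ := id h
  change X.basicOpen f = V at hf
  subst hf
  exact hA.isGradedBaseChange_basicOpen (siteOpen U) f

variable (hA : A.IsQuasiCoherent)

def projPieces : Pieces X where
  F :=
    { obj U := Proj (A.gr (siteOpen U))
      map i := Proj.map _ (hA.isGradedBaseChange i.le).irr
      map_id U := by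
        have H (φ : A.gr (siteOpen U) →+*ᵍ A.gr (siteOpen U)) (h) (hφ : φ = .id _) :
            Proj.map φ h = 𝟙 _ := by
          subst hφ; exact Proj.map_id
        refine H _ _ ?_
        ext x
        exact hA.res_id _ x
      map_comp {U V W} i j := by
        rw [← Proj.map_comp]
        have H (φ φ' : A.gr (siteOpen W) →+*ᵍ A.gr (siteOpen U)) (h h') (hφ : φ = φ') :
            Proj.map φ h = Proj.map φ' h' := by
          subst hφ; rfl
        refine H _ _ _ _ ?_
        ext x
        exact (hA.res_comp _ _ x).symm }
  str U := projStr (A.strZero (siteOpen U))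
  isPullback i := (hA.isGradedBaseChange i.le).isPullback_proj

def conePieces : Pieces X where
  F :=
    { obj U := Cone (A.gr (siteOpen U))
      map i := coneMap _ (hA.isGradedBaseChange i.le).irr
      map_id U := by
        rw [← cancel_mono (coneOpens (A.gr (siteOpen U))).ι, coneMap_ι, id_comp]
        have : (A.resHom (siteOpen_le (𝟙 U : U ⟶ U).le)).toRingHom = RingHom.id _ :=
          RingHom.ext fun x => hA.res_id _ x
        rw [this]
        exact (congrArg _ (Spec.map_id _)).trans (comp_id _)
      map_comp {U V W} i j := by
        rw [← cancel_mono (coneOpens (A.gr (siteOpen W))).ι, assoc, coneMap_ι, coneMap_ι,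
          reassoc_of% coneMap_ι, ← Spec.map_comp, ← ofHom_comp]
        congr 3
        exact RingHom.ext fun x => (hA.res_comp _ _ x).symm }
  str U := coneStr (A.strZero (siteOpen U))
  isPullback i := (hA.isGradedBaseChange i.le).isPullback_cone

def relProj : Scheme.{0} := (projPieces hA).glued

def relProjπ : relProj hA ⟶ X := (projPieces hA).toBase

/-- The complement of the zero section in the relative spectrum of `A`. -/
def relCone : Scheme.{0} := (conePieces hA).glued

def projι (U : X.AffineZariskiSite) : Proj (A.gr (siteOpen U)) ⟶ relProj hA := (projPieces hA).ι U

instance (U : X.AffineZariskiSite) : IsOpenImmersion (projι hA U) :=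
  inferInstanceAs (IsOpenImmersion ((projPieces hA).ι U))

def relConeι (U : X.AffineZariskiSite) : Cone (A.gr (siteOpen U)) ⟶ relCone hA :=
  (conePieces hA).ι U

instance (U : X.AffineZariskiSite) : IsOpenImmersion (relConeι hA U) :=
  inferInstanceAs (IsOpenImmersion ((conePieces hA).ι U))

lemma projι_π (U : X.AffineZariskiSite) : projι hA U ≫ relProjπ hA =
    projStr (A.strZero (siteOpen U)) ≫ U.2.fromSpec :=
  (projPieces hA).ι_toBase U

lemma map_projι {U V : X.AffineZariskiSite} (h : V ≤ U) :
    Proj.map _ (hA.isGradedBaseChange h).irr ≫ projι hA U = projι hA V :=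
  (projPieces hA).map_ι (homOfLE h)

lemma map_relConeι {U V : X.AffineZariskiSite} (h : V ≤ U) :
    coneMap _ (hA.isGradedBaseChange h).irr ≫ relConeι hA U = relConeι hA V :=
  (conePieces hA).map_ι (homOfLE h)

lemma opensRange_projι (U : X.AffineZariskiSite) :
    (projι hA U).opensRange = relProjπ hA ⁻¹ᵁ U.toOpens := (projPieces hA).opensRange_ι U

lemma exists_mem_range_projι (y : relProj hA) : ∃ U, y ∈ (projι hA U).opensRange :=
  (projPieces hA).exists_mem_range y

variable {hA} in
lemma relProj_hom_ext {Z : Scheme.{0}} {f g : relProj hA ⟶ Z}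
    (h : ∀ U, projι hA U ≫ f = projι hA U ≫ g) : f = g := Pieces.hom_ext h

variable {hA} in
lemma relCone_hom_ext {Z : Scheme.{0}} {f g : relCone hA ⟶ Z}
    (h : ∀ U, relConeι hA U ≫ f = relConeι hA U ≫ g) : f = g := Pieces.hom_ext h

def relProjDesc {Z : Scheme.{0}} (f : ∀ U : X.AffineZariskiSite, Proj (A.gr (siteOpen U)) ⟶ Z)
    (hf : ∀ {U V : X.AffineZariskiSite} (h : V ≤ U),
      Proj.map _ (hA.isGradedBaseChange h).irr ≫ f U = f V) : relProj hA ⟶ Z :=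
  (projPieces hA).desc f fun i => hf i.le

lemma projι_desc {Z : Scheme.{0}} (f : ∀ U : X.AffineZariskiSite, Proj (A.gr (siteOpen U)) ⟶ Z)
    (hf : ∀ {U V : X.AffineZariskiSite} (h : V ≤ U),
      Proj.map _ (hA.isGradedBaseChange h).irr ≫ f U = f V) (U : X.AffineZariskiSite) :
    projι hA U ≫ relProjDesc hA f hf = f U :=
  (projPieces hA).ι_desc f (fun i => hf i.le) U

def relConeDesc {Z : Scheme.{0}} (f : ∀ U : X.AffineZariskiSite, Cone (A.gr (siteOpen U)) ⟶ Z)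
    (hf : ∀ {U V : X.AffineZariskiSite} (h : V ≤ U),
      coneMap _ (hA.isGradedBaseChange h).irr ≫ f U = f V) : relCone hA ⟶ Z :=
  (conePieces hA).desc f fun i => hf i.le

lemma relConeι_desc {Z : Scheme.{0}} (f : ∀ U : X.AffineZariskiSite, Cone (A.gr (siteOpen U)) ⟶ Z)
    (hf : ∀ {U V : X.AffineZariskiSite} (h : V ≤ U),
      coneMap _ (hA.isGradedBaseChange h).irr ≫ f U = f V) (U : X.AffineZariskiSite) :
    relConeι hA U ≫ relConeDesc hA f hf = f U :=
  (conePieces hA).ι_desc f (fun i => hf i.le) U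

lemma relConeToProj_compat {U V : X.AffineZariskiSite} (h : V ≤ U) :
    coneMap _ (hA.isGradedBaseChange h).irr ≫ coneToProj (A.gr (siteOpen U)) ≫ projι hA U =
      coneToProj (A.gr (siteOpen V)) ≫ projι hA V := by
  rw [reassoc_of% coneMap_coneToProj, map_projι hA h]

/-- The frame bundle `q : P ⟶ Proj_X A` of the tautological orbifold line bundle. -/
def relConeToProj : relCone hA ⟶ relProj hA :=
  relConeDesc hA (fun U => coneToProj (A.gr (siteOpen U)) ≫ projι hA U) (relConeToProj_compat hA)

lemma relConeι_relConeToProj (U : X.AffineZariskiSite) :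
    relConeι hA U ≫ relConeToProj hA = coneToProj (A.gr (siteOpen U)) ≫ projι hA U :=
  relConeι_desc hA _ _ U

lemma isPullback_relConeToProj (U : X.AffineZariskiSite) :
    IsPullback (coneToProj (A.gr (siteOpen U))) (relConeι hA U) (projι hA U) (relConeToProj hA) :=
  Pieces.isPullback_ι (G := conePieces hA) (G' := projPieces hA)
    (fun U => coneToProj (A.gr (siteOpen U))) (relConeToProj hA)
    (relConeι_relConeToProj hA) (fun _ => coneToProj_projStr _) U

instance : IsAffineHom (relConeToProj hA) := by
  have := isZariskiLocalAtTarget_isAffineHom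
  refine (IsZariskiLocalAtTarget.iff_of_openCover (P := @IsAffineHom) (projPieces hA).cover).2
    fun U => ?_
  have h := isPullback_relConeToProj hA U
  have h2 : h.flip.isoPullback.inv ≫ coneToProj (A.gr (siteOpen U)) =
      Limits.pullback.snd (relConeToProj hA) (projι hA U) := h.flip.isoPullback_inv_snd
  change IsAffineHom (Limits.pullback.snd (relConeToProj hA) (projι hA U))
  rw [← h2]
  infer_instance

end GradedAlgOn

end

section
section Eigen

lemma mem_iSup_eigenspace {M : Type} [AddCommGroup M] [Module ℂ M] (T : Module.End ℂ M)
    (F : Finset ℂ) {x : M}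
    (hx : Polynomial.aeval T (∏ c ∈ F, (Polynomial.X - Polynomial.C c)) x = 0) :
    x ∈ ⨆ c ∈ F, T.eigenspace c := by
  classical
  induction F using Finset.induction_on generalizing x with
  | empty => simpa using hx
  | insert a F ha ih =>
    rw [Finset.prod_insert ha] at hx
    have hc : IsCoprime (Polynomial.X - Polynomial.C a)
        (∏ c ∈ F, (Polynomial.X - Polynomial.C c)) :=
      IsCoprime.prod_right fun c hc => Polynomial.isCoprime_X_sub_C_of_isUnit_sub
        (isUnit_iff_ne_zero.2 (sub_ne_zero.2 fun h => ha (h ▸ hc)))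
    have hx' : x ∈ (Polynomial.aeval T ((Polynomial.X - Polynomial.C a) *
      ∏ c ∈ F, (Polynomial.X - Polynomial.C c))).ker := hx
    rw [← Polynomial.sup_ker_aeval_eq_ker_aeval_mul_of_coprime _ hc, Submodule.mem_sup] at hx'
    obtain ⟨y, hy, z, hz, rfl⟩ := hx'
    rw [Finset.iSup_insert]
    refine Submodule.add_mem_sup ?_ (ih hz)
    have : T y - a • y = 0 := by simpa [Polynomial.aeval_X, Module.algebraMap_end_apply] using hy
    exact Module.End.mem_eigenspace_iff.2 (sub_eq_zero.1 this)

lemma aeval_prod_eq_zero {M : Type} [AddCommGroup M] [Module ℂ M] (T : Module.End ℂ M)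
    (F : Finset ℂ) {x : M} (hx : x ∈ ⨆ c ∈ F, T.eigenspace c) :
    Polynomial.aeval T (∏ c ∈ F, (Polynomial.X - Polynomial.C c)) x = 0 := by
  classical
  have h : ⨆ c ∈ F, T.eigenspace c ≤
      (Polynomial.aeval T (∏ c ∈ F, (Polynomial.X - Polynomial.C c))).ker := by
    refine iSup₂_le fun c hc y hy => ?_
    rw [LinearMap.mem_ker, ← Finset.prod_erase_mul _ _ hc, map_mul, Module.End.mul_apply]
    have : (Polynomial.aeval T (Polynomial.X - Polynomial.C c)) y = 0 := by
      simp [Module.algebraMap_end_apply, Module.End.mem_eigenspace_iff.1 hy]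
    rw [this, map_zero]
  exact h hx

lemma two_zpow_injective : Injective fun m : ℤ => (2 : ℂ) ^ m := by
  intro m n h
  have h' := congrArg (fun z : ℂ => ‖z‖) h
  simp only [norm_zpow, Complex.norm_ofNat] at h'
  exact zpow_right_injective₀ (by norm_num) (by norm_num) h'

end Eigen

section Action

variable {Y P : Scheme.{0}} (q : P ⟶ Y) (z : P ⟶ SpecC) (σ : P ⟶ P)

def secPull {P Q : Scheme.{0}} {z : P ⟶ SpecC} {w : Q ⟶ SpecC} (f : Q ⟶ P) (hf : f ≫ z = w)
    {U : P.Opens} {V : Q.Opens} (h : V ≤ f ⁻¹ᵁ U) : Sec z U →ₐ[ℂ] Sec w V where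
  __ := (f.appLE U V h).hom
  commutes' c := by
    subst hf
    have e : z.appLE ⊤ U le_top ≫ f.appLE U V h = (f ≫ z).appLE ⊤ V le_top :=
      appLE_comp_appLE _ _ _ _ _ _ _
    exact congrArg (fun φ => φ.hom ((Scheme.ΓSpecIso (CommRingCat.of ℂ)).inv.hom c)) e

variable (hσ : σ ≫ q = q) (hz : σ ≫ z = z)

include hσ in
lemma preimage_le_action (U : Y.Opens) : q ⁻¹ᵁ U ≤ σ ⁻¹ᵁ q ⁻¹ᵁ U := by
  rw [← comp_preimage, hσ]

/-- The action of an automorphism of `P` over `Y` on functions. -/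
def act (U : Y.Opens) : Sec z (q ⁻¹ᵁ U) →ₐ[ℂ] Sec z (q ⁻¹ᵁ U) :=
  secPull σ hz (preimage_le_action q σ hσ U)

lemma act_res {U V : Y.Opens} (h : V ≤ U) (x : Sec z (q ⁻¹ᵁ U)) :
    act q z σ hσ hz V (secRes z (q.preimage_mono h) x) =
      secRes z (q.preimage_mono h) (act q z σ hσ hz U x) := by
  have e : P.presheaf.map (homOfLE (q.preimage_mono h)).op ≫
      σ.appLE (q ⁻¹ᵁ V) (q ⁻¹ᵁ V) (preimage_le_action q σ hσ V) =
      σ.appLE (q ⁻¹ᵁ U) (q ⁻¹ᵁ U) (preimage_le_action q σ hσ U) ≫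
        P.presheaf.map (homOfLE (q.preimage_mono h)).op := by
    rw [Scheme.Hom.map_appLE, Scheme.Hom.appLE_map]
  exact congrArg (fun φ => φ.hom x) e

lemma act_app (U : Y.Opens) (y : Γ(Y, U)) :
    act q z σ hσ hz U ((q.app U).hom y) = (q.app U).hom y := by
  have e : q.app U ≫ σ.appLE (q ⁻¹ᵁ U) (q ⁻¹ᵁ U) (preimage_le_action q σ hσ U) = q.app U := by
    rw [app_eq_appLE, appLE_comp_appLE]
    simp_rw [hσ]
  exact congrArg (fun φ => φ.hom y) e

def eigen (U : Y.Opens) (m : ℤ) : Submodule ℂ (Sec z (q ⁻¹ᵁ U)) :=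
  Module.End.eigenspace (act q z σ hσ hz U).toLinearMap ((2 : ℂ) ^ m)

variable {q z σ hσ hz}

lemma mem_eigen {U : Y.Opens} {m : ℤ} {x : Sec z (q ⁻¹ᵁ U)} :
    x ∈ eigen q z σ hσ hz U m ↔ act q z σ hσ hz U x = (2 : ℂ) ^ m • x :=
  Module.End.mem_eigenspace_iff

lemma eigen_mul {U : Y.Opens} {i j : ℤ} {x y : Sec z (q ⁻¹ᵁ U)}
    (hx : x ∈ eigen q z σ hσ hz U i) (hy : y ∈ eigen q z σ hσ hz U j) :
    x * y ∈ eigen q z σ hσ hz U (i + j) := by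
  rw [mem_eigen] at *
  rw [map_mul, hx, hy, smul_mul_smul_comm, zpow_add₀ two_ne_zero]

lemma eigen_res {U V : Y.Opens} (h : V ≤ U) {m : ℤ} {x : Sec z (q ⁻¹ᵁ U)}
    (hx : x ∈ eigen q z σ hσ hz U m) :
    secRes z (q.preimage_mono h) x ∈ eigen q z σ hσ hz V m := by
  rw [mem_eigen] at *
  rw [act_res q z σ hσ hz h, hx, map_smul]

lemma sec_ext {U : Y.Opens} {x y : Sec z (q ⁻¹ᵁ U)}
    (h : ∀ u ∈ U, ∃ (V : Y.Opens) (hV : V ≤ U), u ∈ V ∧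
      secRes z (q.preimage_mono hV) x = secRes z (q.preimage_mono hV) y) : x = y := by
  choose V hV hu e using h
  refine TopCat.Sheaf.eq_of_locally_eq' P.sheaf (fun u : U => q ⁻¹ᵁ V u u.2) (q ⁻¹ᵁ U)
    (fun u => homOfLE (q.preimage_mono (hV u u.2))) ?_ x y fun u => e u u.2
  intro p hp
  exact mem_iSup.2 ⟨⟨q p, hp⟩, hu _ hp⟩

lemma eigen_locality {U : Y.Opens} {m : ℤ} {x : Sec z (q ⁻¹ᵁ U)}
    (h : ∀ y ∈ U, ∃ (V : Y.Opens) (hV : V ≤ U), y ∈ V ∧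
      secRes z (q.preimage_mono hV) x ∈ eigen q z σ hσ hz V m) : x ∈ eigen q z σ hσ hz U m := by
  rw [mem_eigen]
  refine sec_ext fun u hu => ?_
  obtain ⟨V, hV, huV, e⟩ := h u hu
  rw [mem_eigen, act_res q z σ hσ hz hV] at e
  exact ⟨V, hV, huV, by rw [e, map_smul]⟩

variable (q z σ hσ hz)

/-- Locally on `Y`, the functions on `P` are sums of functions that have a weight, and those of
weight zero come from `Y`. -/
structure IsFrameAction : Prop where
  exists_open : ∀ (U : Y.Opens), ∀ y ∈ U, ∃ V : Y.Opens, V ≤ U ∧ y ∈ V ∧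
    (∀ x, x ∈ ⨆ m, eigen q z σ hσ hz V m) ∧
    (∀ x ∈ eigen q z σ hσ hz V 0, ∃ t, (q.app V).hom t = x) ∧ Injective (q.app V).hom

variable {q z σ hσ hz}

lemma aeval_act_res {U V : Y.Opens} (h : V ≤ U) (p : Polynomial ℂ) (x : Sec z (q ⁻¹ᵁ U)) :
    secRes z (q.preimage_mono h) (Polynomial.aeval (act q z σ hσ hz U).toLinearMap p x) =
      Polynomial.aeval (act q z σ hσ hz V).toLinearMap p (secRes z (q.preimage_mono h) x) := by
  induction p using Polynomial.induction_on' with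
  | add p r hp hr => simp only [map_add, LinearMap.add_apply, hp, hr]
  | monomial n c =>
    simp only [Polynomial.aeval_monomial, Module.End.mul_apply, Module.algebraMap_end_apply,
      map_smul]
    congr 1
    induction n with
    | zero => simp
    | succ n ih =>
      rw [pow_succ', pow_succ', Module.End.mul_apply, Module.End.mul_apply, ← ih]
      exact (act_res q z σ hσ hz h _).symm

lemma exists_finset_of_mem_iSup {V : Y.Opens} {x : Sec z (q ⁻¹ᵁ V)}
    (hx : x ∈ ⨆ m, eigen q z σ hσ hz V m) : ∃ F : Finset ℤ, x ∈ ⨆ m ∈ F, eigen q z σ hσ hz V m :=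
  (Submodule.mem_iSup_iff_exists_finset).1 hx

lemma IsFrameAction.mem_iSup_eigen (H : IsFrameAction q z σ hσ hz) {U : Y.Opens}
    (hU : IsCompact (U : Set Y)) (x : Sec z (q ⁻¹ᵁ U)) : x ∈ ⨆ m, eigen q z σ hσ hz U m := by
  classical
  choose V hVU hV h1 h2 h3 using H.exists_open U
  have h4 : ∀ (u : Y) (hu : u ∈ U), ∃ F : Finset ℤ, secRes z (q.preimage_mono (hVU u hu)) x ∈
    ⨆ m ∈ F, eigen q z σ hσ hz (V u hu) m := fun u hu => exists_finset_of_mem_iSup (h1 u hu _)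
  choose F hF using h4
  obtain ⟨t, ht⟩ := hU.elim_finite_subcover (fun u : U => (V u u.2 : Set Y))
    (fun u => (V u u.2).2) fun u hu => Set.mem_iUnion.2 ⟨⟨u, hu⟩, hV u hu⟩
  let G : Finset ℂ := t.biUnion fun u => (F u u.2).image fun m => (2 : ℂ) ^ m
  have key : x ∈ ⨆ c ∈ G, Module.End.eigenspace (act q z σ hσ hz U).toLinearMap c := by
    refine mem_iSup_eigenspace _ _ (sec_ext fun u hu => ?_)
    obtain ⟨v, hv, huv⟩ := Set.mem_iUnion₂.1 (ht hu)
    refine ⟨V v v.2, hVU v v.2, huv, ?_⟩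
    rw [aeval_act_res (hVU v v.2), map_zero]
    refine aeval_prod_eq_zero _ _ ?_
    refine (iSup₂_le fun m hm => ?_ : ⨆ m ∈ F v v.2, eigen q z σ hσ hz (V v v.2) m ≤ _) (hF v v.2)
    exact le_iSup₂_of_le ((2 : ℂ) ^ m)
      (Finset.mem_biUnion.2 ⟨v, hv, Finset.mem_image_of_mem _ hm⟩) le_rfl
  refine (iSup₂_le fun c hc => ?_ : ⨆ c ∈ G,
    Module.End.eigenspace (act q z σ hσ hz U).toLinearMap c ≤ _) key
  obtain ⟨v, hv, hc⟩ := Finset.mem_biUnion.1 hc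
  obtain ⟨m, hm, rfl⟩ := Finset.mem_image.1 hc
  exact le_iSup_of_le m le_rfl

lemma IsFrameAction.isInternal (H : IsFrameAction q z σ hσ hz) {U : Y.Opens}
    (hU : IsCompact (U : Set Y)) : DirectSum.IsInternal (eigen q z σ hσ hz U) := by
  refine DirectSum.isInternal_submodule_of_iSupIndep_of_iSup_eq_top
    ((Module.End.eigenspaces_iSupIndep _).comp two_zpow_injective) ?_
  rw [eq_top_iff]
  exact fun x _ => H.mem_iSup_eigen hU x

lemma app_res {U V : Y.Opens} (h : V ≤ U) (t : Γ(Y, U)) :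
    (q.app V).hom ((Y.presheaf.map (homOfLE h).op).hom t) =
      secRes z (q.preimage_mono h) ((q.app U).hom t) :=
  congrArg (fun φ => φ.hom t) (q.naturality (homOfLE h).op)

lemma IsFrameAction.injective (H : IsFrameAction q z σ hσ hz) (U : Y.Opens) :
    Injective (q.app U).hom := by
  intro t t' htt
  choose V hVU hV h1 h2 h3 using H.exists_open U
  refine TopCat.Sheaf.eq_of_locally_eq' Y.sheaf (fun u : U => V u u.2) U
    (fun u => homOfLE (hVU u u.2)) (fun u hu => mem_iSup.2
      ⟨⟨u, hu⟩, hV _ hu⟩) t t' fun u => h3 u u.2 ?_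
  exact (app_res (z := z) _ t).trans ((congrArg _ htt).trans (app_res (z := z) _ t').symm)

lemma IsFrameAction.zero_eq (H : IsFrameAction q z σ hσ hz) (U : Y.Opens)
    (x : Sec z (q ⁻¹ᵁ U)) : x ∈ eigen q z σ hσ hz U 0 ↔ ∃ t, (q.app U).hom t = x := by
  constructor
  · intro hx
    choose V hVU hV h1 h2 h3 using H.exists_open U
    choose t ht using fun u : U => h2 u u.2 _ (eigen_res (hVU u u.2) hx)
    have hcov : U ≤ ⨆ u : U, V u u.2 := fun u hu => mem_iSup.2 ⟨⟨u, hu⟩, hV _ hu⟩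
    have hcomp : TopCat.Presheaf.IsCompatible Y.presheaf (fun u : U => V u u.2) t := by
      intro u v
      refine H.injective _ ?_
      refine (app_res (z := z) _ _).trans (Eq.trans ?_ (app_res (z := z) _ _).symm)
      rw [ht, ht]
      exact (DFunLike.congr_fun (secRes_comp z _ _) x).trans
        (DFunLike.congr_fun (secRes_comp z _ _) x).symm
    obtain ⟨s, hs, -⟩ := TopCat.Sheaf.existsUnique_gluing' Y.sheaf (fun u : U => V u u.2) U
      (fun u => homOfLE (hVU u u.2)) hcov t hcomp
    refine ⟨s, sec_ext fun u hu => ⟨V u hu, hVU u hu, hV u hu, ?_⟩⟩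
    rw [← ht ⟨u, hu⟩, ← hs ⟨u, hu⟩]
    exact (app_res (z := z) _ _).symm
  · rintro ⟨t, rfl⟩
    refine mem_eigen.2 ((act_app q z σ hσ hz U t).trans ?_)
    rw [zpow_zero]
    exact (one_smul ℂ (show Sec z (q ⁻¹ᵁ U) from (q.app U).hom t)).symm

end Action

section Orbi

variable {S Y P : Scheme.{0}} {s : S ⟶ SpecC} {q : P ⟶ Y} {z : P ⟶ SpecC} {σ : P ⟶ P}
  {hσ : σ ≫ q = q} {hz : σ ≫ z = z}

/-- The quotient by an action, with its tautological orbifold line bundle. -/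
def IsFrameAction.orbiFamily (H : IsFrameAction q z σ hσ hz) (π : Y ⟶ S) [IsAffineHom q]
    (hs : q ≫ π ≫ s = z) (hsm : Smooth z)
    (hu : ∀ y : Y, ∃ U : Y.Opens, y ∈ U ∧ ∃ N : ℤ, 0 < N ∧ ∃ u ∈ eigen q z σ hσ hz U N, IsUnit u) :
    OrbiFamily s where
  Y := Y
  π := π
  P := P
  q := q
  affine := inferInstance
  smooth := by rw [hs]; exact hsm
  O U m := (eigen q z σ hσ hz U m).toAddSubgroup
  mul _ _ _ _ _ hx hy := eigen_mul hx hy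
  res h _ _ hx := eigen_res h hx
  locality _ _ _ h := eigen_locality h
  internal U := H.isInternal U.2.isCompact
  zero_eq U := Set.ext fun x => H.zero_eq U x
  injective := H.injective
  exists_unit := hu

end Orbi

end

section
section Evaluation

variable {P Q : Scheme.{0}} {R R' : Type} [CommRing R] [CommRing R']

/-- Functions on an open set that contains the image of `Spec R`, as elements of `R`. -/
def evalSpec (f : Spec (.of R) ⟶ P) (V : P.Opens) (h : ⊤ ≤ f ⁻¹ᵁ V) : Γ(P, V) →+* R :=
  (f.appLE V ⊤ h ≫ (Scheme.ΓSpecIso (.of R)).hom).hom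

lemma evalSpec_congr {f g : Spec (.of R) ⟶ P} (e : f = g) {V : P.Opens} (h : ⊤ ≤ f ⁻¹ᵁ V)
    (x : Γ(P, V)) : evalSpec f V h x = evalSpec g V (e ▸ h) x := by
  subst e; rfl

lemma evalSpec_res (f : Spec (.of R) ⟶ P) {U V : P.Opens} (hV : V ≤ U) (h : ⊤ ≤ f ⁻¹ᵁ V)
    (x : Γ(P, U)) : evalSpec f V h ((P.presheaf.map (homOfLE hV).op).hom x) =
      evalSpec f U (h.trans (f.preimage_mono hV)) x := by
  have e : P.presheaf.map (homOfLE hV).op ≫ f.appLE V ⊤ h =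
    f.appLE U ⊤ (h.trans (f.preimage_mono hV)) := f.map_appLE _ _
  exact congrArg (fun φ => (Scheme.ΓSpecIso (.of R)).hom.hom (φ.hom x)) e

lemma evalSpec_comp (f : Spec (.of R) ⟶ P) (g : P ⟶ Q) {V : Q.Opens} {U : P.Opens}
    (hU : U ≤ g ⁻¹ᵁ V) (h : ⊤ ≤ f ⁻¹ᵁ U) (x : Γ(Q, V)) :
    evalSpec f U h ((g.appLE V U hU).hom x) =
      evalSpec (f ≫ g) V (h.trans (f.preimage_mono hU)) x := by
  have e : g.appLE V U hU ≫ f.appLE U ⊤ h =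
    (f ≫ g).appLE V ⊤ (h.trans (f.preimage_mono hU)) := appLE_comp_appLE _ _ _ _ _ _ _
  exact congrArg (fun φ => (Scheme.ΓSpecIso (.of R)).hom.hom (φ.hom x)) e

lemma evalSpec_app (f : Spec (.of R) ⟶ P) (g : P ⟶ Q) {V : Q.Opens}
    (h : ⊤ ≤ f ⁻¹ᵁ g ⁻¹ᵁ V) (x : Γ(Q, V)) :
    evalSpec f (g ⁻¹ᵁ V) h ((g.app V).hom x) = evalSpec (f ≫ g) V h x := by
  rw [app_eq_appLE]
  exact evalSpec_comp f g le_rfl h x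

lemma evalSpec_specMap (φ : R →+* R') (f : Spec (.of R) ⟶ P) {V : P.Opens}
    (h : ⊤ ≤ f ⁻¹ᵁ V) (h' : ⊤ ≤ (Spec.map (ofHom φ) ≫ f) ⁻¹ᵁ V) (x : Γ(P, V)) :
    evalSpec (Spec.map (ofHom φ) ≫ f) V h' x = φ (evalSpec f V h x) := by
  have e : f.appLE V ⊤ h ≫ (Spec.map (ofHom φ)).appLE ⊤ ⊤ le_rfl =
    (Spec.map (ofHom φ) ≫ f).appLE V ⊤ h' := appLE_comp_appLE _ _ _ _ _ _ _
  have e2 : (Spec.map (ofHom φ)).appLE ⊤ ⊤ le_rfl ≫ (Scheme.ΓSpecIso (.of R')).hom =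
      (Scheme.ΓSpecIso (.of R)).hom ≫ ofHom φ := by
    rw [← Scheme.ΓSpecIso_naturality, Scheme.Hom.appTop, app_eq_appLE]
    rfl
  refine (congrArg (fun φ => (Scheme.ΓSpecIso (.of R')).hom.hom (φ.hom x)) e.symm).trans ?_
  exact congrArg (fun φ => φ.hom ((f.appLE V ⊤ h).hom x)) e2

lemma evalSpec_Γ (φ : R →+* R') (h) (a : R) :
    evalSpec (Spec.map (ofHom φ)) ⊤ h ((Scheme.ΓSpecIso (.of R)).inv.hom a) = φ a := by
  have e2 : (Spec.map (ofHom φ)).appLE ⊤ ⊤ le_rfl ≫ (Scheme.ΓSpecIso (.of R')).hom =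
      (Scheme.ΓSpecIso (.of R)).hom ≫ ofHom φ := by
    rw [← Scheme.ΓSpecIso_naturality, Scheme.Hom.appTop, app_eq_appLE]
    rfl
  refine (congrArg (fun φ => φ.hom ((Scheme.ΓSpecIso (.of R)).inv.hom a)) e2).trans ?_
  have e3 := congrArg (fun φ => φ.hom a) (Scheme.ΓSpecIso (.of R)).inv_hom_id
  exact congrArg φ e3

lemma evalSpec_bijective (f : Spec (.of R) ⟶ P) [IsOpenImmersion f] {V : P.Opens}
    (hV : f.opensRange = V) (h) : Bijective (evalSpec f V h) := by
  subst hV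
  have e : f.appLE f.opensRange ⊤ h = f.app f.opensRange ≫
      (Spec (.of R)).presheaf.map (eqToHom (f.preimage_opensRange).symm).op := rfl
  have : IsIso (f.app f.opensRange) := f.isIso_app _ le_rfl
  have : IsIso (f.appLE f.opensRange ⊤ h ≫ (Scheme.ΓSpecIso (.of R)).hom) := by
    rw [e]; infer_instance
  exact ConcreteCategory.bijective_of_isIso
    (f.appLE f.opensRange ⊤ h ≫ (Scheme.ΓSpecIso (.of R)).hom)

lemma evalSpec_appIso_inv (f : Spec (.of R) ⟶ P) (g : P ⟶ Q) [IsOpenImmersion g] {U : P.Opens}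
    (h : ⊤ ≤ f ⁻¹ᵁ U) (h' : ⊤ ≤ (f ≫ g) ⁻¹ᵁ g ''ᵁ U) (x : Γ(P, U)) :
    evalSpec (f ≫ g) (g ''ᵁ U) h' ((g.appIso U).inv.hom x) = evalSpec f U h x := by
  refine (evalSpec_comp f g (V := g ''ᵁ U) (U := U) (g.preimage_image_eq U).ge h _).symm.trans ?_
  have := congrArg (fun φ => φ.hom x) (g.appIso U).inv_hom_id
  rw [Scheme.Hom.appIso_hom'] at this
  exact congrArg (evalSpec f U h) this

variable {A : Type} [CommRing A] (𝒜 : ℕ → AddSubgroup A) [GradedRing 𝒜]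

lemma evalSpec_awayToSection {n : ℕ} {s : A} (hs : s ∈ 𝒜 n) (hn : 0 < n) (h)
    (x : HomogeneousLocalization.Away 𝒜 s) :
    evalSpec (awayι 𝒜 s hs hn) (Proj.basicOpen 𝒜 s) h ((awayToSection 𝒜 s).hom x) =
      x := by
  have e1 : (Proj.basicOpen 𝒜 s).ι.appLE (Proj.basicOpen 𝒜 s) ⊤
      ((Proj.basicOpen 𝒜 s).ι_preimage_self.ge) = (Proj.basicOpen 𝒜 s).topIso.inv := by
    simp
    rfl
  have e2 : awayToSection 𝒜 s ≫ (Proj.basicOpen 𝒜 s).ι.appLE (Proj.basicOpen 𝒜 s) ⊤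
      ((Proj.basicOpen 𝒜 s).ι_preimage_self.ge) =
      (Scheme.ΓSpecIso (.of (HomogeneousLocalization.Away 𝒜 s))).inv ≫
        (basicOpenIsoSpec 𝒜 s hs hn).hom.appLE ⊤ ⊤ le_rfl := by
    rw [e1, Iso.eq_inv_comp]
    exact (Proj.basicOpenToSpec_app_top 𝒜 s).symm.trans (app_eq_appLE _)
  refine (evalSpec_comp (basicOpenIsoSpec 𝒜 s hs hn).inv (Proj.basicOpen 𝒜 s).ι
    ((Proj.basicOpen 𝒜 s).ι_preimage_self.ge) le_rfl _).symm.trans ?_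
  refine (congrArg (fun φ => evalSpec (basicOpenIsoSpec 𝒜 s hs hn).inv ⊤ le_rfl
    (φ.hom x)) e2).trans ?_
  refine (evalSpec_comp (basicOpenIsoSpec 𝒜 s hs hn).inv
    (basicOpenIsoSpec 𝒜 s hs hn).hom (V := ⊤) (U := ⊤) le_rfl le_rfl _).trans ?_
  have e3 : (basicOpenIsoSpec 𝒜 s hs hn).inv ≫ (basicOpenIsoSpec 𝒜 s hs hn).hom =
      Spec.map (ofHom (RingHom.id (HomogeneousLocalization.Away 𝒜 s))) := by
    rw [Iso.inv_hom_id]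
    exact (Spec.map_id _).symm
  exact (evalSpec_congr e3 _ _).trans (evalSpec_Γ _ _ _)

end Evaluation

section Scale

variable {A : Type} [CommRing A] (𝒜 : ℕ → AddSubgroup A) [GradedRing 𝒜]

/-- The action of `2` on a graded ring: multiplication by `2 ^ n` in degree `n`. -/
def scaleHom : A →+* A :=
  (DirectSum.toSemiring (fun n => (AddMonoidHom.mulLeft ((2 : A) ^ n)).comp (𝒜 n).subtype)
    (by change (2 : A) ^ 0 * 1 = 1; simp)
    (by
      intro i j a b
      change (2 : A) ^ (i + j) * ((a : A) * (b : A)) = ((2 : A) ^ i * a) * ((2 : A) ^ j * b)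
      ring)).comp (DirectSum.decomposeRingEquiv 𝒜).toRingHom

variable {𝒜}

lemma scaleHom_of_mem {n : ℕ} {a : A} (ha : a ∈ 𝒜 n) : scaleHom 𝒜 a = 2 ^ n * a := by
  have h : (DirectSum.decomposeRingEquiv 𝒜).toRingHom a =
      DirectSum.of (fun n => 𝒜 n) n ⟨a, ha⟩ := DirectSum.decompose_of_mem 𝒜 ha
  rw [scaleHom, comp_apply, h]
  exact DirectSum.toSemiring_of _ _ _ _ _

variable (𝒜) in
/-- The action of `2` on a graded ring, as a graded homomorphism. -/
def scale : 𝒜 →+*ᵍ 𝒜 where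
  __ := scaleHom 𝒜
  map_mem {n x} hx := by
    rw [scaleHom_of_mem hx]
    have := nsmul_mem hx (2 ^ n)
    rwa [nsmul_eq_mul, Nat.cast_pow, Nat.cast_ofNat] at this

lemma scale_of_mem {n : ℕ} {a : A} (ha : a ∈ 𝒜 n) : scale 𝒜 a = 2 ^ n * a := scaleHom_of_mem ha

lemma scale_irrelevant (h2 : IsUnit (2 : A)) :
    irrelevant 𝒜 ≤ (irrelevant 𝒜).map (scale 𝒜) :=
  irrelevant_le_map _ fun m _ y hy => ⟨2 ^ m, y, h2.pow m, hy, scale_of_mem hy⟩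

lemma scale_comm {B : Type} [CommRing B] {ℬ : ℕ → AddSubgroup B} [GradedRing ℬ]
    (φ : 𝒜 →+*ᵍ ℬ) (a : A) : φ (scale 𝒜 a) = scale ℬ (φ a) := by
  classical
  rw [← DirectSum.sum_support_decompose 𝒜 a]
  simp only [map_sum]
  refine sum_congr rfl fun n _ => ?_
  rw [scale_of_mem (SetLike.coe_mem _), scale_of_mem (Graded.map_mem φ (SetLike.coe_mem _)),
    map_mul, map_pow, map_ofNat]

variable {n : ℕ} {s : A} (hs : s ∈ 𝒜 n) (h2 : IsUnit (2 : A))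

include hs h2 in
lemma isUnit_scale : IsUnit (algebraMap A (Away s) (scale 𝒜 s)) := by
  rw [scale_of_mem hs, map_mul]
  exact ((h2.pow n).map _).mul (algebraMap_isUnit s)

/-- The action of `2` on the localization of a graded ring. -/
def scaleAway : Away s →+* Away s := IsLocalization.Away.lift (S := Away s) s
    (g := (algebraMap A (Away s)).comp (scale 𝒜).toRingHom) (isUnit_scale hs h2)

lemma scaleAway_comp : (scaleAway hs h2).comp (algebraMap A _) =
    (algebraMap A (Away s)).comp (scale 𝒜).toRingHom :=
  IsLocalization.Away.lift_comp _ _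

lemma scaleAway_algebraMap (a : A) : scaleAway hs h2 (algebraMap A _ a) =
    algebraMap A (Away s) (scale 𝒜 a) :=
  DFunLike.congr_fun (scaleAway_comp hs h2) a

lemma scaleAway_mk' {i : ℕ} {a : A} (ha : a ∈ 𝒜 i) (k : ℕ) {x : Away s}
    (hx : x * algebraMap A _ s ^ k = algebraMap A _ a) :
    2 ^ (k * n) * scaleAway hs h2 x = 2 ^ i * x := by
  have h := congrArg (scaleAway hs h2) hx
  rw [map_mul, map_pow, scaleAway_algebraMap, scaleAway_algebraMap, scale_of_mem hs,
    scale_of_mem ha, map_mul, map_mul, ← hx, map_pow, map_pow, map_ofNat, mul_pow, ← pow_mul] at h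
  refine ((algebraMap_isUnit (S := Away s) s).pow k).mul_right_cancel ?_
  rw [mul_comm k n]
  linear_combination h

lemma scaleAway_val (x : HomogeneousLocalization.Away 𝒜 s) :
    scaleAway hs h2 (algebraMap _ _ x) = algebraMap _ _ x := by
  obtain ⟨d, a, ha, rfl⟩ := HomogeneousLocalization.Away.mk_surjective 𝒜 hs x
  have h := mk'_spec (Away s) a (⟨s ^ d, d, rfl⟩ : powers s)
  rw [map_pow] at h
  rw [HomogeneousLocalization.algebraMap_apply, val_mk, mk_eq_mk'_apply]
  have := scaleAway_mk' hs h2 ha d h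
  rw [smul_eq_mul] at this
  exact (((h2.map (algebraMap A (Away s))).pow (d * n)).mul_left_cancel (by rwa [map_ofNat]))

lemma exists_sum_away (x : Away s) : ∃ (k : ℕ) (a : A),
    x * algebraMap A _ s ^ k = algebraMap A _ a := by
  obtain ⟨k, a, h⟩ := IsLocalization.Away.surj s x
  exact ⟨k, a, by rw [← map_pow, map_pow, h]⟩

lemma eq_zero_of_two_pow_mul (hQ : ∀ N : ℕ, N ≠ 0 → IsUnit (N : A)) {i j : ℕ} (hij : i ≠ j)
    {z : A} (h : 2 ^ i * z = 2 ^ j * z) : z = 0 := by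
  wlog hlt : i < j generalizing i j
  · exact this hij.symm h.symm (by omega)
  have hp : 2 ^ i < 2 ^ j := Nat.pow_lt_pow_right (by norm_num) hlt
  refine (hQ (2 ^ j - 2 ^ i) (by omega)).mul_left_cancel ?_
  rw [Nat.cast_sub hp.le, Nat.cast_pow, Nat.cast_pow, Nat.cast_ofNat, mul_zero, sub_mul, h, sub_self]

lemma natCast_mem_zero (N : ℕ) : (N : A) ∈ 𝒜 0 := by
  have := nsmul_mem (SetLike.GradedOne.one_mem : (1 : A) ∈ 𝒜 0) N
  rwa [nsmul_one] at this

/-- The elements of degree zero are those fixed by the action of `2`. -/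
lemma exists_of_scaleAway_eq (hQ : ∀ N : ℕ, N ≠ 0 → IsUnit (N : A)) {x : Away s}
    (hx : scaleAway hs h2 x = x) : ∃ y : HomogeneousLocalization.Away 𝒜 s,
      algebraMap _ (Away s) y = x := by
  classical
  obtain ⟨k, a, h⟩ := exists_sum_away x
  have h1 := congrArg (scaleAway hs h2) h
  rw [map_mul, map_pow, scaleAway_algebraMap, scaleAway_algebraMap, hx, scale_of_mem hs, map_mul,
    mul_pow, mul_left_comm, h, ← map_pow, ← map_mul] at h1
  obtain ⟨⟨_, N, rfl⟩, hN⟩ := (IsLocalization.eq_iff_exists (powers s) _).1 h1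
  change s ^ N * (((2 ^ n) ^ k) * a) = s ^ N * scale 𝒜 a at hN
  have hsN (i : ℕ) (a : A) : proj 𝒜 (N • n + i) (s ^ N * a) =
      s ^ N * proj 𝒜 i a := by
    rw [proj_apply, proj_apply]
    exact DirectSum.coe_decompose_mul_add_of_left_mem 𝒜 (SetLike.pow_mem_graded N hs)
  have key : ∀ i, i ≠ n * k → s ^ N * proj 𝒜 i a = 0 := by
    intro i hi
    have h3 := congrArg (proj 𝒜 (N • n + i)) hN
    have hc : (2 ^ n) ^ k ∈ 𝒜 0 := by
      have := natCast_mem_zero (𝒜 := 𝒜) ((2 ^ n) ^ k)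
      rwa [Nat.cast_pow, Nat.cast_pow, Nat.cast_ofNat] at this
    rw [hsN, hsN, proj_mul_of_mem_zero 𝒜 hc, ← map_proj, scale_of_mem (proj_mem 𝒜 i a),
      ← pow_mul] at h3
    refine eq_zero_of_two_pow_mul hQ hi ?_
    linear_combination -h3
  have h5 : s ^ N * a = s ^ N * proj 𝒜 (n * k) a := by
    conv_lhs => rw [← DirectSum.sum_support_decompose 𝒜 a, mul_sum]
    rw [sum_eq_single (n * k)]
    · rw [proj_apply]
    · intro i _ hi
      rw [← proj_apply]
      exact key i hi
    · intro hi
      rw [DFinsupp.notMem_support_iff.1 hi]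
      simp
  have hb : proj 𝒜 (n * k) a ∈ 𝒜 (k • n) := by
    rw [smul_eq_mul, mul_comm k n]; exact proj_mem 𝒜 _ a
  refine ⟨HomogeneousLocalization.Away.mk 𝒜 hs k _ hb, ?_⟩
  have h6 := mk'_spec (Away s) (proj 𝒜 (n * k) a) (⟨s ^ k, k, rfl⟩ : powers s)
  rw [HomogeneousLocalization.algebraMap_apply, val_mk, mk_eq_mk'_apply]
  have hu : IsUnit (algebraMap A (Away s) s) := algebraMap_isUnit s
  refine (hu.pow k).mul_right_cancel ?_
  rw [h, ← map_pow]
  refine h6.trans ?_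
  refine (hu.pow N).mul_left_cancel ?_
  rw [← map_pow, ← map_mul, ← map_mul, h5]

end Scale

end

section
lemma opensRange_eq_of_isPullback {W X Y Z : Scheme.{0}} {f : W ⟶ X}
    {f' : W ⟶ Y} {g : X ⟶ Z} {g' : Y ⟶ Z} [IsOpenImmersion f] [IsOpenImmersion g']
    (h : IsPullback f f' g g') : f.opensRange = g ⁻¹ᵁ g'.opensRange := by
  rw [← Scheme.Hom.opensRange_pullbackFst]
  apply TopologicalSpace.Opens.ext
  change Set.range f = _
  rw [← h.isoPullback_hom_fst]
  exact congrArg (fun U : X.Opens => (U : Set X)) (Scheme.Hom.opensRange_comp_of_isIso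
    h.isoPullback.hom (Limits.pullback.fst g g'))

section FrameChart

variable {Y P : Scheme.{0}} (q : P ⟶ Y) (z : P ⟶ SpecC) (σ : P ⟶ P)
  {A : Type} [CommRing A] (𝒜 : ℕ → AddSubgroup A) [GradedRing 𝒜]

/-- A chart of the quotient of `P` by an action of the form `Spec A ∖ V(A₊) ⟶ Proj A`. -/
structure FrameChart where
  hQ : ∀ N : ℕ, N ≠ 0 → IsUnit (N : A)
  chart : Proj 𝒜 ⟶ Y
  cone : Cone 𝒜 ⟶ P
  chart_open : IsOpenImmersion chart
  cone_open : IsOpenImmersion cone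
  isPullback : IsPullback (coneToProj 𝒜) cone chart q
  scale : ∀ h2 : IsUnit (2 : A), cone ≫ σ = coneMap (scale 𝒜) (scale_irrelevant h2) ≫ cone

namespace FrameChart

variable {q z σ 𝒜} (c : FrameChart q σ 𝒜)

attribute [instance] chart_open cone_open

include c in
lemma isUnit_two : IsUnit (2 : A) := by
  have := c.hQ 2 two_ne_zero
  rwa [Nat.cast_ofNat] at this

abbrev V (s : A) : Y.Opens := c.chart ''ᵁ Proj.basicOpen 𝒜 s

variable {n : ℕ} {s : A} (hs : s ∈ 𝒜 n) (hn : 0 < n)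

abbrev j : Spec (.of (Away s)) ⟶ P := coneι 𝒜 hs hn ≫ c.cone

lemma isPullback_j : IsPullback (c.j hs hn) (Spec.map (ofHom (algebraMap
    (HomogeneousLocalization.Away 𝒜 s) (Away s)))) q (awayι 𝒜 s hs hn ≫ c.chart) :=
  ((isPullback_coneι 𝒜 hs hn).flip.paste_horiz c.isPullback.flip)

lemma opensRange_awayι_chart : (awayι 𝒜 s hs hn ≫ c.chart).opensRange = c.V s := by
  rw [Scheme.Hom.opensRange_comp, opensRange_awayι]

lemma opensRange_j : (c.j hs hn).opensRange = q ⁻¹ᵁ c.V s := by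
  rw [← c.opensRange_awayι_chart hs hn, opensRange_eq_of_isPullback (c.isPullback_j hs hn)]

lemma top_le_j : ⊤ ≤ c.j hs hn ⁻¹ᵁ q ⁻¹ᵁ c.V s := by
  rw [← c.opensRange_j hs hn, Scheme.Hom.preimage_opensRange]

lemma top_le_awayι : ⊤ ≤ (awayι 𝒜 s hs hn ≫ c.chart) ⁻¹ᵁ c.V s := by
  rw [← c.opensRange_awayι_chart hs hn, Scheme.Hom.preimage_opensRange]

variable (z) in
/-- The functions over `D₊(s)` on `P` are the elements of `A_s`. -/
def ev : Sec z (q ⁻¹ᵁ c.V s) →+* Away s := evalSpec (c.j hs hn) _ (c.top_le_j hs hn)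

lemma ev_bijective : Bijective (c.ev z hs hn) := evalSpec_bijective _ (c.opensRange_j hs hn) _

/-- The functions on `D₊(s)` are the elements of degree zero of `A_s`. -/
def evY : Γ(Y, c.V s) →+* HomogeneousLocalization.Away 𝒜 s :=
  evalSpec (awayι 𝒜 s hs hn ≫ c.chart) _ (c.top_le_awayι hs hn)

lemma evY_bijective : Bijective (c.evY hs hn) :=
  evalSpec_bijective _ (c.opensRange_awayι_chart hs hn) _

lemma ev_app (t : Γ(Y, c.V s)) : evalSpec (c.j hs hn) _ (c.top_le_j hs hn) ((q.app _).hom t) =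
    algebraMap _ _ (c.evY hs hn t) := by
  refine (evalSpec_app _ q (c.top_le_j hs hn) t).trans ?_
  refine (evalSpec_congr (c.isPullback_j hs hn).w _ t).trans ?_
  exact evalSpec_specMap _ _ (c.top_le_awayι hs hn) _ t

lemma j_scale : c.j hs hn ≫ σ = Spec.map (ofHom (scaleAway hs c.isUnit_two)) ≫ c.j hs hn := by
  rw [assoc, c.scale c.isUnit_two, ← assoc, ← assoc]
  congr 1
  rw [← cancel_mono (coneOpens 𝒜).ι, assoc, assoc, coneMap_ι, coneι_ι,
    reassoc_of% coneι_ι, ← Spec.map_comp, ← Spec.map_comp, ← ofHom_comp,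
    ← ofHom_comp, scaleAway_comp]

variable {hσ : σ ≫ q = q} {hz : σ ≫ z = z}

lemma ev_act (x : Sec z (q ⁻¹ᵁ c.V s)) :
    c.ev z hs hn (act q z σ hσ hz _ x) = scaleAway hs c.isUnit_two (c.ev z hs hn x) := by
  refine (evalSpec_comp (c.j hs hn) σ (preimage_le_action q σ hσ _) (c.top_le_j hs hn) x).trans ?_
  refine (evalSpec_congr (c.j_scale hs hn) _ x).trans ?_
  exact evalSpec_specMap _ _ (c.top_le_j hs hn) _ x

end FrameChart

lemma mem_eigen_sub {q : P ⟶ Y} {z : P ⟶ SpecC} {σ : P ⟶ P} {hσ : σ ≫ q = q} {hz : σ ≫ z = z}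
    {U : Y.Opens} {x : Sec z (q ⁻¹ᵁ U)} {i j : ℕ} :
    x ∈ eigen q z σ hσ hz U ((i : ℤ) - j) ↔ 2 ^ j * act q z σ hσ hz U x = 2 ^ i * x := by
  have h (m : ℕ) (y : Sec z (q ⁻¹ᵁ U)) : 2 ^ m * y = (2 : ℂ) ^ m • y := by
    rw [smul_def, map_pow, map_ofNat]
  rw [mem_eigen, zpow_sub₀ two_ne_zero, h, h, zpow_natCast, zpow_natCast, div_eq_inv_mul, mul_smul,
    eq_inv_smul_iff₀ (pow_ne_zero _ two_ne_zero)]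

namespace FrameChart

variable {q z σ 𝒜} (c : FrameChart q σ 𝒜) {n : ℕ} {s : A} (hs : s ∈ 𝒜 n) (hn : 0 < n)
  {hσ : σ ≫ q = q} {hz : σ ≫ z = z}

lemma mem_eigen_iff {x : Sec z (q ⁻¹ᵁ c.V s)} {i j : ℕ} :
    x ∈ eigen q z σ hσ hz (c.V s) ((i : ℤ) - j) ↔
      2 ^ j * scaleAway hs c.isUnit_two (c.ev z hs hn x) = 2 ^ i * c.ev z hs hn x := by
  rw [mem_eigen_sub, ← (c.ev_bijective hs hn (z := z)).1.eq_iff, ← c.ev_act hs hn (hσ := hσ) (hz := hz)]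
  refine iff_of_eq (congrArg₂ _ ?_ ?_)
  · refine ((c.ev z hs hn).map_mul _ _).trans ?_
    rw [map_pow, map_ofNat]
  · refine ((c.ev z hs hn).map_mul _ _).trans ?_
    rw [map_pow, map_ofNat]

include hs hn in
lemma mem_iSup_eigen (x : Sec z (q ⁻¹ᵁ c.V s)) : x ∈ ⨆ m, eigen q z σ hσ hz (c.V s) m := by
  classical
  obtain ⟨k, a, h⟩ := exists_sum_away (c.ev z hs hn x)
  have hu : IsUnit (algebraMap A (Away s) s ^ k) := (algebraMap_isUnit s).pow k
  obtain ⟨v, hv⟩ := hu.exists_left_inv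
  choose y hy using fun i => (c.ev_bijective hs hn (z := z)).2
    (v * algebraMap A (Away s) (proj 𝒜 i a))
  have hx : x = ∑ i ∈ DFinsupp.support (DirectSum.decompose 𝒜 a), (y i : Sec z (q ⁻¹ᵁ c.V s)) := by
    apply (c.ev_bijective hs hn (z := z)).1
    refine Eq.trans ?_ (map_sum (c.ev z hs hn) _ _).symm
    simp only [hy]
    rw [← mul_sum, ← map_sum]
    have : ∑ i ∈ DFinsupp.support (DirectSum.decompose 𝒜 a), proj 𝒜 i a = a :=
      DirectSum.sum_support_decompose 𝒜 a
    rw [this, ← h, mul_comm, mul_assoc, mul_comm _ v, hv, mul_one]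
  rw [hx]
  refine sum_mem fun i _ => Submodule.mem_iSup_of_mem ((i : ℤ) - (k * n : ℕ)) ?_
  rw [c.mem_eigen_iff hs hn]
  refine scaleAway_mk' hs c.isUnit_two (proj_mem 𝒜 i a) k ?_
  rw [hy, mul_right_comm, hv, one_mul]

include hs hn in
lemma exists_app_eq {x : Sec z (q ⁻¹ᵁ c.V s)} (hx : x ∈ eigen q z σ hσ hz (c.V s) 0) :
    ∃ t, (q.app (c.V s)).hom t = x := by
  have h : x ∈ eigen q z σ hσ hz (c.V s) (((0 : ℕ) : ℤ) - (0 : ℕ)) := by simpa using hx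
  rw [c.mem_eigen_iff hs hn, pow_zero, one_mul, one_mul] at h
  obtain ⟨y, hy⟩ := exists_of_scaleAway_eq hs c.isUnit_two c.hQ h
  obtain ⟨t, rfl⟩ := (c.evY_bijective hs hn).2 y
  exact ⟨t, (c.ev_bijective hs hn (z := z)).1 ((c.ev_app hs hn t).trans hy)⟩

include hs hn in
lemma app_injective : Injective (q.app (c.V s)).hom := by
  intro t t' h
  apply (c.evY_bijective hs hn).1
  have h' := congrArg (evalSpec (c.j hs hn) _ (c.top_le_j hs hn)) h
  exact val_injective _ ((c.ev_app hs hn t).symm.trans (h'.trans (c.ev_app hs hn t')))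

lemma exists_basicOpen {U : Y.Opens} {y : Y} (hyU : y ∈ U) (hy : y ∈ c.chart.opensRange) :
    ∃ (n : ℕ) (s : A), 0 < n ∧ s ∈ 𝒜 n ∧ y ∈ c.V s ∧ c.V s ≤ U := by
  obtain ⟨x, rfl⟩ := hy
  obtain ⟨_, ⟨_, ⟨f, rfl⟩, rfl⟩, hxf, hfU⟩ :=
    (Proj.isBasis_basicOpen 𝒜).exists_subset_of_mem_open (a := x) hyU (c.chart ⁻¹ᵁ U).2
  have hxf' : x ∈ Proj.basicOpen 𝒜 f := hxf
  rw [Proj.basicOpen_eq_iSup_proj] at hxf'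
  obtain ⟨i, hi⟩ := mem_iSup.1 hxf'
  obtain ⟨m, hm, t, ht, hxt⟩ : ∃ m, 0 < m ∧ ∃ t ∈ 𝒜 m, x ∈ Proj.basicOpen 𝒜 t := by
    by_contra! H
    refine x.not_irrelevant_le ((toIdeal_irrelevant_le 𝒜).2 fun m hm t ht => ?_)
    by_contra htx
    exact H m hm t ht htx
  refine ⟨i + m, proj 𝒜 i f * t, by omega,
    SetLike.mul_mem_graded (proj_mem 𝒜 i f) ht, ⟨x, ?_, rfl⟩, ?_⟩
  · change x ∈ Proj.basicOpen 𝒜 _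
    rw [Proj.basicOpen_mul]
    exact ⟨hi, hxt⟩
  · rintro _ ⟨w, hw, rfl⟩
    refine hfU (?_ : w ∈ Proj.basicOpen 𝒜 f)
    rw [Proj.basicOpen_eq_iSup_proj]
    exact mem_iSup.2 ⟨i, (Proj.basicOpen_mul 𝒜 _ _ ▸ hw).1⟩

include hs hn in
lemma exists_unit : ∃ u ∈ eigen q z σ hσ hz (c.V s) n, IsUnit u := by
  obtain ⟨u, hu⟩ := (c.ev_bijective hs hn (z := z)).2 (algebraMap A (Away s) s)
  refine ⟨u, ?_, ?_⟩
  · have : u ∈ eigen q z σ hσ hz (c.V s) ((n : ℤ) - (0 : ℕ)) := by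
      rw [c.mem_eigen_iff hs hn]
      rw [hu, pow_zero, one_mul, scaleAway_algebraMap, scale_of_mem hs, map_mul, map_pow, map_ofNat]
    simpa using this
  · obtain ⟨w, hw⟩ := (algebraMap_isUnit (S := Away s) s).exists_right_inv
    obtain ⟨w, rfl⟩ := (c.ev_bijective hs hn (z := z)).2 w
    refine IsUnit.of_mul_eq_one w ((c.ev_bijective hs hn (z := z)).1 ?_)
    refine ((c.ev z hs hn).map_mul _ _).trans ?_
    rw [hu, hw]
    exact (map_one (c.ev z hs hn)).symm

end FrameChart

end FrameChart

end

section
section FrameSections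

variable {Y P : Scheme.{0}} {q : P ⟶ Y} {z : P ⟶ SpecC} {σ : P ⟶ P}
  {hσ : σ ≫ q = q} {hz : σ ≫ z = z}

lemma IsFrameAction.of_charts {ι : Type} {A : ι → Type} [∀ i, CommRing (A i)]
    (𝒜 : ∀ i, ℕ → AddSubgroup (A i)) [∀ i, GradedRing (𝒜 i)] (c : ∀ i, FrameChart q σ (𝒜 i))
    (h : ∀ y : Y, ∃ i, y ∈ (c i).chart.opensRange) : IsFrameAction q z σ hσ hz where
  exists_open U y hy := by
    obtain ⟨i, hi⟩ := h y
    obtain ⟨n, s, hn, hs, hys, hsU⟩ := (c i).exists_basicOpen hy hi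
    exact ⟨_, hsU, hys, (c i).mem_iSup_eigen hs hn, fun x hx => (c i).exists_app_eq hs hn hx,
      (c i).app_injective hs hn⟩

lemma exists_unit_of_charts {ι : Type} {A : ι → Type} [∀ i, CommRing (A i)]
    (𝒜 : ∀ i, ℕ → AddSubgroup (A i)) [∀ i, GradedRing (𝒜 i)] (c : ∀ i, FrameChart q σ (𝒜 i))
    (h : ∀ y : Y, ∃ i, y ∈ (c i).chart.opensRange) (y : Y) : ∃ U : Y.Opens, y ∈ U ∧
      ∃ N : ℤ, 0 < N ∧ ∃ u ∈ eigen q z σ hσ hz U N, IsUnit u := by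
  obtain ⟨i, hi⟩ := h y
  obtain ⟨n, s, hn, hs, hys, -⟩ := (c i).exists_basicOpen (U := ⊤) trivial hi
  exact ⟨_, hys, n, by exact_mod_cast hn, (c i).exists_unit hs hn⟩

namespace FrameChart

variable {A : Type} [CommRing A] {𝒜 : ℕ → AddSubgroup A} [GradedRing 𝒜] (c : FrameChart q σ 𝒜)
  {W : Y.Opens} (hW : c.chart.opensRange = W)

include hW in
lemma preimage_eq : q ⁻¹ᵁ W = c.cone ''ᵁ ((coneOpens 𝒜).ι ⁻¹ᵁ ⊤) := by
  rw [← hW, ← opensRange_eq_of_isPullback c.isPullback.flip]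
  exact c.cone.image_top_eq_opensRange.symm

def sec : A →+* Γ(P, q ⁻¹ᵁ W) :=
  ((Scheme.ΓSpecIso (.of A)).inv ≫ (coneOpens 𝒜).ι.app ⊤ ≫ (c.cone.appIso _).inv ≫
    P.presheaf.map (homOfLE (c.preimage_eq hW).le).op).hom

include hW in
lemma top_le_comp {R : Type} [CommRing R] (f : Spec (.of R) ⟶ Cone 𝒜) :
    ⊤ ≤ (f ≫ c.cone) ⁻¹ᵁ q ⁻¹ᵁ W := by
  rw [c.preimage_eq hW, comp_preimage, c.cone.preimage_image_eq]
  exact le_rfl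

lemma evalSpec_sec {R : Type} [CommRing R] (f : Spec (.of R) ⟶ Cone 𝒜) (φ : A →+* R)
    (hf : f ≫ (coneOpens 𝒜).ι = Spec.map (ofHom φ)) (a : A) :
    evalSpec (f ≫ c.cone) (q ⁻¹ᵁ W) (c.top_le_comp hW f) (c.sec hW a) = φ a := by
  have h0 : ⊤ ≤ (f ≫ c.cone) ⁻¹ᵁ c.cone ''ᵁ ((coneOpens 𝒜).ι ⁻¹ᵁ ⊤) := by
    rw [comp_preimage, c.cone.preimage_image_eq]
    exact le_rfl
  refine (evalSpec_res (f ≫ c.cone) (c.preimage_eq hW).le (c.top_le_comp hW f) _).trans ?_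
  refine (evalSpec_appIso_inv f c.cone (U := (coneOpens 𝒜).ι ⁻¹ᵁ ⊤) le_rfl h0 _).trans ?_
  refine (evalSpec_app f (coneOpens 𝒜).ι (V := ⊤) le_rfl _).trans ?_
  exact (evalSpec_congr hf _ _).trans (evalSpec_Γ φ _ a)

variable {n : ℕ} {s : A} (hs : s ∈ 𝒜 n) (hn : 0 < n)

lemma evalSpec_j_sec (a : A) :
    evalSpec (c.j hs hn) (q ⁻¹ᵁ W) (c.top_le_comp hW _) (c.sec hW a) = algebraMap A _ a :=
  c.evalSpec_sec hW _ _ (coneι_ι 𝒜 hs hn) a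

include z in
lemma sec_ext {x y : Γ(P, q ⁻¹ᵁ W)} (h : ∀ (n : ℕ) (s : A) (hs : s ∈ 𝒜 n) (hn : 0 < n),
    evalSpec (c.j hs hn) (q ⁻¹ᵁ W) (c.top_le_comp hW _) x =
      evalSpec (c.j hs hn) (q ⁻¹ᵁ W) (c.top_le_comp hW _) y) : x = y := by
  refine JetDeformation.sec_ext (z := z) (q := q) (U := W) fun u hu => ?_
  obtain ⟨n, s, hn, hs, hys, hsU⟩ := c.exists_basicOpen hu (hW ▸ hu)
  refine ⟨_, hsU, hys, (c.ev_bijective hs hn (z := z)).1 ?_⟩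
  refine (evalSpec_res (c.j hs hn) (q.preimage_mono hsU) (c.top_le_j hs hn) x).trans ?_
  exact (h n s hs hn).trans
    (evalSpec_res (c.j hs hn) (q.preimage_mono hsU) (c.top_le_j hs hn) y).symm

lemma _root_.JetDeformation.map_two_pow_mul {R S : Type} [CommRing R] [CommRing S] (f : R →+* S)
    (m : ℕ) (x : R) : f (2 ^ m * x) = 2 ^ m * f x := by
  rw [map_mul, map_pow, map_ofNat]

lemma sec_mem {m : ℕ} {a : A} (ha : a ∈ 𝒜 m) {x : Sec z (q ⁻¹ᵁ W)} (hx : x = c.sec hW a) :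
    x ∈ eigen q z σ hσ hz W m := by
  have : x ∈ eigen q z σ hσ hz W ((m : ℤ) - (0 : ℕ)) := by
    rw [mem_eigen_sub, pow_zero, one_mul]
    subst hx
    refine c.sec_ext (z := z) hW fun n s hs hn => ?_
    refine (evalSpec_comp (c.j hs hn) σ (preimage_le_action q σ hσ _)
      (c.top_le_comp hW _) _).trans ?_
    refine (evalSpec_congr (c.j_scale hs hn) _ _).trans ?_
    refine (evalSpec_specMap _ _ (c.top_le_comp hW _) _ _).trans ?_
    refine Eq.trans ?_ (map_two_pow_mul (evalSpec (c.j hs hn) (q ⁻¹ᵁ W)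
      (c.top_le_comp hW _)) m _).symm
    rw [evalSpec_j_sec, scaleAway_algebraMap, scale_of_mem ha, map_two_pow_mul]
  simpa using this

lemma evalSpec_j_res_sec (h : c.V s ≤ W) (a : A) : evalSpec (c.j hs hn) _ (c.top_le_j hs hn)
      ((P.presheaf.map (homOfLE (q.preimage_mono h)).op).hom (c.sec hW a)) = algebraMap A _ a :=
  (evalSpec_res (c.j hs hn) (q.preimage_mono h) (c.top_le_j hs hn) _).trans
    (c.evalSpec_j_sec hW hs hn a)

include hs hn in
lemma isLocalization (h : c.V s ≤ W) :
    letI := ((P.presheaf.map (homOfLE (q.preimage_mono h)).op).hom.comp (c.sec hW)).toAlgebra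
    IsLocalization.Away s Γ(P, q ⁻¹ᵁ c.V s) := by
  let _ := ((P.presheaf.map (homOfLE (q.preimage_mono h)).op).hom.comp (c.sec hW)).toAlgebra
  let e : Γ(P, q ⁻¹ᵁ c.V s) ≃+* Away s :=
    RingEquiv.ofBijective (evalSpec (c.j hs hn) _ (c.top_le_j hs hn))
      (evalSpec_bijective _ (c.opensRange_j hs hn) _)
  refine IsLocalization.isLocalization_of_algEquiv (powers s)
    (AlgEquiv.ofRingEquiv (R := A) (f := e.symm) fun a => ?_)
  rw [RingEquiv.symm_apply_eq]
  exact (c.evalSpec_j_res_sec hW hs hn h a).symm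

include hn in
lemma fraction (h : c.V s ≤ W) (k : ℕ) (a : A) (ha : a ∈ 𝒜 (k • n)) :
    (q.app (c.V s)).hom ((c.chart.appIso (Proj.basicOpen 𝒜 s)).inv.hom
      ((awayToSection 𝒜 s).hom (HomogeneousLocalization.Away.mk 𝒜 hs k a ha))) *
        (P.presheaf.map (homOfLE (q.preimage_mono h)).op).hom (c.sec hW s) ^ k =
      (P.presheaf.map (homOfLE (q.preimage_mono h)).op).hom (c.sec hW a) := by
  refine (evalSpec_bijective _ (c.opensRange_j hs hn) (c.top_le_j hs hn)).1 ?_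
  rw [map_mul, map_pow]
  rw [c.evalSpec_j_res_sec hW hs hn h, c.evalSpec_j_res_sec hW hs hn h, ev_app]
  have e : c.evY hs hn ((c.chart.appIso (Proj.basicOpen 𝒜 s)).inv.hom
      ((awayToSection 𝒜 s).hom (HomogeneousLocalization.Away.mk 𝒜 hs k a ha))) =
      HomogeneousLocalization.Away.mk 𝒜 hs k a ha :=
    (evalSpec_appIso_inv _ c.chart (U := Proj.basicOpen 𝒜 s)
      (by rw [← opensRange_awayι 𝒜 s hs hn, Scheme.Hom.preimage_opensRange])
      (c.top_le_awayι hs hn) _).trans (evalSpec_awayToSection 𝒜 hs hn _ _)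
  rw [e, HomogeneousLocalization.algebraMap_apply, val_mk, mk_eq_mk'_apply, ← map_pow]
  exact mk'_spec (Away s) a (⟨s ^ k, k, rfl⟩ : powers s)

lemma j_comp {S : Scheme.{0}} (π : Y ⟶ S) {R : Type} [CommRing R] (ψ : R →+* 𝒜 0)
    (t : Spec (.of R) ⟶ S) (h : c.chart ≫ π = projStr ψ ≫ t) : (c.j hs hn ≫ q) ≫ π =
      Spec.map (ofHom ((algebraMap A (Away s)).comp ((algebraMap (𝒜 0) A).comp ψ))) ≫ t := by
  rw [assoc, assoc, ← reassoc_of% c.isPullback.w, h,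
    ← assoc (coneToProj 𝒜), coneToProj_projStr, ← assoc, coneι_coneStr]

end FrameChart

lemma evalSpec_fromSpec {X : Scheme.{0}} {U : X.Opens} (hU : IsAffineOpen U) (h) (r : Γ(X, U)) :
    evalSpec (R := Γ(X, U)) hU.fromSpec U h r = r := by
  have e : hU.fromSpec.appLE U ⊤ h = (Scheme.ΓSpecIso Γ(X, U)).inv := by
    rw [Scheme.Hom.appLE, hU.fromSpec_app_self, assoc, ← Functor.map_comp]
    exact (congrArg ((Scheme.ΓSpecIso Γ(X, U)).inv ≫ ·)
      ((Spec Γ(X, U)).presheaf.map_id _)).trans (comp_id _)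
  have e2 : hU.fromSpec.appLE U ⊤ h ≫ (Scheme.ΓSpecIso Γ(X, U)).hom = 𝟙 _ := by
    rw [e, Iso.inv_hom_id]
  exact congrArg (fun φ => φ.hom r) e2

lemma exists_basicOpen_le_inter {X : Scheme.{0}} (U V : X.affineOpens) {x : X}
    (hU : x ∈ (U : X.Opens)) (hV : x ∈ (V : X.Opens)) : ∃ (f : Γ(X, U)) (g : Γ(X, V)),
      X.basicOpen f = X.basicOpen g ∧ x ∈ X.basicOpen f := by
  obtain ⟨f, g, h, hx⟩ := exists_basicOpen_le_affine_inter U.2 V.2 x ⟨hU, hV⟩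
  exact ⟨f, g, h, hx⟩

section IsProj

variable (A : GradedAlgOn b) (c : ∀ U, FrameChart q σ (A.gr U))
  {π : Y ⟶ X} (hrange : ∀ U : X.affineOpens, (c U).chart.opensRange = π ⁻¹ᵁ (U : X.Opens))
  (hstr : ∀ U : X.affineOpens, (c U).chart ≫ π = projStr (A.strZero U) ≫ U.2.fromSpec)
  (hres : ∀ {U V W : X.affineOpens} (h : (V : X.Opens) ≤ U) (h' : (W : X.Opens) ≤ V)
    (x : A.ring U), A.res h' (A.res h x) = A.res (h'.trans h) x)
  (hcompat : ∀ (U : X.affineOpens) (f : Sec b U),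
    ∃ g : Cone (A.gr (X.affineBasicOpen (U := U) f)) ⟶ Cone (A.gr U),
      g ≫ (coneOpens _).ι = (coneOpens _).ι ≫ Spec.map (ofHom
        (A.res (V := X.affineBasicOpen (U := U) f) (X.basicOpen_le f))) ∧
      g ≫ (c U).cone = (c _).cone)

include hcompat in
lemma sec_res_basicOpen {U V : X.affineOpens} (h : (V : X.Opens) ≤ U)
    (hf : ∃ f : Sec b U, X.basicOpen (U := U) f = V) (x : A.ring U) :
    (c V).sec (hrange V) (A.res h x) =
      (P.presheaf.map (homOfLE (q.preimage_mono (π.preimage_mono h))).op).hom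
        ((c U).sec (hrange U) x) := by
  obtain ⟨V, hV⟩ := V
  obtain ⟨f, hf⟩ := hf
  change X.basicOpen (U := U) f = V at hf
  subst hf
  obtain ⟨g, hg1, hg2⟩ := hcompat U f
  refine (c (X.affineBasicOpen (U := U) f)).sec_ext (z := q ≫ π ≫ b)
    (hrange (X.affineBasicOpen (U := U) f)) fun n s hs hn => ?_
  refine ((c (X.affineBasicOpen (U := U) f)).evalSpec_j_sec
    (hrange (X.affineBasicOpen (U := U) f)) hs hn _).trans ?_
  refine Eq.trans ?_ (evalSpec_res _ _ _ _).symm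
  have e : (c (X.affineBasicOpen (U := U) f)).j hs hn = (coneι _ hs hn ≫ g) ≫ (c U).cone := by
    rw [assoc, hg2]
  refine Eq.trans ?_ (evalSpec_congr e _ _).symm
  refine ((c U).evalSpec_sec (hrange U) _ ((algebraMap _ _).comp
    (A.res (V := X.affineBasicOpen (U := U) f) h)) ?_ x).symm
  rw [assoc, hg1, reassoc_of% coneι_ι, ← Spec.map_comp, ← ofHom_comp]

include hcompat hres in
lemma sec_res_affine {U V : X.affineOpens} (h : (V : X.Opens) ≤ U) (x : A.ring U) :
    (c V).sec (hrange V) (A.res h x) =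
      (P.presheaf.map (homOfLE (q.preimage_mono (π.preimage_mono h))).op).hom
        ((c U).sec (hrange U) x) := by
  refine JetDeformation.sec_ext (z := q ≫ π ≫ b) (q := q) (U := π ⁻¹ᵁ (V : X.Opens)) fun y hy => ?_
  obtain ⟨f, g, hfg, hyf⟩ := exists_basicOpen_le_inter U V (h hy) hy
  have hV : X.basicOpen f ≤ (V : X.Opens) := hfg.trans_le (X.basicOpen_le g)
  refine ⟨π ⁻¹ᵁ (X.basicOpen f), π.preimage_mono hV, hyf, ?_⟩
  have h1 := sec_res_basicOpen A c hrange hcompat (V := X.affineBasicOpen f) hV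
    ⟨g, hfg.symm⟩ (A.res h x)
  have h2 := sec_res_basicOpen A c hrange hcompat (U := U) (V := X.affineBasicOpen f)
    (X.basicOpen_le f) ⟨f, rfl⟩ x
  refine h1.symm.trans ((congrArg ((c (X.affineBasicOpen f)).sec _) (hres h hV x)).trans
    (h2.trans ?_))
  exact (DFunLike.congr_fun (secRes_comp (q ≫ π ≫ b) (q.preimage_mono (π.preimage_mono h))
    (q.preimage_mono (π.preimage_mono hV))) ((c U).sec (hrange U) x)).symm

include hstr in
lemma sec_str_affine (U : X.affineOpens) (r : Sec b U) : (c U).sec (hrange U) (A.str U r) =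
    (q.app (π ⁻¹ᵁ (U : X.Opens))).hom ((π.app (U : X.Opens)).hom r) := by
  refine (c U).sec_ext (z := q ≫ π ≫ b) (hrange U) fun n s hs hn => ?_
  refine ((c U).evalSpec_j_sec (hrange U) hs hn _).trans ?_
  refine Eq.trans ?_ (evalSpec_app _ q _ _).symm
  refine Eq.trans ?_ (evalSpec_app ((c U).j hs hn ≫ q) π
    ((c U).top_le_comp (hrange U) (coneι _ hs hn)) r).symm
  refine Eq.trans ?_ (evalSpec_congr ((c U).j_comp hs hn π (A.strZero U) _ (hstr U)) _ r).symm
  refine Eq.trans ?_ (evalSpec_specMap _ _ (IsAffineOpen.fromSpec_preimage_self U.2).ge _ r).symm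
  exact (congrArg (fun r => algebraMap _ (Away s) (A.str U r)) (evalSpec_fromSpec U.2 _ r)).symm

/-- A quotient with compatible charts is the relative `Proj`. -/
def isProjOfCharts [IsAffineHom q] (H : IsFrameAction q z σ hσ hz) (hs hsm hu) :
    IsProj A (H.orbiFamily π hs hsm hu) where
  chart U := (c U).chart
  openImm U := (c U).chart_open
  range := hrange
  sec U := (c U).sec (hrange U)
  sec_mem U _ _ hx := (c U).sec_mem (hrange U) hx rfl
  sec_str U r := sec_str_affine A c hrange hstr U r
  sec_res h x := sec_res_affine A c hrange hres hcompat h x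
  isLocalization U _ _ hd hf h := (c U).isLocalization (hrange U) hf hd h
  fraction U _ _ hd hf h n a ha := (c U).fraction (hrange U) hf hd h n a ha

end IsProj

end FrameSections

end

section
section ConeMapComp

variable {A B C : Type} [CommRing A] [CommRing B] [CommRing C] {𝒜 : ℕ → AddSubgroup A}
  {ℬ : ℕ → AddSubgroup B} {𝒞 : ℕ → AddSubgroup C} [GradedRing 𝒜] [GradedRing ℬ] [GradedRing 𝒞]

lemma coneMap_comp_eq {D : Type} [CommRing D] {𝒟 : ℕ → AddSubgroup D} [GradedRing 𝒟] (φ : 𝒜 →+*ᵍ ℬ) (hφ)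
    (φ' : ℬ →+*ᵍ 𝒞) (hφ') (ψ : 𝒜 →+*ᵍ 𝒟) (hψ) (ψ' : 𝒟 →+*ᵍ 𝒞) (hψ')
    (h : φ'.comp φ = ψ'.comp ψ) :
    coneMap φ' hφ' ≫ coneMap φ hφ = coneMap ψ' hψ' ≫ coneMap ψ hψ := by
  rw [← cancel_mono (coneOpens 𝒜).ι, assoc, assoc, coneMap_ι, coneMap_ι,
    reassoc_of% coneMap_ι, reassoc_of% coneMap_ι, ← Spec.map_comp, ← Spec.map_comp,
    ← ofHom_comp, ← ofHom_comp]
  congr 3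
  exact RingHom.ext fun a => DFunLike.congr_fun h a

lemma coneMap_scale_comm (φ : 𝒜 →+*ᵍ ℬ) (hφ) (hA : IsUnit (2 : A)) (hB : IsUnit (2 : B)) :
    coneMap φ hφ ≫ coneMap (scale 𝒜) (scale_irrelevant hA) =
      coneMap (scale ℬ) (scale_irrelevant hB) ≫ coneMap φ hφ := by
  rw [← cancel_mono (coneOpens 𝒜).ι, assoc, assoc, coneMap_ι, coneMap_ι,
    reassoc_of% coneMap_ι, reassoc_of% coneMap_ι, ← Spec.map_comp, ← Spec.map_comp,
    ← ofHom_comp, ← ofHom_comp]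
  congr 3
  exact RingHom.ext fun a => scale_comm φ a

lemma coneι_coneMap_scale {n : ℕ} {s : A} (hs : s ∈ 𝒜 n) (hn : 0 < n) (h2 : IsUnit (2 : A)) :
    coneι 𝒜 hs hn ≫ coneMap (scale 𝒜) (scale_irrelevant h2) =
      Spec.map (ofHom (scaleAway hs h2)) ≫ coneι 𝒜 hs hn := by
  rw [← cancel_mono (coneOpens 𝒜).ι, assoc, assoc, coneMap_ι, coneι_ι,
    reassoc_of% coneι_ι, ← Spec.map_comp, ← Spec.map_comp, ← ofHom_comp,
    ← ofHom_comp, scaleAway_comp]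

lemma coneMap_scale_coneToProj (h2 : IsUnit (2 : A)) :
    coneMap (scale 𝒜) (scale_irrelevant h2) ≫ coneToProj 𝒜 = coneToProj 𝒜 := by
  refine cone_hom_ext fun n s hs hn => ?_
  rw [reassoc_of% coneι_coneMap_scale hs hn h2, coneι_coneToProj, coneAway, ← assoc,
    ← Spec.map_comp, ← ofHom_comp]
  congr 3
  exact RingHom.ext fun x => scaleAway_val hs h2 x

variable {φ : 𝒜 →+*ᵍ ℬ}

lemma isGradedBaseChange_of_bijective' {R : Type} [CommRing R] (ψ : R →+* 𝒜 0) (ψ' : R →+* ℬ 0)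
    (w : ∀ r, φ (ψ r : A) = ψ' r) (h : Bijective φ) :
    IsGradedBaseChange φ ψ ψ' (RingHom.id R) := by
  have h1 : ((ψ 1 : 𝒜 0) : A) = 1 := by rw [map_one]; rfl
  refine IsLoc.isGradedBaseChange (r := 1) w
    ⟨by simp, fun x hx => ⟨0, by simpa using hx⟩, fun y => ⟨0, y, by simp⟩⟩ ?_
  rw [h1]
  refine ⟨by rw [map_one]; exact isUnit_one, fun x hx => ⟨0, ?_⟩, fun y => ⟨0, ?_⟩⟩
  · rw [pow_zero, one_mul]
    exact h.1 ((show φ x = 0 from hx).trans (map_zero φ).symm)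
  · obtain ⟨x, rfl⟩ := h.2 y
    exact ⟨x, by rw [pow_zero, one_mul]; rfl⟩

lemma isGradedBaseChange_of_bijective (h : Bijective φ) :
    IsGradedBaseChange φ (Int.castRingHom (𝒜 0)) (Int.castRingHom (ℬ 0)) (RingHom.id ℤ) :=
  isGradedBaseChange_of_bijective' _ _ (fun r =>
    DFunLike.congr_fun (RingHom.ext_int ((φ.toRingHom.comp (algebraMap (𝒜 0) A)).comp
      (Int.castRingHom (𝒜 0))) ((algebraMap (ℬ 0) B).comp (Int.castRingHom (ℬ 0)))) r) h

lemma isIso_projMap_of_bijective (h : Bijective φ) :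
    IsIso (Proj.map φ (isGradedBaseChange_of_bijective h).irr) := by
  have hp := (isGradedBaseChange_of_bijective h).isPullback_proj
  have : IsIso (Spec.map (ofHom (RingHom.id ℤ))) := by
    have : Spec.map (ofHom (RingHom.id ℤ)) = 𝟙 _ := Spec.map_id _
    rw [this]; infer_instance
  exact hp.isIso_fst_of_isIso

lemma isIso_coneMap_of_bijective (h : Bijective φ) :
    IsIso (coneMap φ (isGradedBaseChange_of_bijective h).irr) := by
  have hp := (isGradedBaseChange_of_bijective h).isPullback_coneToProj
  have := isIso_projMap_of_bijective h
  exact hp.isIso_fst_of_isIso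

/-- Frame charts can be transported along isomorphisms of graded rings. -/
def FrameChart.ofBijective {Y P : Scheme.{0}} {q : P ⟶ Y} {σ : P ⟶ P} (c : FrameChart q σ 𝒜)
    (h : Bijective φ) : FrameChart q σ ℬ where
  hQ N hN := by
    have := (c.hQ N hN).map φ
    rwa [map_natCast] at this
  chart := Proj.map φ (isGradedBaseChange_of_bijective h).irr ≫ c.chart
  cone := coneMap φ (isGradedBaseChange_of_bijective h).irr ≫ c.cone
  chart_open := by
    have := isIso_projMap_of_bijective h
    infer_instance
  cone_open := by
    have := isIso_coneMap_of_bijective h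
    infer_instance
  isPullback := ((isGradedBaseChange_of_bijective h).isPullback_coneToProj.paste_horiz
    c.isPullback.flip).flip
  scale h2 := by
    rw [assoc, c.scale c.isUnit_two, ← assoc, coneMap_scale_comm φ _ c.isUnit_two h2, assoc]

end ConeMapComp

section GradedAlgOn

lemma GradedAlgOn.isUnit_natCast (A : GradedAlgOn b) (U : X.affineOpens) (N : ℕ) (hN : N ≠ 0) :
    IsUnit (N : A.ring U) := by
  have h : IsUnit (N : ℂ) := (Nat.cast_ne_zero.2 hN).isUnit
  have := (h.map (algebraMap ℂ (Sec b U))).map (A.str U)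
  rwa [map_natCast, map_natCast] at this

lemma GradedAlgOn.isUnit_two (A : GradedAlgOn b) (U : X.affineOpens) : IsUnit (2 : A.ring U) := by
  have := A.isUnit_natCast U 2 two_ne_zero
  rwa [Nat.cast_ofNat] at this

variable {A : GradedAlgOn b} (hA : A.IsQuasiCoherent)

lemma relScale_compat {U V : X.AffineZariskiSite} (h : V ≤ U) :
    coneMap _ (hA.isGradedBaseChange h).irr ≫
      coneMap (scale _) (scale_irrelevant (A.isUnit_two (siteOpen U))) ≫ relConeι hA U =
      coneMap (scale _) (scale_irrelevant (A.isUnit_two (siteOpen V))) ≫ relConeι hA V := by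
  rw [← assoc, coneMap_scale_comm _ _ (A.isUnit_two (siteOpen U))
    (A.isUnit_two (siteOpen V)), assoc, map_relConeι hA h]

def relScale : relCone hA ⟶ relCone hA :=
  relConeDesc hA (fun U => coneMap (scale _) (scale_irrelevant (A.isUnit_two (siteOpen U))) ≫
    relConeι hA U) (relScale_compat hA)

lemma relConeι_relScale (U : X.AffineZariskiSite) : relConeι hA U ≫ relScale hA =
    coneMap (scale _) (scale_irrelevant (A.isUnit_two (siteOpen U))) ≫ relConeι hA U :=
  relConeι_desc hA _ (relScale_compat hA) U

lemma relScale_relConeToProj : relScale hA ≫ relConeToProj hA = relConeToProj hA :=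
  relCone_hom_ext fun U => by
    rw [reassoc_of% relConeι_relScale hA U, relConeι_relConeToProj,
      reassoc_of% coneMap_scale_coneToProj (𝒜 := A.gr (siteOpen U)) (A.isUnit_two _)]

def relChart (U : X.affineOpens) : FrameChart (relConeToProj hA) (relScale hA) (A.gr U) where
  hQ := A.isUnit_natCast U
  chart := projι hA ⟨U.1, U.2⟩
  cone := relConeι hA ⟨U.1, U.2⟩
  chart_open := inferInstanceAs (IsOpenImmersion (projι hA (show X.AffineZariskiSite from ⟨U.1, U.2⟩)))
  cone_open := inferInstanceAs (IsOpenImmersion (relConeι hA (show X.AffineZariskiSite from ⟨U.1, U.2⟩)))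
  isPullback := isPullback_relConeToProj hA ⟨U.1, U.2⟩
  scale _ := relConeι_relScale hA ⟨U.1, U.2⟩

lemma exists_mem_range_relChart (y : relProj hA) : ∃ U, y ∈ (relChart hA U).chart.opensRange := by
  obtain ⟨U, hU⟩ := exists_mem_range_projι hA y
  exact ⟨siteOpen U, hU⟩

lemma relFrameAction (z : relCone hA ⟶ SpecC) (hz : relScale hA ≫ z = z) :
    IsFrameAction (relConeToProj hA) z (relScale hA) (relScale_relConeToProj hA) hz :=
  .of_charts (fun U => A.gr U) (relChart hA) (exists_mem_range_relChart hA)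

/-- `Proj_X A` with its tautological orbifold line bundle, over a scheme `S` over `X`. -/
def relOrbi {S : Scheme.{0}} {s : S ⟶ SpecC} (π : relProj hA ⟶ S)
    (hsm : Smooth (relConeToProj hA ≫ π ≫ s)) : OrbiFamily s :=
  (relFrameAction hA (relConeToProj hA ≫ π ≫ s)
    (by rw [← assoc, relScale_relConeToProj])).orbiFamily π rfl hsm
      (exists_unit_of_charts (fun U => A.gr U) (relChart hA) (exists_mem_range_relChart hA))

structure GradedAlgOn.Iso (A A' : GradedAlgOn b) where
  hom : ∀ U, A.gr U →+*ᵍ A'.gr U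
  bij : ∀ U, Bijective (hom U)
  res : ∀ {U V : X.affineOpens} (h : (V : X.Opens) ≤ U) (x : A.ring U),
    hom V (A.res h x) = A'.res h (hom U x)
  str : ∀ U r, hom U (A.str U r) = A'.str U r

lemma GradedAlgOn.Iso.isQuasiCoherent {A' : GradedAlgOn b} (e : A.Iso A')
    (hA : A.IsQuasiCoherent) : A'.IsQuasiCoherent where
  res_id U x := by
    obtain ⟨x, rfl⟩ := (e.bij U).2 x
    rw [← e.res, hA.res_id]
  res_comp {U V W} h h' x := by
    obtain ⟨x, rfl⟩ := (e.bij U).2 x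
    rw [← e.res, ← e.res, ← e.res, hA.res_comp]
  inj U f x hx := by
    obtain ⟨x, rfl⟩ := (e.bij U).2 x
    have hx' := (e.res _ x).trans (hx.trans (map_zero (e.hom _)).symm)
    obtain ⟨n, hn⟩ := hA.inj U f x ((e.bij _).1 hx')
    exact ⟨n, by rw [← e.str, ← map_pow, ← map_mul, hn, map_zero]⟩
  surj U f y := by
    obtain ⟨y, rfl⟩ := (e.bij _).2 y
    obtain ⟨n, x, hx⟩ := hA.surj U f y
    refine ⟨n, e.hom U x, (e.res _ x).symm.trans ((congrArg _ hx).trans ?_)⟩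
    rw [map_mul, map_pow]
    exact congrArg (fun t => t ^ n * _) ((e.res _ _).trans (congrArg _ (e.str U f)))

lemma GradedAlgOn.Iso.irr {A' : GradedAlgOn b} (e : A.Iso A') (U : X.affineOpens) :
    irrelevant (A'.gr U) ≤ (irrelevant (A.gr U)).map (e.hom U) :=
  (isGradedBaseChange_of_bijective (e.bij U)).irr

lemma coneMap_relConeι_compat {A' : GradedAlgOn b} (e : A.Iso A') {U V : X.AffineZariskiSite}
    (h : V ≤ U) (irr : irrelevant (A'.gr (siteOpen V)) ≤
      (irrelevant (A'.gr (siteOpen U))).map (A'.resHom (siteOpen_le h))) :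
    coneMap (A'.resHom (siteOpen_le h)) irr ≫
      coneMap (e.hom (siteOpen U)) (e.irr _) ≫ relConeι hA U =
      coneMap (e.hom (siteOpen V)) (e.irr _) ≫ relConeι hA V := by
  have key : coneMap (A'.resHom (siteOpen_le h)) irr ≫ coneMap (e.hom (siteOpen U)) (e.irr _) =
      coneMap (e.hom (siteOpen V)) (e.irr _) ≫ coneMap (A.resHom (siteOpen_le h))
        (hA.isGradedBaseChange h).irr :=
    coneMap_comp_eq _ _ _ _ _ _ _ _ (GradedRingHom.ext fun a => (e.res (siteOpen_le h) a).symm)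
  rw [← assoc, key, assoc, map_relConeι hA h]

/-- `relOrbi` is the relative `Proj` of all algebras isomorphic to `A`. -/
lemma nonempty_isProj {A' : GradedAlgOn b} (e : A.Iso A')
    (hsm : Smooth (relConeToProj hA ≫ relProjπ hA ≫ b)) :
    Nonempty (IsProj A' (relOrbi hA (relProjπ hA) hsm)) := by
  refine ⟨isProjOfCharts A' (fun U => (relChart hA U).ofBijective (e.bij U)) ?_ ?_ ?_ ?_ _ _ _ _⟩
  · intro U
    have := isIso_projMap_of_bijective (e.bij U)
    refine (Scheme.Hom.opensRange_comp_of_isIso _ _).trans ?_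
    exact opensRange_projι hA _
  · intro U
    refine (assoc _ _ _).trans ((congrArg _ (projι_π hA ⟨U.1, U.2⟩)).trans
      ((assoc _ _ _).symm.trans (congrArg (· ≫ IsAffineOpen.fromSpec U.2) ?_)))
    refine (isGradedBaseChange_of_bijective' (φ := e.hom U) (A.strZero U) (A'.strZero U)
      (e.str U) (e.bij U)).isPullback_proj.w.trans ?_
    exact (congrArg (projStr (A'.strZero U) ≫ ·) (Spec.map_id _)).trans (comp_id _)
  · exact (e.isQuasiCoherent hA).res_comp
  · intro U f
    refine ⟨coneMap (A'.resHom (X.basicOpen_le f)) (IsLoc.irrelevant_le (A'.str_mem U f)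
      ((e.isQuasiCoherent hA).isLoc U f)), coneMap_ι _ _, ?_⟩
    have h : (show X.AffineZariskiSite from ⟨X.basicOpen (U := U) f, U.2.basicOpen f⟩) ≤
      (show X.AffineZariskiSite from ⟨U.1, U.2⟩) := ⟨f, rfl⟩
    exact coneMap_relConeι_compat hA e h _

end GradedAlgOn

end

section
section EigenPull

variable {Y P Y' P' : Scheme.{0}} {q : P ⟶ Y} {z : P ⟶ SpecC} {σ : P ⟶ P} {hσ : σ ≫ q = q}
  {hz : σ ≫ z = z} {q' : P' ⟶ Y'} {z' : P' ⟶ SpecC} {σ' : P' ⟶ P'} {hσ' : σ' ≫ q' = q'}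
  {hz' : σ' ≫ z' = z'} {f : Y' ⟶ Y} {g : P' ⟶ P}

lemma eigen_pull (hg : g ≫ z = z') (hgσ : σ' ≫ g = g ≫ σ) {U : Y.Opens}
    (h : q' ⁻¹ᵁ f ⁻¹ᵁ U ≤ g ⁻¹ᵁ q ⁻¹ᵁ U) {m : ℤ} {x : Sec z (q ⁻¹ᵁ U)}
    (hx : x ∈ eigen q z σ hσ hz U m) :
    secPull g hg h x ∈ eigen q' z' σ' hσ' hz' (f ⁻¹ᵁ U) m := by
  rw [mem_eigen] at hx ⊢
  have e : g.appLE (q ⁻¹ᵁ U) (q' ⁻¹ᵁ f ⁻¹ᵁ U) h ≫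
      σ'.appLE _ _ (preimage_le_action q' σ' hσ' (f ⁻¹ᵁ U)) =
      σ.appLE _ _ (preimage_le_action q σ hσ U) ≫ g.appLE (q ⁻¹ᵁ U) (q' ⁻¹ᵁ f ⁻¹ᵁ U) h := by
    rw [appLE_comp_appLE, appLE_comp_appLE]
    simp_rw [hgσ]
  refine (congrArg (fun φ => φ.hom x) e).trans ?_
  change secPull g hg h (act q z σ hσ hz U x) = _
  rw [hx, map_smul]

end EigenPull

section ProjStr

variable {A B : Type} [CommRing A] [CommRing B] {𝒜 : ℕ → AddSubgroup A} {ℬ : ℕ → AddSubgroup B}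
  [GradedRing 𝒜] [GradedRing ℬ] {R R' R'' : Type} [CommRing R] [CommRing R'] [CommRing R'']

lemma projMap_projStr (φ : 𝒜 →+*ᵍ ℬ) (hφ) {ψ : R →+* 𝒜 0} {ψ' : R' →+* ℬ 0} {ρ : R →+* R'}
    (w : ∀ r, φ (ψ r : A) = ψ' (ρ r)) :
    Proj.map φ hφ ≫ projStr ψ = projStr ψ' ≫ Spec.map (ofHom ρ) := by
  have H {n : ℕ} {s : A} (hs : s ∈ 𝒜 n) (hn : 0 < n) :
      awayι ℬ (φ s) (Graded.map_mem φ hs) hn ≫ Proj.map φ hφ ≫ projStr ψ =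
        awayι ℬ (φ s) (Graded.map_mem φ hs) hn ≫ projStr ψ' ≫ Spec.map (ofHom ρ) := by
    rw [← (isPullback_projMap_awayι φ hφ hs hn).w_assoc, awayι_projStr,
      reassoc_of% awayι_projStr, ← Spec.map_comp, ← Spec.map_comp, ← ofHom_comp,
      ← ofHom_comp, awayMap_fromZero w hs]
  exact (Proj.mapAffineOpenCover φ hφ).openCover.hom_ext _ _ fun s => H s.2.2 s.1.2

lemma projStr_comp (ψ : R →+* 𝒜 0) (ρ : R' →+* R) :
    projStr (ψ.comp ρ) = projStr ψ ≫ Spec.map (ofHom ρ) := by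
  have h : irrelevant 𝒜 ≤ (irrelevant 𝒜).map (.id 𝒜) := by
    rw [HomogeneousIdeal.map_id]
  have := projMap_projStr (.id 𝒜) h (ψ := ψ.comp ρ) (ψ' := ψ) (ρ := ρ) fun _ => rfl
  rwa [Proj.map_id, id_comp] at this

end ProjStr

section Family

lemma fromSpec_comp (U : X.affineOpens) : U.2.fromSpec ≫ b =
    Spec.map (ofHom (algebraMap ℂ (Sec b U))) := by
  have h := IsAffineOpen.SpecMap_appLE_fromSpec b (isAffineOpen_top SpecC) U.2 le_top
  refine h.symm.trans (Eq.trans ?_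
    (Spec.map_comp (Scheme.ΓSpecIso (CommRingCat.of ℂ)).inv (b.appLE ⊤ U le_top)).symm)
  refine congrArg (Spec.map (b.appLE ⊤ U le_top) ≫ ·) ?_
  exact IsAffineOpen.fromSpec_top.trans (Scheme.isoSpec_Spec_inv (CommRingCat.of ℂ))

def GradedAlgOn.scalar (A : GradedAlgOn b) (U : X.affineOpens) : ℂ →+* A.gr U 0 :=
  (A.strZero U).comp (algebraMap ℂ (Sec b U))

structure GradedAlgOn.Parameter (A : GradedAlgOn b) where
  t : ∀ U, A.ring U
  mem : ∀ U, t U ∈ A.gr U 0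
  res : ∀ {U V : X.affineOpens} (h : (V : X.Opens) ≤ U), A.res h (t U) = t V

variable {A : GradedAlgOn b} (p : A.Parameter)

def GradedAlgOn.Parameter.hom (U : X.affineOpens) : Polynomial ℂ →+* A.gr U 0 :=
  eval₂RingHom (A.scalar U) ⟨p.t U, p.mem U⟩

lemma GradedAlgOn.Parameter.hom_C (U : X.affineOpens) (c : ℂ) :
    p.hom U (Polynomial.C c) = A.scalar U c := eval₂_C _ _

lemma GradedAlgOn.Parameter.hom_X (U : X.affineOpens) :
    p.hom U Polynomial.X = ⟨p.t U, p.mem U⟩ := eval₂_X _ _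

lemma GradedAlgOn.Parameter.hom_res {U V : X.affineOpens} (h : (V : X.Opens) ≤ U)
    (r : Polynomial ℂ) : A.resHom h (p.hom U r : A.ring U) = p.hom V r := by
  have : ((A.resHom h).toRingHom.comp (algebraMap (A.gr U 0) (A.ring U))).comp (p.hom U) =
      (algebraMap (A.gr V 0) (A.ring V)).comp (p.hom V) := by
    refine Polynomial.ringHom_ext (fun c => ?_) ?_
    · rw [comp_apply, comp_apply, comp_apply, p.hom_C, p.hom_C]
      refine (A.res_str h _).trans (congrArg (A.str V) ?_)
      exact (secRes b h).commutes c
    · rw [comp_apply, comp_apply, comp_apply, p.hom_X, p.hom_X]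
      exact p.res h
  exact DFunLike.congr_fun this r

lemma GradedAlgOn.Parameter.res_sub {U V : X.affineOpens} (h : (V : X.Opens) ≤ U) (c : ℂ) :
    A.res h (p.t U - A.scalar U c) = p.t V - A.scalar V c := by
  rw [map_sub, p.res]
  exact congrArg (p.t V - ·) ((A.res_str h _).trans (congrArg (A.str V) ((secRes b h).commutes c)))

structure GradedAlgOn.Parameter.Fibre (c : ℂ) (F : GradedAlgOn b) where
  hom : ∀ U, A.gr U →+*ᵍ F.gr U
  isQuot : ∀ U, IsQuot (hom U).toRingHom (p.t U - A.scalar U c)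
  res : ∀ {U V : X.affineOpens} (h : (V : X.Opens) ≤ U) (x : A.ring U),
    hom V (A.res h x) = F.res h (hom U x)
  str : ∀ U r, hom U (A.str U r) = F.str U r

lemma isQuot_eval (c : ℂ) : IsQuot (evalRingHom c) (Polynomial.X - Polynomial.C c) where
  zero := by simp
  inj x hx := Polynomial.dvd_iff_isRoot.2 hx
  surj y := ⟨Polynomial.C y, by simp⟩

namespace GradedAlgOn.Parameter.Fibre

variable {p} {c : ℂ} {F : GradedAlgOn b} (e : p.Fibre c F)
include e

lemma isGradedBaseChange (U : X.affineOpens) :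
    IsGradedBaseChange (e.hom U) (p.hom U) (F.scalar U) (evalRingHom c) := by
  have hw : ∀ r, e.hom U (p.hom U r : A.ring U) = F.scalar U (evalRingHom c r) := by
    have : ((e.hom U).toRingHom.comp (algebraMap (A.gr U 0) (A.ring U))).comp (p.hom U) =
        ((algebraMap (F.gr U 0) (F.ring U)).comp (F.scalar U)).comp (evalRingHom c) := by
      refine Polynomial.ringHom_ext (fun a => ?_) ?_
      · rw [comp_apply, comp_apply, p.hom_C]
        refine (e.str U _).trans ?_
        rw [comp_apply, coe_evalRingHom, eval_C]
        rfl
      · rw [comp_apply, comp_apply, p.hom_X]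
        have h := (e.isQuot U).zero
        rw [map_sub, sub_eq_zero] at h
        refine h.trans ((e.str U _).trans ?_)
        rw [comp_apply, coe_evalRingHom, eval_X]
        rfl
    exact DFunLike.congr_fun this
  refine IsQuot.isGradedBaseChange (r := Polynomial.X - Polynomial.C c) hw (isQuot_eval c) ?_
  rw [map_sub, p.hom_X, p.hom_C]
  exact e.isQuot U

lemma isQuasiCoherent (hA : A.IsQuasiCoherent) : F.IsQuasiCoherent where
  res_id U x := by
    obtain ⟨x, rfl⟩ := (e.isQuot U).surj x
    exact (e.res _ x).symm.trans (congrArg _ (hA.res_id U x))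
  res_comp {U V W} h h' x := by
    obtain ⟨x, rfl⟩ := (e.isQuot U).surj x
    exact (congrArg _ (e.res h x).symm).trans ((e.res h' _).symm.trans
      ((congrArg _ (hA.res_comp h h' x)).trans (e.res _ x)))
  inj U f x hx := by
    obtain ⟨x, rfl⟩ := (e.isQuot U).surj x
    obtain ⟨y, hy⟩ := (e.isQuot _).inj _ ((e.res _ x).trans hx)
    obtain ⟨n, y', hy'⟩ := hA.surj U f y
    have hz : A.res (V := X.affineBasicOpen (U := U) f) (X.basicOpen_le f)
        (A.str U f ^ n * x - (p.t U - A.scalar U c) * y') = 0 := by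
      rw [map_sub, map_mul, map_mul, hy', map_pow, hy]
      have := p.res_sub (V := X.affineBasicOpen (U := U) f) (X.basicOpen_le f) c
      linear_combination (-(A.res (V := X.affineBasicOpen (U := U) f) (X.basicOpen_le f)
        (A.str U f) ^ n * y)) * this
    obtain ⟨m, hm⟩ := hA.inj U f _ hz
    refine ⟨m + n, ?_⟩
    have h := congrArg (e.hom U) hm
    have h0 : e.hom U (p.t U - A.scalar U c) = 0 := (e.isQuot U).zero
    rw [map_mul, map_sub, map_mul (e.hom U) (p.t U - _), h0, zero_mul, sub_zero, map_zero, map_mul,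
      map_pow, map_pow, e.str] at h
    rw [pow_add, mul_assoc]
    exact h
  surj U f y := by
    obtain ⟨y, rfl⟩ := (e.isQuot _).surj y
    obtain ⟨n, x, hx⟩ := hA.surj U f y
    refine ⟨n, e.hom U x, (e.res _ x).symm.trans ((congrArg _ hx).trans ?_)⟩
    rw [map_mul, map_pow]
    exact congrArg (fun t => t ^ n * _) ((e.res _ _).trans (congrArg _ (e.str U f)))

end GradedAlgOn.Parameter.Fibre

variable (hA : A.IsQuasiCoherent)

lemma relParam_compat {U V : X.AffineZariskiSite} (h : V ≤ U) :
    Proj.map _ (hA.isGradedBaseChange h).irr ≫ projStr (p.hom (siteOpen U)) =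
      projStr (p.hom (siteOpen V)) := by
  rw [projMap_projStr _ (hA.isGradedBaseChange h).irr (ρ := RingHom.id _)
      (p.hom_res (siteOpen_le h))]
  exact (congrArg _ (Spec.map_id _)).trans (comp_id _)

/-- The parameter as a morphism from `Proj_X A` to the affine line. -/
def relParam : relProj hA ⟶ affineLine :=
  relProjDesc hA (fun U => projStr (p.hom (siteOpen U))) (relParam_compat p hA)

lemma projι_relParam (U : X.AffineZariskiSite) :
    projι hA U ≫ relParam p hA = projStr (p.hom (siteOpen U)) :=
  projι_desc hA _ (relParam_compat p hA) U

lemma projι_relProjπ_comp (U : X.AffineZariskiSite) :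
    projι hA U ≫ relProjπ hA ≫ b = projStr (A.scalar (siteOpen U)) := by
  have h := (congrArg (· ≫ b) (projι_π hA U)).trans (assoc _ _ _)
  exact (assoc _ _ _).symm.trans (h.trans ((congrArg (projStr (A.strZero (siteOpen U)) ≫ ·)
    (fromSpec_comp (siteOpen U))).trans (projStr_comp _ _).symm))

lemma relParam_comp : relParam p hA ≫ affineLineMap = relProjπ hA ≫ b := relProj_hom_ext fun U => by
    rw [reassoc_of% projι_relParam p hA U, projι_relProjπ_comp hA U, affineLineMap]
    refine (projStr_comp _ _).symm.trans (congrArg projStr ?_)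
    exact RingHom.ext fun c => p.hom_C _ c

/-- The family of the `Proj` of the fibres of `A`, over `X × ℂ`. -/
def relFamily : relProj hA ⟶ timesLine b :=
  Limits.pullback.lift (relProjπ hA) (relParam p hA) (relParam_comp p hA).symm

lemma relFamily_fst : relFamily p hA ≫ Limits.pullback.fst b affineLineMap = relProjπ hA :=
  lift_fst _ _ _

lemma relFamily_snd : relFamily p hA ≫ Limits.pullback.snd b affineLineMap = relParam p hA :=
  lift_snd _ _ _

lemma isPullback_slice (c : ℂ) :
    IsPullback (slice b c) b (Limits.pullback.snd b affineLineMap) (point c) := by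
  refine IsPullback.of_right ?_ (lift_snd _ _ _) (IsPullback.of_hasPullback b affineLineMap)
  have : slice b c ≫ Limits.pullback.fst b affineLineMap = 𝟙 X := lift_fst _ _ _
  rw [this, point_comp]
  exact IsPullback.of_horiz_isIso ⟨by rw [id_comp, comp_id]⟩

end Family

end

section
namespace GradedAlgOn.Parameter.Fibre

variable {A F : GradedAlgOn b} {p : A.Parameter} {c : ℂ}
  (e : p.Fibre c F) (hA : A.IsQuasiCoherent) (hF : F.IsQuasiCoherent)

include e in
lemma irr (U : X.affineOpens) :
    irrelevant (F.gr U) ≤ (irrelevant (A.gr U)).map (e.hom U) :=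
  (e.isGradedBaseChange U).irr

include e in
lemma hom_comp {U V : X.affineOpens} (h : (V : X.Opens) ≤ U) :
    (F.resHom h).comp (e.hom U) = (e.hom V).comp (A.resHom h) :=
  GradedRingHom.ext fun x => (e.res h x).symm

lemma projMap_compat {U V : X.AffineZariskiSite} (h : V ≤ U) :
    Proj.map _ (hF.isGradedBaseChange h).irr ≫
      Proj.map (e.hom (siteOpen U)) (e.irr _) ≫ projι hA U =
        Proj.map (e.hom (siteOpen V)) (e.irr _) ≫ projι hA V := by
  have key : Proj.map _ (hF.isGradedBaseChange h).irr ≫ Proj.map (e.hom (siteOpen U)) (e.irr _) =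
      Proj.map (e.hom (siteOpen V)) (e.irr _) ≫ Proj.map _ (hA.isGradedBaseChange h).irr := by
    rw [← Proj.map_comp, ← Proj.map_comp]
    have H (φ φ' : A.gr (siteOpen U) →+*ᵍ F.gr (siteOpen V)) (h h') (hφ : φ = φ') :
        Proj.map φ h = Proj.map φ' h' := by
      subst hφ; rfl
    exact H _ _ _ _ (e.hom_comp _)
  rw [reassoc_of% key, map_projι hA h]

lemma coneMap_compat {U V : X.AffineZariskiSite} (h : V ≤ U) :
    coneMap _ (hF.isGradedBaseChange h).irr ≫
      coneMap (e.hom (siteOpen U)) (e.irr _) ≫ relConeι hA U =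
        coneMap (e.hom (siteOpen V)) (e.irr _) ≫ relConeι hA V := by
  have key : coneMap _ (hF.isGradedBaseChange h).irr ≫ coneMap (e.hom (siteOpen U)) (e.irr _) =
      coneMap (e.hom (siteOpen V)) (e.irr _) ≫ coneMap _ (hA.isGradedBaseChange h).irr :=
    coneMap_comp_eq _ _ _ _ _ _ _ _ (e.hom_comp _)
  rw [reassoc_of% key, map_relConeι hA h]

def projMap : relProj hF ⟶ relProj hA :=
  relProjDesc hF (fun U => Proj.map (e.hom (siteOpen U)) (e.irr _) ≫ projι hA U)
    (e.projMap_compat hA hF)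

lemma projι_projMap (U : X.AffineZariskiSite) : projι hF U ≫ e.projMap hA hF =
    Proj.map (e.hom (siteOpen U)) (e.irr _) ≫ projι hA U :=
  projι_desc hF _ (e.projMap_compat hA hF) U

def relConeMap : relCone hF ⟶ relCone hA :=
  relConeDesc hF (fun U => coneMap (e.hom (siteOpen U)) (e.irr _) ≫ relConeι hA U)
    (e.coneMap_compat hA hF)

lemma relConeι_relConeMap (U : X.AffineZariskiSite) : relConeι hF U ≫ e.relConeMap hA hF =
    coneMap (e.hom (siteOpen U)) (e.irr _) ≫ relConeι hA U :=
  relConeι_desc hF _ (e.coneMap_compat hA hF) U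

lemma projMap_projStr_strZero (U : X.affineOpens) :
    Proj.map (e.hom U) (e.irr U) ≫ projStr (A.strZero U) = projStr (F.strZero U) := by
  rw [projMap_projStr (e.hom U) (e.irr U) (ψ' := F.strZero U) (ρ := RingHom.id _) (e.str U)]
  exact (congrArg _ (Spec.map_id _)).trans (comp_id _)

lemma projMap_relProjπ : e.projMap hA hF ≫ relProjπ hA = relProjπ hF := relProj_hom_ext fun U => by
    rw [reassoc_of% e.projι_projMap hA hF U, projι_π hA U, projι_π hF U]
    exact (assoc _ _ _).symm.trans
      (congrArg (· ≫ U.2.fromSpec) (e.projMap_projStr_strZero (siteOpen U)))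

lemma isPullback_projι (U : X.AffineZariskiSite) :
    IsPullback (Proj.map (e.hom (siteOpen U)) (e.irr _)) (projι hF U) (projι hA U)
      (e.projMap hA hF) := by
  refine isPullback_of_preimage_opensRange _ _ _ _ (e.projι_projMap hA hF U).symm (le_of_eq ?_)
  rw [opensRange_projι, opensRange_projι, ← comp_preimage, e.projMap_relProjπ]

lemma isPullback_projMap :
    IsPullback (e.projMap hA hF) (relProjπ hF ≫ b) (relParam p hA) (point c) := by
  refine isPullback_of_cover _ _ _ _ (projPieces hA).cover (fun U => Proj (F.gr (siteOpen U)))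
    (fun U => Proj.map (e.hom (siteOpen U)) (e.irr _)) (fun U => projι hF U)
    (e.isPullback_projι hA hF) fun U => ?_
  rw [projι_relProjπ_comp hF U]
  refine Eq.mpr (congrArg (IsPullback _ _ · _) (projι_relParam p hA U)) ?_
  exact (e.isGradedBaseChange (siteOpen U)).isPullback_proj

end GradedAlgOn.Parameter.Fibre

end

section
lemma of_isPullback_openCover {P : MorphismProperty Scheme.{0}} [IsZariskiLocalAtTarget P]
    {X Y : Scheme.{0}} (f : X ⟶ Y) (𝒰 : Y.OpenCover) (Z : 𝒰.I₀ → Scheme.{0}) (j : ∀ i, Z i ⟶ X)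
    (g : ∀ i, Z i ⟶ 𝒰.X i) (h : ∀ i, IsPullback (j i) (g i) f (𝒰.f i)) (hg : ∀ i, P (g i)) :
    P f := by
  refine (IsZariskiLocalAtTarget.iff_of_openCover (P := P) 𝒰).2 fun i => ?_
  have h2 : (h i).isoPullback.inv ≫ g i = Limits.pullback.snd f (𝒰.f i) := (h i).isoPullback_inv_snd
  change P (Limits.pullback.snd f (𝒰.f i))
  rw [← h2]
  exact (P.cancel_left_of_respectsIso _ _).2 (hg i)

namespace GradedAlgOn.Parameter.Fibre

variable {A F : GradedAlgOn b} {p : A.Parameter} {c : ℂ}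
  (e : p.Fibre c F) (hA : A.IsQuasiCoherent) (hF : F.IsQuasiCoherent)

lemma relConeMap_relConeToProj : e.relConeMap hA hF ≫ relConeToProj hA =
    relConeToProj hF ≫ e.projMap hA hF :=
  relCone_hom_ext fun U => by
    rw [reassoc_of% e.relConeι_relConeMap hA hF U, relConeι_relConeToProj,
      reassoc_of% relConeι_relConeToProj hF U, e.projι_projMap hA hF U,
      reassoc_of% coneMap_coneToProj]

lemma isPullback_relConeι (U : X.AffineZariskiSite) :
    IsPullback (coneMap (e.hom (siteOpen U)) (e.irr _)) (relConeι hF U) (relConeι hA U)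
      (e.relConeMap hA hF) := by
  refine isPullback_of_preimage_opensRange _ _ _ _ (e.relConeι_relConeMap hA hF U).symm
    (le_of_eq ?_)
  rw [opensRange_eq_of_isPullback (isPullback_relConeToProj hA U).flip,
    opensRange_eq_of_isPullback (isPullback_relConeToProj hF U).flip, ← comp_preimage,
    e.relConeMap_relConeToProj, opensRange_projι, opensRange_projι, comp_preimage,
    ← comp_preimage _ (relProjπ hA), e.projMap_relProjπ]

lemma isPullback_relConeMap :
    IsPullback (e.relConeMap hA hF) (relConeToProj hF) (relConeToProj hA) (e.projMap hA hF) := by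
  refine isPullback_of_cover _ _ _ _ (conePieces hA).cover (fun U => Cone (F.gr (siteOpen U)))
    (fun U => coneMap (e.hom (siteOpen U)) (e.irr _)) (fun U => relConeι hF U)
    (e.isPullback_relConeι hA hF) fun U => ?_
  refine Eq.mpr (congrArg (IsPullback _ · _ _) (relConeι_relConeToProj hF U)) ?_
  refine Eq.mpr (congrArg (IsPullback _ _ · _) (relConeι_relConeToProj hA U)) ?_
  exact (e.isGradedBaseChange (siteOpen U)).isPullback_coneToProj.paste_vert
    (e.isPullback_projι hA hF U)

lemma relScale_relConeMap : relScale hF ≫ e.relConeMap hA hF = e.relConeMap hA hF ≫ relScale hA :=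
  relCone_hom_ext fun U => by
    rw [reassoc_of% relConeι_relScale hF U, e.relConeι_relConeMap hA hF U,
      reassoc_of% e.relConeι_relConeMap hA hF U, relConeι_relScale hA U,
      reassoc_of% coneMap_scale_comm (e.hom (siteOpen U)) (e.irr _) (A.isUnit_two (siteOpen U))
        (F.isUnit_two (siteOpen U))]

variable {hA hF}

/-- The `Proj` of a fibre of `A` is the fibre of the `Proj` of `A`. -/
def isRestriction
    (hs : Smooth (relConeToProj hA ≫ relFamily p hA ≫ Limits.pullback.fst b affineLineMap ≫ b))
    (hs' : Smooth (relConeToProj hF ≫ relProjπ hF ≫ b)) :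
    IsRestriction (slice b c) (relOrbi hF (relProjπ hF) hs') (relOrbi hA (relFamily p hA) hs) where
  f := e.projMap hA hF
  isPullback := by
    refine IsPullback.of_bot (v₂₁ := b) ?_ ?_ (isPullback_slice c)
    · change IsPullback _ _ (relFamily p hA ≫ Limits.pullback.snd b affineLineMap) _
      rw [relFamily_snd]
      exact e.isPullback_projMap hA hF
    · change e.projMap hA hF ≫ relFamily p hA = relProjπ hF ≫ slice b c
      refine Limits.pullback.hom_ext ?_ ?_
      · rw [assoc, relFamily_fst, e.projMap_relProjπ, assoc]
        exact ((congrArg (relProjπ hF ≫ ·) (lift_fst _ _ _)).trans (comp_id _)).symm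
      · rw [assoc, relFamily_snd, (e.isPullback_projMap hA hF).w, assoc, assoc]
        exact (congrArg (relProjπ hF ≫ ·) (lift_snd _ _ _)).symm
  g := e.relConeMap hA hF
  isPullback_frames := e.isPullback_relConeMap hA hF
  map_mem U m x hx := by
    refine eigen_pull (f := e.projMap hA hF) ?_ (e.relScale_relConeMap hA hF) _ hx
    rw [reassoc_of% e.relConeMap_relConeToProj hA hF, reassoc_of% relFamily_fst p hA,
      reassoc_of% e.projMap_relProjπ hA hF]

include e in
lemma smooth_fibre (h : Smooth (relConeToProj hA ≫ relParam p hA)) :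
    Smooth (relConeToProj hF ≫ relProjπ hF ≫ b) :=
  MorphismProperty.of_isPullback
    ((e.isPullback_relConeMap hA hF).paste_vert (e.isPullback_projMap hA hF)) h

end GradedAlgOn.Parameter.Fibre

section Family

variable {A : GradedAlgOn b} (p : A.Parameter) (hA : A.IsQuasiCoherent)

/-- The structure map from polynomials in the parameter over functions on `U`. -/
def GradedAlgOn.Parameter.strPoly (U : X.affineOpens) : Polynomial (Sec b U) →+* A.gr U 0 :=
  eval₂RingHom (A.strZero U) ⟨p.t U, p.mem U⟩

/-- Conditions for the family of `Proj`s over `U` to be proper and smooth. -/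
structure GradedAlgOn.Parameter.IsGood (U : X.affineOpens) : Prop where
  smooth : ((algebraMap (A.gr U 0) (A.ring U)).comp (p.hom U)).Smooth
  finite : Algebra.FiniteType (A.gr U 0) (A.ring U)
  surj : Surjective (p.strPoly U)

lemma smooth_affineLineMap : Smooth affineLineMap := by
  rw [affineLineMap, HasRingHomProperty.Spec_iff (P := @Smooth)]
  exact (RingHom.smooth_algebraMap (R := ℂ) (S := Polynomial ℂ)).2 ⟨inferInstance, inferInstance⟩

lemma smooth_coneStr {A : Type} [CommRing A] {𝒜 : ℕ → AddSubgroup A} [GradedRing 𝒜] {R : Type}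
    [CommRing R] (ψ : R →+* 𝒜 0) (h : ((algebraMap (𝒜 0) A).comp ψ).Smooth) :
    Smooth (coneStr ψ) := by
  have : Smooth (Spec.map (ofHom ((algebraMap (𝒜 0) A).comp ψ))) := by
    rw [HasRingHomProperty.Spec_iff (P := @Smooth)]
    exact h
  exact smooth_comp _ _

lemma flat_projStr {A : Type} [CommRing A] {𝒜 : ℕ → AddSubgroup A} [GradedRing 𝒜]
    (ψ : Polynomial ℂ →+* 𝒜 0) (h : ((algebraMap (𝒜 0) A).comp ψ).Smooth) :
    Flat (projStr ψ) := by
  have H {n : ℕ} {s : A} (hs : s ∈ 𝒜 n) (hn : 0 < n) :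
      Flat (awayι 𝒜 s hs hn ≫ projStr ψ) := by
    rw [awayι_projStr, Flat.SpecMap_iff, CommRingCat.hom_ofHom]
    let _ : Algebra (Polynomial ℂ) A := ((algebraMap (𝒜 0) A).comp ψ).toAlgebra
    let _ : Algebra (Polynomial ℂ) (HomogeneousLocalization.Away 𝒜 s) :=
      ((fromZeroRingHom 𝒜 (powers s)).comp ψ).toAlgebra
    have hA : Module.Flat (Polynomial ℂ) A := h.flat
    have hloc : Module.Flat (Polynomial ℂ) (Away s) := Module.Flat.trans (Polynomial ℂ) A (Away s)
    have ht : Module.IsTorsionFree (Polynomial ℂ) (HomogeneousLocalization.Away 𝒜 s) := by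
      refine ⟨fun r hr x y hxy => ?_⟩
      apply val_injective
      refine (Module.Flat.isSMulRegular_of_isRegular (M := Away s) hr) ?_
      have := congrArg HomogeneousLocalization.val hxy
      simp only [smul_def, HomogeneousLocalization.val_mul] at this ⊢
      exact this
    change Module.Flat (Polynomial ℂ) (HomogeneousLocalization.Away 𝒜 s)
    infer_instance
  have : IsZariskiLocalAtSource @Flat.{0} := @HasRingHomProperty.instIsZariskiLocalAtSource _ _ inferInstance
  exact (IsZariskiLocalAtSource.iff_of_openCover (P := @Flat) (affineOpenCover 𝒜).openCover).2
    fun s => H s.2.2 s.1.2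

variable {p}

section Good

variable (U : X → X.AffineZariskiSite) (hU : ∀ x, x ∈ (U x).toOpens)

/-- A cover of `X` by affine open sets gives one of `Proj_X A`. -/
def relProjCover : (relProj hA).OpenCover where
  I₀ := X
  X x := Proj (A.gr (siteOpen (U x)))
  f x := projι hA (U x)
  mem₀ := by
    rw [presieve₀_mem_precoverage_iff]
    refine ⟨fun y => ⟨relProjπ hA y, ?_⟩, fun x => inferInstance⟩
    change y ∈ (projι hA _).opensRange
    rw [opensRange_projι hA]
    exact hU _

/-- A cover of `X` by affine open sets gives one of the cone over `Proj_X A`. -/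
def relConeCover : (relCone hA).OpenCover where
  I₀ := X
  X x := Cone (A.gr (siteOpen (U x)))
  f x := relConeι hA (U x)
  mem₀ := by
    rw [presieve₀_mem_precoverage_iff]
    refine ⟨fun y => ⟨relProjπ hA (relConeToProj hA y), ?_⟩, fun x => inferInstance⟩
    change y ∈ (relConeι hA _).opensRange
    rw [opensRange_eq_of_isPullback (isPullback_relConeToProj hA _).flip, opensRange_projι hA]
    exact hU _

variable (hg : ∀ x, p.IsGood (siteOpen (U x)))
include hU hg

lemma smooth_relParam : Smooth (relConeToProj hA ≫ relParam p hA) := by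
  have H (V : X.AffineZariskiSite) (hV : p.IsGood (siteOpen V)) :
      Smooth (relConeι hA V ≫ relConeToProj hA ≫ relParam p hA) := by
    rw [reassoc_of% relConeι_relConeToProj hA V, projι_relParam, coneToProj_projStr]
    exact smooth_coneStr _ hV.smooth
  have : IsZariskiLocalAtSource @Smooth.{0} :=
    @HasRingHomProperty.instIsZariskiLocalAtSource _ _ inferInstance
  exact (IsZariskiLocalAtSource.iff_of_openCover (P := @Smooth)
    (𝒰 := relConeCover hA U hU)).2 fun x => H _ (hg x)

lemma flat_relParam : Flat (relParam p hA) := by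
  have H (V : X.AffineZariskiSite) (hV : p.IsGood (siteOpen V)) :
      Flat (projι hA V ≫ relParam p hA) := by
    rw [projι_relParam]
    exact flat_projStr _ hV.smooth
  have : IsZariskiLocalAtSource @Flat.{0} :=
    @HasRingHomProperty.instIsZariskiLocalAtSource _ _ inferInstance
  exact (IsZariskiLocalAtSource.iff_of_openCover (P := @Flat)
    (𝒰 := relProjCover hA U hU)).2 fun x => H _ (hg x)

end Good

end Family

end

section
variable {A : GradedAlgOn b} (p : A.Parameter) (hA : A.IsQuasiCoherent)

attribute [local instance] Polynomial.algebra in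
lemma isPullback_specPolynomial (B : Type) [CommRing B] [Algebra ℂ B] :
    IsPullback (Spec.map (ofHom (Polynomial.C : B →+* Polynomial B)))
      (Spec.map (ofHom (mapRingHom (algebraMap ℂ B))))
      (Spec.map (ofHom (algebraMap ℂ B))) affineLineMap :=
  (isPullback_SpecMap_of_isPushout _ _ _ _
    (CommRingCat.isPushout_of_isPushout ℂ B (Polynomial ℂ) (Polynomial B)))

variable (b) in
def siteSpec (V : X.AffineZariskiSite) : Spec (.of (Sec b (siteOpen V))) ⟶ X := V.2.fromSpec

instance (V : X.AffineZariskiSite) : IsOpenImmersion (siteSpec b V) :=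
  inferInstanceAs (IsOpenImmersion V.2.fromSpec)

lemma opensRange_siteSpec (V : X.AffineZariskiSite) :
    (siteSpec b V).opensRange = V.toOpens := V.2.opensRange_fromSpec

lemma siteSpec_comp (V : X.AffineZariskiSite) : siteSpec b V ≫ b =
    Spec.map (ofHom (algebraMap ℂ (Sec b (siteOpen V)))) := fromSpec_comp _

lemma projι_relProjπ (V : X.AffineZariskiSite) : projι hA V ≫ relProjπ hA =
    projStr (A.strZero (siteOpen V)) ≫ siteSpec b V := projι_π hA V

lemma isPullback_relProjπ (V : X.AffineZariskiSite) :
    IsPullback (projι hA V) (projStr (A.strZero (siteOpen V))) (relProjπ hA) (siteSpec b V) := by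
  refine (isPullback_of_preimage_opensRange _ _ _ _ (projι_relProjπ hA V).symm (le_of_eq ?_)).flip
  rw [opensRange_siteSpec, opensRange_projι]

variable (b) in
def lineChart (V : X.AffineZariskiSite) :
    Spec (.of (Polynomial (Sec b (siteOpen V)))) ⟶ timesLine b :=
  Limits.pullback.lift (Spec.map (ofHom Polynomial.C) ≫ siteSpec b V)
    (Spec.map (ofHom (mapRingHom (algebraMap ℂ (Sec b (siteOpen V)))))) (by
      rw [assoc, ← (isPullback_specPolynomial _).w, siteSpec_comp])

lemma isPullback_lineChart (V : X.AffineZariskiSite) :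
    IsPullback (lineChart b V) (Spec.map (ofHom Polynomial.C))
      (Limits.pullback.fst b affineLineMap) (siteSpec b V) := by
  refine (IsPullback.of_right (h₁₂ := Limits.pullback.snd b affineLineMap) (h₂₂ := b) ?_
    (lift_fst _ _ _) (IsPullback.of_hasPullback b affineLineMap).flip)
  rw [lineChart, lift_snd, siteSpec_comp]
  exact (isPullback_specPolynomial _).flip

instance (V : X.AffineZariskiSite) : IsOpenImmersion (lineChart b V) :=
  MorphismProperty.of_isPullback (P := @IsOpenImmersion) (isPullback_lineChart V).flip inferInstance

lemma GradedAlgOn.Parameter.strPoly_C (U : X.affineOpens) :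
    (p.strPoly U).comp Polynomial.C = A.strZero U :=
  RingHom.ext fun _ => eval₂_C _ _

lemma GradedAlgOn.Parameter.strPoly_map (U : X.affineOpens) :
    (p.strPoly U).comp (mapRingHom (algebraMap ℂ (Sec b U))) = p.hom U := by
  refine Polynomial.ringHom_ext (fun c => ?_) ?_
  · rw [comp_apply, coe_mapRingHom, Polynomial.map_C, p.hom_C]
    exact eval₂_C _ _
  · rw [comp_apply, coe_mapRingHom, Polynomial.map_X, p.hom_X]
    exact eval₂_X _ _

lemma isPullback_relFamily (V : X.AffineZariskiSite) :
    IsPullback (projι hA V) (projStr (p.strPoly (siteOpen V))) (relFamily p hA)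
      (lineChart b V) := by
  refine IsPullback.of_bot (v₂₁ := Spec.map (ofHom Polynomial.C)) ?_ ?_ (isPullback_lineChart V)
  · rw [← projStr_comp, p.strPoly_C, relFamily_fst]
    exact isPullback_relProjπ hA V
  · refine Limits.pullback.hom_ext ?_ ?_
    · rw [assoc, relFamily_fst, projι_relProjπ, ← p.strPoly_C, projStr_comp,
        assoc, assoc, lineChart, lift_fst]
    · rw [assoc, relFamily_snd, projι_relParam, ← p.strPoly_map, projStr_comp,
        assoc, lineChart, lift_snd]

variable (U : X → X.AffineZariskiSite) (hU : ∀ x, x ∈ (U x).toOpens)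

variable (b) in
def lineCover : (timesLine b).OpenCover where
  I₀ := X
  X x := Spec (.of (Polynomial (Sec b (siteOpen (U x)))))
  f x := lineChart b (U x)
  mem₀ := by
    rw [presieve₀_mem_precoverage_iff]
    refine ⟨fun y => ⟨Limits.pullback.fst b affineLineMap y, ?_⟩, fun x => inferInstance⟩
    change y ∈ (lineChart b _).opensRange
    rw [opensRange_eq_of_isPullback (isPullback_lineChart _), opensRange_siteSpec]
    exact hU _

lemma isProper_projStr {B : Type} [CommRing B] {ℬ : ℕ → AddSubgroup B} [GradedRing ℬ] {R : Type}
    [CommRing R] (ψ : R →+* ℬ 0) (hψ : Surjective ψ)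
    (hf : Algebra.FiniteType (ℬ 0) B) : IsProper (projStr ψ) := by
  have : IsClosedImmersion (Spec.map (ofHom ψ)) := IsClosedImmersion.spec_of_surjective _ hψ
  rw [projStr]
  infer_instance

variable (hg : ∀ x, p.IsGood (siteOpen (U x)))
include hU hg

lemma isProper_relFamily : IsProper (relFamily p hA) :=
  of_isPullback_openCover (P := @IsProper) (relFamily p hA) (lineCover b U hU)
    (fun x => Proj (A.gr (siteOpen (U x)))) (fun x => projι hA (U x))
    (fun x => projStr (p.strPoly (siteOpen (U x)))) (fun x => isPullback_relFamily p hA (U x))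
    fun x => isProper_projStr _ (hg x).surj (hg x).finite

include hA in
lemma deformsTo_of_family {E G F : GradedAlgOn b}
    (hE : ∀ c : ℂ, c ≠ 0 → ∃ E' : GradedAlgOn b, Nonempty (p.Fibre c E') ∧ Nonempty (E'.Iso E))
    (hF : p.Fibre 0 F) (hG : F.Iso G) : DeformsTo E G F := by
  have hsm := smooth_relParam hA U hU hg
  have hs : Smooth (relConeToProj hA ≫ relFamily p hA ≫ Limits.pullback.fst b affineLineMap ≫ b) := by
    have := smooth_affineLineMap
    rw [reassoc_of% relFamily_fst p hA, ← relParam_comp p hA, ← assoc]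
    infer_instance
  have id (F : GradedAlgOn b) : F.Iso F :=
    { hom := fun _ => .id _
      bij := fun _ => bijective_id
      res := fun _ _ => rfl
      str := fun _ _ => rfl }
  refine ⟨relOrbi hA (relFamily p hA) hs, isProper_relFamily p hA U hU hg, ?_, fun c hc => ?_, ?_⟩
  · change Flat (relFamily p hA ≫ _)
    rw [relFamily_snd]
    exact flat_relParam hA U hU hg
  · obtain ⟨E', ⟨e⟩, ⟨i⟩⟩ := hE c hc
    have hE' := e.isQuasiCoherent hA
    have hs' := e.smooth_fibre (hF := hE') hsm
    exact ⟨relOrbi hE' (relProjπ hE') hs', ⟨e.isRestriction hs hs'⟩, nonempty_isProj hE' i hs'⟩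
  · have hF' := hF.isQuasiCoherent hA
    have hs' := hF.smooth_fibre (hF := hF') hsm
    exact ⟨relOrbi hF' (relProjπ hF') hs', ⟨hF.isRestriction hs hs'⟩,
      nonempty_isProj hF' hG hs', nonempty_isProj hF' (id F) hs'⟩

end

section
open MvPolynomial (C)

lemma sum_fin_filter_eq_antidiagonal {M : Type*} [AddCommMonoid M] {k : ℕ} (i : Fin (k + 1))
    (f : ℕ → ℕ → M) :
    ∑ p : Fin (k + 1) × Fin (k + 1) with (p.1 : ℕ) + (p.2 : ℕ) = (i : ℕ), f p.1 p.2 =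
      ∑ p ∈ antidiagonal (i : ℕ), f p.1 p.2 := by
  refine Finset.sum_bij (fun p _ => ((p.1 : ℕ), (p.2 : ℕ))) ?_ ?_ ?_ ?_
  · intro p hp
    exact mem_antidiagonal.2 (mem_filter.1 hp).2
  · intro p _ q _ h
    rw [Prod.mk.injEq] at h
    exact Prod.ext (Fin.ext h.1) (Fin.ext h.2)
  · rintro ⟨a, c⟩ h
    rw [mem_antidiagonal] at h
    have := i.2
    exact ⟨(⟨a, by omega⟩, ⟨c, by omega⟩), mem_filter.2 ⟨mem_univ _, h⟩, rfl⟩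
  · intro _ _
    rfl

lemma iterate_leibniz {P : Type*} [CommRing P] (Δ : P →+ P)
    (hΔ : ∀ a b, Δ (a * b) = a * Δ b + b * Δ a) (n : ℕ) (a b : P) :
    Δ^[n] (a * b) = ∑ p ∈ antidiagonal n, n.choose p.1 • (Δ^[p.1] a * Δ^[p.2] b) := by
  induction n with
  | zero => simp
  | succ n ih =>
    rw [iterate_succ_apply', ih, map_sum,
      Finset.sum_antidiagonal_choose_succ_nsmul fun i j => Δ^[i] a * Δ^[j] b,
      ← sum_add_distrib]
    refine sum_congr rfl fun p hp => ?_
    rw [map_nsmul, hΔ, iterate_succ_apply', iterate_succ_apply', nsmul_add,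
      ← (Nat.choose_symm_of_eq_add (mem_antidiagonal.1 hp).symm), mul_comm (Δ^[p.2] b)]

lemma derivation_eq_zero_of_span {B ι : Type} [CommRing B] [Algebra ℂ B] (z : ι → B)
    (hz : Submodule.span B (Set.range fun i => D ℂ B (z i)) = ⊤)
    {M : Type} [AddCommGroup M] [Module B M] [Module ℂ M]
    [IsScalarTower ℂ B M] (d : Derivation ℂ B M) (hD : ∀ i, d (z i) = 0) (x : B) : d x = 0 := by
  have h : D ℂ B x ∈ LinearMap.ker d.liftKaehlerDifferential := by
    have : (⊤ : Submodule B (Ω[B⁄ℂ])) ≤ LinearMap.ker d.liftKaehlerDifferential := by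
      rw [← hz, Submodule.span_le]
      rintro _ ⟨i, rfl⟩
      exact (d.liftKaehlerDifferential_comp_D _).trans (hD i)
    exact this trivial
  exact (d.liftKaehlerDifferential_comp_D x).symm.trans h

/-- Coordinates on a ring `B` over `ℂ`, some of them invertible and considered up to logarithms,
with the dual derivations preserving a subring `A₀`. -/
structure LogCoord (B : Type) [CommRing B] [Algebra ℂ B] (A₀ : Subring B) (ι : Type) where
  z : ι → B
  z_mem : ∀ i, z i ∈ A₀
  c : Set ι
  unit : ∀ i ∈ c, IsUnit (z i)
  θ : ι → Derivation ℂ B B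
  θ_ne : ∀ i j, i ≠ j → θ i (z j) = 0
  θ_self : ∀ i, i ∉ c → θ i (z i) = 1
  θ_log : ∀ i, i ∈ c → θ i (z i) = z i
  θ_mem : ∀ i, ∀ a ∈ A₀, θ i a ∈ A₀
  θ_unit : ∀ i (u : Bˣ), (u : B) ∈ A₀ → θ i u * ((u⁻¹ : Bˣ) : B) ∈ A₀
  span : Submodule.span B (Set.range fun i => D ℂ B (z i)) = ⊤

namespace LogCoord

variable {B : Type} [CommRing B] [Algebra ℂ B] {A₀ : Subring B} {ι : Type} (L : LogCoord B A₀ ι)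

include L in
lemma derivation_eq_zero {M : Type} [AddCommGroup M] [Module B M] [Module ℂ M]
    [IsScalarTower ℂ B M] (d : Derivation ℂ B M) (hD : ∀ i, d (L.z i) = 0) (x : B) : d x = 0 :=
  derivation_eq_zero_of_span L.z L.span d hD x

variable (k : ℕ)

def var (B : Type) [CommRing B] (j : ι) (n : ℕ) : MvPolynomial (ι × Fin k) B :=
  if h : n < k then MvPolynomial.X (j, ⟨n, h⟩) else 0

variable [Fintype ι]

/-- The total derivative of functions, with its base point. -/
def totalHom₀ : B →+* DualNumber (MvPolynomial (ι × Fin k) B) where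
  toFun b := TrivSqZeroExt.inl (C b) + TrivSqZeroExt.inr (∑ j, C (L.θ j b) * var k B j 0)
  map_one' := by ext <;> simp
  map_mul' a b := by
    refine TrivSqZeroExt.ext (by simp) ?_
    have h : ∑ j, C (L.θ j (a * b)) * var k B j 0 = C a * ∑ j, C (L.θ j b) * var k B j 0 +
          C b * ∑ j, C (L.θ j a) * var k B j 0 := by
      rw [mul_sum, mul_sum, ← sum_add_distrib]
      refine sum_congr rfl fun j _ => ?_
      rw [Derivation.leibniz, smul_eq_mul, smul_eq_mul, map_add, map_mul, map_mul]
      ring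
    simp only [Derivation.leibniz, smul_eq_mul, map_add, map_mul] at h
    simp [h, mul_comm _ (C b)]
  map_zero' := by ext <;> simp
  map_add' a b := by
    refine TrivSqZeroExt.ext (by simp) ?_
    simp [add_mul, sum_add_distrib]

def totalHom : MvPolynomial (ι × Fin k) B →+* DualNumber (MvPolynomial (ι × Fin k) B) :=
  eval₂Hom (L.totalHom₀ k) fun v =>
    TrivSqZeroExt.inl (MvPolynomial.X v) + TrivSqZeroExt.inr (var k B v.1 (v.2 + 1))

lemma fst_totalHom (p : MvPolynomial (ι × Fin k) B) : (L.totalHom k p).fst = p := by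
  have : (TrivSqZeroExt.fstHom (MvPolynomial (ι × Fin k) B) (MvPolynomial (ι × Fin k) B)
      (MvPolynomial (ι × Fin k) B)).toRingHom.comp (L.totalHom k) = RingHom.id _ := by
    refine ringHom_ext (fun b => ?_) fun v => ?_
    · simp [totalHom, totalHom₀]
    · simp [totalHom]
  exact DFunLike.congr_fun this p

def total : MvPolynomial (ι × Fin k) B →+ MvPolynomial (ι × Fin k) B where
  toFun p := (L.totalHom k p).snd
  map_zero' := by simp
  map_add' := by simp

lemma total_mul (p q : MvPolynomial (ι × Fin k) B) :
    L.total k (p * q) = p * L.total k q + q * L.total k p := by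
  change (L.totalHom k (p * q)).snd = p * (L.totalHom k q).snd + q * (L.totalHom k p).snd
  rw [map_mul, TrivSqZeroExt.snd_mul, fst_totalHom, fst_totalHom, smul_eq_mul,
    MulOpposite.smul_eq_mul_unop, MulOpposite.unop_op, mul_comm _ q]

lemma total_C (b : B) : L.total k (C b) = ∑ j, C (L.θ j b) * var k B j 0 := by
  change (L.totalHom k _).snd = _
  simp [totalHom, totalHom₀]

lemma total_X (v : ι × Fin k) : L.total k (MvPolynomial.X v) = var k B v.1 (v.2 + 1) := by
  change (L.totalHom k _).snd = _
  simp [totalHom]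

lemma iterate_var (j : ι) (n : ℕ) : (L.total k)^[n] (var k B j 0) = var k B j n := by
  induction n with
  | zero => rfl
  | succ n ih =>
    rw [iterate_succ_apply', ih]
    by_cases h : n < k
    · rw [var, dif_pos h, total_X]
    · rw [var, dif_neg h, map_zero, var, dif_neg (by omega)]

lemma iterate_const (n : ℕ) (c : ℂ) : (L.total k)^[n + 1] (C (algebraMap ℂ B c)) = 0 := by
  rw [iterate_succ_apply, total_C]
  simp [iterate_map_zero]

def toPoly : JetRing k B →ₐ[ℂ] MvPolynomial (ι × Fin k) B :=
  jetLift (fun i b => (L.total k)^[(i : ℕ)] (C b)) (by intro i a b; rw [map_add, iterate_map_add])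
    (by
      intro i a b
      rw [map_mul, iterate_leibniz _ (L.total_mul k)]
      exact (sum_fin_filter_eq_antidiagonal i fun p q => (i : ℕ).choose p •
        ((L.total k)^[p] (C a) * (L.total k)^[q] (C b))).symm)
    (by
      intro i c
      split_ifs with h
      · subst h; rfl
      · obtain ⟨n, hn⟩ := Nat.exists_eq_succ_of_ne_zero (fun h' => h (Fin.ext h'))
        rw [hn, iterate_const])

lemma toPoly_jd (i : Fin (k + 1)) (b : B) :
    L.toPoly k (jd k i b) = (L.total k)^[(i : ℕ)] (C b) := jetLift_jd _ _ _ _ _ _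

lemma jd_succ_eq (u : Bˣ) (i : Fin k) : jd k i.succ (u : B) = jd k 0 (u : B) * logD u i +
    ∑ j : Fin (i : ℕ), ((i : ℕ).choose (j : ℕ)) •
      (jd k ⟨(i : ℕ) - (j : ℕ), by omega⟩ (u : B) * logD u ⟨(j : ℕ), by omega⟩) := by
  have h : jd k 0 (u : B) * jd k 0 ((u⁻¹ : Bˣ) : B) = 1 := by
    change jd0 k B u * jd0 k B _ = 1
    rw [← map_mul, Units.mul_inv, map_one]
  rw [logD, ← mul_assoc, h, one_mul, sub_add_cancel]

lemma toPoly_logD (u : Bˣ) (i : Fin k) : L.toPoly k (logD u i) = (L.total k)^[(i : ℕ)]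
    (C ((u⁻¹ : Bˣ) : B) * L.total k (C (u : B))) := by
  set ℓ := C ((u⁻¹ : Bˣ) : B) * L.total k (C (u : B)) with hℓ
  have hu : C (u : B) * ℓ = L.total k (C (u : B)) := by
    rw [hℓ, ← mul_assoc, ← map_mul, Units.mul_inv, map_one, one_mul]
  obtain ⟨n, hn⟩ := i
  induction n using Nat.strong_induction_on with
  | _ n ih =>
    have h := congrArg (L.toPoly k) (jd_succ_eq (k := k) u ⟨n, hn⟩)
    rw [toPoly_jd, map_add, map_sum, map_mul, toPoly_jd] at h
    change (L.total k)^[n + 1] _ = C (u : B) * _ + _ at h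
    rw [iterate_succ_apply, ← hu, iterate_leibniz _ (L.total_mul k),
      ← Finset.Nat.sum_antidiagonal_swap, Finset.Nat.sum_antidiagonal_eq_sum_range_succ_mk,
      Finset.sum_range_succ, add_comm, Finset.sum_range] at h
    have e : (∑ j : Fin n, L.toPoly k (n.choose (j : ℕ) •
        (jd k ⟨n - (j : ℕ), by omega⟩ (u : B) * logD u ⟨(j : ℕ), by omega⟩))) =
        ∑ j : Fin n, n.choose (n - j) • ((L.total k)^[n - j] (C (u : B)) *
          (L.total k)^[(j : ℕ)] ℓ) := by
      refine sum_congr rfl fun j _ => ?_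
      rw [map_nsmul, map_mul, toPoly_jd, ih j j.2, Nat.choose_symm j.2.le]
    change _ = _ + ∑ j : Fin n, L.toPoly k (n.choose (j : ℕ) •
        (jd k ⟨n - (j : ℕ), by omega⟩ (u : B) * logD u ⟨(j : ℕ), by omega⟩)) at h
    rw [e] at h
    have h' := add_right_cancel h
    simp only [Prod.fst_swap, Prod.snd_swap, Nat.sub_self, Nat.choose_zero_right, one_smul,
      Function.iterate_zero, id] at h'
    have hc := congrArg (C ((u⁻¹ : Bˣ) : B) * ·) h'
    simp only [← mul_assoc, ← map_mul, Units.inv_mul, map_one, one_mul] at hc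
    exact hc.symm

end LogCoord

end

section
open MvPolynomial (C)

namespace LogCoord

variable {B : Type} [CommRing B] [Algebra ℂ B] {A₀ : Subring B} {ι : Type}
  (L : LogCoord B A₀ ι) (k : ℕ)

open Classical in
def letter (j : ι) (i : Fin k) : JetRing k B :=
  if h : j ∈ L.c then logD (L.unit j h).unit i else jd k i.succ (L.z j)

lemma letter_mem (j : ι) (i : Fin k) : L.letter k j i ∈ letters A₀ i := by
  rw [letter]
  split_ifs with h
  · exact Or.inr ⟨_, L.z_mem j, rfl⟩
  · exact Or.inl ⟨_, L.z_mem j, rfl⟩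

def ofPoly : MvPolynomial (ι × Fin k) B →+* JetRing k B :=
  eval₂Hom (jd0 k B) fun v => L.letter k v.1 v.2

lemma jd_mem_range (i : ℕ) (hi : i < k + 1) (b : B) : jd k ⟨i, hi⟩ b ∈ (L.ofPoly k).range := by
  induction i using Nat.strong_induction_on generalizing b with
  | _ i ih =>
  have hC : ∀ b, jd k 0 b ∈ (L.ofPoly k).range := fun b =>
    ⟨C b, eval₂Hom_C _ _ b⟩
  rcases i with _ | i
  · exact hC b
  have hX : ∀ j n, L.letter k j n ∈ (L.ofPoly k).range := fun j n =>
    ⟨MvPolynomial.X (j, n), eval₂Hom_X' _ _ (j, n)⟩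
  let _ : Algebra B (JetRing k B) := (jd0 k B).toAlgebra
  have _ : IsScalarTower ℂ B (JetRing k B) := IsScalarTower.of_algebraMap_eq fun c =>
    ((jd_const (k := k) (B := B) 0 c).trans (if_pos rfl)).symm
  let N : Submodule B (JetRing k B) :=
    { carrier := (L.ofPoly k).range
      zero_mem' := zero_mem _
      add_mem' := add_mem
      smul_mem' := fun r x hx => by
        rw [smul_def]; exact mul_mem (hC r) hx }
  have hN : ∀ x, (Submodule.Quotient.mk x : JetRing k B ⧸ N) = 0 ↔ x ∈ (L.ofPoly k).range :=
    fun x => Submodule.Quotient.mk_eq_zero N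
  have hconst : ∀ c : ℂ, jd k ⟨i + 1, hi⟩ (algebraMap ℂ B c) = 0 := fun c =>
    (jd_const _ c).trans (if_neg (by simp [Fin.ext_iff]))
  have hsmul : ∀ a b : B, jd k ⟨i + 1, hi⟩ (a * b) - (jd k 0 a * jd k ⟨i + 1, hi⟩ b +
      jd k 0 b * jd k ⟨i + 1, hi⟩ a) ∈ (L.ofPoly k).range := by
    intro a b
    rw [jd_mul, ← Finset.add_sum_erase _ _
      (mem_filter.2 ⟨mem_univ ((0, ⟨i + 1, hi⟩) : Fin (k + 1) × Fin (k + 1)), by simp⟩),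
      ← Finset.add_sum_erase _ _ (Finset.mem_erase.2 ⟨fun h => by
        have := congrArg (fun p : Fin (k + 1) × Fin (k + 1) => (p.1 : ℕ)) h
        simp at this, mem_filter.2
          ⟨mem_univ ((⟨i + 1, hi⟩, 0) : Fin (k + 1) × Fin (k + 1)), by simp⟩⟩)]
    have e : ∀ s : JetRing k B, (((i + 1 : ℕ).choose 0) • (jd k 0 a * jd k ⟨i + 1, hi⟩ b) +
        (((i + 1 : ℕ).choose (i + 1)) • (jd k ⟨i + 1, hi⟩ a * jd k 0 b) + s)) -
        (jd k 0 a * jd k ⟨i + 1, hi⟩ b + jd k 0 b * jd k ⟨i + 1, hi⟩ a) = s := by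
      intro s
      rw [Nat.choose_self, Nat.choose_zero_right]
      ring
    refine (e _).symm ▸ sum_mem fun p hp => nsmul_mem (mul_mem ?_ ?_) _
    all_goals
      rw [Finset.mem_erase, Finset.mem_erase, mem_filter] at hp
      obtain ⟨h1, h2, _, h3⟩ := hp
      change (p.1 : ℕ) + p.2 = i + 1 at h3
      have h1' : (p.2 : ℕ) ≠ 0 := fun h => h1 (Prod.ext (Fin.ext (by simp; omega)) (Fin.ext h))
      have h2' : (p.1 : ℕ) ≠ 0 := fun h => h2 (Prod.ext (Fin.ext h) (Fin.ext (by simp; omega)))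
      first
      | exact ih (p.1 : ℕ) (by omega) p.1.2 a
      | exact ih (p.2 : ℕ) (by omega) p.2.2 b
  let D : Derivation ℂ B (JetRing k B ⧸ N) := Derivation.mk'
    { toFun := fun b => Submodule.Quotient.mk (jd k ⟨i + 1, hi⟩ b)
      map_add' := fun a b => by rw [jd_add]; rfl
      map_smul' := fun c b => by
        rw [RingHom.id_apply, ← Submodule.Quotient.mk_smul, ← sub_eq_zero,
          ← Submodule.Quotient.mk_sub, hN, smul_def, smul_def]
        have := hsmul (algebraMap ℂ B c) b
        rw [hconst, mul_zero, add_zero, jd_const, if_pos rfl] at this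
        exact this }
    (fun a b => by
      change Submodule.Quotient.mk (jd k ⟨i + 1, hi⟩ (a * b)) =
        a • Submodule.Quotient.mk (jd k ⟨i + 1, hi⟩ b) +
          b • Submodule.Quotient.mk (jd k ⟨i + 1, hi⟩ a)
      rw [← Submodule.Quotient.mk_smul, ← Submodule.Quotient.mk_smul,
        ← Submodule.Quotient.mk_add, ← sub_eq_zero, ← Submodule.Quotient.mk_sub, hN]
      exact hsmul a b)
  refine (hN _).1 (L.derivation_eq_zero D (fun j => (hN _).2 ?_) b)
  by_cases hj : j ∈ L.c
  · have h := jd_succ_eq (k := k) (L.unit j hj).unit ⟨i, by omega⟩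
    have hX' : ∀ n, logD (L.unit j hj).unit n ∈ (L.ofPoly k).range := fun n => by
      have := hX j n
      rwa [letter, dif_pos hj] at this
    refine (h.symm ▸ add_mem (mul_mem (hC _) (hX' _)) (sum_mem fun n _ =>
      nsmul_mem (mul_mem (ih _ ?_ _ _) (hX' _)) _) : jd k ⟨i + 1, hi⟩
        ((L.unit j hj).unit : B) ∈ (L.ofPoly k).range)
    change i - (n : ℕ) < i + 1
    omega
  · have := hX j ⟨i, by omega⟩
    rwa [letter, dif_neg hj] at this

lemma ofPoly_surjective : Surjective (L.ofPoly k) := by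
  rw [← RingHom.range_eq_top]
  exact jetRing_closure _ fun i b => L.jd_mem_range k i i.2 b

variable [Fintype ι]

lemma total_z (j : ι) (hj : j ∉ L.c) : L.total k (C (L.z j)) = var k B j 0 := by
  rw [total_C, sum_eq_single j]
  · rw [L.θ_self j hj, map_one, one_mul]
  · intro j' _ h
    rw [L.θ_ne _ _ h, map_zero, zero_mul]
  · exact fun h => absurd (mem_univ j) h

lemma total_z_log (j : ι) (hj : j ∈ L.c) : L.total k (C (L.z j)) =
    C (L.z j) * var k B j 0 := by
  rw [total_C, sum_eq_single j]
  · rw [L.θ_log j hj]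
  · intro j' _ h
    rw [L.θ_ne _ _ h, map_zero, zero_mul]
  · exact fun h => absurd (mem_univ j) h

lemma toPoly_letter (j : ι) (i : Fin k) : L.toPoly k (L.letter k j i) = MvPolynomial.X (j, i) := by
  have e : var k B j (i : ℕ) = MvPolynomial.X (j, i) := dif_pos i.2
  rw [letter]
  split_ifs with h
  · rw [toPoly_logD, ← e, ← L.iterate_var]
    congr 1
    rw [IsUnit.unit_spec, total_z_log _ _ _ h, ← mul_assoc, ← map_mul,
      IsUnit.val_inv_mul, map_one, one_mul]
  · rw [toPoly_jd, Fin.val_succ, iterate_succ_apply, total_z _ _ _ h, iterate_var, e]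

lemma toPoly_jd0 (b : B) : L.toPoly k (jd k 0 b) = C b := L.toPoly_jd k 0 b

lemma toPoly_ofPoly (p : MvPolynomial (ι × Fin k) B) : L.toPoly k (L.ofPoly k p) = p := by
  have : (L.toPoly k).toRingHom.comp (L.ofPoly k) = RingHom.id _ := by
    refine ringHom_ext (fun b => ?_) fun v => ?_
    · change L.toPoly k (L.ofPoly k _) = _
      rw [ofPoly, eval₂Hom_C]
      exact L.toPoly_jd0 k b
    · change L.toPoly k (L.ofPoly k _) = _
      rw [ofPoly, eval₂Hom_X', toPoly_letter]
      rfl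
  exact DFunLike.congr_fun this p

lemma ofPoly_toPoly (x : JetRing k B) : L.ofPoly k (L.toPoly k x) = x := by
  obtain ⟨p, rfl⟩ := L.ofPoly_surjective k x
  rw [toPoly_ofPoly]

end LogCoord

end

section
open MvPolynomial (C)

section Types

variable {k : ℕ}

/-- The weight of a type, where letters of order `i + 1` have weight `i`. -/
def typeWeight : (Fin k →₀ ℕ) →+ ℕ where
  toFun l := l.sum fun i n => n * (i : ℕ)
  map_zero' := Finsupp.sum_zero_index
  map_add' l l' := Finsupp.sum_add_index' (by simp) (by intros; ring)

/-- The order of a type, where letters of order `i + 1` have order `i + 1`. -/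
def typeOrder : (Fin k →₀ ℕ) →+ ℕ where
  toFun l := l.sum fun i n => n * ((i : ℕ) + 1)
  map_zero' := Finsupp.sum_zero_index
  map_add' l l' := Finsupp.sum_add_index' (by simp) (by intros; ring)

lemma typeWeight_single (i : Fin k) : typeWeight (single i 1) = i :=
  (Finsupp.sum_single_index (h := fun (i : Fin k) n => n * (i : ℕ)) (zero_mul _)).trans (one_mul _)

lemma typeOrder_single (i : Fin k) : typeOrder (single i 1) = i + 1 :=
  (Finsupp.sum_single_index (h := fun (i : Fin k) n => n * ((i : ℕ) + 1)) (zero_mul _)).trans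
    (one_mul _)

lemma typeWeight_lt_typeOrder {l : Fin k →₀ ℕ} (h : l ≠ 0) : typeWeight l < typeOrder l := by
  obtain ⟨i, hi⟩ := Finsupp.ne_iff.1 h
  change ∑ i ∈ l.support, l i * (i : ℕ) < ∑ i ∈ l.support, l i * ((i : ℕ) + 1)
  exact Finset.sum_lt_sum (fun j _ => Nat.mul_le_mul_left _ (Nat.le_succ _))
    ⟨i, Finsupp.mem_support_iff.2 hi,
      Nat.mul_lt_mul_of_pos_left (Nat.lt_succ_self _) (Nat.pos_of_ne_zero hi)⟩

/-- The types that occur in the expressions of a monomial of type `l` in other letters. -/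
def lowerSet (l : Fin k →₀ ℕ) : Set (Fin k →₀ ℕ) :=
  {l' | l' = l ∨ (lexLT l' l ∧ typeWeight l' < typeWeight l)}

/-- A set of types that is stable under a change of coordinates. -/
def IsLowerType (S : Set (Fin k →₀ ℕ)) : Prop := ∀ l ∈ S, lowerSet l ⊆ S

lemma lexLT_trans {l l' l'' : Fin k →₀ ℕ} (h : lexLT l l') (h' : lexLT l' l'') :
    lexLT l l'' := by
  obtain ⟨i, hi, hij⟩ := h
  obtain ⟨i', hi', hij'⟩ := h'
  rcases lt_trichotomy i i' with h | h | h
  · exact ⟨i', by rw [hij i' h]; exact hi', fun j hj => by rw [hij j (h.trans hj), hij' j hj]⟩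
  · subst h
    exact ⟨i, hi.trans hi', fun j hj => by rw [hij j hj, hij' j hj]⟩
  · exact ⟨i, by rw [← hij' i h]; exact hi, fun j hj => by rw [hij j hj, hij' j (h.trans hj)]⟩

lemma lexLT_irrefl (l : Fin k →₀ ℕ) : ¬ lexLT l l := fun ⟨_, h, _⟩ => lt_irrefl _ h

lemma isLowerType_lowerSet (l : Fin k →₀ ℕ) : IsLowerType (lowerSet l) := by
  rintro l' (rfl | ⟨h1, h2⟩) l'' (rfl | ⟨h3, h4⟩)
  · exact Or.inl rfl
  · exact Or.inr ⟨h3, h4⟩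
  · exact Or.inr ⟨h1, h2⟩
  · exact Or.inr ⟨lexLT_trans h3 h1, h4.trans h2⟩

lemma isLowerType_lowerSet_diff (l : Fin k →₀ ℕ) : IsLowerType (lowerSet l \ {l}) := by
  rintro l' ⟨rfl | ⟨h1, h2⟩, h⟩ l'' (rfl | ⟨h3, h4⟩)
  · exact absurd rfl h
  · exact absurd rfl h
  · exact ⟨Or.inr ⟨h1, h2⟩, h⟩
  · exact ⟨Or.inr ⟨lexLT_trans h3 h1, h4.trans h2⟩, fun (e : l'' = l) =>
      lt_irrefl _ ((h4.trans h2).trans_eq (by rw [e]))⟩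

lemma isLowerType_weight (n : ℕ) : IsLowerType {l : Fin k →₀ ℕ | typeWeight l ≤ n} := by
  rintro l h l' (rfl | ⟨_, h2⟩)
  · exact h
  · exact h2.le.trans h

lemma isLowerType_le (l : Fin k →₀ ℕ) : IsLowerType {l' | lexLE l' l} := by
  rintro l' h l'' (rfl | ⟨h1, _⟩)
  · exact h
  · rcases h with rfl | h
    · exact Or.inr h1
    · exact Or.inr (lexLT_trans h1 h)

lemma isLowerType_lt (l : Fin k →₀ ℕ) : IsLowerType {l' | lexLT l' l} := by
  rintro l' h l'' (rfl | ⟨h1, _⟩)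
  · exact h
  · exact lexLT_trans h1 h

lemma lowerSet_add {l l' m m' : Fin k →₀ ℕ} (h : m ∈ lowerSet l) (h' : m' ∈ lowerSet l') :
    m + m' ∈ lowerSet (l + l') := by
  rcases h with rfl | ⟨h1, h2⟩
  · rcases h' with rfl | ⟨h1', h2'⟩
    · exact Or.inl rfl
    · refine Or.inr ⟨?_, by rw [map_add, map_add]; omega⟩
      rw [add_comm m, add_comm m]
      exact lexLT_add h1' (Or.inl rfl)
  · rcases h' with rfl | ⟨h1', h2'⟩
    · exact Or.inr ⟨lexLT_add h1 (Or.inl rfl), by rw [map_add, map_add]; omega⟩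
    · exact Or.inr ⟨lexLT_add h1 (Or.inr h1'), by rw [map_add, map_add]; omega⟩

lemma lowerSet_of_typeOrder {l : Fin k →₀ ℕ} {i : Fin k} (h : typeOrder l = i + 1) :
    l ∈ lowerSet (single i 1) := by
  have hle : ∀ j, 0 < l j → ∃ l', l = l' + single j 1 := fun j hj =>
    ⟨l - single j 1, (tsub_add_cancel_of_le (by
      rw [Finsupp.single_le_iff]; exact hj)).symm⟩
  have hj : ∀ j, 0 < l j → (j : ℕ) < i ∨ l = single i 1 := by
    intro j hj
    obtain ⟨l', rfl⟩ := hle j hj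
    rw [map_add, typeOrder_single] at h
    by_cases h0 : l' = 0
    · subst h0
      right
      rw [map_zero] at h
      rw [zero_add, show j = i from Fin.ext (by omega)]
    · left
      have := typeWeight_lt_typeOrder h0
      omega
  by_cases he : l = single i 1
  · exact Or.inl he
  right
  have hi : ∀ j, i ≤ j → l j = 0 := by
    intro j hij
    by_contra h0
    rcases hj j (Nat.pos_of_ne_zero h0) with h' | h'
    · exact absurd hij (not_le.2 h')
    · exact he h'
  refine ⟨⟨i, by rw [hi i le_rfl]; simp, fun j hij => by
    rw [hi j hij.le, Finsupp.single_apply, if_neg hij.ne]⟩, ?_⟩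
  rw [typeWeight_single]
  have h0 : l ≠ 0 := by
    rintro rfl
    rw [map_zero] at h
    omega
  obtain ⟨j, hj0⟩ := Finsupp.ne_iff.1 h0
  obtain ⟨l', rfl⟩ := hle j (Nat.pos_of_ne_zero hj0)
  rcases hj j (Nat.pos_of_ne_zero hj0) with h' | h'
  · rw [map_add, typeOrder_single] at h
    rw [map_add, typeWeight_single]
    by_cases hl : l' = 0
    · subst hl; rw [map_zero]; omega
    · have := typeWeight_lt_typeOrder hl
      omega
  · exact absurd h' he

end Types

section PolySpan

variable {k : ℕ} {ι B : Type} [CommRing B] (A₀ : Subring B)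

def monoType (m : ι × Fin k →₀ ℕ) : Fin k →₀ ℕ := m.mapDomain Prod.snd

lemma monoType_add (m m' : ι × Fin k →₀ ℕ) : monoType (m + m') = monoType m + monoType m' :=
  Finsupp.mapDomain_add

lemma monoType_zero : monoType (0 : ι × Fin k →₀ ℕ) = 0 := Finsupp.mapDomain_zero

lemma monoType_single (v : ι × Fin k) (n : ℕ) :
    monoType (single v n) = single v.2 n := Finsupp.mapDomain_single

/-- The polynomials with coefficients in `A₀` whose monomials have type in `S`. -/
def polySpan (S : Set (Fin k →₀ ℕ)) : AddSubgroup (MvPolynomial (ι × Fin k) B) where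
  carrier := {p | ∀ m, p.coeff m ∈ A₀ ∧ (p.coeff m ≠ 0 → monoType m ∈ S)}
  zero_mem' m := by simp
  add_mem' {p q} hp hq m := by
    rw [coeff_add]
    refine ⟨add_mem (hp m).1 (hq m).1, fun h => ?_⟩
    by_cases h0 : p.coeff m = 0
    · rw [h0, zero_add] at h
      exact (hq m).2 h
    · exact (hp m).2 h0
  neg_mem' {p} hp m := by
    rw [coeff_neg]
    exact ⟨neg_mem (hp m).1, fun h => (hp m).2 (neg_ne_zero.1 h)⟩

variable {A₀}

lemma polySpan_mono {S S' : Set (Fin k →₀ ℕ)} (h : S ⊆ S') :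
    (polySpan A₀ S : AddSubgroup (MvPolynomial (ι × Fin k) B)) ≤ polySpan A₀ S' :=
  fun _ hp m => ⟨(hp m).1, fun h' => h ((hp m).2 h')⟩

lemma polySpan_mul {S S' S'' : Set (Fin k →₀ ℕ)} (h : ∀ l ∈ S, ∀ l' ∈ S', l + l' ∈ S'')
    {p q : MvPolynomial (ι × Fin k) B} (hp : p ∈ polySpan A₀ S) (hq : q ∈ polySpan A₀ S') :
    p * q ∈ polySpan A₀ S'' := by
  classical
  intro m
  rw [coeff_mul]
  refine ⟨sum_mem fun x _ => mul_mem (hp _).1 (hq _).1, fun hm => ?_⟩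
  obtain ⟨x, hx, hx0⟩ := Finset.exists_ne_zero_of_sum_ne_zero hm
  rw [← mem_antidiagonal.1 hx, monoType_add]
  exact h _ ((hp _).2 (left_ne_zero_of_mul hx0)) _ ((hq _).2 (right_ne_zero_of_mul hx0))

lemma monomial_mem_polySpan {S : Set (Fin k →₀ ℕ)} {m : ι × Fin k →₀ ℕ} {a : B} (ha : a ∈ A₀)
    (hm : monoType m ∈ S) : monomial m a ∈ polySpan A₀ S := by
  classical
  intro m'
  rw [coeff_monomial]
  split_ifs with h
  · exact ⟨ha, fun _ => h ▸ hm⟩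
  · exact ⟨zero_mem _, fun h => absurd rfl h⟩

lemma C_mem_polySpan {S : Set (Fin k →₀ ℕ)} {a : B} (ha : a ∈ A₀) (hS : 0 ∈ S) :
    (C a : MvPolynomial (ι × Fin k) B) ∈ polySpan A₀ S :=
  monomial_mem_polySpan ha (by rwa [monoType_zero])

lemma X_mem_polySpan {S : Set (Fin k →₀ ℕ)} {v : ι × Fin k} (hS : single v.2 1 ∈ S) :
    (MvPolynomial.X v : MvPolynomial (ι × Fin k) B) ∈ polySpan A₀ S :=
  monomial_mem_polySpan (one_mem _) (by rwa [monoType_single])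

lemma polySpan_induction {S : Set (Fin k →₀ ℕ)} {M : Type*} [AddCommGroup M]
    (f : MvPolynomial (ι × Fin k) B →+ M) (N : AddSubgroup M)
    (h : ∀ a ∈ A₀, ∀ m, monoType m ∈ S → f (monomial m a) ∈ N)
    {p : MvPolynomial (ι × Fin k) B} (hp : p ∈ polySpan A₀ S) : f p ∈ N := by
  rw [p.as_sum, map_sum]
  exact sum_mem fun m hm => h _ (hp m).1 m ((hp m).2 (mem_support_iff.1 hm))

lemma var_mem (k : ℕ) (j : ι) (n : ℕ) :
    LogCoord.var k B j n ∈ polySpan A₀ {l : Fin k →₀ ℕ | typeOrder l = n + 1} := by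
  rw [LogCoord.var]
  split_ifs with h
  · exact X_mem_polySpan (typeOrder_single _)
  · exact zero_mem _

lemma polySpan_order_mul {n n' n'' : ℕ} (h : n + n' = n'') {p q : MvPolynomial (ι × Fin k) B}
    (hp : p ∈ polySpan A₀ {l | typeOrder l = n}) (hq : q ∈ polySpan A₀ {l | typeOrder l = n'}) :
    p * q ∈ polySpan A₀ {l | typeOrder l = n''} :=
  polySpan_mul (fun l hl l' hl' => by
    rw [Set.mem_ofPred_eq] at *
    rw [map_add, hl, hl', h]) hp hq

end PolySpan

namespace LogCoord

variable {B : Type} [CommRing B] [Algebra ℂ B] {A₀ : Subring B} {ι : Type}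
  (L : LogCoord B A₀ ι) (k : ℕ)

lemma ofPoly_C (a : B) : L.ofPoly k (C a) = jd k 0 a := eval₂Hom_C _ _ a

lemma ofPoly_X (v : ι × Fin k) : L.ofPoly k (MvPolynomial.X v) = L.letter k v.1 v.2 :=
  eval₂Hom_X' _ _ v

lemma isMono_ofPoly (m : ι × Fin k →₀ ℕ) :
    IsMono A₀ (monoType m) (L.ofPoly k (monomial m 1)) := by
  induction m using induction_linear with
  | zero =>
    rw [monoType_zero]
    have : L.ofPoly k (monomial 0 1) = 1 := map_one _
    rw [this]
    exact IsMono.one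
  | add m m' h h' =>
    have := h.mul_mono h'
    rwa [← map_mul, monomial_mul, mul_one, ← monoType_add] at this
  | single v n =>
    rw [monoType_single, ← X_pow_eq_monomial, map_pow, ofPoly_X]
    induction n with
    | zero => simpa using IsMono.one
    | succ n ih =>
      rw [pow_succ, Finsupp.single_add]
      exact ih.mul _ _ _ _ (L.letter_mem k _ _)

lemma ofPoly_mem_typeSpan {S : Set (Fin k →₀ ℕ)} {p : MvPolynomial (ι × Fin k) B}
    (hp : p ∈ polySpan A₀ S) : L.ofPoly k p ∈ typeSpan A₀ S := by
  refine polySpan_induction (L.ofPoly k).toAddMonoidHom _ (fun a ha m hm => ?_) hp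
  have : monomial m a = C a * monomial m (1 : B) := by
    rw [C_mul_monomial, mul_one]
  refine subset_closure ⟨a, ha, _, hm, _, L.isMono_ofPoly k m, ?_⟩
  change L.ofPoly k _ = _
  rw [this, map_mul, ofPoly_C]

variable [Fintype ι]

lemma total_monomial_mem (m : ι × Fin k →₀ ℕ) : L.total k (monomial m 1) ∈
    polySpan A₀ {l | typeOrder l = typeOrder (monoType m) + 1} := by
  have hm : ∀ m : ι × Fin k →₀ ℕ, (monomial m 1 : MvPolynomial (ι × Fin k) B) ∈
      polySpan A₀ {l | typeOrder l = typeOrder (monoType m)} := fun m =>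
    monomial_mem_polySpan (one_mem _) rfl
  have h1 : L.total k 1 = 0 := by
    have := L.iterate_const k 0 1
    rwa [map_one, map_one] at this
  have hmul : ∀ m m' : ι × Fin k →₀ ℕ, L.total k (monomial m 1) ∈
        polySpan A₀ {l | typeOrder l = typeOrder (monoType m) + 1} →
      L.total k (monomial m' 1) ∈ polySpan A₀ {l | typeOrder l = typeOrder (monoType m') + 1} →
      L.total k (monomial (m + m') 1) ∈
        polySpan A₀ {l | typeOrder l = typeOrder (monoType (m + m')) + 1} := by
    intro m m' h h'
    rw [← mul_one (1 : B), ← monomial_mul, total_mul, monoType_add, map_add]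
    exact add_mem (polySpan_order_mul (by ring) (hm m) h')
      (polySpan_order_mul (by ring) (hm m') h)
  induction m using induction_linear with
  | zero => exact (h1 : L.total k (monomial 0 1) = 0) ▸ zero_mem _
  | add m m' h h' => exact hmul m m' h h'
  | single v n =>
    induction n with
    | zero =>
      rw [Finsupp.single_zero]
      exact (h1 : L.total k (monomial 0 1) = 0) ▸ zero_mem _
    | succ n ih =>
      rw [Finsupp.single_add]
      refine hmul _ _ ih ?_
      change L.total k (MvPolynomial.X v) ∈ _
      rw [total_X, monoType_single, typeOrder_single]
      exact var_mem k _ _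

lemma total_mem {n : ℕ} {p : MvPolynomial (ι × Fin k) B}
    (hp : p ∈ polySpan A₀ {l | typeOrder l = n}) :
    L.total k p ∈ polySpan A₀ {l | typeOrder l = n + 1} := by
  refine polySpan_induction (L.total k) _ (fun a ha m hm => ?_) hp
  have : monomial m a = C a * monomial m (1 : B) := by
    rw [C_mul_monomial, mul_one]
  rw [this, total_mul, total_C]
  refine add_mem (polySpan_order_mul (zero_add _) (C_mem_polySpan ha (map_zero _)) ?_)
    (polySpan_order_mul rfl (monomial_mem_polySpan (one_mem _) hm) ?_)
  · have := L.total_monomial_mem k m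
    rwa [show typeOrder (monoType m) = n from hm] at this
  · exact sum_mem fun j _ => polySpan_order_mul (zero_add _)
      (C_mem_polySpan (L.θ_mem j a ha) (map_zero _)) (var_mem k j 0)

lemma iterate_total_mem {n : ℕ} {p : MvPolynomial (ι × Fin k) B}
    (hp : p ∈ polySpan A₀ {l | typeOrder l = n}) (i : ℕ) :
    (L.total k)^[i] p ∈ polySpan A₀ {l | typeOrder l = n + i} := by
  induction i with
  | zero => exact hp
  | succ i ih =>
    rw [iterate_succ_apply']
    exact L.total_mem k ih

lemma toPoly_letters {i : Fin k} {x : JetRing k B} (hx : x ∈ letters A₀ i) :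
    L.toPoly k x ∈ polySpan A₀ (lowerSet (single i 1)) := by
  have key : ∀ p ∈ polySpan A₀ {l | typeOrder l = 1}, (L.total k)^[(i : ℕ)] p ∈
      polySpan A₀ (lowerSet (single i 1)) := fun p hp =>
    polySpan_mono (fun l hl => lowerSet_of_typeOrder (by
      rw [Set.mem_ofPred_eq] at hl; rw [hl, add_comm])) (L.iterate_total_mem k hp i)
  rcases hx with ⟨a, ha, rfl⟩ | ⟨u, hu, rfl⟩
  · rw [toPoly_jd, Fin.val_succ, iterate_succ_apply, total_C]
    exact key _ (sum_mem fun j _ => polySpan_order_mul (zero_add _)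
      (C_mem_polySpan (L.θ_mem j a ha) (map_zero _)) (var_mem k j 0))
  · rw [toPoly_logD, total_C, mul_sum]
    refine key _ (sum_mem fun j _ => ?_)
    rw [← mul_assoc, ← map_mul, mul_comm]
    rw [mul_comm _ (L.θ j _), mul_comm]
    exact polySpan_order_mul (zero_add _)
      (C_mem_polySpan (L.θ_unit j u hu) (map_zero _)) (var_mem k j 0)

lemma toPoly_isMono {l : Fin k →₀ ℕ} {x : JetRing k B} (hx : IsMono A₀ l x) :
    L.toPoly k x ∈ polySpan A₀ (lowerSet l) := by
  induction hx with
  | one => rw [map_one]; exact C_mem_polySpan (one_mem _) (Or.inl rfl)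
  | mul l x i y _ hy ih =>
    rw [map_mul]
    exact polySpan_mul (fun _ h _ h' => lowerSet_add h h') ih (L.toPoly_letters k hy)

/-- In coordinates, the filtration by types becomes the filtration of polynomials by types. -/
lemma mem_typeSpan_iff {S : Set (Fin k →₀ ℕ)} (hS : IsLowerType S) {x : JetRing k B} :
    x ∈ typeSpan A₀ S ↔ L.toPoly k x ∈ polySpan A₀ S := by
  refine ⟨fun hx => ?_, fun hx => ?_⟩
  · refine closure_induction (p := fun x _ => L.toPoly k x ∈ polySpan A₀ S) ?_ ?_ ?_ ?_ hx
    · rintro x ⟨a, ha, l, hl, y, hy, rfl⟩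
      rw [map_mul, toPoly_jd0]
      exact polySpan_mul (S := {0}) (fun l' h l'' h' => by
        rw [Set.mem_singleton_iff] at h; rw [h, zero_add]; exact hS l hl h')
        (C_mem_polySpan ha rfl) (L.toPoly_isMono k hy)
    · rw [map_zero]; exact zero_mem _
    · intro u v _ _ hu hv; rw [map_add]; exact add_mem hu hv
    · intro u _ hu; rw [map_neg]; exact neg_mem hu
  · have := L.ofPoly_mem_typeSpan k hx
    rwa [ofPoly_toPoly] at this

end LogCoord

end

section
/-! ### Local rings with coordinates -/

section LocalCoordinates

open IsLocalRing

variable {R ι : Type} [CommRing R] [IsLocalRing R] [Algebra ℂ R]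

/-- Local coordinates `t` on a local ring with residue field `ℂ`, and the dual derivations. -/
structure IsLocalCoord (t : ι → R) (d : ι → Derivation ℂ R R) : Prop where
  mem : ∀ i, t i ∈ maximalIdeal R
  le : maximalIdeal R ≤ Ideal.span (Set.range t) ⊔ maximalIdeal R ^ 2
  residue : ∀ r : R, ∃ c : ℂ, r - algebraMap ℂ R c ∈ maximalIdeal R
  self : ∀ i, d i (t i) = 1
  ne : ∀ i j, i ≠ j → d i (t j) = 0

namespace IsLocalCoord

variable {t : ι → R} {d : ι → Derivation ℂ R R} (h : IsLocalCoord t d)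

lemma derivation_mem_pow (D : Derivation ℂ R R) (n : ℕ) {x : R}
    (hx : x ∈ maximalIdeal R ^ (n + 1)) : D x ∈ maximalIdeal R ^ n := by
  induction n generalizing x with
  | zero => simp
  | succ n ih =>
    rw [pow_succ] at hx
    refine Submodule.mul_induction_on hx (fun a ha b hb => ?_) fun a b ha hb => ?_
    · rw [Derivation.leibniz, smul_eq_mul, smul_eq_mul]
      refine add_mem (Ideal.mul_mem_right _ _ ha) ?_
      rw [mul_comm, pow_succ]
      exact Ideal.mul_mem_mul (ih ha) hb
    · rw [map_add]
      exact add_mem ha hb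

include h

lemma exists_linear {x : R} (hx : x ∈ maximalIdeal R) : ∃ F : MvPolynomial ι ℂ,
    F.IsHomogeneous 1 ∧ x - aeval t F ∈ maximalIdeal R ^ 2 := by
  obtain ⟨y, hy, q, hq, rfl⟩ := Submodule.mem_sup.1 (h.le hx)
  have hle : Ideal.span (Set.range t) ≤ maximalIdeal R := by
    rw [Ideal.span_le]
    rintro _ ⟨i, rfl⟩
    exact h.mem i
  suffices hs : ∃ F : MvPolynomial ι ℂ, F.IsHomogeneous 1 ∧ y - aeval t F ∈ maximalIdeal R ^ 2 by
    obtain ⟨F, hF, hyF⟩ := hs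
    exact ⟨F, hF, by rw [add_sub_right_comm]; exact add_mem hyF hq⟩
  refine Submodule.span_induction (p := fun y _ => ∃ F : MvPolynomial ι ℂ,
      F.IsHomogeneous 1 ∧ y - aeval t F ∈ maximalIdeal R ^ 2) ?_ ?_ ?_ ?_ hy
  · rintro _ ⟨i, rfl⟩
    exact ⟨MvPolynomial.X i, MvPolynomial.isHomogeneous_X _ _, by simp⟩
  · exact ⟨0, MvPolynomial.isHomogeneous_zero _ _ _, by simp⟩
  · rintro a b _ _ ⟨F, hF, haF⟩ ⟨G, hG, hbG⟩
    exact ⟨F + G, hF.add hG, by rw [map_add, add_sub_add_comm]; exact add_mem haF hbG⟩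
  · rintro r a ha ⟨F, hF, haF⟩
    obtain ⟨c, hc⟩ := h.residue r
    refine ⟨MvPolynomial.C c * F, by simpa using (MvPolynomial.isHomogeneous_C ι c).mul hF, ?_⟩
    have e : r • a - aeval t (MvPolynomial.C c * F) =
        (r - algebraMap ℂ R c) * a + algebraMap ℂ R c * (a - aeval t F) := by
      rw [map_mul, MvPolynomial.algHom_C, smul_eq_mul]
      ring
    rw [e, pow_two]
    rw [pow_two] at haF
    exact add_mem (Ideal.mul_mem_mul hc (hle ha)) (Ideal.mul_mem_left _ _ haF)

lemma exists_homogeneous (n : ℕ) {x : R} (hx : x ∈ maximalIdeal R ^ n) : ∃ F : MvPolynomial ι ℂ,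
      F.IsHomogeneous n ∧ x - aeval t F ∈ maximalIdeal R ^ (n + 1) := by
  induction n generalizing x with
  | zero =>
    obtain ⟨c, hc⟩ := h.residue x
    exact ⟨MvPolynomial.C c, MvPolynomial.isHomogeneous_C _ _, by simpa using hc⟩
  | succ n ih =>
    rw [pow_succ] at hx
    refine Submodule.mul_induction_on hx (fun a ha b hb => ?_) ?_
    · obtain ⟨F, hF, haF⟩ := ih ha
      obtain ⟨G, hG, hbG⟩ := h.exists_linear hb
      refine ⟨F * G, hF.mul hG, ?_⟩
      have e : a * b - aeval t (F * G) = (a - aeval t F) * b +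
          aeval t F * (b - aeval t G) := by
        rw [map_mul]; ring
      have hFt : aeval t F ∈ maximalIdeal R ^ n := by
        have := sub_mem ha (Ideal.pow_le_pow_right (Nat.le_succ n) haF)
        rwa [sub_sub_cancel] at this
      rw [e]
      refine add_mem ?_ ?_
      · rw [pow_succ]
        exact Ideal.mul_mem_mul haF hb
      · rw [add_assoc, pow_add]
        exact Ideal.mul_mem_mul hFt hbG
    · rintro a b ⟨F, hF, haF⟩ ⟨G, hG, hbG⟩
      exact ⟨F + G, hF.add hG, by rw [map_add, add_sub_add_comm]; exact add_mem haF hbG⟩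

lemma derivation_aeval (i : ι) (F : MvPolynomial ι ℂ) : d i (aeval t F) =
    aeval t (MvPolynomial.pderiv i F) := by
  classical
  induction F using induction_on with
  | C c => rw [MvPolynomial.pderiv_C, map_zero, MvPolynomial.algHom_C, Derivation.map_algebraMap]
  | add F G hF hG => rw [map_add, map_add, map_add, map_add, hF, hG]
  | mul_X F j hF =>
    rw [map_mul, Derivation.leibniz, Derivation.leibniz, map_add, hF, smul_eq_mul, smul_eq_mul,
      smul_eq_mul, smul_eq_mul, map_mul, map_mul, aeval_X, MvPolynomial.pderiv_X]
    congr 2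
    by_cases hj : i = j
    · subst hj
      rw [h.self, Pi.single_eq_same, map_one]
    · rw [h.ne _ _ hj, Pi.single_eq_of_ne' hj, map_zero]

lemma eq_zero_of_aeval_mem [Fintype ι] (n : ℕ) {F : MvPolynomial ι ℂ} (hF : F.IsHomogeneous n)
    (hFt : aeval t F ∈ maximalIdeal R ^ (n + 1)) : F = 0 := by
  induction n generalizing F with
  | zero =>
    rw [← MvPolynomial.totalDegree_zero_iff_isHomogeneous,
      MvPolynomial.totalDegree_eq_zero_iff_eq_C] at hF
    rw [hF, MvPolynomial.algHom_C, zero_add, pow_one] at hFt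
    by_contra h0
    have hc : F.coeff 0 ≠ 0 := fun hc => h0 (by rw [hF, hc, map_zero])
    exact (mem_maximalIdeal _).1 hFt ((IsUnit.mk0 _ hc).map (algebraMap ℂ R))
  | succ n ih =>
    have hd : ∀ i, MvPolynomial.pderiv i F = 0 := fun i => ih hF.pderiv (by
      rw [← h.derivation_aeval]
      exact derivation_mem_pow (d i) _ hFt)
    have := hF.sum_X_mul_pderiv
    simp only [hd, mul_zero, Finset.sum_const_zero] at this
    exact (smul_eq_zero.1 this.symm).resolve_left (Nat.succ_ne_zero n)

lemma isDomain [Fintype ι] [IsNoetherianRing R] : IsDomain R := by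
  have hk : ∀ x : R, x ≠ 0 → ∃ (n : ℕ) (F : MvPolynomial ι ℂ), F.IsHomogeneous n ∧ F ≠ 0 ∧
      x ∈ maximalIdeal R ^ n ∧ x - aeval t F ∈ maximalIdeal R ^ (n + 1) := by
    intro x hx
    have hex : ∃ n, x ∉ maximalIdeal R ^ n := by
      by_contra! hall
      refine hx ?_
      have : x ∈ ⨅ n : ℕ, maximalIdeal R ^ n := Ideal.mem_iInf.2 hall
      rwa [Ideal.iInf_pow_eq_bot_of_isLocalRing _ (Ideal.IsPrime.ne_top')] at this
    classical
    obtain ⟨n, hn⟩ : ∃ n, Nat.find hex = n + 1 := Nat.exists_eq_succ_of_ne_zero (fun h0 => by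
      have := Nat.find_spec hex
      rw [h0, pow_zero, Ideal.one_eq_top] at this
      exact this trivial)
    have h1 := Nat.find_spec hex
    have h2 := Nat.find_min hex (m := n) (by omega)
    rw [hn] at h1
    rw [not_not] at h2
    obtain ⟨F, hF, hxF⟩ := h.exists_homogeneous n h2
    refine ⟨n, F, hF, ?_, h2, hxF⟩
    rintro rfl
    rw [map_zero, sub_zero] at hxF
    exact h1 hxF
  have : NoZeroDivisors R := by
    refine ⟨fun {a b} hab => ?_⟩
    by_contra! h0
    obtain ⟨n, F, hF, hF0, han, haF⟩ := hk a h0.1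
    obtain ⟨m, G, hG, hG0, hbm, hbG⟩ := hk b h0.2
    refine mul_ne_zero hF0 hG0 (h.eq_zero_of_aeval_mem (n + m) (hF.mul hG) ?_)
    have e : aeval t (F * G) = -((a - aeval t F) * b + aeval t F * (b - aeval t G)) := by
      have : aeval t (F * G) = aeval t (F * G) - a * b := by
        rw [hab, sub_zero]
      rw [this, map_mul]
      ring
    have hFt : aeval t F ∈ maximalIdeal R ^ n := by
      have := sub_mem han (Ideal.pow_le_pow_right (Nat.le_succ n) haF)
      rwa [sub_sub_cancel] at this
    rw [e]
    refine neg_mem (add_mem ?_ ?_)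
    · rw [show n + m + 1 = n + 1 + m by ring, pow_add]
      exact Ideal.mul_mem_mul haF hbm
    · rw [add_assoc, pow_add]
      exact Ideal.mul_mem_mul hFt hbG
  exact NoZeroDivisors.to_isDomain R

lemma prime [Fintype ι] [IsNoetherianRing R] (j : ι) : Prime (t j) := by
  classical
  have hj0 : t j ≠ 0 := fun h0 => by
    have := h.self j
    rw [h0, map_zero] at this
    exact zero_ne_one this
  rw [← Ideal.span_singleton_prime hj0, ← Ideal.Quotient.isDomain_iff_prime]
  have hle : Ideal.span {t j} ≤ maximalIdeal R := by
    rw [Ideal.span_le, Set.singleton_subset_iff]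
    exact h.mem j
  have : Nontrivial (R ⧸ Ideal.span {t j}) := Ideal.Quotient.nontrivial_iff.2 fun h' =>
    Ideal.IsPrime.ne_top' (top_le_iff.1 (h' ▸ hle))
  have hs : Surjective (Ideal.Quotient.mkₐ ℂ (Ideal.span {t j})) := mk_surjective
  have hloc : IsLocalRing (R ⧸ Ideal.span {t j}) :=
    IsLocalRing.of_surjective' (Ideal.Quotient.mk (Ideal.span {t j})) mk_surjective
  have hmax : maximalIdeal (R ⧸ Ideal.span {t j}) =
      (maximalIdeal R).map (Ideal.Quotient.mk (Ideal.span {t j})) := by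
    have hl := IsLocalHom.of_surjective (Ideal.Quotient.mk (Ideal.span {t j})) mk_surjective
    refine le_antisymm (fun x hx => ?_) ?_
    · obtain ⟨r, rfl⟩ := mk_surjective x
      exact Ideal.mem_map_of_mem _ ((mem_maximalIdeal r).2 fun hr =>
        (mem_maximalIdeal _).1 hx (hr.map _))
    · rw [Ideal.map_le_iff_le_comap]
      intro r hr
      exact (mem_maximalIdeal _).2 fun hu => (mem_maximalIdeal r).1 hr (hl.map_nonunit r hu)
  have hd : ∀ i : {i // i ≠ j}, ∀ x, Ideal.Quotient.mkₐ ℂ (Ideal.span {t j}) x = 0 →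
      Ideal.Quotient.mkₐ ℂ (Ideal.span {t j}) (d i x) = 0 := by
    intro i x hx
    obtain ⟨r, rfl⟩ := Ideal.mem_span_singleton'.1 (eq_zero_iff_mem.1 hx)
    refine eq_zero_iff_mem.2 ?_
    rw [Derivation.leibniz, h.ne _ _ i.2, smul_zero, zero_add]
    exact Ideal.mul_mem_right _ _ (Ideal.mem_span_singleton_self _)
  have key : IsLocalCoord (fun i : {i // i ≠ j} => Ideal.Quotient.mkₐ ℂ (Ideal.span {t j}) (t i))
      (fun i => Derivation.liftOfSurjective hs (hd i)) :=
    { mem := fun i => by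
        rw [hmax]; exact Ideal.mem_map_of_mem _ (h.mem i)
      le := by
        rw [hmax, ← Ideal.map_pow]
        refine (Ideal.map_mono h.le).trans ?_
        rw [Ideal.map_sup, Ideal.map_span]
        refine sup_le_sup_right ?_ _
        rw [Ideal.span_le]
        rintro _ ⟨_, ⟨i, rfl⟩, rfl⟩
        by_cases hi : i = j
        · subst hi
          rw [(eq_zero_iff_mem).2 (Ideal.mem_span_singleton_self _)]
          exact zero_mem _
        · exact Ideal.subset_span ⟨⟨i, hi⟩, rfl⟩
      residue := fun r => by
        obtain ⟨r, rfl⟩ := mk_surjective r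
        obtain ⟨c, hc⟩ := h.residue r
        refine ⟨c, ?_⟩
        rw [hmax]
        have := Ideal.mem_map_of_mem (Ideal.Quotient.mk (Ideal.span {t j})) hc
        rwa [map_sub] at this
      self := fun i => by
        rw [Derivation.liftOfSurjective_apply hs (hd i), h.self, map_one]
      ne := fun i i' hi => by
        rw [Derivation.liftOfSurjective_apply hs (hd i),
          h.ne _ _ (fun e => hi (Subtype.ext e)), map_zero] }
  exact key.isDomain

end IsLocalCoord

end LocalCoordinates

/-- The divisors of a product of primes that divide their own derivatives have the same property. -/
lemma dvd_derivation_of_mul_eq {R : Type} [CommRing R] [IsDomain R] [Algebra ℂ R]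
    (D : Derivation ℂ R R) (s : Multiset R) (hs : ∀ p ∈ s, Prime p ∧ p ∣ D p) {u : R}
    (hu : IsUnit u) {x y : R} (h : x * y = u * s.prod) : x ∣ D x := by
  induction s using Multiset.induction_on generalizing x y with
  | empty =>
    rw [Multiset.prod_zero, mul_one] at h
    rw [← h] at hu
    exact (isUnit_of_mul_isUnit_left hu).dvd
  | cons p s ih =>
    have hs' := fun q hq => hs q (Multiset.mem_cons_of_mem hq)
    obtain ⟨hp, hpD⟩ := hs p (Multiset.mem_cons_self p s)
    have hdvd : p ∣ x * y := ⟨u * s.prod, by rw [h, Multiset.prod_cons]; ring⟩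
    rcases hp.dvd_or_dvd hdvd with ⟨x', rfl⟩ | ⟨y', rfl⟩
    · have : x' ∣ D x' := ih hs' (y := y) (mul_left_cancel₀ hp.ne_zero (by
        rw [← mul_assoc, h, Multiset.prod_cons]; ring))
      rw [Derivation.leibniz, smul_eq_mul, smul_eq_mul, mul_comm x']
      exact dvd_add (mul_dvd_mul_left p this) (mul_dvd_mul_right hpD x')
    · exact ih hs' (y := y') (mul_left_cancel₀ hp.ne_zero (by
        rw [mul_left_comm, h, Multiset.prod_cons]; ring))

end

section
/-- Functions whose differentials form a basis of the module of differentials. -/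
structure IsCoord {B ι : Type} [CommRing B] [Algebra ℂ B] (z : ι → B) : Prop where
  linearIndependent : LinearIndependent B fun i => D ℂ B (z i)
  span : Submodule.span B (Set.range fun i => D ℂ B (z i)) = ⊤

namespace IsCoord

variable {B ι : Type} [CommRing B] [Algebra ℂ B] {z : ι → B} (h : IsCoord z)

def basis : Module.Basis ι B (Ω[B⁄ℂ]) := Module.Basis.mk h.linearIndependent h.span.ge

lemma basis_apply (i : ι) : h.basis i = D ℂ B (z i) := Module.Basis.mk_apply _ _ i

def der (i : ι) : Derivation ℂ B B := (h.basis.coord i).compDer (D ℂ B)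

lemma der_apply (i : ι) (x : B) : h.der i x = h.basis.repr (D ℂ B x) i := rfl

lemma der_self (i : ι) : h.der i (z i) = 1 := by
  rw [der_apply, ← h.basis_apply, Module.Basis.repr_self, single_eq_same]

lemma der_ne {i j : ι} (hij : i ≠ j) : h.der i (z j) = 0 := by
  rw [der_apply, ← h.basis_apply, Module.Basis.repr_self, single_eq_of_ne hij]

section Localization

variable (M : Submonoid B) (C : Type) [CommRing C] [Algebra ℂ C] [Algebra B C]
  [IsScalarTower ℂ B C] [IsLocalization M C]

include h M in
lemma localize : IsCoord fun i => algebraMap B C (z i) := by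
  have e : (fun i => D ℂ C (algebraMap B C (z i))) =
      h.basis.ofIsLocalizedModule C M (KaehlerDifferential.map ℂ ℂ B C) := by
    funext i
    rw [Module.Basis.ofIsLocalizedModule_apply, basis_apply, KaehlerDifferential.map_D]
  constructor
  · rw [e]; exact Module.Basis.linearIndependent _
  · rw [e]; exact Module.Basis.span_eq _

lemma der_localize (i : ι) (x : B) :
    (h.localize M C).der i (algebraMap B C x) = algebraMap B C (h.der i x) := by
  have e : (h.localize M C).basis =
      h.basis.ofIsLocalizedModule C M (KaehlerDifferential.map ℂ ℂ B C) := by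
    refine Module.Basis.eq_of_apply_eq fun j => ?_
    rw [Module.Basis.ofIsLocalizedModule_apply, basis_apply, basis_apply, KaehlerDifferential.map_D]
  rw [der_apply, e, ← KaehlerDifferential.map_D ℂ ℂ B C,
    Module.Basis.ofIsLocalizedModule_repr_apply, der_apply]

end Localization

section LogDer

variable (c : Finset ι)

open Classical in
/-- The derivations dual to the logarithmic forms `dz i / z i` for `i ∈ c` and the `dz i` for the
other `i`. -/
def logDer (i : ι) : Derivation ℂ B B := if i ∈ c then z i • h.der i else h.der i

lemma logDer_localize (M : Submonoid B) (C : Type) [CommRing C] [Algebra ℂ C] [Algebra B C]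
    [IsScalarTower ℂ B C] [IsLocalization M C] (i : ι) (x : B) :
    (h.localize M C).logDer c i (algebraMap B C x) = algebraMap B C (h.logDer c i x) := by
  rw [logDer, logDer]
  split_ifs
  · rw [Derivation.smul_apply, Derivation.smul_apply, h.der_localize M C, smul_eq_mul, smul_eq_mul,
      map_mul]
  · exact der_localize h M C i x

lemma logDer_ne {i j : ι} (hij : i ≠ j) : h.logDer c i (z j) = 0 := by
  rw [logDer]
  split_ifs
  · rw [Derivation.smul_apply, h.der_ne hij, smul_zero]
  · exact h.der_ne hij

lemma logDer_self {i : ι} (hi : i ∉ c) : h.logDer c i (z i) = 1 := by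
  rw [logDer, if_neg hi, der_self]

lemma logDer_log {i : ι} (hi : i ∈ c) : h.logDer c i (z i) = z i := by
  rw [logDer, if_pos hi, Derivation.smul_apply, der_self, smul_eq_mul, mul_one]

end LogDer

variable [Algebra.FiniteType ℂ B]

lemma exists_residue (m : Ideal B) [m.IsMaximal] (r : B) : ∃ c : ℂ, r - algebraMap ℂ B c ∈ m := by
  let _ := Ideal.Quotient.field m
  have := finite_of_finite_type_of_isJacobsonRing ℂ (B ⧸ m)
  obtain ⟨c, hc⟩ := (IsAlgClosed.algebraMap_bijective_of_isIntegral (k := ℂ) (K := B ⧸ m)).2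
    (Ideal.Quotient.mk m r)
  refine ⟨c, ?_⟩
  rw [← eq_zero_iff_mem, map_sub, ← hc]
  exact sub_self _

include h in
lemma le_span_sup (m : Ideal B) [m.IsMaximal] (c : ι → ℂ)
    (hc : ∀ i, z i - algebraMap ℂ B (c i) ∈ m) :
    m ≤ Ideal.span (Set.range fun i => z i - algebraMap ℂ B (c i)) ⊔ m ^ 2 := by
  choose ev hev using exists_residue (B := B) m
  have huniq : ∀ (x : B) (a : ℂ), x - algebraMap ℂ B a ∈ m → ev x = a := by
    intro x a ha
    by_contra hne
    have hm : algebraMap ℂ B (ev x - a) ∈ m := by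
      have := sub_mem ha (hev x)
      rwa [sub_sub_sub_cancel_left, ← map_sub] at this
    exact Ideal.IsPrime.ne_top' (Ideal.eq_top_of_isUnit_mem _ hm
      ((IsUnit.mk0 _ (sub_ne_zero.2 hne)).map (algebraMap ℂ B)))
  set J := Ideal.span (Set.range fun i => z i - algebraMap ℂ B (c i)) ⊔ m ^ 2 with hJ
  have hadd : ∀ a b, ev (a + b) = ev a + ev b := fun a b => huniq _ _ (by
    rw [map_add, add_sub_add_comm]; exact add_mem (hev a) (hev b))
  have hsmul : ∀ (a : ℂ) b, ev (a • b) = a * ev b := fun a b => huniq _ _ (by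
    rw [map_mul, smul_def, ← mul_sub]
    exact Ideal.mul_mem_left _ _ (hev b))
  have hmul : ∀ a b, ev (a * b) = ev a * ev b := fun a b => huniq _ _ (by
    have e : a * b - algebraMap ℂ B (ev a * ev b) =
        a * (b - algebraMap ℂ B (ev b)) + algebraMap ℂ B (ev b) * (a - algebraMap ℂ B (ev a)) := by
      rw [map_mul]; ring
    rw [e]
    exact add_mem (Ideal.mul_mem_left _ _ (hev b)) (Ideal.mul_mem_left _ _ (hev a)))
  let D : Derivation ℂ B (B ⧸ J) := Derivation.mk'
    { toFun := fun x => Ideal.Quotient.mk J (x - algebraMap ℂ B (ev x))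
      map_add' := fun a b => by
        rw [hadd, map_add, add_sub_add_comm, map_add]
      map_smul' := fun a b => by
        rw [hsmul, map_mul, smul_def, ← mul_sub, RingHom.id_apply, map_mul, smul_def]
        rfl }
    (fun a b => by
      change Ideal.Quotient.mk J (a * b - algebraMap ℂ B (ev (a * b))) =
        Ideal.Quotient.mk J a * Ideal.Quotient.mk J (b - algebraMap ℂ B (ev b)) +
          Ideal.Quotient.mk J b * Ideal.Quotient.mk J (a - algebraMap ℂ B (ev a))
      rw [← map_mul, ← map_mul, ← map_add, ← sub_eq_zero, ← map_sub, eq_zero_iff_mem, hmul]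
      have e : a * b - algebraMap ℂ B (ev a * ev b) - (a * (b - algebraMap ℂ B (ev b)) +
          b * (a - algebraMap ℂ B (ev a))) =
          -((a - algebraMap ℂ B (ev a)) * (b - algebraMap ℂ B (ev b))) := by
        rw [map_mul]; ring
      rw [e]
      exact neg_mem (Ideal.mem_sup_right (pow_two m ▸ Ideal.mul_mem_mul (hev a) (hev b))))
  intro x hx
  have h0 : ev x = 0 := huniq _ _ (by rwa [map_zero, sub_zero])
  have h1 : Ideal.Quotient.mk J (x - algebraMap ℂ B (ev x)) = 0 :=
    derivation_eq_zero_of_span z h.span D (fun i => eq_zero_iff_mem.2 (by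
      rw [huniq _ _ (hc i)]
      exact Ideal.mem_sup_left (Ideal.subset_span ⟨i, rfl⟩))) x
  rwa [h0, map_zero, sub_zero, eq_zero_iff_mem] at h1

lemma isLocalCoord (m : Ideal B) [m.IsMaximal] (c : ι → ℂ)
    (hc : ∀ i, z i - algebraMap ℂ B (c i) ∈ m) :
    IsLocalCoord (fun i => algebraMap B (AtPrime m) (z i - algebraMap ℂ B (c i)))
      (h.localize m.primeCompl (AtPrime m)).der := by
  have hmax := Localization.AtPrime.map_eq_maximalIdeal (I := m)
  have hder : ∀ i j, (h.localize m.primeCompl (AtPrime m)).der i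
      (algebraMap B (AtPrime m) (z j - algebraMap ℂ B (c j))) =
        algebraMap B (AtPrime m) (h.der i (z j)) := by
    intro i j
    rw [h.der_localize m.primeCompl, map_sub, Derivation.map_algebraMap, sub_zero]
  exact
    { mem := fun i => hmax ▸ Ideal.mem_map_of_mem _ (hc i)
      le := by
        rw [← hmax, ← Ideal.map_pow]
        refine (Ideal.map_mono (h.le_span_sup m c hc)).trans ?_
        rw [Ideal.map_sup, Ideal.map_span, ← Set.range_comp]
        rfl
      residue := fun r => by
        obtain ⟨⟨a, s⟩, hr⟩ := IsLocalization.surj m.primeCompl r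
        obtain ⟨α, hα⟩ := exists_residue m a
        obtain ⟨σ, hσ⟩ := exists_residue m (s : B)
        have hσ0 : σ ≠ 0 := by
          rintro rfl
          rw [map_zero, sub_zero] at hσ
          exact s.2 hσ
        refine ⟨α / σ, ?_⟩
        have hs : IsUnit (algebraMap B (AtPrime m) s) := IsLocalization.map_units _ s
        have e : algebraMap B (AtPrime m) s * (r - algebraMap ℂ (AtPrime m) (α / σ)) =
              algebraMap B (AtPrime m) ((a - algebraMap ℂ B α) -
                algebraMap ℂ B (α / σ) * (s - algebraMap ℂ B σ)) := by
          have e' : (a - algebraMap ℂ B α) - algebraMap ℂ B (α / σ) * (s - algebraMap ℂ B σ) =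
              a - s * algebraMap ℂ B (α / σ) := by
            rw [mul_sub, ← map_mul, div_mul_cancel₀ _ hσ0]
            ring
          rw [e', map_sub, map_mul, ← IsScalarTower.algebraMap_apply, mul_sub, mul_comm _ r]
          exact congrArg (· - _) hr
        rw [← Ideal.unit_mul_mem_iff_mem _ hs, e, ← hmax]
        exact Ideal.mem_map_of_mem _ (sub_mem hα (Ideal.mul_mem_left _ _ hσ))
      self := fun i => by rw [hder, der_self, map_one]
      ne := fun i j hij => by rw [hder, der_ne _ hij, map_zero] }

section Log

variable [Fintype ι] (c : Finset ι)

include h in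
lemma isDomain_localization (m : Ideal B) [m.IsMaximal] : IsDomain (AtPrime m) := by
  have : IsNoetherianRing B := Algebra.FiniteType.isNoetherianRing ℂ B
  have : IsNoetherianRing (AtPrime m) :=
    IsLocalization.isNoetherianRing m.primeCompl _ inferInstance
  choose a ha using fun i => exists_residue m (z i)
  exact (h.isLocalCoord m a ha).isDomain

include h in
lemma prime_localization (m : Ideal B) [m.IsMaximal] (i : ι) (hi : z i ∈ m) :
    Prime (algebraMap B (AtPrime m) (z i)) := by
  have : IsNoetherianRing B := Algebra.FiniteType.isNoetherianRing ℂ B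
  have : IsNoetherianRing (AtPrime m) :=
    IsLocalization.isNoetherianRing m.primeCompl _ inferInstance
  classical
  choose a ha using fun i => exists_residue m (z i)
  have ha' : ∀ j, z j - algebraMap ℂ B (Function.update a i 0 j) ∈ m := by
    intro j
    by_cases hj : j = i
    · subst hj
      rw [Function.update_self, map_zero, sub_zero]
      exact hi
    · rw [Function.update_of_ne hj]
      exact ha j
  have := (h.isLocalCoord m _ ha').prime i
  rwa [Function.update_self, map_zero, sub_zero] at this

include h in
lemma prod_mem_nonZeroDivisors : ∏ i ∈ c, z i ∈ nonZeroDivisors B := by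
  rw [mem_nonZeroDivisors_iff_right]
  intro x hx
  refine eq_zero_of_localization x fun m hm => ?_
  have := h.isDomain_localization m
  have hx' := congrArg (algebraMap B (AtPrime m)) hx
  rw [map_mul, map_zero, map_prod] at hx'
  refine (mul_eq_zero.1 hx').resolve_right (Finset.prod_ne_zero_iff.2 fun i _ => ?_)
  by_cases hi : z i ∈ m
  · exact (h.prime_localization m i hi).ne_zero
  · exact (IsLocalization.map_units (M := m.primeCompl) (AtPrime m) ⟨z i, hi⟩).ne_zero

lemma dvd_logDer (N : ℕ) {x y : B} (hxy : x * y = (∏ i ∈ c, z i) ^ N) (i : ι) :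
    x ∣ h.logDer c i x := by
  classical
  rw [← Ideal.mem_span_singleton]
  refine Ideal.mem_of_localization_maximal fun m hm => ?_
  have := h.isDomain_localization m
  rw [Ideal.map_span, Set.image_singleton, Ideal.mem_span_singleton,
    ← h.logDer_localize c m.primeCompl (AtPrime m)]
  have hc : ∏ i ∈ c, z i = (∏ i ∈ c with z i ∉ m, z i) * ∏ i ∈ c with z i ∈ m, z i := by
    rw [mul_comm, Finset.prod_filter_mul_prod_filter_not]
  refine dvd_derivation_of_mul_eq _ (N • ((c.filter fun i => z i ∈ m).val.map
    fun i => algebraMap B (AtPrime m) (z i))) ?_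
    (u := algebraMap B (AtPrime m) ((∏ i ∈ c with z i ∉ m, z i) ^ N)) ?_
    (y := algebraMap B (AtPrime m) y) ?_
  · intro p hp
    obtain ⟨j, hj, rfl⟩ := Multiset.mem_map.1 (Multiset.mem_of_mem_nsmul hp)
    obtain ⟨hjc, hjm⟩ := mem_filter.1 hj
    refine ⟨h.prime_localization m j hjm, ?_⟩
    rw [h.logDer_localize c m.primeCompl]
    refine map_dvd _ ?_
    by_cases hij : i = j
    · subst hij
      rw [h.logDer_log c hjc]
    · rw [h.logDer_ne c hij]
      exact dvd_zero _
  · have hp : (∏ i ∈ c with z i ∉ m, z i) ^ N ∈ m.primeCompl :=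
      pow_mem (prod_mem fun j hj => by have h' := (mem_filter.1 hj).2; exact h') N
    exact IsLocalization.map_units (AtPrime m) ⟨_, hp⟩
  · rw [Multiset.prod_nsmul, ← map_mul, hxy, hc, mul_pow, map_mul, map_pow _ (∏ i ∈ c with z i ∈ m, z i),
      map_prod]
    rfl

variable (C : Type) [CommRing C] [Algebra ℂ C] [Algebra B C]
  [IsScalarTower ℂ B C] [IsLocalization.Away (∏ i ∈ c, z i) C]

/-- Coordinates on `B` as logarithmic coordinates on the complement of the zeros of some of them. -/
def logCoord : LogCoord C (algebraMap B C).range ι where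
  z i := algebraMap B C (z i)
  z_mem i := ⟨_, rfl⟩
  c := c
  unit i hi := isUnit_of_dvd_unit (map_dvd _ (Finset.dvd_prod_of_mem z hi))
    (algebraMap_isUnit (S := C) (∏ i ∈ c, z i))
  θ := (h.localize (powers (∏ i ∈ c, z i)) C).logDer c
  θ_ne i j hij := IsCoord.logDer_ne _ c hij
  θ_self i hi := IsCoord.logDer_self _ c hi
  θ_log i hi := IsCoord.logDer_log _ c hi
  θ_mem := by
    rintro i _ ⟨a, rfl⟩
    exact ⟨h.logDer c i a, (h.logDer_localize c (powers (∏ i ∈ c, z i)) C i a).symm⟩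
  θ_unit := by
    rintro i u ⟨x, hx⟩
    obtain ⟨⟨y, ⟨_, n, rfl⟩⟩, hy⟩ := IsLocalization.surj (powers (∏ i ∈ c, z i)) ((u⁻¹ : Cˣ) : C)
    have h1 : algebraMap B C (x * y) = algebraMap B C ((∏ i ∈ c, z i) ^ n) := by
      rw [map_mul, hx, ← hy, ← mul_assoc, Units.mul_inv, one_mul]
    have h2 : x * y = (∏ i ∈ c, z i) ^ n := IsLocalization.injective C
      (Submonoid.powers_le.2 (h.prod_mem_nonZeroDivisors c)) h1
    obtain ⟨w, hw⟩ := h.dvd_logDer c n h2 i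
    refine ⟨w, ?_⟩
    rw [← hx, h.logDer_localize c (powers (∏ i ∈ c, z i)), hw, map_mul, hx, mul_comm (u : C), mul_assoc, Units.mul_inv,
      mul_one]
  span := (h.localize (powers (∏ i ∈ c, z i)) C).span

end Log

end IsCoord

end

section
section JetLocalization

variable {k : ℕ} {B : Type} [CommRing B] [Algebra ℂ B]

abbrev TruncSeries (k : ℕ) (L : Type) [CommRing L] : Type :=
  PowerSeries L ⧸ Ideal.span {(PowerSeries.X : PowerSeries L) ^ (k + 1)}

lemma truncSeries_mk_eq {L : Type} [CommRing L] {p q : PowerSeries L} :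
    (Ideal.Quotient.mk (Ideal.span {(PowerSeries.X : PowerSeries L) ^ (k + 1)}) p =
      Ideal.Quotient.mk _ q) ↔ ∀ i < k + 1, PowerSeries.coeff i p = PowerSeries.coeff i q := by
  rw [Ideal.Quotient.eq, Ideal.mem_span_singleton, PowerSeries.X_pow_dvd_iff]
  simp only [map_sub, sub_eq_zero]

def truncCoeff {L : Type} [CommRing L] (i : Fin (k + 1)) (p : TruncSeries k L) : L :=
  PowerSeries.coeff (i : ℕ) (Quotient.out p)

lemma truncCoeff_mk {L : Type} [CommRing L] (i : Fin (k + 1)) (p : PowerSeries L) :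
    truncCoeff (k := k) i (Ideal.Quotient.mk _ p) = PowerSeries.coeff (i : ℕ) p :=
  truncSeries_mk_eq.1 (Ideal.Quotient.mk_out (Ideal.Quotient.mk _ p)) i i.2

variable {L : Type} [CommRing L] [Algebra ℂ L]

def taylorSeries (φ : JetRing k B →ₐ[ℂ] L) (b : B) : PowerSeries L :=
  PowerSeries.mk fun i => if h : i < k + 1 then
    algebraMap ℂ L (i.factorial : ℂ)⁻¹ * φ (jd k ⟨i, h⟩ b) else 0

lemma coeff_taylorSeries (φ : JetRing k B →ₐ[ℂ] L) (b : B) (i : Fin (k + 1)) :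
    PowerSeries.coeff (i : ℕ) (taylorSeries φ b) =
      algebraMap ℂ L ((i : ℕ).factorial : ℂ)⁻¹ * φ (jd k i b) := by
  rw [taylorSeries, PowerSeries.coeff_mk, dif_pos i.2]

lemma choose_mul_factorial_inv {n i j : ℕ} (h : i + j = n) :
    (n.factorial : ℂ)⁻¹ * n.choose i = (i.factorial : ℂ)⁻¹ * (j.factorial : ℂ)⁻¹ := by
  have hi : (i.factorial : ℂ) ≠ 0 := Nat.cast_ne_zero.2 i.factorial_ne_zero
  have hj : (j.factorial : ℂ) ≠ 0 := Nat.cast_ne_zero.2 j.factorial_ne_zero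
  have hn : (n.factorial : ℂ) ≠ 0 := Nat.cast_ne_zero.2 n.factorial_ne_zero
  have := Nat.choose_mul_factorial_mul_factorial (n := n) (k := i) (by omega)
  rw [show n - i = j by omega] at this
  have h' : (n.choose i : ℂ) * i.factorial * j.factorial = n.factorial := by exact_mod_cast this
  field_simp
  linear_combination h'

def taylorHom (φ : JetRing k B →ₐ[ℂ] L) : B →+* TruncSeries k L where
  toFun b := Ideal.Quotient.mk _ (taylorSeries φ b)
  map_one' := by
    rw [← map_one (Ideal.Quotient.mk _), truncSeries_mk_eq]
    intro i hi
    have h := coeff_taylorSeries φ 1 ⟨i, hi⟩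
    rw [← map_one (algebraMap ℂ B), jd_const] at h
    rw [← map_one (algebraMap ℂ B), h, PowerSeries.coeff_one]
    by_cases h0 : i = 0
    · subst h0
      simp
    · rw [if_neg (fun e => h0 (congrArg Fin.val e)), if_neg h0, map_zero, mul_zero]
  map_mul' a b := by
    rw [← map_mul, truncSeries_mk_eq]
    intro i hi
    have h := coeff_taylorSeries φ (a * b) ⟨i, hi⟩
    rw [jd_mul, map_sum, mul_sum] at h
    have hsum := sum_fin_filter_eq_antidiagonal (k := k) ⟨i, hi⟩ fun p q =>
      PowerSeries.coeff p (taylorSeries φ a) * PowerSeries.coeff q (taylorSeries φ b)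
    change _ = ∑ p ∈ antidiagonal i, _ at hsum
    refine h.trans (Eq.trans (sum_congr rfl fun p hp => ?_)
      (hsum.trans (PowerSeries.coeff_mul _ _ _).symm))
    rw [coeff_taylorSeries, coeff_taylorSeries, map_nsmul, map_mul, nsmul_eq_mul,
      ← map_natCast (algebraMap ℂ L)]
    have e := congrArg (algebraMap ℂ L) (choose_mul_factorial_inv (mem_filter.1 hp).2)
    rw [map_mul, map_mul] at e
    calc _ = (algebraMap ℂ L ((i.factorial : ℂ)⁻¹) * algebraMap ℂ L (i.choose p.1)) *
        (φ (jd k p.1 a) * φ (jd k p.2 b)) := by ring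
      _ = _ := by
        refine (congrArg (· * (φ (jd k p.1 a) * φ (jd k p.2 b))) e).trans ?_
        ring
  map_zero' := by
    rw [← map_zero (Ideal.Quotient.mk _), truncSeries_mk_eq]
    intro i hi
    have h := coeff_taylorSeries φ 0 ⟨i, hi⟩
    have h0 : jd k ⟨i, hi⟩ (0 : B) = 0 := by
      have := jd_add (k := k) ⟨i, hi⟩ (0 : B) 0
      rw [add_zero] at this
      exact left_eq_add.1 this
    rw [h0, map_zero, mul_zero] at h
    rw [h, map_zero]
  map_add' a b := by
    rw [← map_add, truncSeries_mk_eq]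
    intro i hi
    rw [map_add]
    have h := fun x => coeff_taylorSeries φ x ⟨i, hi⟩
    exact (h _).trans (by rw [jd_add, map_add, mul_add, ← h, ← h])

lemma truncCoeff_taylorHom (φ : JetRing k B →ₐ[ℂ] L) (b : B) (i : Fin (k + 1)) :
    truncCoeff i (taylorHom φ b) = algebraMap ℂ L ((i : ℕ).factorial : ℂ)⁻¹ * φ (jd k i b) :=
  (truncCoeff_mk _ _).trans (coeff_taylorSeries _ _ _)

variable {C : Type} [CommRing C] [Algebra ℂ C]

/-- A homomorphism to truncated power series defines a jet. -/
def jetOfHom (Φ : C →+* TruncSeries k L) (hΦ : ∀ c : ℂ, Φ (algebraMap ℂ C c) =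
    Ideal.Quotient.mk _ (PowerSeries.C (algebraMap ℂ L c))) : JetRing k C →ₐ[ℂ] L :=
  jetLift (fun i c => algebraMap ℂ L ((i : ℕ).factorial : ℂ) * truncCoeff i (Φ c)) (by
      intro i a b
      obtain ⟨p, hp⟩ := mk_surjective (Φ a)
      obtain ⟨q, hq⟩ := mk_surjective (Φ b)
      rw [map_add, ← hp, ← hq, ← map_add, truncCoeff_mk, truncCoeff_mk, truncCoeff_mk, map_add,
        mul_add])
    (by
      intro i a b
      obtain ⟨p, hp⟩ := mk_surjective (Φ a)
      obtain ⟨q, hq⟩ := mk_surjective (Φ b)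
      have hsum := sum_fin_filter_eq_antidiagonal i fun m n =>
        PowerSeries.coeff m p * PowerSeries.coeff n q
      rw [map_mul, ← hp, ← hq, ← map_mul, truncCoeff_mk, PowerSeries.coeff_mul, ← hsum, mul_sum]
      refine sum_congr rfl fun r hr => ?_
      rw [truncCoeff_mk, truncCoeff_mk, nsmul_eq_mul, ← map_natCast (algebraMap ℂ L)]
      have hr' := (mem_filter.1 hr).2
      have := Nat.choose_mul_factorial_mul_factorial (n := (i : ℕ)) (k := (r.1 : ℕ)) (by omega)
      rw [show (i : ℕ) - r.1 = r.2 by omega] at this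
      rw [← this]
      push_cast
      ring)
    (by
      intro i c
      rw [hΦ, truncCoeff_mk, PowerSeries.coeff_C]
      by_cases h : i = 0
      · subst h
        simp
      · have h' : (i : ℕ) ≠ 0 := fun e => h (Fin.ext e)
        rw [if_neg h, if_neg h', mul_zero])

lemma exists_extend_jet (g : B →ₐ[ℂ] C) (f : B)
    (hloc : letI := g.toRingHom.toAlgebra; IsLocalization.Away f C) (φ : JetRing k B →ₐ[ℂ] L)
    (hf : IsUnit (φ (jd k 0 f))) :
    ∃ ψ : JetRing k C →ₐ[ℂ] L, ∀ x, ψ (jetMap k g x) = φ x := by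
  let _ := g.toRingHom.toAlgebra
  have hu : IsUnit (taylorHom φ f) := by
    refine IsUnit.map (Ideal.Quotient.mk _) ?_
    rw [PowerSeries.isUnit_iff_constantCoeff, ← PowerSeries.coeff_zero_eq_constantCoeff_apply]
    have := coeff_taylorSeries φ f 0
    rw [Fin.val_zero] at this
    rw [this]
    simpa using hf
  have hlift : ∀ b, IsLocalization.Away.lift (S := C) f hu (g b) = taylorHom φ b := fun b =>
    IsLocalization.Away.lift_eq f hu b
  have hc : ∀ c : ℂ, IsLocalization.Away.lift (S := C) f hu (algebraMap ℂ C c) =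
      Ideal.Quotient.mk _ (PowerSeries.C (algebraMap ℂ L c)) := fun c => by
    rw [← g.commutes, hlift]
    refine truncSeries_mk_eq.2 fun i hi => ?_
    have h := coeff_taylorSeries φ (algebraMap ℂ B c) ⟨i, hi⟩
    rw [jd_const] at h
    refine h.trans ?_
    rw [PowerSeries.coeff_C]
    by_cases h0 : i = 0
    · subst h0
      simp
    · rw [if_neg (fun e => h0 (congrArg Fin.val e)), if_neg h0, map_zero, mul_zero]
  refine ⟨jetOfHom (IsLocalization.Away.lift (S := C) f hu) hc, fun x => ?_⟩
  refine DFunLike.congr_fun (jetHom_ext (f := (jetOfHom (IsLocalization.Away.lift (S := C) f hu)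
    hc).comp (jetMap k g)) (g := φ) fun i b => ?_) x
  rw [AlgHom.comp_apply, jetMap_jd, jetOfHom, jetLift_jd, hlift, truncCoeff_taylorHom,
    ← mul_assoc, ← map_mul, mul_inv_cancel₀ (Nat.cast_ne_zero.2 (Nat.factorial_ne_zero _)),
    map_one, one_mul]

lemma jetMap_eq_zero (g : B →ₐ[ℂ] C) (f : B)
    (hloc : letI := g.toRingHom.toAlgebra; IsLocalization.Away f C) {x : JetRing k B}
    (hx : jetMap k g x = 0) : ∃ n : ℕ, jd k 0 f ^ n * x = 0 := by
  obtain ⟨ψ, hψ⟩ := exists_extend_jet g f hloc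
    (IsScalarTower.toAlgHom ℂ (JetRing k B) (Away (jd k 0 f)))
    (algebraMap_isUnit (jd k 0 f))
  have h := hψ x
  rw [hx, map_zero] at h
  obtain ⟨⟨_, n, rfl⟩, hn⟩ := (map_eq_zero_iff (powers (jd k 0 f)) _ x).1 h.symm
  exact ⟨n, hn⟩

lemma jetMap_surj (g : B →ₐ[ℂ] C) (f : B)
    (hloc : letI := g.toRingHom.toAlgebra; IsLocalization.Away f C) (y : JetRing k C) :
    ∃ (n : ℕ) (x : JetRing k B), jetMap k g x = jd k 0 (g f) ^ n * y := by
  let _ := g.toRingHom.toAlgebra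
  have hp : ∀ n, jetMap k g (jd k 0 f ^ n) = jd k 0 (g f) ^ n := fun n => by
    rw [map_pow, jetMap_jd]
  let S : Subring (JetRing k C) :=
    { carrier := {y | ∃ (n : ℕ) (x : JetRing k B), jetMap k g x = jd k 0 (g f) ^ n * y}
      mul_mem' := by
        rintro a b ⟨n, x, hx⟩ ⟨m, y, hy⟩
        exact ⟨n + m, x * y, by rw [map_mul, hx, hy]; ring⟩
      one_mem' := ⟨0, 1, by simp⟩
      add_mem' := by
        rintro a b ⟨n, x, hx⟩ ⟨m, y, hy⟩
        exact ⟨n + m, jd k 0 f ^ m * x + jd k 0 f ^ n * y, by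
          rw [map_add, map_mul, map_mul, hx, hy, hp, hp]; ring⟩
      zero_mem' := ⟨0, 0, by simp⟩
      neg_mem' := by
        rintro a ⟨n, x, hx⟩
        exact ⟨n, -x, by rw [map_neg, hx, mul_neg]⟩ }
  have hS : ∀ x, jetMap k g x ∈ S := fun x => ⟨0, x, by simp⟩
  have hdiv : ∀ (n : ℕ) y, jd k 0 (g f) ^ n * y ∈ S → y ∈ S := by
    rintro n y ⟨m, x, hx⟩
    exact ⟨m + n, x, by rw [hx]; ring⟩
  suffices h : ∀ (i : ℕ) (hi : i < k + 1) (c : C), jd k ⟨i, hi⟩ c ∈ S by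
    have := jetRing_closure S fun i b => h i i.2 b
    exact (this ▸ mem_top y : y ∈ S)
  intro i
  induction i using Nat.strong_induction_on with
  | _ i ih =>
  intro hi c
  obtain ⟨⟨b, ⟨_, n, rfl⟩⟩, hb⟩ := IsLocalization.surj (powers f) c
  have hb' : g f ^ n * c = g b := by
    have : c * g (f ^ n) = g b := hb
    rw [← this, map_pow, mul_comm]
  refine hdiv n _ ?_
  have h1 : jd k ⟨i, hi⟩ (g f ^ n * c) ∈ S := by
    rw [hb', ← jetMap_jd]
    exact hS _
  rw [jd_mul, ← Finset.add_sum_erase _ _ (mem_filter.2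
    ⟨mem_univ ((0, ⟨i, hi⟩) : Fin (k + 1) × Fin (k + 1)), by simp⟩)] at h1
  have h2 : ∀ s, s ∈ S → ((i : ℕ).choose 0) • (jd k 0 (g f ^ n) * jd k ⟨i, hi⟩ c) + s ∈ S →
      jd k 0 (g f) ^ n * jd k ⟨i, hi⟩ c ∈ S := by
    intro s hs h
    have := sub_mem h hs
    rw [add_sub_cancel_right, Nat.choose_zero_right, one_smul] at this
    rwa [show jd k 0 (g f ^ n) = jd k 0 (g f) ^ n from map_pow (jd0 k C) _ _] at this
  refine h2 _ (sum_mem fun p hp => nsmul_mem (mul_mem ?_ ?_) _) h1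
  · rw [← map_pow, ← jetMap_jd]
    exact hS _
  · rw [Finset.mem_erase, mem_filter] at hp
    obtain ⟨h1, _, h3⟩ := hp
    change (p.1 : ℕ) + p.2 = i at h3
    have h2' : (p.1 : ℕ) ≠ 0 := fun h => h1 (Prod.ext (Fin.ext h) (Fin.ext (by
      change (p.2 : ℕ) = i
      omega)))
    exact ih p.2 (by omega) p.2.2 c

end JetLocalization

end

section
namespace LogCoord

variable {B C : Type} [CommRing B] [Algebra ℂ B] [CommRing C] [Algebra ℂ C] {A₀ : Subring B}
  {C₀ : Subring C} {ι : Type} (L : LogCoord B A₀ ι) (L' : LogCoord C C₀ ι) (g : B →ₐ[ℂ] C)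
  (hz : ∀ i, g (L.z i) = L'.z i) (hc : L.c = L'.c) (k : ℕ)
include hz hc

lemma jetMap_letter (j : ι) (i : Fin k) : jetMap k g (L.letter k j i) = L'.letter k j i := by
  rw [letter, letter]
  by_cases h : j ∈ L.c
  · have h' : j ∈ L'.c := hc ▸ h
    rw [dif_pos h, dif_pos h', jetMap_logD]
    congr 1
    exact Units.ext (hz j)
  · have h' : j ∉ L'.c := hc ▸ h
    rw [dif_neg h, dif_neg h', jetMap_jd, hz]

lemma jetMap_ofPoly (p : MvPolynomial (ι × Fin k) B) :
    jetMap k g (L.ofPoly k p) = L'.ofPoly k (MvPolynomial.map (g : B →+* C) p) := by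
  have : (jetMap k g).toRingHom.comp (L.ofPoly k) =
      (L'.ofPoly k).comp (MvPolynomial.map (g : B →+* C)) := by
    refine ringHom_ext (fun b => ?_) fun v => ?_
    · rw [comp_apply, comp_apply, ofPoly_C, map_C, ofPoly_C]
      exact jetMap_jd g 0 b
    · rw [comp_apply, comp_apply, ofPoly_X, map_X, ofPoly_X]
      exact L.jetMap_letter L' g hz hc k _ _
  exact DFunLike.congr_fun this p

lemma toPoly_jetMap [Fintype ι] (x : JetRing k B) :
    L'.toPoly k (jetMap k g x) = MvPolynomial.map (g : B →+* C) (L.toPoly k x) := by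
  conv_lhs => rw [← L.ofPoly_toPoly k x]
  rw [L.jetMap_ofPoly L' g hz hc, toPoly_ofPoly]

end LogCoord

variable {W : X.Opens}

lemma one_mem_of_cover (U : X.affineOpens) (J : Ideal (Sec b U))
    (h : ∀ u ∈ (U : X.Opens), ∃ f ∈ J, u ∈ X.basicOpen (f : Γ(X, U))) : (1 : Sec b U) ∈ J := by
  have hs : ⨆ f : (J : Set (Sec b U)), X.basicOpen ((f : Sec b U) : Γ(X, U)) = U := by
    refine le_antisymm (iSup_le fun f => X.basicOpen_le _) fun u hu => ?_
    obtain ⟨f, hf, hu⟩ := h u hu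
    exact mem_iSup.2 ⟨⟨f, hf⟩, hu⟩
  have := (U.2.iSup_basicOpen_eq_self_iff (s := (J : Set (Sec b U)))).1 hs
  have h1 : Ideal.span (J : Set (Sec b U)) = ⊤ := this
  rw [Ideal.span_eq] at h1
  exact h1 ▸ Submodule.mem_top

lemma isLocalization_secRes {U V : X.Opens} (hU : IsCompact (U : Set X))
    (hU' : IsQuasiSeparated (U : Set X)) (f : Sec b U) (h : V ≤ U)
    (hV : V = X.basicOpen (f : Γ(X, U))) :
    letI := (secRes b h).toRingHom.toAlgebra
    IsLocalization.Away f (Sec b V) := by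
  subst hV
  exact isLocalization_basicOpen_of_qcqs hU hU' f

lemma isLocalization_secRes_affine (U : X.affineOpens) {V : X.Opens} (f : Sec b U)
    (h : V ≤ U) (hV : V = X.basicOpen (f : Γ(X, U))) :
    letI := (secRes b h).toRingHom.toAlgebra
    IsLocalization.Away f (Sec b V) :=
  isLocalization_secRes U.2.isCompact U.2.isQuasiSeparated f h hV

lemma basicOpen_inf {U : X.Opens} (f : Sec b U) : X.basicOpen (f : Γ(X, U)) ⊓ W =
    X.basicOpen (secRes b (inf_le_left : U ⊓ W ≤ U) f : Γ(X, U ⊓ W)) := by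
  refine Eq.trans ?_ (X.basicOpen_res (U := U) f (homOfLE (inf_le_left : U ⊓ W ≤ U)).op).symm
  exact le_antisymm (le_inf (le_inf (inf_le_left.trans (X.basicOpen_le _)) inf_le_right) inf_le_left)
    (le_inf inf_le_right (inf_le_left.trans inf_le_right))

lemma isLocalization_secResLog [IsLocallyNoetherian X] (U : X.affineOpens) (f : Sec b U) :
    letI := (secResLog b W (basicOpen_le f)).toRingHom.toAlgebra
    IsLocalization.Away (secRes b (inf_le_left : (U : X.Opens) ⊓ W ≤ U) f)
      (Sec b (X.basicOpen (f : Γ(X, U)) ⊓ W)) := by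
  have := IsLocallyNoetherian.component_noetherian U
  have hc : IsCompact (((U : X.Opens) ⊓ W : X.Opens) : Set X) :=
    (TopologicalSpace.noetherianSpace_set_iff _).1 (noetherianSpace_of_isAffineOpen _ U.2) _
      Set.inter_subset_left
  exact isLocalization_secRes hc (IsQuasiSeparated.of_quasiSeparatedSpace _) _ _ (basicOpen_inf f)

lemma finiteType_sec [LocallyOfFiniteType b] (V : X.affineOpens) :
    Algebra.FiniteType ℂ (Sec b V) := by
  have h := b.finiteType_appLE (isAffineOpen_top SpecC) V.2 (e := le_top)
  exact h.comp (RingHom.FiniteType.of_surjective _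
    (ConcreteCategory.bijective_of_isIso (Scheme.ΓSpecIso (CommRingCat.of ℂ)).inv).2)

variable (b W) in
/-- Local coordinates on `V` such that the complement of `W` is defined by some of them. -/
structure Chart (V : X.affineOpens) where
  n : ℕ
  z : Fin n → Sec b V
  c : Finset (Fin n)
  isCoord : IsCoord z
  mem_iff : ∀ y ∈ (V : X.Opens), y ∈ W ↔ ∀ i ∈ c, y ∈ X.basicOpen (z i : Γ(X, V))

namespace Chart

variable {V : X.affineOpens} (ch : Chart b W V)

def res (f : Sec b V) : Chart b W (X.affineBasicOpen (U := V) f) where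
  n := ch.n
  z i := secRes b (basicOpen_le f) (ch.z i)
  c := ch.c
  isCoord := by
    let _ := (secRes b (basicOpen_le f)).toRingHom.toAlgebra
    have : IsScalarTower ℂ (Sec b V) (Sec b (X.basicOpen (f : Γ(X, V)))) :=
      IsScalarTower.of_algebraMap_eq fun c =>
        ((secRes b (basicOpen_le f)).commutes c).symm
    have := isLocalization_secRes_affine V f (basicOpen_le f) rfl
    exact ch.isCoord.localize (powers f) (Sec b (X.basicOpen (f : Γ(X, V))))
  mem_iff y hy := by
    refine (ch.mem_iff y (basicOpen_le f hy)).trans (forall₂_congr fun i _ => ?_)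
    have : X.basicOpen (secRes b (basicOpen_le f) (ch.z i) :
        Γ(X, X.basicOpen (f : Γ(X, V)))) = X.basicOpen (f : Γ(X, V)) ⊓
          X.basicOpen (ch.z i : Γ(X, V)) := X.basicOpen_res _ _
    constructor
    · intro h
      exact this.ge ⟨hy, h⟩
    · intro h
      exact (this.le h).2

lemma inf_eq : (V : X.Opens) ⊓ W = X.basicOpen ((∏ i ∈ ch.c, ch.z i : Sec b V) : Γ(X, V)) := by
  have key : ∀ s : Finset (Fin ch.n), ∀ y ∈ (V : X.Opens),
      y ∈ X.basicOpen ((∏ i ∈ s, ch.z i : Sec b V) : Γ(X, V)) ↔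
        ∀ i ∈ s, y ∈ X.basicOpen (ch.z i : Γ(X, V)) := by
    intro s y hy
    classical
    induction s using Finset.induction_on with
    | empty =>
      have : X.basicOpen (1 : Γ(X, V)) = V := X.basicOpen_of_isUnit isUnit_one
      exact ⟨fun _ _ h => absurd h (Finset.notMem_empty _), fun _ => this.ge hy⟩
    | insert a s ha ih =>
      have : X.basicOpen ((∏ i ∈ insert a s, ch.z i : Sec b V) : Γ(X, V)) =
          X.basicOpen (ch.z a : Γ(X, V)) ⊓ X.basicOpen ((∏ i ∈ s, ch.z i : Sec b V) : Γ(X, V)) :=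
        (congrArg (fun f : Sec b V => X.basicOpen (f : Γ(X, V))) (Finset.prod_insert ha)).trans
          (X.basicOpen_mul _ _)
      rw [this, Finset.forall_mem_insert]
      exact and_congr_right fun _ => ih
  ext y
  constructor
  · rintro ⟨h1, h2⟩
    exact (key _ y h1).2 ((ch.mem_iff y h1).1 h2)
  · intro h
    have h1 := X.basicOpen_le _ h
    exact ⟨h1, (ch.mem_iff y h1).2 ((key _ y h1).1 h)⟩

variable [LocallyOfFiniteType b]

def log : LogCoord (Sec b ((V : X.Opens) ⊓ W)) (extendable b W V) (Fin ch.n) :=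
  letI := (secRes b (inf_le_left : (V : X.Opens) ⊓ W ≤ V)).toRingHom.toAlgebra
  haveI : IsScalarTower ℂ (Sec b V) (Sec b ((V : X.Opens) ⊓ W)) :=
    IsScalarTower.of_algebraMap_eq fun c =>
      ((secRes b (inf_le_left : (V : X.Opens) ⊓ W ≤ V)).commutes c).symm
  haveI := isLocalization_secRes_affine V _ (inf_le_left : (V : X.Opens) ⊓ W ≤ V) ch.inf_eq
  haveI := finiteType_sec (b := b) V
  ch.isCoord.logCoord ch.c (Sec b ((V : X.Opens) ⊓ W))

include ch in
lemma secRes_injective : Injective (secRes b (inf_le_left : (V : X.Opens) ⊓ W ≤ V)) := by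
  let _ := (secRes b (inf_le_left : (V : X.Opens) ⊓ W ≤ V)).toRingHom.toAlgebra
  have := isLocalization_secRes_affine V _ (inf_le_left : (V : X.Opens) ⊓ W ≤ V) ch.inf_eq
  have := finiteType_sec (b := b) V
  exact IsLocalization.injective _ (Submonoid.powers_le.2 (ch.isCoord.prod_mem_nonZeroDivisors ch.c))

lemma toPoly_res (k : ℕ) (f : Sec b V) (x : JetRing k (Sec b ((V : X.Opens) ⊓ W))) :
    (ch.res f).log.toPoly k (jetMap k (secResLog b W (basicOpen_le f)) x) =
      MvPolynomial.map (secResLog b W (basicOpen_le f) :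
        Sec b ((V : X.Opens) ⊓ W) →+* Sec b (X.basicOpen (f : Γ(X, V)) ⊓ W)) (ch.log.toPoly k x) := by
  refine ch.log.toPoly_jetMap (ch.res f).log _ (fun i => ?_) rfl k x
  change (secResLog b W (basicOpen_le f)).comp (secRes b inf_le_left) (ch.z i) =
    (secRes b (inf_le_left : X.basicOpen (f : Γ(X, V)) ⊓ W ≤ _)).comp
      (secRes b (basicOpen_le f)) (ch.z i)
  rw [secResLog, secRes_comp, secRes_comp]

end Chart

end

section
lemma exists_eq_pow_mul {B C : Type} [CommRing B] [CommRing C] {g : B →+* C} {f : B}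
    (h : letI := g.toAlgebra; IsLocalization.Away f C) (y : C) : ∃ n x, g x = g f ^ n * y := by
  let _ := g.toAlgebra
  obtain ⟨⟨x, _, n, rfl⟩, hx⟩ := IsLocalization.surj (powers f) y
  refine ⟨n, x, hx.symm.trans ?_⟩
  rw [mul_comm]
  exact congrArg (· * y) (map_pow g f n)

lemma exists_pow_mul_eq_zero {B C : Type} [CommRing B] [CommRing C] {g : B →+* C} {f : B}
    (h : letI := g.toAlgebra; IsLocalization.Away f C) {x : B} (hx : g x = 0) :
    ∃ n, f ^ n * x = 0 := by
  let _ := g.toAlgebra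
  obtain ⟨⟨_, n, rfl⟩, hn⟩ := (map_eq_zero_iff (powers f) C x).1 hx
  exact ⟨n, hn⟩

variable {W : X.Opens}

lemma secRes_secRes {U V V' : X.Opens} (h : V ≤ U) (h' : V' ≤ V) (r : Sec b U) :
    secRes b h' (secRes b h r) = secRes b (h'.trans h) r :=
  DFunLike.congr_fun (secRes_comp b h h') r

lemma jetMap_secResLog {k : ℕ} {U V V' : X.Opens} (h : V ≤ U) (h' : V' ≤ V)
    (x : JetRing k (Sec b (U ⊓ W))) : jetMap k (secResLog b W h') (jetMap k (secResLog b W h) x) =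
      jetMap k (secResLog b W (h'.trans h)) x := by
  rw [jetMap_comp, secResLog_comp]

lemma secResLog_secRes {U V : X.Opens} (h : V ≤ U) (r : Sec b U) :
    secResLog b W h (secRes b inf_le_left r) = secRes b inf_le_left (secRes b h r) := by
  rw [secResLog, secRes_secRes, secRes_secRes]

lemma jd0_mul_mem_typeSpan {k : ℕ} {B : Type} [CommRing B] [Algebra ℂ B] {A₀ : Subring B}
    {S : Set (Fin k →₀ ℕ)} {r : B} (hr : r ∈ A₀) {x : JetRing k B} (hx : x ∈ typeSpan A₀ S) :
    jd k 0 r * x ∈ typeSpan A₀ S :=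
  typeSpan_mul _ (S := {0}) (fun l h l' h' => by
    rw [Set.mem_singleton_iff] at h; rwa [h, zero_add]) (typeSpan_jd0 _ hr) hx

lemma logStr_mul_typeSpan {k : ℕ} {U : X.Opens} {S : Set (Fin k →₀ ℕ)} (r : Sec b U)
    {x : JetRing k (Sec b (U ⊓ W))} (hx : x ∈ typeSpan (extendable b W U) S) :
    logStr b W k U r * x ∈ typeSpan (extendable b W U) S :=
  jd0_mul_mem_typeSpan (A₀ := extendable b W U) ⟨r, rfl⟩ hx

lemma logStr_mul_logTypeSpan {k : ℕ} {U : X.Opens} {S : Set (Fin k →₀ ℕ)} (r : Sec b U)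
    {x : JetRing k (Sec b (U ⊓ W))} (hx : x ∈ logTypeSpan b W k U S) :
    logStr b W k U r * x ∈ logTypeSpan b W k U S :=
  logTypeSpan_mul b W k (S := {0}) (fun l h l' h' => by
    rw [Set.mem_singleton_iff] at h; rwa [h, zero_add]) (logStr_type b W k U r) hx

namespace Chart

variable [LocallyOfFiniteType b] {V : X.affineOpens} (ch : Chart b W V) {k : ℕ}

include ch in
lemma typeSpan_of_res {S : Set (Fin k →₀ ℕ)} (hS : IsLowerType S) (f : Sec b V)
    {x : JetRing k (Sec b ((V : X.Opens) ⊓ W))}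
    (hx : jetMap k (secResLog b W (basicOpen_le f)) x ∈
      typeSpan (extendable b W (X.basicOpen (f : Γ(X, V)))) S) :
    ∃ N, logStr b W k V f ^ N * x ∈ typeSpan (extendable b W V) S := by
  have := LocallyOfFiniteType.isLocallyNoetherian b
  have hx' := ((ch.res f).log.mem_typeSpan_iff k hS).1 hx
  rw [ch.toPoly_res] at hx'
  have key : ∀ m, ∃ n, secRes b inf_le_left f ^ n * (ch.log.toPoly k x).coeff m ∈
      extendable b W V ∧ (monoType m ∉ S →
        secRes b inf_le_left f ^ n * (ch.log.toPoly k x).coeff m = 0) := by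
    intro m
    obtain ⟨⟨d, hd⟩, hm⟩ := hx' m
    replace hd := hd.trans (coeff_map _ _ m)
    obtain ⟨d, hd⟩ : ∃ d : Sec b (X.basicOpen (f : Γ(X, V))), secRes b inf_le_left d =
      secResLog b W (basicOpen_le f) ((ch.log.toPoly k x).coeff m) := ⟨d, hd⟩
    replace hm : secResLog b W (basicOpen_le f) ((ch.log.toPoly k x).coeff m) ≠ 0 →
        monoType m ∈ S := fun h => hm fun h' => h ((coeff_map _ _ m).symm.trans h')
    by_cases hmS : monoType m ∈ S
    · obtain ⟨n, e, he⟩ := exists_eq_pow_mul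
        (isLocalization_secRes_affine V f (basicOpen_le f) rfl) d
      obtain ⟨n', hn'⟩ := exists_pow_mul_eq_zero (isLocalization_secResLog (W := W) V f)
        (x := secRes b inf_le_left f ^ n * (ch.log.toPoly k x).coeff m - secRes b inf_le_left e) (by
        change secResLog b W (basicOpen_le f) _ = 0
        replace he : secRes b (basicOpen_le f) e =
          secRes b (basicOpen_le f) f ^ n * d := he
        rw [map_sub, map_mul, map_pow, secResLog_secRes, secResLog_secRes, he, map_mul, map_pow,
          hd, sub_self])
      refine ⟨n' + n, ?_, fun h => absurd hmS h⟩
      rw [mul_sub, sub_eq_zero, ← mul_assoc, ← pow_add] at hn'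
      rw [hn']
      exact mul_mem (pow_mem (show _ ∈ extendable b W V from ⟨f, rfl⟩) n') ⟨e, rfl⟩
    · obtain ⟨n, hn⟩ := exists_pow_mul_eq_zero (isLocalization_secResLog (W := W) V f)
        (x := (ch.log.toPoly k x).coeff m) (by_contra fun h => hmS (hm h))
      exact ⟨n, hn ▸ zero_mem _, fun _ => hn⟩
  choose n hn using key
  refine ⟨(ch.log.toPoly k x).support.sup n, (ch.log.mem_typeSpan_iff k hS).2 fun m => ?_⟩
  have e : ch.log.toPoly k (logStr b W k V f ^ ((ch.log.toPoly k x).support.sup n) * x) =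
      MvPolynomial.C (secRes b inf_le_left f ^ ((ch.log.toPoly k x).support.sup n)) *
        ch.log.toPoly k x := by
    rw [map_mul, map_pow, C_pow]
    congr 2
    exact ch.log.toPoly_jd0 k _
  rw [e, coeff_C_mul]
  by_cases hm : m ∈ (ch.log.toPoly k x).support
  · obtain ⟨d, hd⟩ := Nat.exists_eq_add_of_le (Finset.le_sup (f := n) hm)
    rw [hd, add_comm, pow_add, mul_assoc]
    refine ⟨mul_mem (pow_mem (show _ ∈ extendable b W V from ⟨f, rfl⟩) d) (hn m).1, fun h => ?_⟩
    by_contra hmS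
    exact h (by rw [(hn m).2 hmS, mul_zero])
  · rw [notMem_support_iff.1 hm, mul_zero]
    exact ⟨zero_mem _, fun h => absurd rfl h⟩

include ch in
lemma mem_logTypeSpan_iff {S : Set (Fin k →₀ ℕ)} (hS : IsLowerType S)
    {x : JetRing k (Sec b ((V : X.Opens) ⊓ W))} :
    x ∈ logTypeSpan b W k V S ↔ x ∈ typeSpan (extendable b W V) S := by
  refine ⟨fun hx => ?_, logTypeSpan_of_typeSpan b W k⟩
  let J : Ideal (Sec b V) :=
    { carrier := {r | logStr b W k V r * x ∈ typeSpan (extendable b W V) S}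
      add_mem' := by
        intro r s hr hs
        rw [Set.mem_ofPred_eq, map_add, add_mul]
        exact add_mem hr hs
      zero_mem' := by rw [Set.mem_ofPred_eq, map_zero, zero_mul]; exact zero_mem _
      smul_mem' := by
        intro c r hr
        rw [Set.mem_ofPred_eq, smul_eq_mul, map_mul, mul_assoc]
        exact logStr_mul_typeSpan c hr }
  have h1 : logStr b W k V 1 * x ∈ typeSpan (extendable b W V) S := by
    refine one_mem_of_cover V J fun u hu => ?_
    obtain ⟨Z, hZ, huZ, hxZ⟩ := hx u hu
    obtain ⟨f, hf, huf⟩ : ∃ f : Sec b V, X.basicOpen (f : Γ(X, V)) ≤ Z ∧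
        u ∈ X.basicOpen (f : Γ(X, V)) := V.2.exists_basicOpen_le ⟨u, huZ⟩ hu
    obtain ⟨N, hN⟩ := ch.typeSpan_of_res (k := k) hS f (x := x) (by
      have := typeSpan_map (secResLog b W hf) (extendable_res b W hf) S hxZ
      have e := jetMap_secResLog (k := k) (W := W) hZ hf x
      exact (congrArg (· ∈ typeSpan (extendable b W (X.basicOpen (f : Γ(X, V)))) S) e).mp this)
    refine ⟨f ^ (N + 1), ?_, (X.basicOpen_pow f N.succ_pos).ge huf⟩
    change logStr b W k V (f ^ (N + 1)) * x ∈ typeSpan (extendable b W V) S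
    rw [pow_succ', map_mul, map_pow, mul_assoc]
    exact logStr_mul_typeSpan (k := k) f hN
  rwa [map_one, one_mul] at h1

end Chart

variable (b W) in
def HasCharts : Prop := ∀ x : X, ∃ V : X.affineOpens, x ∈ (V : X.Opens) ∧ Nonempty (Chart b W V)

lemma HasCharts.exists_basicOpen (h : HasCharts b W) (U : X.affineOpens) {u : X}
    (hu : u ∈ (U : X.Opens)) : ∃ g : Sec b U, u ∈ X.basicOpen (g : Γ(X, U)) ∧
      Nonempty (Chart b W (X.affineBasicOpen (U := U) g)) := by
  obtain ⟨V, hV, ⟨ch⟩⟩ := h u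
  obtain ⟨g, g', hg, hug⟩ := exists_basicOpen_le_affine_inter U.2 V.2 u ⟨hu, hV⟩
  refine ⟨g, hug, ?_⟩
  have : X.affineBasicOpen (U := V) g' = X.affineBasicOpen (U := U) g := Subtype.ext hg.symm
  exact this ▸ ⟨ch.res g'⟩

lemma exists_uniform (U : X.affineOpens) (P : ℕ → X → Prop)
    (hmono : ∀ {m n}, m ≤ n → ∀ u, P m u → P n u)
    (h : ∀ u ∈ (U : X.Opens), ∃ n, ∃ V : X.Opens, u ∈ V ∧ ∀ v ∈ V, v ∈ (U : X.Opens) → P n v) :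
    ∃ n, ∀ u ∈ (U : X.Opens), P n u := by
  refine U.2.isCompact.induction_on (p := fun s => ∃ n, ∀ u ∈ s, P n u) ?_ ?_ ?_ ?_
  · exact ⟨0, fun u hu => absurd hu (Set.notMem_empty u)⟩
  · rintro s t hst ⟨n, hn⟩
    exact ⟨n, fun u hu => hn u (hst hu)⟩
  · rintro s t ⟨n, hn⟩ ⟨m, hm⟩
    exact ⟨max n m, fun u hu => hu.elim (fun hu => hmono (le_max_left _ _) u (hn u hu))
      fun hu => hmono (le_max_right _ _) u (hm u hu)⟩
  · intro u hu
    obtain ⟨n, V, huV, hV⟩ := h u hu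
    exact ⟨(V : Set X) ∩ U, Filter.inter_mem (mem_nhdsWithin_of_mem_nhds (V.2.mem_nhds huV))
      self_mem_nhdsWithin, n, fun v hv => hV v hv.1 hv.2⟩

lemma logTypeSpan_of_res [LocallyOfFiniteType b] (hW : HasCharts b W) {k : ℕ} (U : X.affineOpens)
    (f : Sec b U) {S : Set (Fin k →₀ ℕ)} (hS : IsLowerType S)
    {x : JetRing k (Sec b ((U : X.Opens) ⊓ W))}
    (hx : jetMap k (secResLog b W (basicOpen_le f)) x ∈
      logTypeSpan b W k (X.basicOpen (f : Γ(X, U))) S) :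
    ∃ N, logStr b W k U f ^ N * x ∈ logTypeSpan b W k U S := by
  obtain ⟨N, hN⟩ := exists_uniform U (fun N u => ∃ (V : X.affineOpens) (h : (V : X.Opens) ≤ U),
      u ∈ (V : X.Opens) ∧ jetMap k (secResLog b W h) (logStr b W k U f ^ N * x) ∈
        typeSpan (extendable b W V) S) (by
      rintro m n hmn u ⟨V, h, hu, hV⟩
      refine ⟨V, h, hu, ?_⟩
      rw [← Nat.sub_add_cancel hmn, pow_add, mul_assoc, map_mul, ← map_pow, logStr_res]
      exact logStr_mul_typeSpan _ hV) (by
      intro u hu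
      obtain ⟨g, hug, ⟨ch⟩⟩ := hW.exists_basicOpen U hu
      let V := X.affineBasicOpen (U := U) g
      have hVU : (V : X.Opens) ≤ U := X.basicOpen_le _
      let f' : Sec b V := secRes b hVU f
      have hf' : X.basicOpen (f' : Γ(X, V)) ≤ X.basicOpen (f : Γ(X, U)) :=
        (X.basicOpen_res (U := U) f (homOfLE hVU).op).le.trans inf_le_right
      obtain ⟨N, hN⟩ := ch.typeSpan_of_res hS f' (x := jetMap k (secResLog b W hVU) x) (by
        refine ((ch.res f').mem_logTypeSpan_iff hS).1 ?_
        have := logTypeSpan_res b W k hf' hx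
        have e1 := jetMap_secResLog (k := k) (W := W) (basicOpen_le f) hf' x
        have e2 := jetMap_secResLog (k := k) (W := W) hVU (X.basicOpen_le (f' : Γ(X, V))) x
        exact (e1.trans e2.symm) ▸ this)
      refine ⟨N, V, hug, fun v hv _ => ⟨V, hVU, hv, ?_⟩⟩
      rw [map_mul, map_pow, logStr_res]
      exact hN)
  exact ⟨N, fun u hu => hN u hu⟩

lemma logTypeSpan_surj [LocallyOfFiniteType b] (hW : HasCharts b W) {k : ℕ} (U : X.affineOpens)
    (f : Sec b U) {S : Set (Fin k →₀ ℕ)} (hS : IsLowerType S)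
    {y : JetRing k (Sec b (X.basicOpen (f : Γ(X, U)) ⊓ W))}
    (hy : y ∈ logTypeSpan b W k (X.basicOpen (f : Γ(X, U))) S) :
    ∃ N, ∃ x ∈ logTypeSpan b W k U S, jetMap k (secResLog b W (basicOpen_le f)) x =
      logStr b W k (X.basicOpen (f : Γ(X, U))) (secRes b (X.basicOpen_le _) f) ^ N * y := by
  have := LocallyOfFiniteType.isLocallyNoetherian b
  obtain ⟨n, x, hx⟩ := jetMap_surj _ _ (isLocalization_secResLog (W := W) U f) y
  have hxy : jetMap k (secResLog b W (basicOpen_le f)) x =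
      logStr b W k (X.basicOpen (f : Γ(X, U))) (secRes b (X.basicOpen_le _) f) ^ n * y := by
    rw [hx, secResLog_secRes]
    rfl
  have hx1 : jetMap k (secResLog b W (basicOpen_le f)) x ∈
      logTypeSpan b W k (X.basicOpen (f : Γ(X, U))) S := by
    rw [hxy, ← map_pow]
    exact logStr_mul_logTypeSpan _ hy
  obtain ⟨N, hN⟩ := logTypeSpan_of_res hW U f hS hx1
  refine ⟨N + n, logStr b W k U f ^ N * x, hN, ?_⟩
  rw [map_mul, map_pow, logStr_res, hxy, pow_add, mul_assoc]

end

section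
lemma weightLE_mono {k m n : ℕ} (h : m ≤ n) :
    {l : Fin k →₀ ℕ | typeWeight l ≤ m} ⊆ {l | typeWeight l ≤ n} := fun l hl => by
  rw [Set.mem_ofPred_eq] at *
  exact hl.trans h

namespace TypeFil

variable {k : ℕ} {H : Type} [CommRing H] {gr : ℕ → AddSubgroup H} [GradedRing gr]
  (T : TypeFil H gr k)

/-- The polynomials `∑ uₙ Tⁿ` with `uₙ` of weight at most `n`. -/
def weightRees : Subring (Polynomial H) where
  carrier := {p | ∀ n, p.coeff n ∈ T.F {l | typeWeight l ≤ n}}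
  zero_mem' n := by simp
  one_mem' n := by
    rw [Polynomial.coeff_one]
    split_ifs
    · exact T.mono (by rintro _ rfl; simp) T.one_mem
    · exact zero_mem _
  add_mem' {p q} hp hq n := by rw [Polynomial.coeff_add]; exact add_mem (hp n) (hq n)
  neg_mem' {p} hp n := by rw [Polynomial.coeff_neg]; exact neg_mem (hp n)
  mul_mem' {p q} hp hq n := by
    rw [Polynomial.coeff_mul]
    refine sum_mem fun x hx => ?_
    have hx := mem_antidiagonal.1 hx
    refine T.mul_mem (S := {l | typeWeight l ≤ x.1}) (S' := {l | typeWeight l ≤ x.2})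
      (fun a ha b hb => ?_) (hp x.1) (hq x.2)
    rw [Set.mem_ofPred_eq] at *
    rw [map_add]
    omega

lemma coeff_mem (p : T.weightRees) (n : ℕ) :
    (p : Polynomial H).coeff n ∈ T.F {l | typeWeight l ≤ n} := p.2 n

lemma monomial_mem_weightRees {n : ℕ} {x : H} (hx : x ∈ T.F {l | typeWeight l ≤ n}) :
    Polynomial.monomial n x ∈ T.weightRees := by
  intro m
  rw [Polynomial.coeff_monomial]
  split_ifs with h
  · exact h ▸ hx
  · exact zero_mem _

def weightMonomial (n : ℕ) : T.F {l | typeWeight l ≤ n} →+ T.weightRees where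
  toFun x := ⟨Polynomial.monomial n (x : H), T.monomial_mem_weightRees x.2⟩
  map_zero' := Subtype.ext (map_zero _)
  map_add' _ _ := Subtype.ext (map_add _ _ _)

lemma eq_sum_weightMonomial (p : T.weightRees) : p =
    ∑ n ∈ (p : Polynomial H).support, T.weightMonomial n ⟨_, T.coeff_mem p n⟩ := by
  apply Subtype.ext
  rw [AddSubmonoidClass.coe_finsetSum]
  exact (p : Polynomial H).as_sum_support

def weightReesGr (m : ℕ) : AddSubgroup T.weightRees where
  carrier := {p | ∀ n, (p : Polynomial H).coeff n ∈ gr m}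
  zero_mem' n := zero_mem _
  add_mem' {p q} hp hq n := by
    rw [Subring.coe_add, Polynomial.coeff_add]; exact add_mem (hp n) (hq n)
  neg_mem' {p} hp n := by rw [Subring.coe_neg, Polynomial.coeff_neg]; exact neg_mem (hp n)

lemma weightMonomial_mem {n m : ℕ} {x : T.F {l | typeWeight l ≤ n}} (hx : (x : H) ∈ gr m) :
    T.weightMonomial n x ∈ T.weightReesGr m := by
  intro n'
  change (Polynomial.monomial n (x : H)).coeff n' ∈ _
  rw [Polynomial.coeff_monomial]
  split_ifs
  · exact hx
  · exact zero_mem _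

instance : GradedRing T.weightReesGr := by
  classical
  refine gradedRingOf _ ?_ ?_ ?_ ?_
  · intro n
    rw [Subring.coe_one, Polynomial.coeff_one]
    split_ifs
    · exact SetLike.GradedOne.one_mem
    · exact zero_mem _
  · intro i j p q hp hq n
    rw [Subring.coe_mul, Polynomial.coeff_mul]
    exact sum_mem fun x _ => SetLike.mul_mem_graded (hp x.1) (hq x.2)
  · rw [eq_top_iff]
    intro p _
    rw [T.eq_sum_weightMonomial p]
    refine sum_mem fun n _ => ?_
    have e : (⟨_, T.coeff_mem p n⟩ : T.F {l | typeWeight l ≤ n}) =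
        ∑ m ∈ DFinsupp.support (DirectSum.decompose gr ((p : Polynomial H).coeff n)),
          ⟨_, T.proj_mem m (T.coeff_mem p n)⟩ := by
      apply Subtype.ext
      rw [AddSubmonoidClass.coe_finsetSum]
      exact (DirectSum.sum_support_decompose gr _).symm
    rw [e, map_sum]
    refine sum_mem fun m _ => AddSubgroup.mem_iSup_of_mem m (T.weightMonomial_mem ?_)
    change proj gr m _ ∈ gr m
    rw [proj_apply]
    exact SetLike.coe_mem _
  · intro s x hx h n hn
    apply Subtype.ext
    ext r
    have h' := congrArg (fun y : T.weightRees => proj gr n ((y : Polynomial H).coeff r)) h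
    simp only [AddSubmonoidClass.coe_finsetSum, Polynomial.finsetSum_coeff, map_sum,
      ZeroMemClass.coe_zero, Polynomial.coeff_zero, map_zero] at h'
    rw [sum_eq_single n] at h'
    · rw [proj_apply, DirectSum.decompose_of_mem_same gr (hx n hn r)] at h'
      exact h'
    · intro m hm hmn
      rw [proj_apply, DirectSum.decompose_of_mem_ne gr (hx m hm r) hmn]
    · exact fun h => absurd hn h

variable {H' : Type} [CommRing H'] {gr' : ℕ → AddSubgroup H'} [GradedRing gr']
  (T' : TypeFil H' gr' k)

def weightMap (g : H →+* H') (hg : ∀ S x, x ∈ T.F S → g x ∈ T'.F S) :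
    T.weightRees →+* T'.weightRees :=
  ((mapRingHom g).comp T.weightRees.subtype).codRestrict T'.weightRees fun p n => by
    change ((p : Polynomial H).map g).coeff n ∈ _
    rw [Polynomial.coeff_map]
    exact hg _ _ (p.2 n)

end TypeFil

variable (b) (W : X.Opens) (k : ℕ)

/-- The family of graded algebras that deforms the logarithmic jet differentials to the graded
algebra of the filtration by types. -/
def logFamily : GradedAlgOn b where
  ring U := (logFil b W k U).weightRees
  gr U := (logFil b W k U).weightReesGr
  str U := (Polynomial.C.comp (logStr b W k U)).codRestrict _ fun r =>
    (logFil b W k U).monomial_mem_weightRees (n := 0)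
      (logTypeSpan_mono b W k (by rintro _ rfl; simp) (logStr_type b W k U r))
  str_mem U r n := by
    change (Polynomial.C (logStr b W k U r)).coeff n ∈ _
    rw [Polynomial.coeff_C]
    split_ifs
    · exact jd_mem 0 _
    · exact zero_mem _
  res {U V} h := (logFil b W k U).weightMap (logFil b W k V)
    (jetMap k (secResLog b W h)).toRingHom fun S x hx => logTypeSpan_res b W k h hx
  res_mem {U V} h m x hx n := by
    exact (congrArg (· ∈ jetGr k (Sec b ((V : X.Opens) ⊓ W)) m) (Polynomial.coeff_map _ _)).mpr
      (jetMap_mem _ (hx n))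
  res_str {U V} h r := Subtype.ext (by
    change (Polynomial.C (logStr b W k U r)).map _ = Polynomial.C (logStr b W k V (secRes b h r))
    rw [Polynomial.map_C]
    exact congrArg Polynomial.C (logStr_res b W k h r))

variable {b W k}

lemma logFamily_ext {U : X.affineOpens} {p q : (logFamily b W k).ring U}
    (h : ∀ n, p.1.coeff n = q.1.coeff n) : p = q := Subtype.ext (Polynomial.ext h)

lemma coeff_logFamily_res {U V : X.affineOpens} (h : (V : X.Opens) ≤ U)
    (p : (logFamily b W k).ring U) (n : ℕ) :
    ((logFamily b W k).res h p).1.coeff n = jetMap k (secResLog b W h) (p.1.coeff n) :=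
  Polynomial.coeff_map _ _

lemma coeff_logFamily_str_mul {U : X.affineOpens} (r : Sec b U)
    (p : (logFamily b W k).ring U) (n : ℕ) :
    ((logFamily b W k).str U r * p).1.coeff n = logStr b W k U r * p.1.coeff n :=
  Polynomial.coeff_C_mul _

def logMonomial {U : X.affineOpens} (n : ℕ) {x : JetRing k (Sec b ((U : X.Opens) ⊓ W))}
    (hx : x ∈ logTypeSpan b W k U {l | typeWeight l ≤ n}) : (logFamily b W k).ring U :=
  (logFil b W k U).weightMonomial n ⟨x, hx⟩

lemma coeff_logMonomial {U : X.affineOpens} (n : ℕ) {x : JetRing k (Sec b ((U : X.Opens) ⊓ W))}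
    (hx : x ∈ logTypeSpan b W k U {l | typeWeight l ≤ n}) (m : ℕ) :
    (logMonomial n hx).1.coeff m = if n = m then x else 0 := Polynomial.coeff_monomial

lemma logFamily_isQuasiCoherent [LocallyOfFiniteType b] (hW : HasCharts b W) :
    (logFamily b W k).IsQuasiCoherent where
  res_id U x := logFamily_ext fun n => by
    rw [coeff_logFamily_res]
    have : jetMap k (secResLog b W (le_refl (U : X.Opens))) = AlgHom.id ℂ _ :=
      jetHom_ext fun i r => by
        rw [jetMap_jd]
        have : secResLog b W (le_refl (U : X.Opens)) = AlgHom.id ℂ _ := by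
          ext r
          exact DFunLike.congr_fun (congrArg CommRingCat.Hom.hom (X.presheaf.map_id _)) r
        rw [this]
        rfl
    rw [this]
    rfl
  res_comp h h' x := logFamily_ext fun n => by
    rw [coeff_logFamily_res, coeff_logFamily_res, coeff_logFamily_res, jetMap_secResLog]
  inj U f p hp := by
    have := LocallyOfFiniteType.isLocallyNoetherian b
    have key : ∀ n, ∃ N, logStr b W k U f ^ N * p.1.coeff n = 0 := fun n => by
      have h : jetMap k (secResLog b W (basicOpen_le f)) (p.1.coeff n) = 0 := by
        have h := congrArg (fun q : (logFamily b W k).ring (X.affineBasicOpen (U := U) f) =>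
          q.1.coeff n) hp
        exact (coeff_logFamily_res (V := X.affineBasicOpen (U := U) f)
          (basicOpen_le f) p n).symm.trans h
      exact jetMap_eq_zero (k := k) _ _ (isLocalization_secResLog (W := W) U f) h
    choose N hN using key
    refine ⟨p.1.support.sup N, logFamily_ext fun n => ?_⟩
    rw [← map_pow, coeff_logFamily_str_mul, map_pow]
    change _ = 0
    by_cases hn : n ∈ p.1.support
    · obtain ⟨d, hd⟩ := Nat.exists_eq_add_of_le (Finset.le_sup (f := N) hn)
      rw [hd, add_comm, pow_add, mul_assoc, hN, mul_zero]
    · rw [Polynomial.notMem_support_iff.1 hn, mul_zero]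
  surj U f q := by
    let y : ℕ → JetRing k (Sec b (X.basicOpen (f : Γ(X, U)) ⊓ W)) := fun n => q.1.coeff n
    let φ : JetRing k (Sec b (X.basicOpen (f : Γ(X, U)) ⊓ W)) :=
      logStr b W k (X.basicOpen (f : Γ(X, U))) (secRes b (X.basicOpen_le _) f)
    have key : ∀ n, ∃ N, ∃ x ∈ logTypeSpan b W k U {l | typeWeight l ≤ n},
        jetMap k (secResLog b W (basicOpen_le f)) x = φ ^ N * y n :=
      fun n => logTypeSpan_surj hW U f (isLowerType_weight n) (q.2 n)
    choose N x hx hN using key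
    let z : (logFamily b W k).ring U := ∑ n ∈ q.1.support, (logFamily b W k).str U (f ^
      (q.1.support.sup N - N n)) * logMonomial n (hx n)
    have hz : ∀ m, jetMap k (secResLog b W (basicOpen_le f)) (z.1.coeff m) =
        φ ^ q.1.support.sup N * y m := fun m => by
      have e : ∀ n, jetMap k (secResLog b W (basicOpen_le f))
          (((logFamily b W k).str U (f ^ (q.1.support.sup N - N n)) *
            logMonomial n (hx n)).1.coeff m) =
          if n = m then φ ^ (q.1.support.sup N - N n + N n) * y n else 0 := fun n => by
        rw [coeff_logFamily_str_mul, coeff_logMonomial]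
        split_ifs
        · rw [map_mul, hN, logStr_res, map_pow, map_pow, pow_add, mul_assoc]
        · rw [mul_zero, map_zero]
      refine (congrArg (fun t : JetRing k (Sec b ((U : X.Opens) ⊓ W)) => jetMap k
        (secResLog b W (basicOpen_le f)) t) ((congrArg (fun t : Polynomial _ =>
          t.coeff m) (AddSubmonoidClass.coe_finsetSum _ _)).trans
            (Polynomial.finsetSum_coeff _ _ _))).trans ?_
      rw [map_sum]
      refine (sum_congr rfl fun n _ => e n).trans ?_
      rw [Finset.sum_ite_eq']
      split_ifs with hm
      · rw [Nat.sub_add_cancel (Finset.le_sup hm)]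
      · rw [show y m = 0 from Polynomial.notMem_support_iff.1 hm, mul_zero]
    refine ⟨q.1.support.sup N, z, logFamily_ext fun m => ?_⟩
    refine (coeff_logFamily_res (V := X.affineBasicOpen (U := U) f) _ z m).trans ((hz m).trans ?_)
    let r : Sec b (X.basicOpen (f : Γ(X, U))) := secRes b (X.basicOpen_le _) f
    have e : (logFamily b W k).res (V := X.affineBasicOpen (U := U) f) (X.basicOpen_le _)
        ((logFamily b W k).str U f) ^ q.1.support.sup N =
        (logFamily b W k).str (X.affineBasicOpen (U := U) f) (r ^ q.1.support.sup N) :=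
      (congrArg (· ^ q.1.support.sup N) ((logFamily b W k).res_str _ f)).trans (map_pow _ _ _).symm
    refine Eq.trans ?_ (congrArg (fun t : (logFamily b W k).ring (X.affineBasicOpen (U := U) f) =>
      (t * q).1.coeff m) e.symm)
    refine Eq.trans ?_ (coeff_logFamily_str_mul (U := X.affineBasicOpen (U := U) f) _ q m).symm
    exact congrArg (· * y m) (map_pow (logStr b W k _) r _).symm

variable (b W k) in
def logParam : (logFamily b W k).Parameter where
  t U := ⟨Polynomial.X, by
    rw [← Polynomial.monomial_one_one_eq_X]
    exact (logFil b W k U).monomial_mem_weightRees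
      ((logFil b W k U).mono (by rintro _ rfl; simp) (logFil b W k U).one_mem)⟩
  mem U n := by
    change (Polynomial.X : Polynomial _).coeff n ∈ _
    rw [Polynomial.coeff_X]
    split_ifs
    · exact weightPart_one _
    · exact zero_mem _
  res h := Subtype.ext (Polynomial.map_X _)

lemma logFamily_scalar (U : X.affineOpens) (c : ℂ) :
    ((logFamily b W k).scalar U c : (logFamily b W k).ring U).1 =
      Polynomial.C (algebraMap ℂ _ c) := by
  change Polynomial.C (jd k 0 (secRes b _ (algebraMap ℂ _ c))) = _
  rw [AlgHom.commutes, jd_const, if_pos rfl]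

lemma algebraMap_mul_logTypeSpan {U : X.Opens} {S : Set (Fin k →₀ ℕ)} (c : ℂ)
    {x : JetRing k (Sec b (U ⊓ W))} (hx : x ∈ logTypeSpan b W k U S) :
    algebraMap ℂ _ c * x ∈ logTypeSpan b W k U S := by
  have := logStr_mul_logTypeSpan (algebraMap ℂ _ c) hx
  have e : logStr b W k U (algebraMap ℂ _ c) = algebraMap ℂ _ c := by
    change jd k 0 (secRes b _ (algebraMap ℂ _ c)) = _
    rw [AlgHom.commutes, jd_const, if_pos rfl]
  rwa [e] at this

lemma exists_weight_le {B : Type} [CommRing B] [Algebra ℂ B] {A₀ : Subring B} {x : JetRing k B}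
    (hx : x ∈ typeSpan A₀ Set.univ) : ∃ n, x ∈ typeSpan A₀ {l | typeWeight l ≤ n} := by
  refine closure_induction
    (p := fun x _ => ∃ n, x ∈ typeSpan A₀ {l | typeWeight l ≤ n}) ?_ ?_ ?_ ?_ hx
  · rintro x ⟨a, ha, l, _, y, hy, rfl⟩
    exact ⟨typeWeight l, subset_closure ⟨a, ha, l, by rw [Set.mem_ofPred_eq], y, hy, rfl⟩⟩
  · exact ⟨0, zero_mem _⟩
  · rintro u v _ _ ⟨n, hn⟩ ⟨m, hm⟩
    exact ⟨max n m, add_mem (typeSpan_mono _ (weightLE_mono (le_max_left _ _)) hn)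
      (typeSpan_mono _ (weightLE_mono (le_max_right _ _)) hm)⟩
  · rintro u _ ⟨n, hn⟩
    exact ⟨n, neg_mem hn⟩

lemma exists_logWeight_le (U : X.affineOpens) {x : JetRing k (Sec b ((U : X.Opens) ⊓ W))}
    (hx : x ∈ logTypeSpan b W k U Set.univ) :
    ∃ n, x ∈ logTypeSpan b W k U {l | typeWeight l ≤ n} := by
  refine exists_uniform U (fun n u => ∃ (V : X.affineOpens) (h : (V : X.Opens) ≤ U),
    u ∈ (V : X.Opens) ∧ jetMap k (secResLog b W h) x ∈
      typeSpan (extendable b W V) {l | typeWeight l ≤ n}) ?_ ?_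
  · rintro m n hmn u ⟨V, h, hu, hV⟩
    exact ⟨V, h, hu, typeSpan_mono _ (weightLE_mono hmn) hV⟩
  · intro u hu
    obtain ⟨V, h, hu, hV⟩ := hx u hu
    obtain ⟨n, hn⟩ := exists_weight_le hV
    exact ⟨n, V, hu, fun v hv _ => ⟨V, h, hv, hn⟩⟩

/-- Where the parameter is `c ≠ 0`, the fibre is the algebra of logarithmic jet differentials. -/
def logFibre {c : ℂ} (hc : c ≠ 0) : (logParam b W k).Fibre c (logGreenGriffiths b W k) where
  hom U :=
    { toRingHom := ((evalRingHom (algebraMap ℂ _ c)).comp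
        (logFil b W k U).weightRees.subtype).codRestrict (logJets b W k U) fun p => by
          change (p : Polynomial _).eval _ ∈ logTypeSpan b W k U _
          rw [Polynomial.eval_eq_sum, Polynomial.sum]
          refine sum_mem fun n _ => ?_
          rw [mul_comm, ← map_pow]
          exact algebraMap_mul_logTypeSpan _ (logTypeSpan_mono b W k (Set.subset_univ _) (p.2 n))
      map_mem := fun {m p} hp => by
        change p.1.eval _ ∈ jetGr k _ m
        rw [Polynomial.eval_eq_sum, Polynomial.sum]
        refine sum_mem fun n _ => ?_
        rw [← map_pow, mul_comm, ← smul_def]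
        have hpn : jetCoaction k _ (p.1.coeff n) = _ := hp n
        change jetCoaction k _ _ = _
        rw [map_smul, hpn]
        exact Polynomial.smul_monomial _ _ _ }
  isQuot U :=
    { zero := Subtype.ext (by
        change ((Polynomial.X : Polynomial _) - Subtype.val ((logFamily b W k).scalar U c :
          (logFamily b W k).ring U)).eval _ = 0
        rw [logFamily_scalar, Polynomial.eval_sub, eval_X, eval_C, sub_self])
      inj := fun p hp => by
        have hp' : p.1.eval (algebraMap ℂ _ c) = 0 := congrArg Subtype.val hp
        obtain ⟨q, hq⟩ := Polynomial.dvd_iff_isRoot.2 hp'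
        have hcc : ∀ x : JetRing k (Sec b ((U : X.Opens) ⊓ W)),
            algebraMap ℂ _ c⁻¹ * (algebraMap ℂ _ c * x) = x := fun x => by
          rw [← mul_assoc, ← map_mul, inv_mul_cancel₀ hc, map_one, one_mul]
        have hqn : ∀ n, q.coeff n ∈ logTypeSpan b W k U {l | typeWeight l ≤ n} := by
          intro n
          induction n with
          | zero =>
            have h : p.1.coeff 0 = _ := congrArg (fun q => q.coeff 0) hq
            rw [Polynomial.mul_coeff_zero, Polynomial.coeff_sub, Polynomial.coeff_X_zero,
              Polynomial.coeff_C_zero, zero_sub, neg_mul] at h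
            rw [← hcc (q.coeff 0), ← neg_neg (_ * q.coeff 0), ← h]
            exact algebraMap_mul_logTypeSpan _ (neg_mem (p.2 0))
          | succ n ih =>
            have h : p.1.coeff (n + 1) = _ := congrArg (fun q => q.coeff (n + 1)) hq
            rw [sub_mul, Polynomial.coeff_sub, Polynomial.coeff_X_mul, Polynomial.coeff_C_mul] at h
            have h' : algebraMap ℂ _ c * q.coeff (n + 1) = q.coeff n - p.1.coeff (n + 1) := by
              rw [h]; ring
            rw [← hcc (q.coeff (n + 1)), h']
            exact algebraMap_mul_logTypeSpan _ (sub_mem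
              (logTypeSpan_mono b W k (weightLE_mono n.le_succ) ih) (p.2 (n + 1)))
        refine ⟨⟨q, hqn⟩, Subtype.ext (hq.trans ?_)⟩
        change _ = ((Polynomial.X : Polynomial _) - Subtype.val ((logFamily b W k).scalar U c :
          (logFamily b W k).ring U)) * q
        rw [logFamily_scalar]
      surj := fun x => by
        obtain ⟨n, hn⟩ := exists_logWeight_le U x.2
        refine ⟨logMonomial n (algebraMap_mul_logTypeSpan ((c ^ n)⁻¹) hn), Subtype.ext ?_⟩
        change (Polynomial.monomial n (_ * x.1)).eval _ = x.1
        rw [Polynomial.eval_monomial, mul_comm, ← mul_assoc, ← map_pow, ← map_mul,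
          mul_inv_cancel₀ (pow_ne_zero n hc), map_one, one_mul] }
  res {U V} h p := Subtype.ext (by
    change (p.1.map (jetMap k (secResLog b W h)).toRingHom).eval _ =
      jetMap k (secResLog b W h) (p.1.eval _)
    rw [← (jetMap k (secResLog b W h)).commutes]
    exact Polynomial.eval_map_apply _ _)
  str U r := Subtype.ext (eval_C)

end

section
section LinearPart

instance (B : Type) [CommRing B] [Algebra ℂ B] : Module Bᵐᵒᵖ (Ω[B⁄ℂ]) :=
  Module.compHom _ ((RingHom.id B).fromOpposite mul_comm)

instance (B : Type) [CommRing B] [Algebra ℂ B] : IsCentralScalar B (Ω[B⁄ℂ]) := ⟨fun _ _ => rfl⟩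

variable {k : ℕ} {B : Type} [CommRing B] [Algebra ℂ B]

lemma sum_fin_filter_eq_ends {M : Type*} [AddCommMonoid M] {j : Fin (k + 1)} (hj : j ≠ 0)
    (g : Fin (k + 1) × Fin (k + 1) → M) (hg : ∀ p, p.1 ≠ 0 → p.2 ≠ 0 → g p = 0) :
    ∑ p : Fin (k + 1) × Fin (k + 1) with (p.1 : ℕ) + (p.2 : ℕ) = (j : ℕ), g p =
      g (0, j) + g (j, 0) := by
  rw [← Finset.sum_pair (f := g) (by simpa using fun h => absurd h.symm hj)]
  symm
  refine Finset.sum_subset (fun p hp => ?_) fun p hp hp' => ?_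
  · rw [mem_filter]
    rcases Finset.mem_insert.1 hp with rfl | hp
    · simp
    · rw [Finset.mem_singleton] at hp
      subst hp
      simp
  · rw [mem_filter] at hp
    rw [Finset.mem_insert, Finset.mem_singleton, not_or, Prod.ext_iff, Prod.ext_iff] at hp'
    refine hg p (fun h => hp'.1 ⟨h, Fin.ext ?_⟩) fun h => hp'.2 ⟨Fin.ext ?_, h⟩
    · have := hp.2; rw [h] at this; simpa using this
    · have := hp.2; rw [h] at this; simpa using this

/-- The homomorphism `b^{(0)} ↦ b`, `b^{(i+1)} ↦ db`, which kills the other derivatives. -/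
def linHom (i : Fin k) : JetRing k B →ₐ[ℂ] TrivSqZeroExt B (Ω[B⁄ℂ]) :=
  jetLift (fun j b => if j = 0 then TrivSqZeroExt.inl b else
      if j = i.succ then TrivSqZeroExt.inr (D ℂ B b) else 0)
    (fun j a b => by split_ifs <;> simp)
    (fun j a b => by
      by_cases hj : j = 0
      · subst hj
        rw [filter_zero]
        simp
      · rw [sum_fin_filter_eq_ends hj]
        · by_cases h : j = i.succ
          · ext <;> simp [h]
          · simp [hj, h]
        · intro p h1 h2
          rw [if_neg h1, if_neg h2]
          split_ifs <;> simp)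
    (fun j c => by
      split_ifs
      · rfl
      · simp
      · rfl)

lemma linHom_jd0 (i : Fin k) (a : B) : linHom i (jd k 0 a) = TrivSqZeroExt.inl a := by
  rw [linHom, jetLift_jd, if_pos rfl]

lemma linHom_jd (i j : Fin k) (a : B) : linHom i (jd k j.succ a) =
    if j = i then TrivSqZeroExt.inr (D ℂ B a) else 0 := by
  rw [linHom, jetLift_jd, if_neg (Fin.succ_ne_zero j)]
  simp only [Fin.succ_inj]

lemma linHom_logD (i j : Fin k) (hj : j ≤ i) (z : Bˣ) : linHom i (logD z j) =
    if j = i then TrivSqZeroExt.inr (((z⁻¹ : Bˣ) : B) • D ℂ B (z : B))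
      else 0 := by
  rw [logD, map_mul, map_sub, linHom_jd0, linHom_jd, map_sum, Finset.sum_eq_zero, sub_zero]
  · split_ifs
    · rw [TrivSqZeroExt.inl_mul_inr]
    · rw [mul_zero]
  · intro m _
    have hm := m.2
    have e : (⟨(j : ℕ) - (m : ℕ), by omega⟩ : Fin (k + 1)) =
        Fin.succ ⟨(j : ℕ) - (m : ℕ) - 1, by omega⟩ := Fin.ext (by simp; omega)
    rw [map_nsmul, map_mul, e, linHom_jd, if_neg, zero_mul, smul_zero]
    intro h
    have h1 := congrArg Fin.val h
    have h2 : (j : ℕ) ≤ i := hj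
    simp at h1
    omega

/-- The linear part of order `i + 1` of a jet differential. -/
def lin (i : Fin k) : JetRing k B →+ Ω[B⁄ℂ] :=
  (TrivSqZeroExt.sndHom B (Ω[B⁄ℂ])).toAddMonoidHom.comp (linHom i).toRingHom.toAddMonoidHom

lemma lin_apply (i : Fin k) (x : JetRing k B) : lin i x = (linHom i x).snd := rfl

lemma lin_jd0_mul (i : Fin k) (a : B) (x : JetRing k B) : lin i (jd k 0 a * x) = a • lin i x := by
  rw [lin_apply, map_mul, linHom_jd0, TrivSqZeroExt.snd_mul]
  simp [lin_apply]

lemma lin_jd (i : Fin k) (a : B) : lin i (jd k i.succ a) = D ℂ B a := by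
  rw [lin_apply, linHom_jd, if_pos rfl, TrivSqZeroExt.snd_inr]

lemma lin_logD (i : Fin k) (z : Bˣ) : lin i (logD z i) = ((z⁻¹ : Bˣ) : B) • D ℂ B (z : B) := by
  rw [lin_apply, linHom_logD i i le_rfl, if_pos rfl, TrivSqZeroExt.snd_inr]

lemma linHom_letters {A₀ : Subring B} {i j : Fin k} (hj : j < i) {x : JetRing k B}
    (hx : x ∈ letters A₀ j) : linHom i x = 0 := by
  rcases hx with ⟨a, _, rfl⟩ | ⟨z, _, rfl⟩
  · rw [linHom_jd, if_neg hj.ne]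
  · rw [linHom_logD i j hj.le, if_neg hj.ne]

lemma lin_isMono {A₀ : Subring B} (i : Fin k) {l : Fin k →₀ ℕ} {x : JetRing k B}
    (hx : IsMono A₀ l x) (hl : ∀ j, i ≤ j → l j = 0) : lin i x = 0 := by
  rw [lin_apply]
  induction hx with
  | one => rw [map_one]; rfl
  | mul l x j y _ hy ih =>
    have hj : j < i := by
      by_contra h
      have := hl j (not_lt.1 h)
      simp at this
    rw [map_mul, linHom_letters hj hy, mul_zero]
    rfl

lemma eq_zero_of_lexLT_single {i : Fin k} {l : Fin k →₀ ℕ}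
    (h : lexLT l (single i 1)) (j : Fin k) (hj : i ≤ j) : l j = 0 := by
  obtain ⟨i', h1, h2⟩ := h
  have hi : i' = i := by
    by_contra hi
    rw [single_eq_of_ne hi] at h1
    omega
  subst hi
  rcases hj.lt_or_eq with hj | rfl
  · rw [h2 j hj, single_eq_of_ne hj.ne']
  · simpa using h1

lemma lexLT_of_mem_lowerSet_diff {l l' : Fin k →₀ ℕ} (h : l' ∈ lowerSet l \ {l}) :
    lexLT l' l := by
  rcases h with ⟨h, h'⟩
  rw [lowerSet, Set.mem_ofPred_eq] at h
  exact (h.resolve_left h').1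

lemma IsMono.mem_letters {A₀ : Subring B} {i : Fin k} {l : Fin k →₀ ℕ} {x : JetRing k B}
    (hx : IsMono A₀ l x) (hl : l = single i 1) : x ∈ letters A₀ i := by
  cases hx with
  | one => exact absurd (DFunLike.congr_fun hl i) (by simp)
  | mul l x j y hx hy =>
    have h0 : ∀ m, l m + single j 1 m = single i 1 m := DFunLike.congr_fun hl
    have hj : j = i := by
      by_contra hj
      have := h0 j
      rw [single_eq_same, single_eq_of_ne hj] at this
      omega
    subst hj
    have hl0 : l = 0 := by
      ext m
      have := h0 m
      rw [Finsupp.coe_zero, Pi.zero_apply]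
      omega
    subst hl0
    have key : ∀ {l : Fin k →₀ ℕ} {x : JetRing k B}, IsMono A₀ l x → l = 0 → x = 1 := by
      intro l x hx hl
      cases hx with
      | one => rfl
      | mul l x j y _ _ => exact absurd (DFunLike.congr_fun hl j) (by simp)
    rwa [key hx rfl, one_mul]

lemma lin_jetMap {C : Type} [CommRing C] [Algebra ℂ C] (g : B →ₐ[ℂ] C) (i : Fin k)
    (x : JetRing k B) : lin i (jetMap k g x) = omegaMap g (lin i x) := by
  let S : Subring (JetRing k B) :=
    { carrier := {x | (linHom i (jetMap k g x)).fst = g (linHom i x).fst ∧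
        (linHom i (jetMap k g x)).snd = omegaMap g (linHom i x).snd}
      mul_mem' := by
        rintro x y ⟨hx, hx'⟩ ⟨hy, hy'⟩
        rw [Set.mem_ofPred_eq, map_mul, map_mul, map_mul, TrivSqZeroExt.fst_mul,
          TrivSqZeroExt.snd_mul, TrivSqZeroExt.fst_mul, TrivSqZeroExt.snd_mul, hx, hx', hy, hy']
        simp [omegaMap_smul]
      one_mem' := by simp
      add_mem' := by
        rintro x y ⟨hx, hx'⟩ ⟨hy, hy'⟩
        simp [hx, hx', hy, hy']
      zero_mem' := by simp
      neg_mem' := by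
        rintro x ⟨hx, hx'⟩
        simp [hx, hx'] }
  have hS : S = ⊤ := jetRing_closure S fun j a => by
    change (linHom i (jetMap k g (jd k j a))).fst = _ ∧ (linHom i (jetMap k g (jd k j a))).snd = _
    rw [jetMap_jd]
    induction j using Fin.cases with
    | zero => simp [linHom_jd0]
    | succ j =>
      rw [linHom_jd, linHom_jd]
      split_ifs <;> simp [omegaMap_D]
  have : x ∈ S := hS ▸ mem_top x
  exact this.2

lemma map_linHom_coaction (i : Fin k) (x : JetRing k B) :
    (jetCoaction k B x).map (linHom i).toRingHom = Polynomial.C (TrivSqZeroExt.inl (linHom i x).fst) +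
      Polynomial.monomial ((i : ℕ) + 1) (TrivSqZeroExt.inr (linHom i x).snd) := by
  let S : Subring (JetRing k B) :=
    { carrier := {x | (jetCoaction k B x).map (linHom i).toRingHom =
        Polynomial.C (TrivSqZeroExt.inl (linHom i x).fst) +
          Polynomial.monomial ((i : ℕ) + 1) (TrivSqZeroExt.inr (linHom i x).snd)}
      mul_mem' := by
        intro x y hx hy
        rw [Set.mem_ofPred_eq] at *
        rw [map_mul, Polynomial.map_mul, hx, hy, map_mul, TrivSqZeroExt.fst_mul,
          TrivSqZeroExt.snd_mul, add_mul, mul_add, mul_add, Polynomial.monomial_mul_monomial,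
          TrivSqZeroExt.inr_mul_inr, map_zero, add_zero, ← Polynomial.C_mul, Polynomial.C_mul_monomial,
          Polynomial.monomial_mul_C, TrivSqZeroExt.inl_mul_inr, TrivSqZeroExt.inr_mul_inl,
          TrivSqZeroExt.inr_add, map_add, TrivSqZeroExt.inl_mul, add_assoc]
      one_mem' := by simp
      add_mem' := by
        intro x y hx hy
        rw [Set.mem_ofPred_eq] at *
        rw [map_add, Polynomial.map_add, hx, hy, map_add, TrivSqZeroExt.fst_add,
          TrivSqZeroExt.snd_add, TrivSqZeroExt.inl_add, TrivSqZeroExt.inr_add, map_add, map_add]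
        abel
      zero_mem' := by simp
      neg_mem' := by
        intro x hx
        rw [Set.mem_ofPred_eq] at *
        rw [map_neg, Polynomial.map_neg, hx, map_neg, TrivSqZeroExt.fst_neg,
          TrivSqZeroExt.snd_neg, TrivSqZeroExt.inl_neg, TrivSqZeroExt.inr_neg, map_neg, map_neg,
          neg_add] }
  have hS : S = ⊤ := jetRing_closure S fun j a => by
    change (jetCoaction k B (jd k j a)).map _ = _
    rw [jetCoaction_jd, Polynomial.map_monomial]
    change Polynomial.monomial _ (linHom i (jd k j a)) = _
    induction j using Fin.cases with
    | zero => simp [linHom_jd0]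
    | succ j =>
      rw [linHom_jd]
      split_ifs with h
      · subst h; simp
      · simp
  have : x ∈ S := hS ▸ mem_top x
  exact this

lemma lin_proj (i : Fin k) (x : JetRing k B) :
    lin i (proj (jetGr k B) ((i : ℕ) + 1) x) = lin i x := by
  classical
  have key : ∀ m (y : JetRing k B), y ∈ jetGr k B m → m ≠ i + 1 → lin i y = 0 := by
    intro m y hy hm
    have h := map_linHom_coaction i y
    rw [show jetCoaction k B y = _ from hy, Polynomial.map_monomial] at h
    have h' := congrArg (fun p => (p.coeff ((i : ℕ) + 1)).snd) h
    simp only [Polynomial.coeff_monomial, if_neg hm, Polynomial.coeff_add, Polynomial.coeff_C,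
      if_neg (Nat.succ_ne_zero _), if_true, zero_add, TrivSqZeroExt.snd_inr,
      TrivSqZeroExt.snd_zero] at h'
    exact h'.symm
  conv_rhs => rw [← DirectSum.sum_support_decompose (jetGr k B) x, map_sum]
  rw [sum_eq_single ((i : ℕ) + 1)]
  · rw [proj_apply]
  · intro n _ hn
    exact key n _ (SetLike.coe_mem _) hn
  · intro h
    rw [DFinsupp.notMem_support_iff.1 h]
    simp

end LinearPart

end

section
/-- The types that occur in the expressions of a letter of order `i + 1` in other coordinates. -/
abbrev letterSet {k : ℕ} (i : Fin k) : Set (Fin k →₀ ℕ) := lowerSet (single i 1)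

/-- The types that occur in the difference of two letters of order `i + 1` with the same linear
part. -/
abbrev letterSetLT {k : ℕ} (i : Fin k) : Set (Fin k →₀ ℕ) := lowerSet (single i 1) \ {single i 1}

lemma single_mem_letterSet {k : ℕ} (i : Fin k) : single i 1 ∈ letterSet i := by
  rw [letterSet, lowerSet, Set.mem_ofPred_eq]
  exact Or.inl rfl

lemma letterSet_cases {k : ℕ} {i : Fin k} {l : Fin k →₀ ℕ} (h : l ∈ letterSet i) :
    l = single i 1 ∨ l ∈ letterSetLT i := by
  by_cases hl : l = single i 1
  · exact Or.inl hl
  · exact Or.inr ⟨h, hl⟩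

lemma monoType_eq_single {k : ℕ} {ι : Type} {m : ι × Fin k →₀ ℕ} {i : Fin k}
    (h : monoType m = single i 1) : ∃ j, m = single (j, i) 1 := by
  classical
  have hm : m ≠ 0 := by
    rintro rfl
    rw [monoType_zero] at h
    exact absurd (DFunLike.congr_fun h i) (by simp)
  obtain ⟨⟨j, i'⟩, hv⟩ := Finsupp.support_nonempty_iff.2 hm
  obtain ⟨m', rfl⟩ : ∃ m', m = single (j, i') 1 + m' :=
    ⟨m - single (j, i') 1, (add_tsub_cancel_of_le (Finsupp.single_le_iff.2
      (Nat.one_le_iff_ne_zero.2 (Finsupp.mem_support_iff.1 hv)))).symm⟩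
  rw [monoType_add, monoType_single] at h
  have h0 : ∀ n, single i' 1 n + monoType m' n = single i 1 n := DFunLike.congr_fun h
  have hi : i' = i := by
    by_contra hi
    have := h0 i'
    rw [single_eq_same, single_eq_of_ne hi] at this
    omega
  subst hi
  refine ⟨j, ?_⟩
  have hm' : m' = 0 := by
    by_contra hm'
    obtain ⟨⟨j', i''⟩, hv'⟩ := Finsupp.support_nonempty_iff.2 hm'
    obtain ⟨m'', rfl⟩ : ∃ m'', m' = single (j', i'') 1 + m'' :=
      ⟨m' - single (j', i'') 1, (add_tsub_cancel_of_le (Finsupp.single_le_iff.2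
        (Nat.one_le_iff_ne_zero.2 (Finsupp.mem_support_iff.1 hv')))).symm⟩
    have := h0 i''
    rw [monoType_add, monoType_single, Finsupp.add_apply, single_eq_same] at this
    omega
  rw [hm', add_zero]

namespace LogCoord

variable {B : Type} [CommRing B] [Algebra ℂ B] {A₀ : Subring B} {ι : Type}
  (L : LogCoord B A₀ ι) {k : ℕ}

def coForm (j : ι) : Ω[B⁄ℂ] →ₗ[B] B := (L.θ j).liftKaehlerDifferential

open Classical in
lemma coForm_letter (j j' : ι) (i : Fin k) :
    L.coForm j (lin i (L.letter k j' i)) = if j' = j then 1 else 0 := by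
  rw [letter, coForm]
  split_ifs with h hj hj
  · subst hj
    rw [lin_logD, map_smul, Derivation.liftKaehlerDifferential_comp_D, IsUnit.unit_spec,
      L.θ_log _ h, smul_eq_mul, IsUnit.val_inv_mul]
  · rw [lin_logD, map_smul, Derivation.liftKaehlerDifferential_comp_D, IsUnit.unit_spec,
      L.θ_ne _ _ (Ne.symm hj), smul_zero]
  · subst hj
    rw [lin_jd, Derivation.liftKaehlerDifferential_comp_D, L.θ_self _ h]
  · rw [lin_jd, Derivation.liftKaehlerDifferential_comp_D, L.θ_ne _ _ (Ne.symm hj)]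

/-- A jet differential is the sum of its linear terms of order `i + 1` and of terms of lower
type. -/
lemma lin_eq_sum [Fintype ι] {i : Fin k} {x : JetRing k B} (hx : x ∈ typeSpan A₀ (letterSet i)) :
    lin i x = ∑ j, (L.toPoly k x).coeff (single (j, i) 1) • lin i (L.letter k j i) := by
  classical
  have key : ∀ P : MvPolynomial (ι × Fin k) B, P ∈ polySpan A₀ (letterSet i) →
      lin i (L.ofPoly k P) = ∑ j, P.coeff (single (j, i) 1) • lin i (L.letter k j i) := by
    intro P hP
    let f : MvPolynomial (ι × Fin k) B →+ Ω[B⁄ℂ] := (lin i).comp (L.ofPoly k).toAddMonoidHom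
    let f' : MvPolynomial (ι × Fin k) B →+ Ω[B⁄ℂ] :=
      { toFun := fun P => ∑ j, P.coeff (single (j, i) 1) • lin i (L.letter k j i)
        map_zero' := by simp
        map_add' := fun P Q => by simp [add_smul, sum_add_distrib] }
    have : (f - f') P ∈ (⊥ : AddSubgroup (Ω[B⁄ℂ])) := by
      refine polySpan_induction (A₀ := A₀) (f - f') ⊥ (fun a ha m hm => ?_) hP
      rw [AddSubgroup.mem_bot, AddMonoidHom.sub_apply, sub_eq_zero]
      change lin i (L.ofPoly k (monomial m a)) =
        ∑ j, (monomial m a).coeff (single (j, i) 1) • lin i (L.letter k j i)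
      rw [← mul_one a, ← C_mul_monomial, map_mul, ofPoly_C, lin_jd0_mul]
      rcases letterSet_cases hm with hm | hm
      · obtain ⟨j, rfl⟩ := monoType_eq_single hm
        rw [sum_eq_single j]
        · rw [coeff_C_mul, coeff_monomial, if_pos rfl, mul_one]
          congr 2
          exact L.ofPoly_X k (j, i)
        · intro j' _ hj'
          rw [coeff_C_mul, coeff_monomial, if_neg, mul_zero, zero_smul]
          intro h
          exact hj' (Prod.ext_iff.1 (Finsupp.single_left_injective one_ne_zero h)).1.symm
        · exact fun h => absurd (mem_univ j) h
      · rw [lin_isMono i (L.isMono_ofPoly k m)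
          (eq_zero_of_lexLT_single (lexLT_of_mem_lowerSet_diff hm)), smul_zero,
          Finset.sum_eq_zero]
        intro j _
        rw [coeff_C_mul, coeff_monomial, if_neg, mul_zero, zero_smul]
        rintro rfl
        rw [monoType_single] at hm
        exact hm.2 rfl
    rw [AddSubgroup.mem_bot, AddMonoidHom.sub_apply, sub_eq_zero] at this
    exact this
  conv_lhs => rw [← L.ofPoly_toPoly k x]
  exact key _ ((L.mem_typeSpan_iff k (isLowerType_lowerSet _)).1 hx)

lemma coForm_lin [Fintype ι] {i : Fin k} {x : JetRing k B} (hx : x ∈ typeSpan A₀ (letterSet i))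
    (j : ι) : L.coForm j (lin i x) = (L.toPoly k x).coeff (single (j, i) 1) := by
  classical
  rw [L.lin_eq_sum hx, map_sum, sum_eq_single j]
  · rw [map_smul, coForm_letter, if_pos rfl, smul_eq_mul, mul_one]
  · intro j' _ hj'
    rw [map_smul, coForm_letter, if_neg hj', smul_zero]
  · exact fun h => absurd (mem_univ j) h

include L in
lemma mem_typeSpan_of_lin_eq_zero [Fintype ι] {i : Fin k} {x : JetRing k B}
    (hx : x ∈ typeSpan A₀ (letterSet i)) (h : lin i x = 0) : x ∈ typeSpan A₀ (letterSetLT i) := by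
  rw [L.mem_typeSpan_iff k (isLowerType_lowerSet_diff _)]
  have hx' := (L.mem_typeSpan_iff k (isLowerType_lowerSet _)).1 hx
  refine fun m => ⟨(hx' m).1, fun hm => (letterSet_cases ((hx' m).2 hm)).resolve_left fun hm' => ?_⟩
  obtain ⟨j, rfl⟩ := monoType_eq_single hm'
  exact hm (by rw [← L.coForm_lin hx, h, map_zero])

end LogCoord

variable {W : X.Opens} {k : ℕ}

lemma lin_mem_logFormSpan {U : X.Opens} {i : Fin k} {x : JetRing k (Sec b (U ⊓ W))}
    (hx : x ∈ typeSpan (extendable b W U) (letterSet i)) : lin i x ∈ logFormSpan b W U := by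
  refine closure_induction (p := fun x _ => lin i x ∈ logFormSpan b W U) ?_ ?_ ?_ ?_ hx
  · rintro x ⟨a, ha, l, hl, y, hy, rfl⟩
    rw [lin_jd0_mul]
    rcases letterSet_cases hl with hl | hl
    · rcases hy.mem_letters hl with ⟨c, hc, rfl⟩ | ⟨z, hz, rfl⟩
      · rw [lin_jd]
        exact subset_closure (Or.inl ⟨a, ha, c, hc, rfl⟩)
      · rw [lin_logD, smul_smul]
        exact subset_closure (Or.inr ⟨a, ha, z, hz, rfl⟩)
    · rw [lin_isMono i hy (eq_zero_of_lexLT_single (lexLT_of_mem_lowerSet_diff hl)), smul_zero]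
      exact zero_mem _
  · rw [map_zero]; exact zero_mem _
  · intro u v _ _ hu hv; rw [map_add]; exact add_mem hu hv
  · intro u _ hu; rw [map_neg]; exact neg_mem hu

lemma exists_lin_of_logFormSpan {U : X.Opens} (i : Fin k) {m : Ω[Sec b (U ⊓ W)⁄ℂ]}
    (hm : m ∈ logFormSpan b W U) :
    ∃ x ∈ typeSpan (extendable b W U) (letterSet i), lin i x = m := by
  have one : ∀ {y : JetRing k (Sec b (U ⊓ W))}, y ∈ letters (extendable b W U) i →
      IsMono (extendable b W U) (single i 1) y := fun hy => by
    simpa using IsMono.mul 0 1 i _ IsMono.one hy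
  refine closure_induction
    (p := fun m _ => ∃ x ∈ typeSpan (extendable b W U) (letterSet i), lin i x = m) ?_ ?_ ?_ ?_ hm
  · rintro x (⟨c, hc, a, ha, rfl⟩ | ⟨c, hc, z, hz, rfl⟩)
    · exact ⟨_, subset_closure ⟨c, hc, _, single_mem_letterSet i, _,
        one (Or.inl ⟨a, ha, rfl⟩), rfl⟩, by rw [lin_jd0_mul, lin_jd]⟩
    · exact ⟨_, subset_closure ⟨c, hc, _, single_mem_letterSet i, _,
        one (Or.inr ⟨z, hz, rfl⟩), rfl⟩, by rw [lin_jd0_mul, lin_logD, smul_smul]⟩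
  · exact ⟨0, zero_mem _, map_zero _⟩
  · rintro u v _ _ ⟨x, hx, rfl⟩ ⟨y, hy, rfl⟩
    exact ⟨x + y, add_mem hx hy, map_add _ _ _⟩
  · rintro u _ ⟨x, hx, rfl⟩
    exact ⟨-x, neg_mem hx, map_neg _ _⟩

lemma lin_logStr_mul {U : X.Opens} (i : Fin k) (r : Sec b U) (x : JetRing k (Sec b (U ⊓ W))) :
    lin i (logStr b W k U r * x) = secRes b (inf_le_left : U ⊓ W ≤ U) r • lin i x :=
  lin_jd0_mul i _ x

lemma lin_mem_logForms {U : X.Opens} {i : Fin k} {x : JetRing k (Sec b (U ⊓ W))}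
    (hx : x ∈ logTypeSpan b W k U (letterSet i)) : lin i x ∈ logForms b W U := by
  intro u hu
  obtain ⟨Z, hZ, huZ, hxZ⟩ := hx u hu
  refine ⟨Z, hZ, huZ, ?_⟩
  have := lin_mem_logFormSpan hxZ
  change lin i (jetMap k (secResLog b W hZ) x) ∈ _ at this
  rwa [lin_jetMap] at this

lemma omega_eq_zero_of_res [IsLocallyNoetherian X] (U : X.affineOpens) (f : Sec b U)
    {m : Ω[Sec b ((U : X.Opens) ⊓ W)⁄ℂ]}
    (hm : omegaMap (secResLog b W (basicOpen_le f)) m = 0) :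
    ∃ n, secRes b (inf_le_left : (U : X.Opens) ⊓ W ≤ U) (f ^ n) • m = 0 := by
  have := isLocalization_secResLog (W := W) U f
  let _ := (secResLog b W (basicOpen_le f)).toRingHom.toAlgebra
  have : IsScalarTower ℂ (Sec b ((U : X.Opens) ⊓ W)) (Sec b (X.basicOpen (f : Γ(X, U)) ⊓ W)) :=
    IsScalarTower.of_algebraMap_eq fun c =>
      ((secResLog b W (basicOpen_le f)).commutes c).symm
  obtain ⟨⟨_, n, rfl⟩, hn⟩ := (IsLocalizedModule.eq_zero_iff
    (powers (secRes b (inf_le_left : (U : X.Opens) ⊓ W ≤ U) f))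
    (KaehlerDifferential.map ℂ ℂ (Sec b ((U : X.Opens) ⊓ W))
      (Sec b (X.basicOpen (f : Γ(X, U)) ⊓ W)))).1 hm
  refine ⟨n, ?_⟩
  rw [map_pow]
  exact hn

lemma exists_lin_eq [LocallyOfFiniteType b] (hW : HasCharts b W) (U : X.affineOpens) (i : Fin k)
    {m : Ω[Sec b ((U : X.Opens) ⊓ W)⁄ℂ]} (hm : m ∈ logForms b W U) :
    ∃ x ∈ logTypeSpan b W k U (letterSet i), lin i x = m := by
  have := LocallyOfFiniteType.isLocallyNoetherian b
  let ρ : Sec b U →ₐ[ℂ] Sec b ((U : X.Opens) ⊓ W) := secRes b inf_le_left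
  let J : Ideal (Sec b U) :=
    { carrier := {r | ∃ x ∈ logTypeSpan b W k U (letterSet i), lin i x = ρ r • m}
      add_mem' := by
        rintro r s ⟨x, hx, hx'⟩ ⟨y, hy, hy'⟩
        exact ⟨x + y, add_mem hx hy, by rw [map_add, map_add, add_smul, hx', hy']⟩
      zero_mem' := ⟨0, zero_mem _, by rw [map_zero, map_zero, zero_smul]⟩
      smul_mem' := by
        rintro c r ⟨x, hx, hx'⟩
        exact ⟨_, logStr_mul_logTypeSpan c hx, by
          rw [lin_logStr_mul, hx', smul_eq_mul, map_mul, mul_smul]⟩ }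
  have h1 : ∃ x ∈ logTypeSpan b W k U (letterSet i), lin i x = ρ 1 • m := by
    refine one_mem_of_cover U J fun u hu => ?_
    obtain ⟨Z, hZ, huZ, hmZ⟩ := hm u hu
    obtain ⟨f, hf, huf⟩ : ∃ f : Sec b U, X.basicOpen (f : Γ(X, U)) ≤ Z ∧
        u ∈ X.basicOpen (f : Γ(X, U)) := U.2.exists_basicOpen_le ⟨u, huZ⟩ hu
    have hmf : omegaMap (secResLog b W (basicOpen_le f)) m ∈
        logFormSpan b W (X.basicOpen (f : Γ(X, U))) := by
      have h := logFormSpan_res b W hf hmZ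
      rwa [omegaMap_comp, secResLog_comp] at h
    obtain ⟨y, hy, hym⟩ := exists_lin_of_logFormSpan i hmf
    obtain ⟨N, x, hx, hxy⟩ := logTypeSpan_surj hW U f (isLowerType_lowerSet _)
      (logTypeSpan_of_typeSpan b W k hy)
    obtain ⟨n, hn⟩ := omega_eq_zero_of_res U f (m := lin i x - ρ (f ^ N) • m) (by
      rw [map_sub, ← lin_jetMap, hxy, ← map_pow, lin_logStr_mul, hym, omegaMap_smul,
        secResLog_secRes, map_pow (secRes b (basicOpen_le f)), sub_self])
    refine ⟨f ^ (n + N + 1), ⟨logStr b W k U (f * f ^ n) * x, logStr_mul_logTypeSpan _ hx, ?_⟩,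
      (X.basicOpen_pow f (n + N).succ_pos).ge huf⟩
    rw [smul_sub, sub_eq_zero] at hn
    rw [lin_logStr_mul, map_mul, mul_smul, hn, smul_smul, smul_smul]
    congr 1
    change ρ f * ρ (f ^ n) * ρ (f ^ N) = _
    rw [← map_mul, ← map_mul]
    congr 1
    ring
  rwa [map_one, one_smul] at h1

lemma mem_logTypeSpan_of_lin_eq_zero [LocallyOfFiniteType b] (hW : HasCharts b W)
    (U : X.affineOpens) {i : Fin k} {x : JetRing k (Sec b ((U : X.Opens) ⊓ W))}
    (hx : x ∈ logTypeSpan b W k U (letterSet i)) (h : lin i x = 0) :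
    x ∈ logTypeSpan b W k U (letterSetLT i) := by
  intro u hu
  obtain ⟨g, hug, ⟨ch⟩⟩ := hW.exists_basicOpen U hu
  refine ⟨X.affineBasicOpen (U := U) g, X.basicOpen_le _, hug, ?_⟩
  refine ch.log.mem_typeSpan_of_lin_eq_zero ((ch.mem_logTypeSpan_iff (isLowerType_lowerSet _)).1
    (logTypeSpan_res b W k _ hx)) ?_
  exact (lin_jetMap _ i x).trans (by rw [h, map_zero])

end

section
def liftSubring {S S' : Type} [CommRing S] [CommRing S'] (φ : S →+* S') (f : S) : Subring S' where
  carrier := {y | ∃ (n : ℕ) (x : S), φ x = φ f ^ n * y}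
  mul_mem' := by
    rintro y y' ⟨n, x, hx⟩ ⟨n', x', hx'⟩
    exact ⟨n + n', x * x', by rw [map_mul, hx, hx']; ring⟩
  one_mem' := ⟨0, 1, by simp⟩
  add_mem' := by
    rintro y y' ⟨n, x, hx⟩ ⟨n', x', hx'⟩
    exact ⟨n + n', f ^ n' * x + f ^ n * x', by
      rw [map_add, map_mul, map_mul, map_pow, map_pow, hx, hx']; ring⟩
  zero_mem' := ⟨0, 0, by simp⟩
  neg_mem' := by
    rintro y ⟨n, x, hx⟩
    exact ⟨n, -x, by rw [map_neg, hx, mul_neg]⟩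

lemma mem_liftSubring {S S' : Type} [CommRing S] [CommRing S'] {φ : S →+* S'} {f : S} {y : S'} :
    y ∈ liftSubring φ f ↔ ∃ (n : ℕ) (x : S), φ x = φ f ^ n * y := Iff.rfl

section SymLocalization

variable {R R' : Type} [CommRing R] [CommRing R'] [Algebra R R'] {p : ℕ} {M M' : Fin p → Type}
  [∀ i, AddCommGroup (M i)] [∀ i, Module R (M i)] [∀ i, AddCommGroup (M' i)]
  [∀ i, Module R (M' i)] [∀ i, Module R' (M' i)] [∀ i, IsScalarTower R R' (M' i)]
  (f : R) [IsLocalization.Away f R'] (g : ∀ i, M i →ₗ[R] M' i)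
  [∀ i, IsLocalizedModule (powers f) (g i)]

lemma symMap_eq_zero (hg : ∀ i (r : R) (x : M i), (g i).toAddMonoidHom (r • x) =
      algebraMap R R' r • (g i).toAddMonoidHom x) {x : SymmetricAlgebra R (∀ i, M i)}
    (hx : symMap (algebraMap R R') (fun i => (g i).toAddMonoidHom) hg x = 0) :
    ∃ n, algebraMap R _ f ^ n * x = 0 := by
  let S := SymmetricAlgebra R (∀ i, M i)
  let L := Away (algebraMap R S f)
  have hu : IsUnit (((algebraMap S L).comp (algebraMap R S)) f) :=
    algebraMap_isUnit (algebraMap R S f)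
  let e : R' →+* L := IsLocalization.Away.lift f hu
  have he : ∀ r, e (algebraMap R R' r) = algebraMap S L (algebraMap R S r) :=
    IsLocalization.Away.lift_eq f hu
  let _ : Algebra R' L := e.toAlgebra
  have : IsScalarTower R R' L := IsScalarTower.of_algebraMap_eq fun r => (he r).symm
  let G : (∀ i, M i) →ₗ[R] (∀ i, M' i) := .pi fun i => g i ∘ₗ .proj i
  let h : (∀ i, M i) →ₗ[R] L :=
    (IsScalarTower.toAlgHom R S L).toLinearMap ∘ₗ SymmetricAlgebra.ι R (∀ i, M i)
  have hunit : ∀ x : powers f, IsUnit (algebraMap R (Module.End R L) x) := by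
    rintro ⟨_, n, rfl⟩
    rw [map_pow]
    exact IsUnit.pow n ((Module.End.isUnit_iff _).2 ⟨fun x y h => hu.mul_left_cancel (by
      change f • x = f • y at h
      rwa [smul_def, smul_def] at h), fun y => by
      obtain ⟨v, hv⟩ := hu.exists_right_inv
      refine ⟨v * y, ?_⟩
      change f • (v * y) = y
      rw [smul_def, ← mul_assoc]
      exact (congrArg (· * y) hv).trans (one_mul y)⟩)
  let h' : (∀ i, M' i) →ₗ[R'] L := (IsLocalizedModule.lift (powers f) G h
    hunit).extendScalarsOfIsLocalization (powers f) R'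
  have hh : ∀ x, h' (G x) = h x := IsLocalizedModule.lift_apply (powers f) G h hunit
  let θ : SymmetricAlgebra R' (∀ i, M' i) →ₐ[R'] L := SymmetricAlgebra.lift h'
  have hθ : eqLocus (θ.toRingHom.comp
      (symMap (algebraMap R R') (fun i => (g i).toAddMonoidHom) hg)) (algebraMap S L) = ⊤ := by
    refine sym_closure R M _ (fun r => ?_) fun i y => ?_
    · change θ (symMap _ _ _ _) = _
      rw [symMap_algebraMap, AlgHom.commutes]
      exact he r
    · change θ (symMap _ _ _ _) = _
      rw [symMap_ι]
      exact (SymmetricAlgebra.lift_ι_apply _ _).trans (hh _)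
  have h1 : x ∈ eqLocus (θ.toRingHom.comp
      (symMap (algebraMap R R') (fun i => (g i).toAddMonoidHom) hg)) (algebraMap S L) :=
    hθ ▸ mem_top x
  have h2 : θ (symMap (algebraMap R R') (fun i => (g i).toAddMonoidHom) hg x) =
    algebraMap S L x := h1
  rw [hx, map_zero] at h2
  obtain ⟨⟨_, n, rfl⟩, hn⟩ := (map_eq_zero_iff (powers (algebraMap R S f)) L x).1 h2.symm
  exact ⟨n, hn⟩

end SymLocalization

lemma liftSubring_symMap {R R' : Type} [CommRing R] [CommRing R'] {p : ℕ} {M M' : Fin p → Type}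
    [∀ i, AddCommGroup (M i)] [∀ i, Module R (M i)] [∀ i, AddCommGroup (M' i)]
    [∀ i, Module R' (M' i)] (ρ : R →+* R') (g : ∀ i, M i →+ M' i)
    (hg : ∀ i (r : R) (x : M i), g i (r • x) = ρ r • g i x) (f : R)
    (hρ : ∀ r, ∃ n x, ρ x = ρ f ^ n * r) (hM : ∀ i y, ∃ n x, g i x = ρ (f ^ n) • y) :
    liftSubring (symMap ρ g hg) (algebraMap R _ f) = ⊤ := by
  refine sym_closure R' M' _ (fun r => ?_) fun i y => ?_
  · obtain ⟨n, x, hx⟩ := hρ r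
    refine mem_liftSubring.2 ⟨n, algebraMap R _ x, ?_⟩
    rw [symMap_algebraMap, symMap_algebraMap, hx, map_mul, map_pow]
  · obtain ⟨n, x, hx⟩ := hM i y
    refine mem_liftSubring.2 ⟨n, SymmetricAlgebra.ι R _ (LinearMap.single R M i x), ?_⟩
    rw [symMap_ι, symMap_algebraMap, ← map_pow, ← map_pow, ← smul_def, ← map_smul, ← map_smul, ← hx]
    congr 1
    ext j
    by_cases hj : j = i
    · subst hj; simp
    · simp [Pi.single_eq_of_ne hj]

def nonvanishing (U : X.affineOpens) (f : Sec b U) : X.affineOpens := X.affineBasicOpen (U := U) f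

lemma nonvanishing_le (U : X.affineOpens) (f : Sec b U) : (nonvanishing U f : X.Opens) ≤ U :=
  basicOpen_le f

lemma isLocalization_nonvanishing (U : X.affineOpens) (f : Sec b U) :
    letI := (secRes b (nonvanishing_le U f)).toRingHom.toAlgebra
    IsLocalization.Away f (Sec b (nonvanishing U f)) :=
  isLocalization_secRes_affine U f _ rfl

section WeightedSym

variable (M : ModuleOn b) (hinj : ∀ (U : X.affineOpens) (f : Sec b U) (x : M.mod U),
    M.res (nonvanishing_le U f) x = 0 → ∃ n : ℕ, f ^ n • x = 0)
  (hsurj : ∀ (U : X.affineOpens) (f : Sec b U) (y : M.mod (nonvanishing U f)),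
    ∃ (n : ℕ) (x : M.mod U), M.res (nonvanishing_le U f) x =
      secRes b (nonvanishing_le U f) (f ^ n) • y)

include hinj hsurj in
lemma weightedSym_inj {p : ℕ} (a : Fin p → ℕ) (U : X.affineOpens) (f : Sec b U)
    (x : (weightedSym b (fun _ => M) a).ring U)
    (hx : (weightedSym b (fun _ => M) a).res (nonvanishing_le U f) x = 0) : ∃ n : ℕ, (weightedSym b (fun _ => M) a).str U f ^ n * x = 0 := by
  let V := nonvanishing U f
  let _ : Algebra (Sec b U) (Sec b V) := (secRes b (nonvanishing_le U f)).toRingHom.toAlgebra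
  have hloc : IsLocalization.Away f (Sec b V) := isLocalization_nonvanishing U f
  let _ : Module (Sec b U) (M.mod V) := Module.compHom _ (algebraMap (Sec b U) (Sec b V))
  have : IsScalarTower (Sec b U) (Sec b V) (M.mod V) := ⟨fun r s m => by
    rw [smul_def, mul_smul]; rfl⟩
  let g : M.mod U →ₗ[Sec b U] M.mod V :=
    { M.res (nonvanishing_le U f) with map_smul' := fun r x => M.res_smul _ r x }
  have : IsLocalizedModule (powers f) g :=
    { map_units := by
        rintro ⟨_, n, rfl⟩
        have hu := (algebraMap_isUnit (S := Sec b V) f).pow n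
        rw [← map_pow] at hu
        refine (Module.End.isUnit_iff _).2 ⟨fun x y h => ?_, fun y => ?_⟩
        · exact (hu.smul_left_cancel).1 h
        · obtain ⟨v, hv⟩ := hu.exists_right_inv
          refine ⟨v • y, ?_⟩
          change algebraMap (Sec b U) (Sec b V) (f ^ n) • v • y = y
          rw [smul_smul, hv, one_smul]
      surj := fun y => by
        obtain ⟨n, x, hx⟩ := hsurj U f y
        refine ⟨⟨x, _, n, rfl⟩, ?_⟩
        exact hx.symm
      exists_of_eq := fun {x y} h => by
        obtain ⟨n, hn⟩ := hinj U f (x - y) (by rw [map_sub, sub_eq_zero]; exact h)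
        refine ⟨⟨_, n, rfl⟩, ?_⟩
        rw [smul_sub, sub_eq_zero] at hn
        exact hn }
  exact symMap_eq_zero f (fun _ : Fin p => g) (fun _ r x => M.res_smul _ r x) hx

include hsurj in
lemma weightedSym_surj {p : ℕ} (a : Fin p → ℕ) (U : X.affineOpens) (f : Sec b U)
    (y : (weightedSym b (fun _ => M) a).ring (nonvanishing U f)) :
    ∃ (n : ℕ) (x : (weightedSym b (fun _ => M) a).ring U),
      (weightedSym b (fun _ => M) a).res (nonvanishing_le U f) x = (weightedSym b (fun _ => M) a).res
          (nonvanishing_le U f) ((weightedSym b (fun _ => M) a).str U f) ^ n * y := by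
  have h := liftSubring_symMap (secRes b (nonvanishing_le U f)).toRingHom
    (fun _ : Fin p => M.res (nonvanishing_le U f))
    (fun _ r x => M.res_smul _ r x) f (exists_eq_pow_mul (isLocalization_nonvanishing U f))
    (fun _ => hsurj U f)
  exact mem_liftSubring.1 (h.ge (mem_top y))

end WeightedSym

lemma bijective_of_basicOpen {A A' : GradedAlgOn b} (φ : ∀ U, A.ring U →+* A'.ring U)
    (hres : ∀ {U V : X.affineOpens} (h : (V : X.Opens) ≤ U) x, φ V (A.res h x) = A'.res h (φ U x))
    (hstr : ∀ U r, φ U (A.str U r) = A'.str U r)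
    (hinj : ∀ (U : X.affineOpens) (f : Sec b U) (x : A.ring U), A.res (nonvanishing_le U f) x = 0 →
        ∃ n : ℕ, A.str U f ^ n * x = 0)
    (hsurj : ∀ (U : X.affineOpens) (f : Sec b U) (y : A.ring (nonvanishing U f)),
      ∃ (n : ℕ) (x : A.ring U), A.res (nonvanishing_le U f) x =
        A.res (nonvanishing_le U f) (A.str U f) ^ n * y)
    (hinj' : ∀ (U : X.affineOpens) (f : Sec b U) (x : A'.ring U),
      A'.res (nonvanishing_le U f) x = 0 → ∃ n : ℕ, A'.str U f ^ n * x = 0) (U : X.affineOpens)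
    (hU : ∀ u ∈ (U : X.Opens), ∃ f : Sec b U, u ∈ X.basicOpen (f : Γ(X, U)) ∧
      Bijective (φ (nonvanishing U f))) : Bijective (φ U) := by
  constructor
  · rw [injective_iff_map_eq_zero]
    intro x hx
    let J : Ideal (Sec b U) := RingHom.ker ((Ideal.Quotient.mk
      (Submodule.annihilator (Ideal.span {x} : Ideal (A.ring U)))).comp (A.str U))
    have hJ : ∀ r, r ∈ J ↔ A.str U r * x = 0 := fun r => by
      rw [RingHom.mem_ker, comp_apply, eq_zero_iff_mem,
        Submodule.mem_annihilator_span_singleton, smul_eq_mul]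
    have h1 := (hJ 1).1 (one_mem_of_cover U J fun u hu => by
      obtain ⟨f, huf, hf⟩ := hU u hu
      obtain ⟨n, hn⟩ := hinj U f x (hf.1 (by rw [hres, hx, map_zero, map_zero]))
      refine ⟨f ^ (n + 1), (hJ _).2 ?_, (X.basicOpen_pow f n.succ_pos).ge huf⟩
      rw [pow_succ', map_mul, map_pow, mul_assoc, hn, mul_zero])
    rwa [map_one, one_mul] at h1
  · intro y
    let J : Ideal (Sec b U) :=
      { carrier := {r | ∃ x, φ U x = A'.str U r * y}
        add_mem' := by
          rintro r s ⟨x, hx⟩ ⟨z, hz⟩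
          exact ⟨x + z, by rw [map_add, map_add, add_mul, hx, hz]⟩
        zero_mem' := ⟨0, by rw [map_zero, map_zero, zero_mul]⟩
        smul_mem' := by
          rintro c r ⟨x, hx⟩
          exact ⟨A.str U c * x, by rw [map_mul, hstr, hx, smul_eq_mul, map_mul, mul_assoc]⟩ }
    have h1 : ∃ x, φ U x = A'.str U 1 * y := one_mem_of_cover U J fun u hu => by
      obtain ⟨f, huf, hf⟩ := hU u hu
      obtain ⟨z, hz⟩ := hf.2 (A'.res (nonvanishing_le U f) y)
      obtain ⟨n, x, hx⟩ := hsurj U f z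
      obtain ⟨m, hm⟩ := hinj' U f (φ U x - A'.str U f ^ n * y) (by
        rw [map_sub, ← hres, hx, map_mul, map_pow, hres, hz, map_mul, map_pow, hstr, sub_self])
      refine ⟨f ^ (m + n + 1), ⟨A.str U (f * f ^ m) * x, ?_⟩,
        (X.basicOpen_pow f (m + n).succ_pos).ge huf⟩
      rw [mul_sub, sub_eq_zero] at hm
      rw [map_mul, hstr, map_mul, mul_assoc, map_pow, hm, ← map_pow, ← map_pow, ← mul_assoc,
        ← mul_assoc, ← map_mul, ← map_mul]
      congr 2
      ring
    rwa [map_one, one_mul] at h1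

end

section
/-- The weighted symmetric algebra of the logarithmic forms, with weights `1, …, k`. -/
abbrev logSym {X : Scheme.{0}} (b : X ⟶ SpecC) (W : X.Opens) (k : ℕ) : GradedAlgOn b :=
  weightedSym b (fun _ : Fin k => logCotangent b W) (fun i => (i : ℕ) + 1)

lemma map_mem_of_closure {S A : Type} [CommRing S] [CommRing A] (gr : ℕ → AddSubgroup S)
    [GradedRing gr] (gr' : ℕ → AddSubgroup A) [GradedRing gr'] (φ : S →+* A)
    (hgen : ∀ T : Subring S, (∀ n, ∀ x ∈ gr n, φ x ∈ gr' n → x ∈ T) → T = ⊤) {m : ℕ} {x : S}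
    (hx : x ∈ gr m) : φ x ∈ gr' m := by
  classical
  let N : AddSubgroup S :=
    { carrier := {x | ∀ m, φ (proj gr m x) ∈ gr' m}
      add_mem' := fun {x y} hx hy m => by rw [map_add, map_add]; exact add_mem (hx m) (hy m)
      zero_mem' := fun m => by rw [map_zero, map_zero]; exact zero_mem _
      neg_mem' := fun {x} hx m => by rw [map_neg, map_neg]; exact neg_mem (hx m) }
  have hN : ∀ n, ∀ x ∈ gr n, φ x ∈ gr' n → x ∈ N := fun n x hx h m => by
    rw [proj_apply]
    by_cases hmn : n = m
    · subst hmn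
      rwa [DirectSum.decompose_of_mem_same gr hx]
    · rw [DirectSum.decompose_of_mem_ne gr hx hmn, map_zero]
      exact zero_mem _
  let T : Subring S :=
    { N with
      one_mem' := hN 0 1 SetLike.GradedOne.one_mem (by rw [map_one]; exact SetLike.GradedOne.one_mem)
      mul_mem' := fun {x y} hx hy => by
        change x * y ∈ N
        rw [← DirectSum.sum_support_decompose gr x, ← DirectSum.sum_support_decompose gr y,
          Finset.sum_mul_sum]
        refine sum_mem fun i _ => sum_mem fun j _ => hN (i + j) _
          (SetLike.mul_mem_graded (SetLike.coe_mem _) (SetLike.coe_mem _)) ?_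
        rw [map_mul]
        exact SetLike.mul_mem_graded (hx i) (hy j) }
  have hxT : x ∈ T := hgen T hN ▸ mem_top x
  have h : φ (proj gr m x) ∈ gr' m := hxT m
  rwa [proj_apply, DirectSum.decompose_of_mem_same gr hx] at h

lemma LogCoord.letter_mem_typeSpan {B : Type} [CommRing B] [Algebra ℂ B] {A₀ : Subring B}
    {ι : Type} (L : LogCoord B A₀ ι) (k : ℕ) (j : ι) (i : Fin k) :
    L.letter k j i ∈ typeSpan A₀ (letterSet i) :=
  subset_closure ⟨1, one_mem _, _, single_mem_letterSet i, _, by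
    simpa using IsMono.mul 0 1 i _ IsMono.one (L.letter_mem k j i), by
      rw [show jd k 0 (1 : B) = 1 from map_one (jd0 k B), one_mul]⟩

variable (W : X.Opens) (k : ℕ)

/-- Compatible homomorphisms from the spaces of jet differentials of the type of a letter of order
`i + 1` to a sheaf of graded algebras, which depend on the linear part only. -/
structure SymTarget (A : GradedAlgOn b) where
  ψ : ∀ (U : X.affineOpens) (i : Fin k), logTypeSpan b W k U (letterSet i) →+ A.ring U
  str : ∀ (U : X.affineOpens) i (r : Sec b U) x (hx : x ∈ logTypeSpan b W k U (letterSet i)),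
    ψ U i ⟨_, logStr_mul_logTypeSpan r hx⟩ = A.str U r * ψ U i ⟨x, hx⟩
  zero : ∀ (U : X.affineOpens) i x (hx : x ∈ logTypeSpan b W k U (letterSet i)),
    x ∈ logTypeSpan b W k U (letterSetLT i) → ψ U i ⟨x, hx⟩ = 0
  mem : ∀ (U : X.affineOpens) i x (hx : x ∈ logTypeSpan b W k U (letterSet i)),
    x ∈ jetGr k (Sec b ((U : X.Opens) ⊓ W)) (i + 1) → ψ U i ⟨x, hx⟩ ∈ A.gr U (i + 1)
  res : ∀ {U V : X.affineOpens} (h : (V : X.Opens) ≤ U) i x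
    (hx : x ∈ logTypeSpan b W k U (letterSet i)),
    A.res h (ψ U i ⟨x, hx⟩) = ψ V i ⟨_, logTypeSpan_res b W k h hx⟩

variable {W k} [LocallyOfFiniteType b] (hW : HasCharts b W)

namespace SymTarget

variable {A : GradedAlgOn b} (T : SymTarget W k A)

/-- The homomorphism of a `SymTarget` as a homomorphism on logarithmic forms. -/
def onForms (U : X.affineOpens) (i : Fin k) : (logCotangent b W).mod U →+ A.ring U :=
  (AddMonoidHom.mk' (fun m : logForms b W U => T.ψ U i ⟨_, (exists_lin_eq hW U i m.2).choose_spec.1⟩) fun m n => by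
    rw [← map_add, ← sub_eq_zero, ← map_sub]
    have h := fun m : logForms b W U => (exists_lin_eq hW U i m.2).choose_spec.2
    refine T.zero U i _ _ (mem_logTypeSpan_of_lin_eq_zero hW U (sub_mem
      (exists_lin_eq hW U i (m + n).2).choose_spec.1 (add_mem
        (exists_lin_eq hW U i m.2).choose_spec.1 (exists_lin_eq hW U i n.2).choose_spec.1)) ?_)
    rw [map_sub]
    exact sub_eq_zero.2 ((h (m + n)).trans ((map_add (lin i) _ _).trans
      (congrArg₂ (· + ·) (h m) (h n))).symm) : logForms b W U →+ A.ring U)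

lemma onForms_lin (U : X.affineOpens) (i : Fin k) {x : JetRing k (Sec b ((U : X.Opens) ⊓ W))}
    (hx : x ∈ logTypeSpan b W k U (letterSet i)) :
    T.onForms hW U i ⟨lin i x, lin_mem_logForms hx⟩ = T.ψ U i ⟨x, hx⟩ := by
  rw [← sub_eq_zero]
  change T.ψ U i ⟨_, _⟩ - _ = 0
  have h := (exists_lin_eq hW U i (lin_mem_logForms hx)).choose_spec
  rw [← map_sub]
  refine T.zero U i _ _ (mem_logTypeSpan_of_lin_eq_zero hW U (sub_mem h.1 hx) ?_)
  rw [map_sub, h.2, sub_self]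

lemma onForms_smul (U : X.affineOpens) (i : Fin k) (r : Sec b U) (m : (logCotangent b W).mod U) :
    T.onForms hW U i (r • m) = A.str U r * T.onForms hW U i m := by
  obtain ⟨m, hm⟩ := m
  obtain ⟨x, hx, rfl⟩ := exists_lin_eq (k := k) hW U i hm
  rw [T.onForms_lin hW U i hx, ← T.str, ← T.onForms_lin hW]
  congr 1
  exact Subtype.ext (lin_logStr_mul i r x).symm

/-- The homomorphism on the symmetric algebra of a `SymTarget`. -/
def symHom (U : X.affineOpens) : SymmetricAlgebra (Sec b U)
    (∀ _ : Fin k, (logCotangent b W).mod U) →+* A.ring U :=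
  letI : Algebra (Sec b U) (A.ring U) := (A.str U).toAlgebra
  (SymmetricAlgebra.lift
    { toFun := fun x => ∑ i, T.onForms hW U i (x i)
      map_add' := fun x y => by
        rw [← sum_add_distrib]
        exact sum_congr rfl fun i _ => map_add _ _ _
      map_smul' := fun r x => by
        rw [RingHom.id_apply, smul_def, mul_sum]
        exact sum_congr rfl fun i _ => T.onForms_smul hW U i r (x i) } :
    SymmetricAlgebra (Sec b U) (∀ _ : Fin k, (logCotangent b W).mod U) →ₐ[Sec b U]
      A.ring U).toRingHom

lemma symHom_algebraMap (U : X.affineOpens) (r : Sec b U) :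
    T.symHom hW U (algebraMap (Sec b U) (SymmetricAlgebra (Sec b U)
      (∀ _ : Fin k, (logCotangent b W).mod U)) r) = A.str U r := by
  let _ : Algebra (Sec b U) (A.ring U) := (A.str U).toAlgebra
  exact AlgHom.commutes _ r

lemma symHom_ι (U : X.affineOpens) (x : Fin k → (logCotangent b W).mod U) :
    T.symHom hW U (SymmetricAlgebra.ι (Sec b U) (∀ _ : Fin k, (logCotangent b W).mod U) x) =
      ∑ i, T.onForms hW U i (x i) := by
  let _ : Algebra (Sec b U) (A.ring U) := (A.str U).toAlgebra
  exact SymmetricAlgebra.lift_ι_apply _ x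

lemma symHom_single (U : X.affineOpens) (i : Fin k) (m : (logCotangent b W).mod U) :
    T.symHom hW U (SymmetricAlgebra.ι (Sec b U) (∀ _ : Fin k, (logCotangent b W).mod U)
      (LinearMap.single (Sec b U) (fun _ : Fin k => (logCotangent b W).mod U) i m)) =
        T.onForms hW U i m := by
  rw [symHom_ι, sum_eq_single i]
  · simp
  · intro j _ hj
    rw [LinearMap.single_apply, Pi.single_eq_of_ne hj]
    exact map_zero (T.onForms hW U j)
  · exact fun h => absurd (mem_univ i) h

lemma onForms_res {U V : X.affineOpens} (h : (V : X.Opens) ≤ U) (i : Fin k)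
    (m : (logCotangent b W).mod U) :
    T.onForms hW V i ((logCotangent b W).res h m) = A.res h (T.onForms hW U i m) := by
  obtain ⟨m, hm⟩ := m
  obtain ⟨x, hx, rfl⟩ := exists_lin_eq (k := k) hW U i hm
  rw [T.onForms_lin hW U i hx, T.res, ← T.onForms_lin hW]
  congr 1
  exact Subtype.ext (lin_jetMap _ i x).symm

lemma symHom_res {U V : X.affineOpens} (h : (V : X.Opens) ≤ U) (x : (logSym b W k).ring U) :
    T.symHom hW V ((logSym b W k).res h x) = A.res h (T.symHom hW U x) := by
  have hS : eqLocus ((T.symHom hW V).comp ((logSym b W k).res h))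
      ((A.res h).comp (T.symHom hW U)) = ⊤ := by
    refine sym_closure (Sec b U) (fun _ : Fin k => (logCotangent b W).mod U) _ (fun r => ?_)
      fun i m => ?_
    · change T.symHom hW V _ = A.res h (T.symHom hW U _)
      rw [T.symHom_algebraMap, A.res_str, ← T.symHom_algebraMap hW]
      exact congrArg (T.symHom hW V) (symMap_algebraMap _ _
        (fun _ r x => (logCotangent b W).res_smul h r x) r)
    · change T.symHom hW V _ = A.res h (T.symHom hW U _)
      rw [T.symHom_single, ← T.onForms_res hW, ← T.symHom_single]
      refine congrArg (T.symHom hW V) ((symMap_ι _ _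
        (fun _ r x => (logCotangent b W).res_smul h r x) _).trans
        (congrArg (SymmetricAlgebra.ι _ _) (funext fun j => ?_)))
      by_cases hj : j = i
      · subst hj; simp
      · simp [Pi.single_eq_of_ne hj]
  have hx : x ∈ eqLocus ((T.symHom hW V).comp ((logSym b W k).res h))
      ((A.res h).comp (T.symHom hW U)) := hS.ge (mem_top x)
  exact hx

lemma symHom_mem (U : X.affineOpens) {m : ℕ} {x : (logSym b W k).ring U}
    (hx : x ∈ (logSym b W k).gr U m) :
    T.symHom hW U x ∈ A.gr U m := by
  refine map_mem_of_closure ((logSym b W k).gr U) (A.gr U) (T.symHom hW U) (fun S hS => ?_) hx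
  refine sym_closure (Sec b U) (fun _ : Fin k => (logCotangent b W).mod U) S (fun r => ?_)
    fun i m => ?_
  · exact hS 0 _ (symGr_algebraMap _ _ _ r) ((T.symHom_algebraMap hW U r).symm ▸ A.str_mem U r)
  · refine hS (i + 1) _ (symGr_ι (Sec b U) (fun _ : Fin k => (logCotangent b W).mod U)
      (fun i => (i : ℕ) + 1) i m) ?_
    refine (congrArg (· ∈ A.gr U (i + 1)) (T.symHom_single hW U i m)).mpr ?_
    obtain ⟨m, hm⟩ := m
    obtain ⟨x, hx, rfl⟩ := exists_lin_eq (k := k) hW U i hm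
    have hx' := logTypeSpan_proj b W k (i + 1) hx
    have e : (⟨lin i x, hm⟩ : logForms b W U) = ⟨_, lin_mem_logForms hx'⟩ :=
      Subtype.ext (lin_proj i x).symm
    refine (congrArg (T.onForms hW U i) e).trans (T.onForms_lin hW U i hx') ▸ T.mem U i _ hx' ?_
    rw [proj_apply]
    exact SetLike.coe_mem _

def onPoly {V : X.affineOpens} (ch : Chart b W V) :
    MvPolynomial (Fin ch.n × Fin k) (Sec b V) →+* A.ring V :=
  eval₂Hom (A.str V) fun v => T.ψ V v.2 ⟨ch.log.letter k v.1 v.2,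
    logTypeSpan_of_typeSpan b W k (ch.log.letter_mem_typeSpan k v.1 v.2)⟩

lemma symHom_bijective_of_chart {V : X.affineOpens} (ch : Chart b W V)
    (h : Bijective (T.onPoly ch)) : Bijective (T.symHom hW V) := by
  let ω : Fin ch.n × Fin k → (logCotangent b W).mod V := fun v =>
    ⟨lin v.2 (ch.log.letter k v.1 v.2), lin_mem_logForms (logTypeSpan_of_typeSpan b W k
      (ch.log.letter_mem_typeSpan k v.1 v.2))⟩
  let σ : MvPolynomial (Fin ch.n × Fin k) (Sec b V) →+*
      SymmetricAlgebra (Sec b V) (∀ _ : Fin k, (logCotangent b W).mod V) :=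
    eval₂Hom (algebraMap _ _) fun v => SymmetricAlgebra.ι (Sec b V) _
      (LinearMap.single (Sec b V) (fun _ : Fin k => (logCotangent b W).mod V) v.2 (ω v))
  have hσ : ∀ p, T.symHom hW V (σ p) = T.onPoly ch p := by
    have : (T.symHom hW V).comp σ = T.onPoly ch := by
      refine ringHom_ext (fun r => ?_) fun v => ?_
      · rw [comp_apply, onPoly, eval₂Hom_C, eval₂Hom_C]
        exact T.symHom_algebraMap hW V r
      · rw [comp_apply, onPoly, eval₂Hom_X', eval₂Hom_X']
        exact (T.symHom_single hW V v.2 (ω v)).trans (T.onForms_lin hW V v.2 _)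
    exact DFunLike.congr_fun this
  have hsurj : σ.range = ⊤ := by
    refine sym_closure (Sec b V) (fun _ : Fin k => (logCotangent b W).mod V) _ (fun r => ?_)
      fun i m => ?_
    · exact ⟨MvPolynomial.C r, eval₂Hom_C _ _ r⟩
    · obtain ⟨m, hm⟩ := m
      obtain ⟨x, hx, rfl⟩ := exists_lin_eq (k := k) hW V i hm
      have hx' := (ch.mem_logTypeSpan_iff (isLowerType_lowerSet _)).1 hx
      have hc : ∀ j, ∃ a : Sec b V, secRes b inf_le_left a =
          (ch.log.toPoly k x).coeff (single (j, i) 1) := fun j =>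
        ((ch.log.mem_typeSpan_iff k (isLowerType_lowerSet _)).1 hx' _).1
      choose a ha using hc
      have e : (⟨lin i x, hm⟩ : (logCotangent b W).mod V) = ∑ j, a j • ω (j, i) := by
        apply Subtype.ext
        refine (ch.log.lin_eq_sum hx').trans ?_
        refine Eq.trans ?_ (AddSubmonoidClass.coe_finsetSum _ _).symm
        refine sum_congr rfl fun j _ => ?_
        rw [← ha]
        rfl
      refine ⟨∑ j, MvPolynomial.C (a j) * MvPolynomial.X (j, i), ?_⟩
      rw [e, map_sum, map_sum, map_sum]
      refine sum_congr rfl fun j _ => ?_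
      rw [map_mul, eval₂Hom_C, eval₂Hom_X', map_smul, map_smul, smul_def]
  constructor
  · rw [injective_iff_map_eq_zero]
    intro s hs
    obtain ⟨p, rfl⟩ : s ∈ σ.range := hsurj.ge (mem_top s)
    have : T.onPoly ch p = T.onPoly ch 0 := by rw [← hσ, map_zero]; exact hs
    rw [h.1 this, map_zero]
  · intro y
    obtain ⟨p, hp⟩ := h.2 y
    exact ⟨σ p, (hσ p).trans hp⟩

/-- The symmetric algebra of the logarithmic forms is isomorphic to a `SymTarget` that is, in
coordinates, a polynomial ring in the letters. -/
def symIso (hA : ∀ (U : X.affineOpens) (f : Sec b U) (x : A.ring U),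
      A.res (nonvanishing_le U f) x = 0 → ∃ n : ℕ, A.str U f ^ n * x = 0)
    (h : ∀ {V : X.affineOpens} (ch : Chart b W V), Bijective (T.onPoly ch)) :
    (logSym b W k).Iso A where
  hom U := { T.symHom hW U with map_mem := fun hx => T.symHom_mem hW U hx }
  bij U := by
    have hinj : ∀ (U : X.affineOpens) (f : Sec b U) (x : (logCotangent b W).mod U),
        (logCotangent b W).res (nonvanishing_le U f) x = 0 → ∃ n : ℕ, f ^ n • x = 0 := by
      intro U f x hx
      have := LocallyOfFiniteType.isLocallyNoetherian b
      obtain ⟨n, hn⟩ := omega_eq_zero_of_res U f (m := x.1) (congrArg Subtype.val hx)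
      exact ⟨n, Subtype.ext hn⟩
    have hsurj : ∀ (U : X.affineOpens) (f : Sec b U)
        (y : (logCotangent b W).mod (nonvanishing U f)),
        ∃ (n : ℕ) (x : (logCotangent b W).mod U), (logCotangent b W).res (nonvanishing_le U f) x =
          secRes b (nonvanishing_le U f) (f ^ n) • y := by
      rintro U f ⟨y, hy⟩
      obtain ⟨z, hz, rfl⟩ := exists_lin_eq (k := 1) hW (nonvanishing U f) 0 hy
      obtain ⟨n, x, hx, hxz⟩ := logTypeSpan_surj hW U f (isLowerType_lowerSet _) hz
      refine ⟨n, ⟨lin 0 x, lin_mem_logForms hx⟩, Subtype.ext ?_⟩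
      refine (lin_jetMap _ 0 x).symm.trans ((congrArg (lin 0) hxz).trans ?_)
      let r : Sec b (nonvanishing U f) := secRes b (nonvanishing_le U f) f
      refine (congrArg (fun t => lin 0 (t * z)) (map_pow (logStr b W 1 (nonvanishing U f)) r n).symm).trans
        ((lin_logStr_mul 0 (r ^ n) z).trans ?_)
      have e : r ^ n = secRes b (nonvanishing_le U f) (f ^ n) :=
        (map_pow (secRes b (nonvanishing_le U f)) f n).symm
      rw [e]
      rfl
    exact bijective_of_basicOpen (fun U => T.symHom hW U) (T.symHom_res hW)
      (T.symHom_algebraMap hW) (weightedSym_inj _ hinj hsurj _) (weightedSym_surj _ hsurj _) hA U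
      fun u hu => by
        obtain ⟨g, hug, ⟨ch⟩⟩ := hW.exists_basicOpen U hu
        exact ⟨g, hug, T.symHom_bijective_of_chart hW ch (h ch)⟩
  res h x := T.symHom_res hW h x
  str U r := T.symHom_algebraMap hW U r

end SymTarget

end

section
section Quotient

variable {A : Type} [CommRing A] (gr : ℕ → AddSubgroup A) [GradedRing gr] (I : Ideal A)

def quotGr (m : ℕ) : AddSubgroup (A ⧸ I) := (gr m).map (Ideal.Quotient.mk I).toAddMonoidHom

@[reducible] def quotGrading (s : gr 0) : GradedRing (quotGr gr (Ideal.span {(s : A)})) := by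
  classical
  refine gradedRingOf _ ⟨1, SetLike.GradedOne.one_mem, map_one (Ideal.Quotient.mk _)⟩ ?_ ?_ ?_
  · rintro i j _ _ ⟨x, hx, rfl⟩ ⟨y, hy, rfl⟩
    exact ⟨x * y, SetLike.mul_mem_graded hx hy, map_mul (Ideal.Quotient.mk _) _ _⟩
  · rw [eq_top_iff]
    intro x _
    obtain ⟨x, rfl⟩ := mk_surjective x
    rw [← DirectSum.sum_support_decompose gr x, map_sum]
    exact sum_mem fun m _ => AddSubgroup.mem_iSup_of_mem m ⟨_, SetLike.coe_mem _, rfl⟩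
  · intro t x hx h n hn
    choose! y hy hyx using hx
    have hs : Ideal.Quotient.mk (Ideal.span {(s : A)}) (∑ m ∈ t, y m) = 0 := by
      rw [map_sum, ← h]
      exact sum_congr rfl fun m hm => hyx m hm
    obtain ⟨w, hw⟩ := Ideal.mem_span_singleton'.1 (eq_zero_iff_mem.1 hs)
    rw [← hyx n hn]
    refine eq_zero_iff_mem.2 (Ideal.mem_span_singleton'.2 ⟨proj gr n w, ?_⟩)
    have h1 : proj gr n (∑ m ∈ t, y m) = y n := by
      rw [map_sum, sum_eq_single n]
      · rw [proj_apply, DirectSum.decompose_of_mem_same gr (hy n hn)]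
      · intro m hm hmn
        rw [proj_apply, DirectSum.decompose_of_mem_ne gr (hy m hm) hmn]
      · exact fun h => absurd hn h
    rw [← h1, ← hw, mul_comm w, mul_comm, proj_apply, proj_apply,
      DirectSum.coe_decompose_mul_of_left_mem_zero gr s.2]

end Quotient

lemma mem_of_bijective {A A' : Type} [CommRing A] [CommRing A'] {gr : ℕ → AddSubgroup A}
    [GradedRing gr] {gr' : ℕ → AddSubgroup A'} [GradedRing gr'] (φ : gr →+*ᵍ gr')
    (h : Injective φ) {m : ℕ} {x : A} (hx : φ x ∈ gr' m) : x ∈ gr m := by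
  have : φ (proj gr m x) = proj gr' m (φ x) :=
    proj_ringHom gr gr' φ.toRingHom (fun m x hx => φ.map_mem hx) m x
  rw [proj_apply gr', DirectSum.decompose_of_mem_same gr' hx] at this
  rw [← h this, proj_apply]
  exact SetLike.coe_mem _

namespace GradedAlgOn.Iso

variable {A A' A'' : GradedAlgOn b}

variable (A) in
def refl : A.Iso A where
  hom _ := .id _
  bij _ := bijective_id
  res _ _ := rfl
  str _ _ := rfl

def symm (φ : A.Iso A') : A'.Iso A :=
  let ψ (U : X.affineOpens) : A.ring U ≃+* A'.ring U :=
    RingEquiv.ofBijective (φ.hom U).toRingHom (φ.bij U)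
  { hom := fun U =>
      { (ψ U).symm.toRingHom with
        map_mem := fun {m x} hx => mem_of_bijective (φ.hom U) (φ.bij U).1 (by
          change ψ U ((ψ U).symm x) ∈ _
          rwa [RingEquiv.apply_symm_apply]) }
    bij := fun U => (ψ U).symm.bijective
    res := fun {U V} h x => (ψ V).injective (by
      change ψ V ((ψ V).symm _) = φ.hom V (A.res h ((ψ U).symm x))
      rw [RingEquiv.apply_symm_apply, φ.res]
      exact congrArg (A'.res h) ((ψ U).apply_symm_apply x).symm)
    str := fun U r => (ψ U).injective (by
      change ψ U ((ψ U).symm _) = φ.hom U _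
      rw [RingEquiv.apply_symm_apply, φ.str]) }

def trans (φ : A.Iso A') (ψ : A'.Iso A'') : A.Iso A'' where
  hom U := (ψ.hom U).comp (φ.hom U)
  bij U := (ψ.bij U).comp (φ.bij U)
  res {U V} h x := (congrArg (ψ.hom V) (φ.res h x)).trans (ψ.res h _)
  str U r := (congrArg (ψ.hom U) (φ.str U r)).trans (ψ.str U r)

end GradedAlgOn.Iso

namespace GradedAlgOn.Parameter

variable {A : GradedAlgOn b} (p : A.Parameter) (c : ℂ)

abbrev fibreIdeal (U : X.affineOpens) : Ideal (A.ring U) := Ideal.span {p.t U - A.scalar U c}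

def fibre : GradedAlgOn b where
  ring U := A.ring U ⧸ p.fibreIdeal c U
  gr U := quotGr (A.gr U) (p.fibreIdeal c U)
  graded U := quotGrading (A.gr U) ⟨_, sub_mem (p.mem U) (A.scalar U c).2⟩
  str U := (Ideal.Quotient.mk _).comp (A.str U)
  str_mem U r := ⟨_, A.str_mem U r, rfl⟩
  res {U V} h := Ideal.quotientMap _ (A.res h) (by
    rw [Ideal.span_le, Set.singleton_subset_iff]
    exact (congrArg (· ∈ p.fibreIdeal c V) (p.res_sub h c)).mpr (Ideal.mem_span_singleton_self _))
  res_mem {U V} h m x hx := by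
    obtain ⟨x, hx, rfl⟩ := hx
    exact ⟨A.res h x, A.res_mem h m x hx, rfl⟩
  res_str {U V} h r := congrArg (Ideal.Quotient.mk (p.fibreIdeal c V)) (A.res_str h r)

def fibreMk (U : X.affineOpens) : A.ring U →+* (p.fibre c).ring U :=
  Ideal.Quotient.mk (p.fibreIdeal c U)

def fibreFibre : p.Fibre c (p.fibre c) where
  hom U := { Ideal.Quotient.mk (p.fibreIdeal c U) with map_mem := fun hx => ⟨_, hx, rfl⟩ }
  isQuot U :=
    { zero := eq_zero_iff_mem.2 (Ideal.mem_span_singleton_self _)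
      inj := fun x hx => by
        obtain ⟨y, hy⟩ := Ideal.mem_span_singleton'.1 (eq_zero_iff_mem.1 hx)
        exact ⟨y, by rw [← hy, mul_comm]⟩
      surj := mk_surjective }
  res _ _ := rfl
  str _ _ := rfl

def Fibre.ofIso {p : A.Parameter} {c : ℂ} {Q F : GradedAlgOn b} (e : p.Fibre c Q) (φ : Q.Iso F) :
    p.Fibre c F where
  hom U := (φ.hom U).comp (e.hom U)
  isQuot U :=
    { zero := (congrArg (φ.hom U) (e.isQuot U).zero).trans (map_zero _)
      inj := fun x hx => (e.isQuot U).inj x ((φ.bij U).1 (hx.trans (map_zero _).symm))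
      surj := (φ.bij U).2.comp (e.isQuot U).surj }
  res {U V} h x := (congrArg (φ.hom V) (e.res h x)).trans (φ.res h _)
  str U r := (congrArg (φ.hom U) (e.str U r)).trans (φ.str U r)

end GradedAlgOn.Parameter

variable {W : X.Opens} {k : ℕ}

lemma typeWeight_le_of_mem_letterSet {i : Fin k} {l : Fin k →₀ ℕ} (h : l ∈ letterSet i) :
    typeWeight l ≤ i := by
  rcases h with rfl | ⟨_, h⟩
  · rw [typeWeight_single]
  · rw [typeWeight_single] at h
    exact h.le

lemma typeWeight_lt_of_mem_letterSetLT {i : Fin k} {l : Fin k →₀ ℕ} (h : l ∈ letterSetLT i) :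
    typeWeight l < i := by
  rcases h with ⟨rfl | ⟨_, h⟩, h'⟩
  · exact absurd rfl h'
  · rwa [typeWeight_single] at h

lemma logTypeSpan_empty [LocallyOfFiniteType b] (U : X.affineOpens)
    {x : JetRing k (Sec b ((U : X.Opens) ⊓ W))} (hW : HasCharts b W)
    (hx : x ∈ logTypeSpan b W k U ∅) : x = 0 := by
  have := LocallyOfFiniteType.isLocallyNoetherian b
  let J : Ideal (Sec b U) :=
    { carrier := {r | logStr b W k U r * x = 0}
      zero_mem' := by rw [Set.mem_ofPred_eq, map_zero, zero_mul]
      add_mem' := fun {r s} hr hs => by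
        rw [Set.mem_ofPred_eq] at *
        rw [map_add, add_mul, hr, hs, add_zero]
      smul_mem' := fun r s hs => by
        rw [Set.mem_ofPred_eq] at *
        rw [smul_eq_mul, map_mul, mul_assoc, hs, mul_zero] }
  have h1 : (1 : Sec b U) ∈ J := one_mem_of_cover U J fun u hu => by
    obtain ⟨g, hug, ⟨ch⟩⟩ := hW.exists_basicOpen U hu
    have hxg := (ch.mem_logTypeSpan_iff (S := ∅) (fun _ h => absurd h (Set.notMem_empty _))).1
      (logTypeSpan_res b W k (X.basicOpen_le _) hx)
    have h0 : ∀ y ∈ typeSpan (k := k) (extendable b W (X.affineBasicOpen (U := U) g)) ∅, y = 0 :=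
      fun y hy => by
        have : (typeSpan (k := k) (extendable b W (X.affineBasicOpen (U := U) g)) ∅) = ⊥ := by
          rw [typeSpan, eq_bot_iff, AddSubgroup.closure_le]
          rintro _ ⟨_, _, _, h, _⟩
          exact absurd h (Set.notMem_empty _)
        rw [this] at hy
        exact hy
    obtain ⟨N, hN⟩ := jetMap_eq_zero (k := k) _ _ (isLocalization_secResLog (W := W) U g) (h0 _ hxg)
    refine ⟨g ^ (N + 1), ?_, ?_⟩
    · change logStr b W k U (g ^ (N + 1)) * x = 0
      rw [pow_succ', map_mul, map_pow, mul_assoc]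
      exact (congrArg (logStr b W k U g * ·) hN).trans (mul_zero _)
    · exact (Scheme.basicOpen_pow (X := X) (U := U) g (n := N + 1) N.succ_pos).ge hug
  have : logStr b W k U 1 * x = 0 := h1
  rwa [map_one, one_mul] at this

lemma logMonomial_mem_fibreIdeal [LocallyOfFiniteType b] (hW : HasCharts b W)
    {U : X.affineOpens} {n : ℕ} {x : JetRing k (Sec b ((U : X.Opens) ⊓ W))}
    (hx : x ∈ logTypeSpan b W k U {l | typeWeight l ≤ n})
    (hx' : x ∈ logTypeSpan b W k U {l | typeWeight l < n}) :
    logMonomial n hx ∈ (logParam b W k).fibreIdeal 0 U := by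
  cases n with
  | zero =>
    have : x = 0 := logTypeSpan_empty U hW (by
      convert hx' using 2
      ext l
      simp)
    subst this
    exact (congrArg (· ∈ (logParam b W k).fibreIdeal 0 U)
      (map_zero ((logFil b W k U).weightMonomial 0))).mpr (zero_mem _)
  | succ n =>
    refine Ideal.mem_span_singleton'.2 ⟨logMonomial n (logTypeSpan_mono b W k (fun l hl => by
      rw [Set.mem_ofPred_eq] at *; omega) hx'), ?_⟩
    rw [map_zero]
    refine (congrArg (_ * ·) (sub_zero _)).trans (Subtype.ext ?_)
    exact Polynomial.monomial_mul_X n x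

lemma letterSet_subset (i : Fin k) : letterSet i ⊆ {l | typeWeight l ≤ i} := fun _ hl => by
  rw [Set.mem_ofPred_eq]
  exact typeWeight_le_of_mem_letterSet hl

variable (k) in
def fibreTarget [LocallyOfFiniteType b] (hW : HasCharts b W) :
    SymTarget W k ((logParam b W k).fibre 0) where
  ψ U i := ((Ideal.Quotient.mk ((logParam b W k).fibreIdeal 0 U)).toAddMonoidHom.comp
    ((logFil b W k U).weightMonomial i)).comp
      (AddSubgroup.inclusion (logTypeSpan_mono b W k (letterSet_subset i)))
  str U i r x hx := by
    refine congrArg (Ideal.Quotient.mk ((logParam b W k).fibreIdeal 0 U)) (Subtype.ext ?_)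
    exact (Polynomial.C_mul_monomial).symm
  zero U i x hx hx' := eq_zero_iff_mem.2
    (logMonomial_mem_fibreIdeal hW _ (logTypeSpan_mono b W k (fun l hl => by
      rw [Set.mem_ofPred_eq]; exact typeWeight_lt_of_mem_letterSetLT hl) hx'))
  mem U i x hx hxi := ⟨_, (logFil b W k U).weightMonomial_mem hxi, rfl⟩
  res {U V} h i x hx := congrArg (Ideal.Quotient.mk ((logParam b W k).fibreIdeal 0 V))
    (Subtype.ext (Polynomial.map_monomial _))

end

section
open MvPolynomial (C)

/-- The projection of jets to functions that kills the derivatives. -/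
def jetFun (k : ℕ) (B : Type) [CommRing B] [Algebra ℂ B] : JetRing k B →+* JetRing k B :=
  (evalRingHom 0).comp (jetCoaction k B).toRingHom

lemma jetFun_of_mem {k : ℕ} {B : Type} [CommRing B] [Algebra ℂ B] {n : ℕ} {x : JetRing k B}
    (hx : x ∈ jetGr k B n) : jetFun k B x = if n = 0 then x else 0 := by
  have hx' : jetCoaction k B x = Polynomial.monomial n x := hx
  change (jetCoaction k B x).eval 0 = _
  rw [hx', Polynomial.eval_monomial]
  split_ifs with h
  · rw [h, pow_zero, mul_one]
  · rw [zero_pow h, mul_zero]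

lemma LogCoord.jetFun_ofPoly {B : Type} [CommRing B] [Algebra ℂ B] {A₀ : Subring B} {ι : Type}
    (L : LogCoord B A₀ ι) (k : ℕ) (P : MvPolynomial (ι × Fin k) B) :
    jetFun k B (L.ofPoly k P) = jd k 0 (P.coeff 0) := by
  have : (jetFun k B).comp (L.ofPoly k) = (jd0 k B).comp MvPolynomial.constantCoeff := by
    refine ringHom_ext (fun r => ?_) fun v => ?_
    · rw [comp_apply, comp_apply, L.ofPoly_C, MvPolynomial.constantCoeff_C,
        jetFun_of_mem (jd_mem 0 r)]
      rfl
    · rw [comp_apply, comp_apply, L.ofPoly_X, MvPolynomial.constantCoeff_X,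
        jetFun_of_mem (letters_mem (L.letter_mem k v.1 v.2)), if_neg (Nat.succ_ne_zero _), map_zero]
  exact DFunLike.congr_fun this P

lemma smooth_sec [Smooth b] (V : X.affineOpens) : (algebraMap ℂ (Sec b V)).Smooth := by
  have h := b.smooth_appLE (isAffineOpen_top SpecC) V.2 (e := le_top)
  exact (RingHom.Smooth.of_bijective (ConcreteCategory.bijective_of_isIso
    (Scheme.ΓSpecIso (CommRingCat.of ℂ)).inv)).comp h

lemma smooth_mapRingHom {B : Type} [CommRing B] [Algebra ℂ B] (h : (algebraMap ℂ B).Smooth) :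
    (mapRingHom (algebraMap ℂ B)).Smooth := by
  have h1 : Smooth (Spec.map (ofHom (algebraMap ℂ B))) := by
    rw [HasRingHomProperty.Spec_iff (P := @Smooth)]
    exact h
  have h2 := MorphismProperty.of_isPullback (P := @Smooth) (isPullback_specPolynomial B) h1
  rw [HasRingHomProperty.Spec_iff (P := @Smooth)] at h2
  exact h2

variable {W : X.Opens} {k : ℕ}

lemma coe_logFamily_strPoly (U : X.affineOpens) (q : Polynomial (Sec b U)) :
    ((logParam b W k).strPoly U q : (logFamily b W k).ring U).1 = q.map (logStr b W k U) := by
  have : ((logFil b W k U).weightRees.subtype.comp (algebraMap ((logFamily b W k).gr U 0)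
      ((logFamily b W k).ring U))).comp ((logParam b W k).strPoly U) =
      mapRingHom (logStr b W k U) := by
    refine Polynomial.ringHom_ext (fun r => ?_) ?_
    · rw [comp_apply, GradedAlgOn.Parameter.strPoly, coe_eval₂RingHom,
        eval₂_C, coe_mapRingHom, Polynomial.map_C]
      rfl
    · rw [comp_apply, GradedAlgOn.Parameter.strPoly, coe_eval₂RingHom,
        eval₂_X, coe_mapRingHom, Polynomial.map_X]
      rfl
  exact DFunLike.congr_fun this q

lemma coeff_logFamily_add {U : X.affineOpens} (p q : (logFamily b W k).ring U) (n : ℕ) :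
    (p + q).1.coeff n = p.1.coeff n + q.1.coeff n := Polynomial.coeff_add _ _ _

namespace Chart

variable [LocallyOfFiniteType b] {V : X.affineOpens} (ch : Chart b W V)

lemma letter_mem_logTypeSpan (v : Fin ch.n × Fin k) :
    ch.log.letter k v.1 v.2 ∈ logTypeSpan b W k V (letterSet v.2) :=
  logTypeSpan_of_typeSpan b W k (ch.log.letter_mem_typeSpan k v.1 v.2)

abbrev monoWeight {ι : Type} (m : ι × Fin k →₀ ℕ) : ℕ := typeWeight (monoType m)

variable (k) in
def familyHom : MvPolynomial (Fin ch.n × Fin k) (Polynomial (Sec b V)) →+*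
    (logFamily b W k).ring V :=
  eval₂Hom ((algebraMap ((logFamily b W k).gr V 0) ((logFamily b W k).ring V)).comp
      ((logParam b W k).strPoly V))
    fun v => logMonomial v.2 (logTypeSpan_mono b W k (letterSet_subset v.2)
      (ch.letter_mem_logTypeSpan v))

lemma familyHom_monomial_one (m : Fin ch.n × Fin k →₀ ℕ) : (ch.familyHom k (monomial m 1)).1 =
      Polynomial.monomial (monoWeight m) (ch.log.ofPoly k (monomial m 1)) := by
  induction m using induction_linear with
  | zero =>
    rw [monoWeight, monoType_zero, map_zero]
    refine (congrArg Subtype.val (map_one (ch.familyHom k))).trans ?_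
    exact (congrArg Polynomial.C (map_one (ch.log.ofPoly k))).symm
  | add m m' h h' =>
    have e : ∀ R : Type, ∀ [CommRing R], (monomial (m + m') (1 : R)) =
        monomial m 1 * monomial m' 1 := by
      intro R _
      rw [monomial_mul, mul_one]
    rw [e, e, map_mul, map_mul, monoWeight, monoType_add, map_add,
      ← Polynomial.monomial_mul_monomial, ← h, ← h']
    rfl
  | single v n =>
    rw [monoWeight, monoType_single, ← Finsupp.smul_single_one v.2, map_nsmul, typeWeight_single,
      smul_eq_mul, ← X_pow_eq_monomial, ← X_pow_eq_monomial, map_pow, map_pow,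
      ch.log.ofPoly_X, mul_comm, ← Polynomial.monomial_pow]
    refine (SubmonoidClass.coe_pow _ _).trans (congrArg (· ^ n) ?_)
    exact congrArg Subtype.val (eval₂Hom_X' _ _ v)

lemma familyHom_monomial (m : Fin ch.n × Fin k →₀ ℕ) (j : ℕ) (r : Sec b V) :
    (ch.familyHom k (monomial m (Polynomial.monomial j r))).1 =
      Polynomial.monomial (j + monoWeight m)
        (ch.log.ofPoly k (monomial m (secRes b inf_le_left r))) := by
  rw [← mul_one (Polynomial.monomial j r), ← C_mul_monomial, map_mul,
    ← mul_one (secRes b inf_le_left r), ← C_mul_monomial, map_mul, ch.log.ofPoly_C]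
  have h1 : (ch.familyHom k (C (Polynomial.monomial j r))).1 =
      Polynomial.monomial j (logStr b W k V r) := by
    rw [familyHom, eval₂Hom_C]
    refine (coe_logFamily_strPoly V _).trans (Polynomial.map_monomial _)
  refine (congrArg₂ (· * ·) h1 (ch.familyHom_monomial_one m)).trans ?_
  rw [Polynomial.monomial_mul_monomial]
  rfl

lemma coeff_familyHom (P : MvPolynomial (Fin ch.n × Fin k) (Polynomial (Sec b V)))
    (n : ℕ) (m : Fin ch.n × Fin k →₀ ℕ) :
    (ch.log.toPoly k ((ch.familyHom k P).1.coeff n)).coeff m =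
      if monoWeight m ≤ n then secRes b inf_le_left ((P.coeff m).coeff (n - monoWeight m))
      else 0 := by
  classical
  induction P using induction_on' with
  | monomial m' q =>
    induction q using Polynomial.induction_on' with
    | add p q hp hq =>
      rw [map_add, map_add, coeff_logFamily_add, map_add, coeff_add,
        hp, hq, coeff_add, Polynomial.coeff_add, map_add]
      split_ifs
      · rfl
      · rw [add_zero]
    | monomial j r =>
      rw [ch.familyHom_monomial, Polynomial.coeff_monomial, coeff_monomial]
      by_cases hm : m' = m
      · subst hm
        rw [if_pos rfl, Polynomial.coeff_monomial]
        by_cases hn : j + monoWeight m' = n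
        · subst hn
          rw [if_pos rfl, if_pos (Nat.le_add_left _ _), Nat.add_sub_cancel, if_pos rfl,
            ch.log.toPoly_ofPoly, coeff_monomial, if_pos rfl]
        · rw [if_neg hn, map_zero, coeff_zero]
          split_ifs with h1 h2
          · omega
          · rw [map_zero]
          · rfl
      · rw [if_neg hm, Polynomial.coeff_zero, map_zero, ite_self]
        split_ifs
        · rw [ch.log.toPoly_ofPoly, coeff_monomial, if_neg hm]
        · rw [map_zero, coeff_zero]
  | add p q hp hq =>
    rw [map_add, coeff_logFamily_add, map_add, coeff_add,
      hp, hq, coeff_add, Polynomial.coeff_add, map_add]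
    split_ifs
    · rfl
    · rw [add_zero]

lemma familyHom_injective : Injective (ch.familyHom k) := by
  rw [injective_iff_map_eq_zero]
  intro P hP
  ext m j
  have h := ch.coeff_familyHom P (j + monoWeight m) m
  rw [if_pos (Nat.le_add_left _ _), Nat.add_sub_cancel] at h
  have h0 : (ch.familyHom k P).1.coeff (j + monoWeight m) = 0 :=
    (congrArg (fun y : (logFamily b W k).ring V => y.1.coeff (j + monoWeight m)) hP).trans
      (Polynomial.coeff_zero _)
  rw [h0, map_zero, coeff_zero] at h
  exact ch.secRes_injective (h.symm.trans (map_zero _).symm)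

lemma familyHom_surjective : Surjective (ch.familyHom k) := by
  let N : AddSubgroup (Polynomial (JetRing k (Sec b ((V : X.Opens) ⊓ W)))) :=
    ((logFil b W k V).weightRees.subtype.comp (ch.familyHom k)).toAddMonoidHom.range
  have hN : ∀ n x, x ∈ logTypeSpan b W k V {l | typeWeight l ≤ n} → Polynomial.monomial n x ∈ N := by
    intro n x hx
    have hx' := (ch.log.mem_typeSpan_iff k (isLowerType_weight n)).1
      ((ch.mem_logTypeSpan_iff (isLowerType_weight n)).1 hx)
    rw [← ch.log.ofPoly_toPoly k x]
    refine polySpan_induction ((Polynomial.monomial n).toAddMonoidHom.comp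
      (ch.log.ofPoly k).toAddMonoidHom) N (fun a ha m hm => ?_) hx'
    obtain ⟨r, rfl⟩ := ha
    rw [Set.mem_ofPred_eq] at hm
    refine ⟨monomial m (Polynomial.monomial (n - monoWeight m) r), ?_⟩
    refine (ch.familyHom_monomial m _ r).trans ?_
    rw [Nat.sub_add_cancel hm]
    rfl
  intro y
  have hy : y.1 ∈ N := by
    rw [y.1.as_sum_support]
    exact sum_mem fun n _ => hN n _ (y.2 n)
  obtain ⟨P, hP⟩ := hy
  exact ⟨P, Subtype.ext hP⟩

lemma familyHom_C (q : Polynomial (Sec b V)) :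
    ch.familyHom k (C q) = (logParam b W k).strPoly V q :=
  eval₂Hom_C _ _ q

variable (k) in
include ch in
lemma isGood [Smooth b] : (logParam b W k).IsGood V where
  smooth := by
    have h : ((familyHom k ch).comp ((C).comp (mapRingHom (algebraMap ℂ (Sec b V))))).Smooth :=
      ((smooth_mapRingHom (smooth_sec V)).comp ((RingHom.smooth_algebraMap
        (R := Polynomial (Sec b V))
        (S := MvPolynomial (Fin ch.n × Fin k) (Polynomial (Sec b V)))).2
          ⟨inferInstance, inferInstance⟩)).comp
        (RingHom.Smooth.of_bijective ⟨ch.familyHom_injective (k := k), ch.familyHom_surjective⟩)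
    convert h using 1
    refine Polynomial.ringHom_ext (fun c => ?_) ?_
    · rw [comp_apply, (logParam b W k).hom_C, comp_apply, comp_apply,
        ch.familyHom_C, coe_mapRingHom, Polynomial.map_C,
        GradedAlgOn.Parameter.strPoly, coe_eval₂RingHom, eval₂_C]
      rfl
    · rw [comp_apply, (logParam b W k).hom_X, comp_apply, comp_apply,
        ch.familyHom_C, coe_mapRingHom, Polynomial.map_X,
        GradedAlgOn.Parameter.strPoly, coe_eval₂RingHom, eval₂_X]
      rfl
  finite := by
    have h : ((familyHom k ch).comp C).FiniteType :=
      (RingHom.FiniteType.of_surjective _ ch.familyHom_surjective).comp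
        ((RingHom.finiteType_algebraMap (A := Polynomial (Sec b V))
          (B := MvPolynomial (Fin ch.n × Fin k) (Polynomial (Sec b V)))).2 inferInstance)
    have e : (familyHom k ch).comp C = (algebraMap ((logFamily b W k).gr V 0)
        ((logFamily b W k).ring V)).comp ((logParam b W k).strPoly V) :=
      RingHom.ext ch.familyHom_C
    rw [e] at h
    exact RingHom.finiteType_algebraMap.1 (RingHom.FiniteType.of_comp_finiteType h)
  surj := by
    rintro ⟨y, hy⟩
    have key : ∀ n, ∃ r, logStr b W k V r = y.1.coeff n := by
      intro n
      have hx' := (ch.log.mem_typeSpan_iff k (isLowerType_weight n)).1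
        ((ch.mem_logTypeSpan_iff (isLowerType_weight n)).1 (y.2 n))
      obtain ⟨r, hr⟩ := (hx' 0).1
      refine ⟨r, ?_⟩
      have h := jetFun_of_mem (hy n)
      rw [if_pos rfl, ← ch.log.ofPoly_toPoly k (y.1.coeff n), ch.log.jetFun_ofPoly] at h
      rw [← ch.log.ofPoly_toPoly k (y.1.coeff n), ← h, ← hr]
      rfl
    choose r hr using key
    refine ⟨∑ n ∈ y.1.support, Polynomial.monomial n (r n), Subtype.ext (logFamily_ext fun m => ?_)⟩
    rw [coe_logFamily_strPoly, Polynomial.coeff_map, Polynomial.finsetSum_coeff, map_sum]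
    simp only [Polynomial.coeff_monomial, apply_ite (logStr b W k V), map_zero, hr]
    rw [Finset.sum_ite_eq']
    split_ifs with h
    · rfl
    · exact (Polynomial.notMem_support_iff.1 h).symm

lemma fibreTarget_onPoly (hW : HasCharts b W)
    (P : MvPolynomial (Fin ch.n × Fin k) (Polynomial (Sec b V))) :
    (fibreTarget k hW).onPoly ch (MvPolynomial.map (evalRingHom 0) P) =
      (logParam b W k).fibreMk 0 V (ch.familyHom k P) := by
  have : ((fibreTarget k hW).onPoly ch).comp (MvPolynomial.map (evalRingHom 0)) =
      ((logParam b W k).fibreMk 0 V).comp (ch.familyHom k) := by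
    refine ringHom_ext (fun q => ?_) fun v => ?_
    · rw [comp_apply, comp_apply, map_C, ch.familyHom_C, SymTarget.onPoly, eval₂Hom_C]
      have : (((logParam b W k).fibre 0).str V).comp (evalRingHom 0) =
          ((logParam b W k).fibreMk 0 V).comp
            ((algebraMap ((logFamily b W k).gr V 0) ((logFamily b W k).ring V)).comp
              ((logParam b W k).strPoly V)) := by
        refine Polynomial.ringHom_ext (fun r => ?_) ?_
        · rw [comp_apply, comp_apply, comp_apply,
            GradedAlgOn.Parameter.strPoly, coe_eval₂RingHom, eval₂_C,
            coe_evalRingHom, eval_C]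
          rfl
        · rw [comp_apply, comp_apply, comp_apply,
            GradedAlgOn.Parameter.strPoly, coe_eval₂RingHom, eval₂_X,
            coe_evalRingHom, eval_X, map_zero]
          refine (eq_zero_iff_mem.2 (Ideal.mem_span_singleton'.2 ⟨1, ?_⟩)).symm
          rw [one_mul, map_zero]
          exact sub_zero _
      exact DFunLike.congr_fun this q
    · rw [comp_apply, comp_apply, map_X, SymTarget.onPoly, eval₂Hom_X', familyHom, eval₂Hom_X']
      rfl
  exact DFunLike.congr_fun this P

lemma fibreTarget_bijective (hW : HasCharts b W) :
    Bijective ((fibreTarget k hW).onPoly ch) := by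
  have hmap : ∀ p : MvPolynomial (Fin ch.n × Fin k) (Sec b V),
      MvPolynomial.map (evalRingHom 0) (MvPolynomial.map Polynomial.C p) = p := by
    intro p
    rw [map_map]
    convert map_id p
    ext r
    simp
  constructor
  · rw [injective_iff_map_eq_zero]
    intro p hp
    rw [← hmap p, ch.fibreTarget_onPoly] at hp
    obtain ⟨y, hy⟩ := Ideal.mem_span_singleton'.1 (eq_zero_iff_mem.1 hp)
    obtain ⟨q, rfl⟩ := ch.familyHom_surjective y
    have e : (logParam b W k).t V - ((logFamily b W k).scalar V 0 : (logFamily b W k).ring V) =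
        ch.familyHom k (C Polynomial.X) := by
      rw [ch.familyHom_C, map_zero, GradedAlgOn.Parameter.strPoly, coe_eval₂RingHom, eval₂_X]
      exact sub_zero _
    rw [e, ← map_mul] at hy
    rw [← hmap p, ← ch.familyHom_injective hy, map_mul, map_C,
      coe_evalRingHom, eval_X, map_zero, mul_zero]
  · intro y
    obtain ⟨y, rfl⟩ := mk_surjective y
    obtain ⟨P, rfl⟩ := ch.familyHom_surjective y
    exact ⟨_, ch.fibreTarget_onPoly hW P⟩

end Chart

variable (k) in
def symFibre [LocallyOfFiniteType b] (hW : HasCharts b W) : (logParam b W k).Fibre 0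
    (logSym b W k) :=
  ((logParam b W k).fibreFibre 0).ofIso ((fibreTarget k hW).symIso hW
    (((logParam b W k).fibreFibre 0).isQuasiCoherent (logFamily_isQuasiCoherent hW)).inj
    fun ch => ch.fibreTarget_bijective hW).symm

end

section
open MvPolynomial (C)

namespace TypeFil

variable {k : ℕ} {H : Type} [CommRing H] {gr : ℕ → AddSubgroup H} [GradedRing gr]
  (T : TypeFil H gr k)

def typeMonomial (l : Fin k →₀ ℕ) : T.F {l' | lexLE l' l} →+ T.rees where
  toFun x := ⟨monomial l (x : H), fun m => by
    classical
    rw [coeff_monomial]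
    split_ifs with h
    · exact h ▸ x.2
    · exact zero_mem _⟩
  map_zero' := Subtype.ext (map_zero _)
  map_add' _ _ := Subtype.ext (map_add _ _ _)

lemma coeff_typeMonomial_mem (N : (Fin k →₀ ℕ) → AddSubgroup H) {l : Fin k →₀ ℕ}
    {x : T.F {l' | lexLE l' l}} (hx : (x : H) ∈ N l) (m : Fin k →₀ ℕ) :
    (T.typeMonomial l x : MvPolynomial (Fin k) H).coeff m ∈ N m := by
  classical
  change (monomial l (x : H)).coeff m ∈ _
  rw [coeff_monomial]
  split_ifs with h
  · exact h ▸ hx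
  · exact zero_mem _

/-- The polynomials with coefficients strictly below the exponents. -/
def ltPoly : AddSubgroup (MvPolynomial (Fin k) H) where
  carrier := {p | ∀ l, p.coeff l ∈ T.lt l}
  zero_mem' l := by rw [coeff_zero]; exact zero_mem _
  add_mem' {p q} hp hq l := by rw [coeff_add]; exact add_mem (hp l) (hq l)
  neg_mem' {p} hp l := by rw [coeff_neg]; exact neg_mem (hp l)

end TypeFil

variable {W : X.Opens} {k : ℕ}

lemma letterSet_subset_le (i : Fin k) : letterSet i ⊆ {l | lexLE l (single i 1)} := by
  rintro l (rfl | ⟨h, _⟩)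
  · exact Or.inl rfl
  · exact Or.inr h

lemma letterSetLT_subset_lt (i : Fin k) : letterSetLT i ⊆ {l | lexLT l (single i 1)} := by
  rintro l ⟨rfl | ⟨h, _⟩, h'⟩
  · exact absurd rfl h'
  · exact h

def grMk (U : X.affineOpens) : (logFil b W k U).rees →+* (grLogGreenGriffiths b W k).ring U :=
  Ideal.Quotient.mk _

lemma grMk_eq_zero {U : X.affineOpens} {p : (logFil b W k U).rees} :
    grMk U p = 0 ↔ ∀ l, p.1.coeff l ∈ logTypeSpan b W k U {l' | lexLT l' l} :=
  eq_zero_iff_mem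

variable (b W k) in
def grTarget : SymTarget W k (grLogGreenGriffiths b W k) where
  ψ U i := ((grMk U).toAddMonoidHom.comp ((logFil b W k U).typeMonomial (single i 1))).comp
      (AddSubgroup.inclusion (logTypeSpan_mono b W k (letterSet_subset_le i)))
  str U _ _ _ _ := congrArg (grMk U) (Subtype.ext C_mul_monomial.symm)
  zero U i _ _ hx' := grMk_eq_zero.2 ((logFil b W k U).coeff_typeMonomial_mem
    (logFil b W k U).lt (logTypeSpan_mono b W k (letterSetLT_subset_lt i) hx'))
  mem U i _ _ hxi := ⟨_, (logFil b W k U).coeff_typeMonomial_mem (fun _ => jetGr k _ (i + 1)) hxi, rfl⟩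
  res {_ V} _ _ _ _ := congrArg (grMk V) (Subtype.ext (map_monomial _ _ _))

lemma grLogGreenGriffiths_inj [LocallyOfFiniteType b] (hW : HasCharts b W) (U : X.affineOpens)
    (f : Sec b U) (x : (grLogGreenGriffiths b W k).ring U)
    (hx : (grLogGreenGriffiths b W k).res (nonvanishing_le U f) x = 0) :
    ∃ n : ℕ, (grLogGreenGriffiths b W k).str U f ^ n * x = 0 := by
  obtain ⟨p, rfl⟩ := mk_surjective x
  have key : ∀ l, ∃ N, logStr b W k U f ^ N * p.1.coeff l ∈
      logTypeSpan b W k U {l' | lexLT l' l} := fun l => by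
    refine logTypeSpan_of_res hW U f (isLowerType_lt l) ?_
    refine (congrArg (· ∈ logTypeSpan b W k (nonvanishing U f : X.Opens) {l' | lexLT l' l})
      (coeff_map _ _ _)).mp ?_
    exact (grMk_eq_zero (U := nonvanishing U f)).1 hx l
  choose N hN using key
  refine ⟨p.1.support.sup N, ?_⟩
  let r : Sec b U := f ^ p.1.support.sup N
  refine (congrArg (· * grMk U p) (map_pow ((grLogGreenGriffiths b W k).str U) f _).symm).trans ?_
  let R : (logFil b W k U).rees := ⟨C (logStr b W k U r), fun l => by
    classical
    rw [coeff_C]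
    split_ifs
    · exact logTypeSpan_mono b W k (by rintro _ rfl; exact TypeFil.zero_le l) (logStr_type b W k U r)
    · exact zero_mem _⟩
  refine (map_mul (grMk U) R p).symm.trans (grMk_eq_zero.2 fun l => ?_)
  refine (congrArg (· ∈ logTypeSpan b W k U {l' | lexLT l' l}) (coeff_C_mul l _ p.1)).mpr ?_
  by_cases hl : l ∈ p.1.support
  · obtain ⟨d, hd⟩ := Nat.exists_eq_add_of_le (Finset.le_sup (f := N) hl)
    have e : logStr b W k U r = logStr b W k U (f ^ d) * logStr b W k U f ^ N l := by
      rw [← map_pow, ← map_mul, ← pow_add, add_comm d, ← hd]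
    rw [e, mul_assoc]
    exact logStr_mul_logTypeSpan _ (hN l)
  · rw [notMem_support_iff.1 hl, mul_zero]
    exact zero_mem _

namespace Chart

variable [LocallyOfFiniteType b] {V : X.affineOpens} (ch : Chart b W V)

variable (k) in
/-- The Rees algebra of the filtration by types, in coordinates and in the degrees that matter. -/
def reesHom : MvPolynomial (Fin ch.n × Fin k) (Sec b V) →+* (logFil b W k V).rees := eval₂Hom
    ((C.comp (logStr b W k V)).codRestrict (logFil b W k V).rees (by
      classical
      intro r l
      rw [comp_apply, coeff_C]
      split_ifs
      · exact logTypeSpan_mono b W k (by rintro _ rfl; exact TypeFil.zero_le l)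
          (logStr_type b W k V r)
      · exact zero_mem _))
    fun v => (logFil b W k V).typeMonomial (single v.2 1)
      ⟨_, logTypeSpan_mono b W k (letterSet_subset_le v.2) (ch.letter_mem_logTypeSpan v)⟩

lemma reesHom_monomial (m : Fin ch.n × Fin k →₀ ℕ) (r : Sec b V) : (ch.reesHom k (monomial m r)).1 =
      monomial (monoType m) (ch.log.ofPoly k (monomial m (secRes b inf_le_left r))) := by
  have hr : ∀ (R : Type) [CommRing R] (r : R), (monomial m r : MvPolynomial (Fin ch.n × Fin k) R) =
        C r * monomial m 1 := fun R _ r => by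
    rw [C_mul_monomial, mul_one]
  rw [hr _ r, hr _ (secRes b _ r), map_mul, map_mul, ch.log.ofPoly_C]
  have h1 : (ch.reesHom k (C r)).1 = C (logStr b W k V r) := congrArg Subtype.val (eval₂Hom_C _ _ r)
  have h2 : (ch.reesHom k (monomial m 1)).1 =
      monomial (monoType m) (ch.log.ofPoly k (monomial m 1)) := by
    clear h1 hr
    induction m using induction_linear with
    | zero =>
      rw [monoType_zero]
      refine (congrArg Subtype.val (map_one (ch.reesHom k))).trans ?_
      exact (congrArg C (map_one (ch.log.ofPoly k))).symm
    | add m m' h h' =>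
      have e : ∀ R : Type, ∀ [CommRing R], (monomial (m + m') (1 : R)) =
          monomial m 1 * monomial m' 1 := by
        intro R _
        rw [monomial_mul, mul_one]
      rw [e, e, map_mul, map_mul, monoType_add, ← monomial_mul, ← h, ← h']
      rfl
    | single v n =>
      rw [monoType_single, ← X_pow_eq_monomial, ← X_pow_eq_monomial,
        map_pow, map_pow, ch.log.ofPoly_X, ← Finsupp.smul_single_one v.2,
        ← monomial_pow]
      refine (SubmonoidClass.coe_pow _ _).trans (congrArg (· ^ n) ?_)
      exact congrArg Subtype.val (eval₂Hom_X' _ _ v)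
  rw [Subring.coe_mul, h1, h2, C_mul_monomial]
  rfl

open Classical in
lemma coeff_reesHom (p : MvPolynomial (Fin ch.n × Fin k) (Sec b V)) (l : Fin k →₀ ℕ)
    (m : Fin ch.n × Fin k →₀ ℕ) :
    (ch.log.toPoly k ((ch.reesHom k p).1.coeff l)).coeff m =
      if monoType m = l then secRes b inf_le_left (p.coeff m) else 0 := by
  induction p using induction_on' with
  | monomial m' r =>
    rw [ch.reesHom_monomial, coeff_monomial, coeff_monomial]
    by_cases hm : m' = m
    · subst hm
      rw [if_pos rfl]
      split_ifs
      · rw [ch.log.toPoly_ofPoly, coeff_monomial, if_pos rfl]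
      · rw [map_zero, coeff_zero]
    · rw [if_neg hm, map_zero, ite_self]
      split_ifs
      · rw [ch.log.toPoly_ofPoly, coeff_monomial, if_neg hm]
      · rw [map_zero, coeff_zero]
  | add p q hp hq =>
    rw [map_add, Subring.coe_add, coeff_add, map_add, coeff_add, hp, hq, coeff_add, map_add]
    split_ifs
    · rfl
    · rw [add_zero]

lemma grTarget_onPoly (p : MvPolynomial (Fin ch.n × Fin k) (Sec b V)) :
    (grTarget b W k).onPoly ch p = grMk V (ch.reesHom k p) := by
  have : (grTarget b W k).onPoly ch = (grMk V).comp (ch.reesHom k) := by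
    refine ringHom_ext (fun r => ?_) fun v => ?_
    · rw [comp_apply, SymTarget.onPoly, reesHom, eval₂Hom_C, eval₂Hom_C]
      rfl
    · rw [comp_apply, SymTarget.onPoly, reesHom, eval₂Hom_X', eval₂Hom_X']
      rfl
  exact DFunLike.congr_fun this p

lemma grTarget_bijective : Bijective ((grTarget b W k).onPoly ch) := by
  constructor
  · rw [injective_iff_map_eq_zero]
    intro p hp
    rw [ch.grTarget_onPoly, grMk_eq_zero] at hp
    ext m
    rw [coeff_zero]
    refine ch.secRes_injective (Eq.trans ?_ (map_zero _).symm)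
    by_contra h0
    have h := ((ch.log.mem_typeSpan_iff k (isLowerType_lt _)).1
      ((ch.mem_logTypeSpan_iff (isLowerType_lt _)).1 (hp (monoType m)))) m
    rw [ch.coeff_reesHom, if_pos rfl] at h
    exact lexLT_irrefl _ (h.2 h0)
  · intro y
    obtain ⟨q, rfl⟩ := mk_surjective y
    let N : AddSubgroup (MvPolynomial (Fin k) (JetRing k (Sec b ((V : X.Opens) ⊓ W)))) :=
      ((logFil b W k V).rees.subtype.comp (ch.reesHom k)).toAddMonoidHom.range ⊔
        (logFil b W k V).ltPoly
    have hN : ∀ l x, x ∈ logTypeSpan b W k V {l' | lexLE l' l} →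
        monomial l x ∈ N := by
      intro l x hx
      have hx' := (ch.log.mem_typeSpan_iff k (isLowerType_le l)).1
        ((ch.mem_logTypeSpan_iff (isLowerType_le l)).1 hx)
      rw [← ch.log.ofPoly_toPoly k x]
      refine polySpan_induction ((monomial l).toAddMonoidHom.comp
        (ch.log.ofPoly k).toAddMonoidHom) N (fun a ha m hm => ?_) hx'
      rcases hm with hm | hm
      · obtain ⟨r, rfl⟩ := ha
        refine AddSubgroup.mem_sup_left ⟨monomial m r, ?_⟩
        refine (ch.reesHom_monomial m r).trans ?_
        rw [hm]
        rfl
      · refine AddSubgroup.mem_sup_right fun l' => ?_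
        change (monomial l _).coeff l' ∈ _
        classical
        rw [coeff_monomial]
        split_ifs with h
        · subst h
          exact logTypeSpan_of_typeSpan b W k (ch.log.ofPoly_mem_typeSpan k
            (monomial_mem_polySpan ha hm))
        · exact zero_mem _
    have hq : q.1 ∈ N := by
      rw [q.1.as_sum]
      exact sum_mem fun l _ => hN l _ (q.2 l)
    obtain ⟨_, ⟨p, rfl⟩, z, hz, hpz⟩ := AddSubgroup.mem_sup.1 hq
    refine ⟨p, (ch.grTarget_onPoly p).trans (sub_eq_zero.1 ?_)⟩
    refine (map_sub (grMk V) (ch.reesHom k p) q).symm.trans (grMk_eq_zero.2 fun l => ?_)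
    have e : (ch.reesHom k p - q).1 = -z := by
      change (ch.reesHom k p).1 - q.1 = -z
      rw [← hpz]
      exact sub_add_cancel_left _ _
    rw [e]
    exact neg_mem hz l

end Chart

variable (k) in
/-- The associated graded algebra of the logarithmic jet differentials is the weighted symmetric
algebra of the logarithmic forms. -/
def symIsoGr [LocallyOfFiniteType b] (hW : HasCharts b W) : (logSym b W k).Iso
      (grLogGreenGriffiths b W k) :=
  (grTarget b W k).symIso hW (grLogGreenGriffiths_inj hW) fun ch => ch.grTarget_bijective

/-- The logarithmic jet differentials deform to the associated graded algebra, up to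
isomorphisms. -/
lemma deformsTo_of_iso [Smooth b] (hW : HasCharts b W) {E G F : GradedAlgOn b}
    (e : (logGreenGriffiths b W k).Iso E) (φ : (grLogGreenGriffiths b W k).Iso G)
    (ψ : (logSym b W k).Iso F) :
    DeformsTo E G F := by
  have hW' := hW
  choose V hV hch using hW'
  exact deformsTo_of_family (logParam b W k) (logFamily_isQuasiCoherent hW)
    (fun x => ⟨(V x : X.Opens), (V x).2⟩) hV (fun x => (hch x).elim fun ch => ch.isGood k)
    (fun c hc => ⟨_, ⟨logFibre hc⟩, ⟨e⟩⟩) ((symFibre k hW).ofIso ψ)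
    (ψ.symm.trans ((symIsoGr k hW).trans φ))

end

section
section Coordinates

variable {B ι : Type} [CommRing B] [Algebra ℂ B]

lemma isCoord_iff_bijective (z : ι → B) : IsCoord z ↔
    Bijective (linearCombination B fun i => D ℂ B (z i)) := by
  rw [Bijective, ← LinearMap.range_eq_top, Finsupp.range_linearCombination]
  exact ⟨fun h => ⟨h.1, h.2⟩, fun h => ⟨h.1, h.2⟩⟩

lemma isCoord_algebraMap_iff (S : Submonoid B) (C : Type) [CommRing C] [Algebra ℂ C] [Algebra B C]
    [IsScalarTower ℂ B C] [IsLocalization S C] (s : ι → B) :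
    IsCoord (fun i => algebraMap B C (s i)) ↔ Bijective (LocalizedModule.map S
      (linearCombination B fun i => D ℂ B (s i))) := by
  rw [isCoord_iff_bijective, ← IsLocalizedModule.map_bijective_iff_localizedModuleMap_bijective
    (Finsupp.mapRange.linearMap (α := ι) (Algebra.linearMap B C))
    (KaehlerDifferential.map ℂ ℂ B C)]
  have e : (linearCombination C fun i =>
      D ℂ C (algebraMap B C (s i))).restrictScalars B =
      IsLocalizedModule.map S (Finsupp.mapRange.linearMap (α := ι) (Algebra.linearMap B C))
        (KaehlerDifferential.map ℂ ℂ B C)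
        (linearCombination B fun i => D ℂ B (s i)) := by
    refine IsLocalizedModule.ext S (Finsupp.mapRange.linearMap (α := ι) (Algebra.linearMap B C))
      (IsLocalizedModule.map_units (KaehlerDifferential.map ℂ ℂ B C)) ?_
    rw [IsLocalizedModule.map_comp]
    ext i
    simp
  rw [← e]
  rfl

lemma exists_isCoord [Algebra.Smooth ℂ B] (p : Ideal B) [p.IsPrime] (A : Type) [CommRing A]
    [Algebra ℂ A] [Algebra B A] [IsScalarTower ℂ B A] [IsLocalization.AtPrime A p] :
    ∃ g ∉ p, ∃ (n : ℕ) (s : Fin n → B), ∀ (C : Type) [CommRing C] [Algebra ℂ C] [Algebra B C]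
      [IsScalarTower ℂ B C] [IsLocalization.Away g C], IsCoord fun i => algebraMap B C (s i) := by
  have := IsLocalization.AtPrime.isLocalRing A p
  have := Algebra.FormallySmooth.of_isLocalization (Rₘ := A) p.primeCompl
  have : Algebra.FormallySmooth ℂ A := .comp ℂ B A
  have := Algebra.EssFiniteType.of_isLocalization A p.primeCompl
  have : Algebra.EssFiniteType ℂ A := .comp ℂ B A
  have : Module.FinitePresentation A (Ω[A⁄ℂ]) := Module.finitePresentation_of_projective _ _
  obtain ⟨κ, a, v, hv⟩ := Module.exists_basis_of_span_of_flat (R := A) _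
    (KaehlerDifferential.span_range_map_derivation_of_isLocalization ℂ B A p.primeCompl)
  have := Module.Finite.finite_basis v
  obtain ⟨n, ⟨e⟩⟩ := Finite.exists_equiv_fin κ
  have h : (fun i => D ℂ A (algebraMap B A (a (e.symm i)))) = v.reindex e := by
    funext i
    rw [Module.Basis.reindex_apply, hv, Function.comp_apply, KaehlerDifferential.map_D]
  have hp : IsCoord fun i => algebraMap B A (a (e.symm i)) :=
    ⟨h ▸ Module.Basis.linearIndependent _, h ▸ Module.Basis.span_eq _⟩
  obtain ⟨g, hg, hgb⟩ := Module.FinitePresentation.exists_notMem_bijective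
    (linearCombination B fun i => D ℂ B (a (e.symm i))) p
    (LocalizedModule.mkLinearMap p.primeCompl _) (LocalizedModule.mkLinearMap p.primeCompl _)
    (IsLocalizedModule.map_bijective_iff_localizedModuleMap_bijective _ _ |>.2
      ((isCoord_algebraMap_iff p.primeCompl A _).1 hp))
  refine ⟨g, hg, n, fun i => a (e.symm i), ?_⟩
  intro C _ _ _ _ _
  exact (isCoord_algebraMap_iff (.powers g) C _).2 hgb

end Coordinates

lemma IsSNCDivisor.hasCharts {D : TopologicalSpace.Closeds X} (h : IsSNCDivisor b D) :
    HasCharts b D.compl := by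
  intro x
  obtain ⟨V, hx, n, z, c, h1, h2, hD⟩ := h x
  refine ⟨V, hx, ⟨⟨n, z, c, ⟨h1, h2⟩, fun y hy => ?_⟩⟩⟩
  rw [← not_iff_not]
  push Not
  exact not_not.trans (hD y hy)

lemma exists_chart_top [Smooth b] (U : X.affineOpens) {u : X} (hu : u ∈ (U : X.Opens)) :
    ∃ g : Sec b U, u ∈ X.basicOpen (g : Γ(X, U)) ∧
      ∃ ch : Chart b ⊤ (X.affineBasicOpen (U := U) g), ch.c = ∅ ∧
        ∃ s : Fin ch.n → Sec b U, ∀ i, ch.z i = secRes b (basicOpen_le g) (s i) := by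
  have : Algebra.Smooth ℂ (Sec b (U : X.Opens)) := RingHom.smooth_algebraMap.1 (smooth_sec U)
  let y := U.2.primeIdealOf ⟨u, hu⟩
  let I : Ideal (Sec b (U : X.Opens)) := y.asIdeal
  have hI : I.IsPrime := y.isPrime
  obtain ⟨g, hg, n, s, hs⟩ := exists_isCoord (B := Sec b (U : X.Opens)) I (AtPrime I)
  have hy : y ∈ U.2.fromSpec ⁻¹ᵁ X.basicOpen (g : Γ(X, U)) :=
    (U.2.fromSpec_preimage_basicOpen _).ge hg
  have hug : u ∈ X.basicOpen (g : Γ(X, U)) :=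
    (congrArg (· ∈ X.basicOpen (g : Γ(X, U))) (U.2.fromSpec_primeIdealOf ⟨u, hu⟩)).mp hy
  refine ⟨g, hug, ⟨n, fun i => secRes b (basicOpen_le g) (s i), ∅, ?_,
    fun y _ => ⟨fun _ i hi => absurd hi (Finset.notMem_empty i), fun _ => trivial⟩⟩, rfl, s,
      fun _ => rfl⟩
  let _ := (secRes b (basicOpen_le g)).toRingHom.toAlgebra
  have : IsScalarTower ℂ (Sec b U) (Sec b (X.basicOpen (g : Γ(X, U)))) :=
    IsScalarTower.of_algebraMap_eq fun c =>
      ((secRes b (basicOpen_le g)).commutes c).symm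
  have := isLocalization_secRes_affine U g (basicOpen_le g) rfl
  exact hs (Sec b (X.basicOpen (g : Γ(X, U))))

end

section
namespace LogCoord

variable {B C ι : Type} [CommRing B] [Algebra ℂ B] [CommRing C] [Algebra ℂ C] {C₀ : Subring C}
  (L : LogCoord C C₀ ι) (hc : L.c = ∅) (σ : B →ₐ[ℂ] C) (s : ι → B) (hs : ∀ i, σ (s i) = L.z i)
  {k : ℕ}
include hc hs

lemma exists_isMono (m : ι × Fin k →₀ ℕ) : ∃ y : JetRing k B, IsMono ⊤ (monoType m) y ∧
    jetMap k σ y = L.ofPoly k (monomial m 1) := by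
  induction m using induction_linear with
  | zero => exact ⟨1, monoType_zero (ι := ι) ▸ IsMono.one, (map_one _).trans (map_one _).symm⟩
  | add m m' h h' =>
    obtain ⟨y, hy, e⟩ := h
    obtain ⟨y', hy', e'⟩ := h'
    refine ⟨y * y', monoType_add m m' ▸ hy.mul_mono hy', ?_⟩
    rw [map_mul, e, e', ← map_mul, monomial_mul, mul_one]
  | single v n =>
    refine ⟨jd k v.2.succ (s v.1) ^ n, ?_, ?_⟩
    · rw [monoType_single]
      induction n with
      | zero => simpa using IsMono.one
      | succ n ih =>
        rw [pow_succ, Finsupp.single_add]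
        exact ih.mul _ _ _ _ (Or.inl ⟨_, mem_top _, rfl⟩)
    · rw [← X_pow_eq_monomial, map_pow, map_pow, ofPoly_X, jetMap_jd, hs, letter,
        dif_neg (hc ▸ Set.notMem_empty _)]

lemma exists_mul_mem_typeSpan [Fintype ι] {f : B}
    (hloc : letI := σ.toRingHom.toAlgebra; IsLocalization.Away f C) {S : Set (Fin k →₀ ℕ)}
    (hS : IsLowerType S) {x : JetRing k B} (hx : jetMap k σ x ∈ typeSpan C₀ S) :
    ∃ N, jd k 0 (f ^ N) * x ∈ typeSpan ⊤ S := by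
  have hmul (r : B) {y : JetRing k B} : y ∈ typeSpan ⊤ S → jd k 0 r * y ∈ typeSpan ⊤ S :=
    jd0_mul_mem_typeSpan (mem_top r)
  have hj : ∀ a b : B, jd k 0 (a * b) = jd k 0 a * jd k 0 b := (jd0 k B).map_mul
  let N : AddSubgroup (JetRing k C) :=
    { carrier := {y | ∃ n, ∃ z ∈ typeSpan ⊤ S, jetMap k σ z = jetMap k σ (jd k 0 (f ^ n)) * y}
      zero_mem' := ⟨0, 0, zero_mem _, by rw [map_zero, mul_zero]⟩
      add_mem' := by
        rintro y y' ⟨n, z, hz, e⟩ ⟨n', z', hz', e'⟩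
        refine ⟨n + n', _, add_mem (hmul (f ^ n') hz) (hmul (f ^ n) hz'), ?_⟩
        rw [map_add, map_mul, map_mul, e, e', pow_add, hj, map_mul]
        ring
      neg_mem' := by
        rintro y ⟨n, z, hz, e⟩
        exact ⟨n, -z, neg_mem hz, by rw [map_neg, e, mul_neg]⟩ }
  have hN : jetMap k σ x ∈ N := by
    rw [← L.ofPoly_toPoly k (jetMap k σ x)]
    refine polySpan_induction (L.ofPoly k).toAddMonoidHom N (fun a _ m hm => ?_)
      ((L.mem_typeSpan_iff k hS).1 hx)
    obtain ⟨n, r, hr⟩ := exists_eq_pow_mul hloc a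
    obtain ⟨y, hy, e⟩ := L.exists_isMono hc σ s hs m
    refine ⟨n, jd k 0 r * y, subset_closure ⟨r, mem_top r, _, hm, y, hy, rfl⟩, ?_⟩
    change _ = _ * L.ofPoly k (monomial m a)
    have ha : monomial m a = MvPolynomial.C a * monomial m 1 := by
      rw [C_mul_monomial, mul_one]
    have hr' : σ r = σ (f ^ n) * a := hr.trans (congrArg (· * a) (map_pow σ f n).symm)
    rw [ha, map_mul, map_mul, e, ofPoly_C, jetMap_jd, jetMap_jd, hr', ← mul_assoc]
    exact congrArg (· * _) ((jd0 k C).map_mul _ _)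
  obtain ⟨n, z, hz, e⟩ := hN
  obtain ⟨n', hn'⟩ := jetMap_eq_zero σ f hloc (x := jd k 0 (f ^ n) * x - z) (by
    rw [map_sub, map_mul, e, sub_self])
  have hp : jd k 0 f ^ n' = jd k 0 (f ^ n') := ((jd0 k B).map_pow f n').symm
  rw [hp, mul_sub, sub_eq_zero, ← mul_assoc, ← hj, ← pow_add] at hn'
  exact ⟨n' + n, hn' ▸ hmul _ hz⟩

end LogCoord

variable {k : ℕ}

/-- Without divisor, the filtration by types is already a sheaf. -/
lemma mem_typeSpan_of_logTypeSpan [Smooth b] (U : X.affineOpens) {S : Set (Fin k →₀ ℕ)}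
    (hS : IsLowerType S) {x : JetRing k (Sec b (U : X.Opens))}
    (hx : jetMap k (secRes b (inf_le_left : (U : X.Opens) ⊓ ⊤ ≤ U)) x ∈ logTypeSpan b ⊤ k U S) :
    x ∈ typeSpan ⊤ S := by
  have hj : ∀ r r' : Sec b (U : X.Opens), jd k 0 (r * r') = jd k 0 r * jd k 0 r' :=
    (jd0 k _).map_mul
  let J : Ideal (Sec b U) :=
    { carrier := {r | jd k 0 r * x ∈ typeSpan ⊤ S}
      add_mem' := by
        intro r s hr hs
        rw [Set.mem_ofPred_eq, jd_add, add_mul]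
        exact add_mem hr hs
      zero_mem' := by
        rw [Set.mem_ofPred_eq, show jd k 0 (0 : Sec b (U : X.Opens)) = 0 from (jd0 k _).map_zero,
          zero_mul]
        exact zero_mem _
      smul_mem' := by
        intro r s hs
        rw [Set.mem_ofPred_eq, smul_eq_mul, hj, mul_assoc]
        exact jd0_mul_mem_typeSpan (mem_top r) hs }
  have h1 : (1 : Sec b U) ∈ J := by
    refine one_mem_of_cover U J fun u hu => ?_
    obtain ⟨g, hug, ch, hc, s, hs⟩ := exists_chart_top (b := b) U hu
    let V := X.affineBasicOpen (U := U) g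
    have hVU : (V : X.Opens) ≤ U := X.basicOpen_le _
    have hxV := (ch.mem_logTypeSpan_iff hS).1 (logTypeSpan_res b ⊤ k hVU hx)
    have hσ : (V : X.Opens) ⊓ ⊤ ≤ U := inf_le_left.trans hVU
    obtain ⟨N, hN⟩ := ch.log.exists_mul_mem_typeSpan
      (Set.eq_empty_of_forall_notMem fun i hi => Finset.notMem_empty i (hc ▸ hi))
      (secRes b hσ) s (fun i => (secRes_secRes hVU inf_le_left (s i)).symm.trans
        (congrArg (secRes b inf_le_left) (hs i).symm))
      (isLocalization_secRes_affine U g hσ (inf_top_eq _)) hS (x := x) (by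
        refine (congrArg (· ∈ typeSpan (extendable b ⊤ V) S) ?_).mp hxV
        rw [jetMap_comp, secResLog, secRes_comp])
    refine ⟨g ^ (N + 1), ?_, (X.basicOpen_pow g N.succ_pos).ge hug⟩
    change jd k 0 (g ^ (N + 1)) * x ∈ typeSpan ⊤ S
    rw [pow_succ', hj, mul_assoc]
    exact jd0_mul_mem_typeSpan (mem_top g) hN
  have h1' : jd k 0 (1 : Sec b (U : X.Opens)) * x ∈ typeSpan ⊤ S := h1
  rwa [show jd k 0 (1 : Sec b (U : X.Opens)) = 1 from (jd0 k _).map_one, one_mul] at h1'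

end

section
lemma typeSpan_univ {k : ℕ} {B : Type} [CommRing B] [Algebra ℂ B] (x : JetRing k B) :
    x ∈ typeSpan ⊤ Set.univ := by
  let S : Subring (JetRing k B) :=
    { typeSpan ⊤ Set.univ with
      one_mem' := typeSpan_mono _ (Set.subset_univ _) (typeSpan_one ⊤)
      mul_mem' := typeSpan_mul _ fun _ _ _ _ => Set.mem_univ _ }
  have hS : S = ⊤ := jetRing_closure S fun i c => by
    refine Fin.cases (typeSpan_mono _ (Set.subset_univ _) (typeSpan_jd0 _ (mem_top c)))
      (fun i => ?_) i
    refine subset_closure ⟨1, one_mem _, _, trivial, _,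
      IsMono.one.mul 0 1 i _ (Or.inl ⟨c, mem_top c, rfl⟩), ?_⟩
    rw [one_mul, show jd k 0 (1 : B) = 1 from (jd0 k B).map_one, one_mul]
  have : x ∈ S := hS ▸ mem_top x
  exact this

lemma TypeFil.map_bijective {k : ℕ} {H H' : Type} [CommRing H] [CommRing H']
    {gr : ℕ → AddSubgroup H} [GradedRing gr] {gr' : ℕ → AddSubgroup H'} [GradedRing gr']
    (T : TypeFil H gr k) (T' : TypeFil H' gr' k) (g : H →+* H')
    (hg : ∀ S x, x ∈ T.F S → g x ∈ T'.F S) (hsurj : Surjective g)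
    (hle : ∀ l x, g x ∈ T'.le l → x ∈ T.le l) (hlt : ∀ l x, g x ∈ T'.lt l → x ∈ T.lt l) :
    Bijective (T.map T' g hg) := by
  constructor
  · rw [injective_iff_map_eq_zero]
    intro x hx
    obtain ⟨p, rfl⟩ := mk_surjective x
    refine eq_zero_iff_mem.2 fun l => hlt l _ ?_
    rw [← coeff_map]
    exact eq_zero_iff_mem.1 hx l
  · intro y
    obtain ⟨q, rfl⟩ := mk_surjective y
    obtain ⟨p, hp⟩ := MvPolynomial.map_surjective g hsurj q.1
    refine ⟨Ideal.Quotient.mk _ ⟨p, fun l => hle l _ ?_⟩, congrArg (Ideal.Quotient.mk _)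
      (Subtype.ext hp)⟩
    rw [← coeff_map, hp]
    exact q.2 l

section Sym

variable {R R' : Type} [CommRing R] [CommRing R'] {n : ℕ} {M M' : Fin n → Type}
  [∀ i, AddCommGroup (M i)] [∀ i, Module R (M i)] [∀ i, AddCommGroup (M' i)]
  [∀ i, Module R' (M' i)]

lemma symHom_ext {T : Type} [CommRing T] {f g : SymmetricAlgebra R (∀ i, M i) →+* T}
    (h : ∀ r, f (algebraMap R _ r) = g (algebraMap R _ r))
    (h' : ∀ x, f (SymmetricAlgebra.ι R _ x) = g (SymmetricAlgebra.ι R _ x)) : f = g := by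
  have : eqLocus f g = ⊤ := sym_closure R M _ h fun i x => h' _
  exact RingHom.ext fun x => (this ▸ mem_top x : x ∈ eqLocus f g)

lemma symMap_bijective (ρ : R →+* R') (hρ : Bijective ρ) (f : ∀ i, M i →+ M' i)
    (hf : ∀ i (r : R) (x : M i), f i (r • x) = ρ r • f i x)
    (hb : ∀ i, Bijective (f i)) : Bijective (symMap ρ f hf) := by
  let e := RingEquiv.ofBijective ρ hρ
  let g i := AddEquiv.ofBijective (f i) (hb i)
  have hg : ∀ i (r : R') (x : M' i), (g i).symm.toAddMonoidHom (r • x) =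
      e.symm.toRingHom r • (g i).symm.toAddMonoidHom x := fun i r x => (g i).injective <| by
    change g i ((g i).symm _) = f i (e.symm r • (g i).symm x)
    rw [AddEquiv.apply_symm_apply, hf]
    exact congrArg₂ (· • ·) (e.apply_symm_apply r).symm ((g i).apply_symm_apply x).symm
  have h1 : (symMap e.symm.toRingHom _ hg).comp (symMap ρ f hf) = RingHom.id _ := by
    refine symHom_ext (fun r => ?_) fun x => ?_
    · rw [comp_apply, symMap_algebraMap, symMap_algebraMap]
      exact congrArg _ (e.symm_apply_apply r)
    · rw [comp_apply, symMap_ι, symMap_ι]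
      exact congrArg _ (funext fun i => (g i).symm_apply_apply _)
  have h2 : (symMap ρ f hf).comp (symMap e.symm.toRingHom _ hg) = RingHom.id _ := by
    refine symHom_ext (fun r => ?_) fun x => ?_
    · rw [comp_apply, symMap_algebraMap, symMap_algebraMap]
      exact congrArg _ (e.apply_symm_apply r)
    · rw [comp_apply, symMap_ι, symMap_ι]
      exact congrArg _ (funext fun i => (g i).apply_symm_apply _)
  exact ⟨Function.LeftInverse.injective (DFunLike.congr_fun h1),
    Function.RightInverse.surjective (DFunLike.congr_fun h2)⟩

end Sym

variable (b)

lemma secRes_self (U : X.Opens) : secRes b (le_refl U) = AlgHom.id ℂ _ := by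
  ext x
  exact congrArg (fun φ => φ.hom x) (X.presheaf.map_id (.op U))

def toInfTop (U : X.Opens) : Sec b U →ₐ[ℂ] Sec b (U ⊓ ⊤) := secRes b inf_le_left

def ofInfTop (U : X.Opens) : Sec b (U ⊓ ⊤) →ₐ[ℂ] Sec b U := secRes b (le_inf le_rfl le_top)

lemma ofInfTop_comp (U : X.Opens) : (ofInfTop b U).comp (toInfTop b U) = AlgHom.id ℂ _ :=
  (secRes_comp b _ _).trans (secRes_self b U)

lemma toInfTop_comp (U : X.Opens) : (toInfTop b U).comp (ofInfTop b U) = AlgHom.id ℂ _ :=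
  (secRes_comp b _ _).trans (secRes_self b _)

lemma toInfTop_res {U V : X.Opens} (h : V ≤ U) :
    (toInfTop b V).comp (secRes b h) = (secResLog b ⊤ h).comp (toInfTop b U) :=
  (secRes_comp b _ _).trans (secRes_comp b _ _).symm

lemma jetMap_id {k : ℕ} {B : Type} [CommRing B] [Algebra ℂ B] (x : JetRing k B) :
    jetMap k (AlgHom.id ℂ B) x = x := by
  have : jetMap k (AlgHom.id ℂ B) = AlgHom.id ℂ (JetRing k B) :=
    jetHom_ext fun i c => by rw [jetMap_jd, AlgHom.id_apply, AlgHom.id_apply]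
  exact DFunLike.congr_fun this x

lemma jetMap_toInfTop_bijective (k : ℕ) (U : X.Opens) :
    Bijective (jetMap k (toInfTop b U)) := by
  refine Function.bijective_iff_has_inverse.2 ⟨jetMap k (ofInfTop b U), fun x => ?_, fun x => ?_⟩
  · rw [jetMap_comp, ofInfTop_comp, jetMap_id]
  · rw [jetMap_comp, toInfTop_comp, jetMap_id]

lemma jetMap_toInfTop_mem {k : ℕ} {U : X.Opens} (S : Set (Fin k →₀ ℕ)) {x : JetRing k (Sec b U)}
    (hx : x ∈ typeSpan ⊤ S) : jetMap k (toInfTop b U) x ∈ logTypeSpan b ⊤ k U S :=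
  logTypeSpan_of_typeSpan b ⊤ k (typeSpan_map (A₀' := extendable b ⊤ U) _
    (fun a _ => ⟨a, rfl⟩) S hx)

lemma jetMap_toInfTop_res {k : ℕ} {U V : X.Opens} (h : V ≤ U) (x : JetRing k (Sec b U)) :
    jetMap k (toInfTop b V) (jetMap k (secRes b h) x) =
      jetMap k (secResLog b ⊤ h) (jetMap k (toInfTop b U) x) := by
  rw [jetMap_comp, jetMap_comp, toInfTop_res]

/-- Jet differentials as logarithmic jet differentials without poles. -/
def greenGriffithsIso (k : ℕ) : (greenGriffiths b k).Iso (logGreenGriffiths b ⊤ k) where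
  hom U :=
    { (jetMap k (toInfTop b U)).toRingHom.codRestrict (logJets b ⊤ k U) fun x =>
        jetMap_toInfTop_mem b _ (typeSpan_univ x) with
      map_mem := fun hx => jetMap_mem _ hx }
  bij U := ⟨fun _ _ h => (jetMap_toInfTop_bijective b k U).1 (congrArg Subtype.val h), fun y =>
    ((jetMap_toInfTop_bijective b k U).2 y.1).imp fun _ h => Subtype.ext h⟩
  res h x := Subtype.ext (jetMap_toInfTop_res b h x)
  str U r := Subtype.ext (jetMap_jd _ 0 r)

def grGreenGriffithsIso [Smooth b] (k : ℕ) :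
    (grGreenGriffiths b k).Iso (grLogGreenGriffiths b ⊤ k) where
  hom U :=
    { (jetFil k (Sec b (U : X.Opens))).map (logFil b ⊤ k U) (jetMap k (toInfTop b U)).toRingHom
        fun S _ => jetMap_toInfTop_mem b S with
      map_mem := fun {m x} hx => TypeFil.map_mem _ _ _ _ (fun _ _ h => jetMap_mem _ h) m x hx }
  bij U := TypeFil.map_bijective _ _ _ (fun S _ => jetMap_toInfTop_mem b S) (jetMap_toInfTop_bijective b k U).2
    (fun l _ h => mem_typeSpan_of_logTypeSpan U (isLowerType_le l) h)
    fun l _ h => mem_typeSpan_of_logTypeSpan U (isLowerType_lt l) h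
  res {U V} h x := by
    obtain ⟨p, rfl⟩ := mk_surjective x
    refine congrArg (grMk V) (Subtype.ext (MvPolynomial.ext _ _ fun l => ?_))
    change (MvPolynomial.map _ (MvPolynomial.map _ p.1)).coeff l =
      (MvPolynomial.map _ (MvPolynomial.map _ p.1)).coeff l
    rw [coeff_map, coeff_map, coeff_map, coeff_map]
    exact jetMap_toInfTop_res b h _
  str U r := TypeFil.map_zeroHom _ _ _ (fun S _ => jetMap_toInfTop_mem b S) _
    (fun r => typeSpan_jd0 _ (mem_top r)) _ (logStr_type b ⊤ k U) (.id _)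
    (fun r => jetMap_jd _ 0 r) r

def toLogForms (U : X.affineOpens) : (cotangent b).mod U →+ (logCotangent b ⊤).mod U :=
  (omegaMap (toInfTop b U)).codRestrict (logForms b ⊤ U) fun x => by
    have hx : x ∈ Submodule.span (Sec b (U : X.Opens)) (Set.range (D ℂ (Sec b (U : X.Opens)))) :=
      span_range_derivation ℂ (Sec b (U : X.Opens)) ▸ Submodule.mem_top
    induction hx using Submodule.span_induction with
    | zero => rw [map_zero]; exact zero_mem _
    | add x y _ _ hx hy => rw [map_add]; exact add_mem hx hy
    | smul r x _ hx => rw [omegaMap_smul]; exact logForms_smul b ⊤ r hx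
    | mem x hx =>
      obtain ⟨a, rfl⟩ := hx
      intro u hu
      refine ⟨U, le_rfl, hu, logFormSpan_res b ⊤ _ (subset_closure
        (Or.inl ⟨1, one_mem _, toInfTop b U a, ⟨a, rfl⟩, ?_⟩))⟩
      rw [one_smul, omegaMap_D]

lemma omegaMap_id {B : Type} [CommRing B] [Algebra ℂ B] (x : Ω[B⁄ℂ]) :
    omegaMap (AlgHom.id ℂ B) x = x := by
  have hx : x ∈ Submodule.span B (Set.range (D ℂ B)) :=
    span_range_derivation ℂ B ▸ Submodule.mem_top
  induction hx using Submodule.span_induction with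
  | mem x hx => obtain ⟨y, rfl⟩ := hx; exact omegaMap_D _ y
  | zero => exact map_zero _
  | add x y _ _ hx hy => rw [map_add, hx, hy]
  | smul r x _ hx => rw [omegaMap_smul, hx]; rfl

lemma toLogForms_bijective (U : X.affineOpens) : Bijective (toLogForms b U) := by
  constructor
  · refine Function.LeftInverse.injective (g := fun y => omegaMap (ofInfTop b U) y.1) fun x => ?_
    exact (omegaMap_comp _ _ x).trans ((congrArg (omegaMap · x) (ofInfTop_comp b U)).trans
      (omegaMap_id x))
  · refine fun y => ⟨omegaMap (ofInfTop b U) y.1, Subtype.ext ?_⟩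
    exact (omegaMap_comp _ _ y.1).trans ((congrArg (omegaMap · y.1) (toInfTop_comp b U)).trans
      (omegaMap_id y.1))

lemma toLogForms_smul (U : X.affineOpens) (r : Sec b U) (x : (cotangent b).mod U) :
    toLogForms b U (r • x) = RingHom.id (Sec b U) r • toLogForms b U x :=
  Subtype.ext (omegaMap_smul (toInfTop b U) r x)

/-- The weighted symmetric algebra of forms, as that of logarithmic forms without poles. -/
def weightedSymIso {n : ℕ} (a : Fin n → ℕ) : (weightedSym b (fun _ => cotangent b) a).Iso
    (weightedSym b (fun _ => logCotangent b ⊤) a) where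
  hom U :=
    { symMap (RingHom.id _) (fun _ => toLogForms b U)
        (fun _ => toLogForms_smul b U) with
      map_mem := fun {m x} hx => symMap_mem a _ _ _ m x hx }
  bij U := symMap_bijective _ bijective_id _
    (fun _ => toLogForms_smul b U) fun _ => toLogForms_bijective b U
  res {U V} h x := by
    refine DFunLike.congr_fun (symHom_ext (f := (symMap _ _ fun _ => toLogForms_smul b V).comp
        (symMap _ _ fun _ => (cotangent b).res_smul h))
      (g := (symMap _ _ fun _ => (logCotangent b ⊤).res_smul h).comp
        (symMap _ _ fun _ => toLogForms_smul b U)) (fun r => ?_) fun y => ?_) x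
    · rw [comp_apply, comp_apply, symMap_algebraMap, symMap_algebraMap,
        symMap_algebraMap, symMap_algebraMap]
      rfl
    · rw [comp_apply, comp_apply, symMap_ι, symMap_ι, symMap_ι, symMap_ι]
      refine congrArg _ (funext fun i => Subtype.ext ?_)
      refine (omegaMap_comp _ _ (y i)).trans (Eq.trans ?_ (omegaMap_comp _ _ (y i)).symm)
      exact congrArg (omegaMap · (y i)) (toInfTop_res b h)
  str U r := symMap_algebraMap _ _ (fun _ => toLogForms_smul b U) r

lemma hasCharts_top [Smooth b] : HasCharts b ⊤ := fun x => by
  obtain ⟨U, -, hx⟩ := exists_affine_le (U := ⊤) (u := x) trivial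
  obtain ⟨g, hg, ch, -⟩ := exists_chart_top (b := b) U hx
  exact ⟨_, hg, ⟨ch⟩⟩

end

end

end JetDeformation

theorem mainTheorem7 (X : Scheme.{0}) (b : X ⟶ JetDeformation.SpecC)
    (hX : JetDeformation.IsProjectiveManifold b) (k : ℕ) (hk : 1 ≤ k) :
    JetDeformation.DeformsTo (JetDeformation.greenGriffiths b k)
      (JetDeformation.grGreenGriffiths b k)
      (JetDeformation.weightedSym b (fun _ : Fin k => JetDeformation.cotangent b)
        (fun i => (i : ℕ) + 1)) ∧
    ∀ D : TopologicalSpace.Closeds X, JetDeformation.IsSNCDivisor b D → JetDeformation.DeformsTo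
        (JetDeformation.logGreenGriffiths b D.compl k)
        (JetDeformation.grLogGreenGriffiths b D.compl k)
        (JetDeformation.weightedSym b (fun _ : Fin k => JetDeformation.logCotangent b D.compl)
          (fun i => (i : ℕ) + 1)) := by
  have := hX.1
  refine ⟨?_, fun D hD => ?_⟩
  · exact JetDeformation.deformsTo_of_iso (JetDeformation.hasCharts_top b)
      (JetDeformation.greenGriffithsIso b k).symm (JetDeformation.grGreenGriffithsIso b k).symm
      (JetDeformation.weightedSymIso b _).symm
  · exact JetDeformation.deformsTo_of_iso hD.hasCharts (.refl _) (.refl _) (.refl _)
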